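/- Let $k$ be a field, $n\ge 0$, and let $R=(R^i{}_j{}^k{}_l)\in M_n(k)\otimes M_n(k)$ be an invertible solution of the Yang–Baxter equation $R_{12}R_{13}R_{23}=R_{23}R_{13}R_{12}$. Let $\kappa\in k^*$ be any nonzero constant, written $\kappa=q-q^{-1}$ in the usual examples. Repeated indices are summed. **Notation.** $A(R)$ is the bialgebra with generators $t^i{}_j$, relations $R\,t_1t_2=t_2t_1R$, $\Delta t^i{}_j=t^i{}_a\otimes t^a{}_j$, $\epsilon t^i{}_j=\delta^i_j$. $\widetilde{U(R)}$ is the bialgebra with generators $m^{\pm i}{}_j$, relations $R\,m^\pm_1m^\pm_2=m^\pm_2m^\pm_1R$, $R\,m^+_1m^-_2=m^-_2m^+_1R$, and $\Delta m^{\pm i}{}_j=m^{\pm a}{}_j\otimes m^{\pm i}{}_a$, $\epsilon m^{\pm i}{}_j=\delta^i_j$. A *weakly quasitriangular dual pair* $(H,A)$ of bialgebras is a bialgebra pairing $\langle\ ,\ \rangle:H\otimes A\to k$ with algebra and anti-coalgebra maps $\mathcal R,\bar{\mathcal R}:A\to H$ such that the forms $a\otimes b\mapsto\langle\bar{\mathcal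 R}(a),b\rangle$ and $a\otimes b\mapsto\langle\mathcal R(b),a\rangle$ are convolution-inverse and, for all $h\in H$, $a\in A$, $h_{1}\langle h_{2},a_{1}\rangle\rho(a_{2})=\rho(a_{1})\langle h_{1},a_{2}\rangle h_{2}$ for $\rho=\mathcal R$ and $\rho=\bar{\mathcal R}$. Left $A$-comodules $b\mapsto b^{(1)}\otimes b^{(2)}$ are right $H$-modules by $b\triangleleft h=\langle h,b^{(1)}\rangle b^{(2)}$ and are braided by $\Psi(v\otimes w)=w^{(2)}\otimes v\triangleleft\mathcal R(w^{(1)})$. Right $A$-comodules $c\mapsto c^{(1)}\otimes c^{(2)}$ are left $H$-modules by $h\triangleright c=c^{(1)}\langle h,c^{(2)}\rangle$, braided by $\Psi(v\otimes w)=\mathcal R(v^{(2)})\triangleright w\otimes v^{(1)}$, with inverse braiding given by $\bar{\mathcal R}$ in place of $\mathcal R$. A braided group is a bialgebra in one of these braided categories. Let $B$ (left comodule) and $D$ (right comodule) be braided groups with a covariant duality pairing $D\otimes B\to k$, and let $\bar C$ be the algebra $D$ with the coproduct $\Psi^{-1}\circ\Delta_D$. The *double bosonisation* $U(B,H,\bar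 C)$ is the bialgebra $U$ containing $B,\bar C$ as subalgebras and $H$ as a sub-bialgebra such that the product map $\bar C\otimes H\otimes B\to U$ is a linear isomorphism, the products are $bh=h_{1}(b\triangleleft h_{2})$, $hc=(h_{1}\triangleright c)h_{2}$, the coproducts are $\Delta b=b_1{}^{(2)}\otimes\mathcal R(b_1{}^{(1)})b_2$, $\Delta c=c_1\bar{\mathcal R}(c_2{}^{(2)})\otimes c_2{}^{(1)}$, the counit of $U$ extends those of $B$ and $\bar C$, and, for all $b\in B$, $c\in\bar C$, $$b_1c_1\bar{\mathcal R}(c_2{}^{(2)})\langle c_2{}^{(1)},b_2\rangle=\langle c_1,b_1{}^{(2)}\rangle\mathcal R(b_1{}^{(1)})c_2b_2 .$$ **Part 1.** $(\widetilde{U(R)},A(R))$ is a weakly quasitriangular dual pair with $\langle m^{+i}{}_j,t^k{}_l\rangle=R^i{}_j{}^k{}_l$, $\langle m^{-i}{}_j,t^k{}_l\rangle=R^{-1\,k}{}_l{}^i{}_j$, $\mathcal R(t)=m^+$, $\bar{\mathcal R}(t)=m^-$. The free algebras $V(R)=k\langle e^i\rangle$ and $k\langle f_i\rangle$ are dually paired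 braided groups with coactions $e^i\mapsto t^i{}_a\otimes e^a$ and $f_i\mapsto f_a\otimes t^a{}_i$, with $e^i$ and $f_i$ braided-primitive and $\langle f_i,e^j\rangle=\kappa^{-1}\delta_i^j$; let $\check V(R_{21}^{-1})$ be the braided group $\bar C$ obtained from $D=k\langle f_i\rangle$. The double bosonisation $U=U(V(R),\widetilde{U(R)},\check V(R_{21}^{-1}))$ exists; it is a bialgebra generated by $m^\pm,e^i,f_i$, contains $\widetilde{U(R)}$ as a sub-bialgebra, and has $$e^im^{+j}{}_k=R^j{}_a{}^i{}_b\,m^{+a}{}_ke^b,\quad m^{-i}{}_je^k=R^k{}_a{}^i{}_b\,e^am^{-b}{}_j,\quad m^{+i}{}_jf_k=f_bm^{+i}{}_aR^a{}_j{}^b{}_k,\quad f_im^{-j}{}_k=m^{-j}{}_bf_aR^a{}_i{}^b{}_k,$$ $$[e^i,f_j]=\frac{m^{+i}{}_j-m^{-i}{}_j}{\kappa},\quad \Delta e^i=e^a\otimes m^{+i}{}_a+1\otimes e^i,\quad \Delta f_i=f_i\otimes1+m^{-a}{}_i\otimes f_a,\quad \epsilon e^i=\epsilon f_i=0 .$$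 As an algebra, $U$ is universal among algebras receiving algebra maps from $\widetilde{U(R)}$, $k\langle e^i\rangle$ and $k\langle f_i\rangle$ for which these cross relations hold. **Part 2.** Let $(H,A)$ be a weakly quasitriangular dual pair of Hopf algebras, let $\widetilde{U(R)}\to H$, $A(R)\to A$ be surjective bialgebra maps (images of generators are denoted by the same letters), and let $\lambda\in k^*$ be such that $\langle m^{+i}{}_j,t^k{}_l\rangle=\lambda R^i{}_j{}^k{}_l$, $\mathcal R(t)=m^+$, $\bar{\mathcal R}(t)=m^-$. Let $R'\in M_n\otimes M_n$ satisfy $(PR+1)(PR'-1)=0$ and $PR\cdot PR'=PR'\cdot PR$ ($P$ the permutation matrix), let $\mathbb A_q=V(R',R)$ be the algebra with generators $e^i$ and relations $e^ie^j=R'^j{}_a{}^i{}_b\,e^ae^b$, and let $\check V(R',R)$ be the algebra with generators $f_i$ and relations $f_if_j=f_bf_aR'^a{}_i{}^b{}_j$; assume that $e^i\mapsto t^i{}_a\otimes e^a$ and $f_i\mapsto f_a\otimes t^a{}_i$ define algebra maps to $A\otimes V(R',R)$ and $\check V(R',R)\otimes A$. Then $\tilde H=H\otimes k[c,c^{-1}]$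 and $\tilde A=A\otimes k[g,g^{-1}]$ ($c,g$ group-like) form a weakly quasitriangular dual pair extending $(H,A)$ with $\langle hc^i,ag^j\rangle=\langle h,a\rangle\lambda^{ij}$, $\mathcal R(g)=c^{-1}$, $\bar{\mathcal R}(g)=c$; $V(R',R)$ and $\check V(R',R)$ are dually paired braided groups over it with coactions $e^i\mapsto t^i{}_ag\otimes e^a$, $f_i\mapsto f_a\otimes t^a{}_ig$, with $e^i,f_i$ braided-primitive and $\langle f_i,e^j\rangle=\kappa^{-1}\delta_i^j$; and the double bosonisation $U=U(\mathbb A_q,\tilde H,\overline{\mathbb A_q^\star})$, where $\overline{\mathbb A_q^\star}$ is $\bar C$ for $D=\check V(R',R)$, exists and is a Hopf algebra containing $\tilde H$. In $U$ the four relations of Part 1 between $m^\pm$ and $e^i,f_i$ hold with $\lambda R$ in place of $R$, the formulas for $\Delta m^\pm,\epsilon m^\pm$ are as above, and $$cf_i=\lambda f_ic,\quad e^ic=\lambda ce^i,\quad [c,m^\pm]=0,\quad [e^i,f_j]=\frac{m^{+i}{}_jc^{-1}-cm^{-i}{}_j}{\kappa},$$ $$\Delta c=c\otimes c,\quad \epsilon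 c=1,\quad \Delta e^i=e^a\otimes m^{+i}{}_ac^{-1}+1\otimes e^i,\quad \Delta f_i=f_i\otimes1+cm^{-a}{}_i\otimes f_a,\quad \epsilon e^i=\epsilon f_i=0 .$$ As an algebra, $U$ is universal among algebras receiving algebra maps from $\tilde H$, $V(R',R)$ and $\check V(R',R)$ for which these cross relations hold. -/

import Mathlib

open scoped TensorProduct

universe u

namespace DoubleBosonisation

noncomputable section

/-! ## Matrices in tensor powers of `M_n`

An element `R` of `M_n ⊗ M_n` is a matrix indexed by pairs, the component `R^i_j^k_l` being
`R (i, k) (j, l)`. -/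

/-- The type of elements of `M_n ⊗ M_n` over `k`. -/
abbrev Mat2 (k : Type u) (n : ℕ) : Type u := Matrix (Fin n × Fin n) (Fin n × Fin n) k

section RMatrix

variable {k : Type u} [Field k] {n : ℕ}

/-- `R₁₂ = R ⊗ id` in `M_n ⊗ M_n ⊗ M_n`. -/
def leg12 (R : Mat2 k n) :
    Matrix (Fin n × Fin n × Fin n) (Fin n × Fin n × Fin n) k :=
  fun x y => R (x.1, x.2.1) (y.1, y.2.1) * (if x.2.2 = y.2.2 then 1 else 0)

/-- `R₁₃` in `M_n ⊗ M_n ⊗ M_n`. -/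
def leg13 (R : Mat2 k n) :
    Matrix (Fin n × Fin n × Fin n) (Fin n × Fin n × Fin n) k :=
  fun x y => R (x.1, x.2.2) (y.1, y.2.2) * (if x.2.1 = y.2.1 then 1 else 0)

/-- `R₂₃ = id ⊗ R` in `M_n ⊗ M_n ⊗ M_n`. -/
def leg23 (R : Mat2 k n) :
    Matrix (Fin n × Fin n × Fin n) (Fin n × Fin n × Fin n) k :=
  fun x y => R (x.2.1, x.2.2) (y.2.1, y.2.2) * (if x.1 = y.1 then 1 else 0)

/-- The (quantum) Yang-Baxter equation `R₁₂ R₁₃ R₂₃ = R₂₃ R₁₃ R₁₂`. -/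
def QYBE (R : Mat2 k n) : Prop :=
  leg12 R * leg13 R * leg23 R = leg23 R * leg13 R * leg12 R

/-- `P R`, where `P` is the permutation matrix: `(PR)^i_j^k_l = R^k_j^i_l`. -/
def permMul (R : Mat2 k n) : Mat2 k n := fun x y => R (x.2, x.1) y

end RMatrix

/-! ## The bialgebras `A(R)` and `Ũ(R)` -/

section FRT

variable {k : Type u} [Field k] {n : ℕ}

/-- The relations `R t₁ t₂ = t₂ t₁ R` of the matrix bialgebra `A(R)`. -/
inductive ARRel (R : Mat2 k n) :
    FreeAlgebra k (Fin n × Fin n) → FreeAlgebra k (Fin n × Fin n) → Prop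
  | rel (i j p l : Fin n) : ARRel R
      (∑ a, ∑ b, R (i, p) (a, b) • (FreeAlgebra.ι k (a, j) * FreeAlgebra.ι k (b, l)))
      (∑ a, ∑ b, R (a, b) (j, l) • (FreeAlgebra.ι k (p, b) * FreeAlgebra.ι k (i, a)))

/-- The matrix bialgebra `A(R)`, generated by `t^i_j` with relations `R t₁ t₂ = t₂ t₁ R`. -/
def AR (R : Mat2 k n) : Type u := RingQuot (ARRel R)

instance (R : Mat2 k n) : Ring (AR R) := inferInstanceAs (Ring (RingQuot (ARRel R)))

instance (R : Mat2 k n) : Algebra k (AR R) := inferInstanceAs (Algebra k (RingQuot (ARRel R)))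

/-- The generator `t^i_j` of `A(R)`. -/
def AR.t (R : Mat2 k n) (i j : Fin n) : AR R :=
  RingQuot.mkAlgHom k (ARRel R) (FreeAlgebra.ι k (i, j))

/-- The relations of `Ũ(R)`: with `true`, `false` standing for `m⁺`, `m⁻`, they are
`R m⁺₁ m⁺₂ = m⁺₂ m⁺₁ R`, `R m⁻₁ m⁻₂ = m⁻₂ m⁻₁ R` and `R m⁺₁ m⁻₂ = m⁻₂ m⁺₁ R`. -/
inductive URRel (R : Mat2 k n) :
    FreeAlgebra k (Bool × Fin n × Fin n) → FreeAlgebra k (Bool × Fin n × Fin n) → Prop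
  | same (s : Bool) (i j p l : Fin n) : URRel R
      (∑ a, ∑ b, R (i, p) (a, b) • (FreeAlgebra.ι k (s, a, j) * FreeAlgebra.ι k (s, b, l)))
      (∑ a, ∑ b, R (a, b) (j, l) • (FreeAlgebra.ι k (s, p, b) * FreeAlgebra.ι k (s, i, a)))
  | cross (i j p l : Fin n) : URRel R
      (∑ a, ∑ b, R (i, p) (a, b) •
        (FreeAlgebra.ι k (true, a, j) * FreeAlgebra.ι k (false, b, l)))
      (∑ a, ∑ b, R (a, b) (j, l) •
        (FreeAlgebra.ι k (false, p, b) * FreeAlgebra.ι k (true, i, a)))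

/-- The bialgebra `Ũ(R)`: two copies of `A(R)` (with the flipped coproduct), generated by `m⁺`
and `m⁻`, with the cross relations `R m⁺₁ m⁻₂ = m⁻₂ m⁺₁ R`. -/
def UR (R : Mat2 k n) : Type u := RingQuot (URRel R)

instance (R : Mat2 k n) : Ring (UR R) := inferInstanceAs (Ring (RingQuot (URRel R)))

instance (R : Mat2 k n) : Algebra k (UR R) := inferInstanceAs (Algebra k (RingQuot (URRel R)))

/-- The generators of `Ũ(R)`, `true` for `m⁺` and `false` for `m⁻`. -/
def UR.m (R : Mat2 k n) (s : Bool) (i j : Fin n) : UR R :=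
  RingQuot.mkAlgHom k (URRel R) (FreeAlgebra.ι k (s, i, j))

/-- The generator `m⁺^i_j` of `Ũ(R)`. -/
def UR.mp (R : Mat2 k n) (i j : Fin n) : UR R := UR.m R true i j

/-- The generator `m⁻^i_j` of `Ũ(R)`. -/
def UR.mm (R : Mat2 k n) (i j : Fin n) : UR R := UR.m R false i j

/-! ### Coalgebra structures -/

theorem AR.rel (R : Mat2 k n) (i j p l : Fin n) :
    ∑ a, ∑ b, R (i, p) (a, b) • (AR.t R a j * AR.t R b l) =
      ∑ a, ∑ b, R (a, b) (j, l) • (AR.t R p b * AR.t R i a) := by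
  have h := RingQuot.mkAlgHom_rel k (ARRel.rel (R := R) i j p l)
  simp only [map_sum, map_smul, map_mul] at h
  exact h

theorem UR.rel_same (R : Mat2 k n) (s : Bool) (i j p l : Fin n) :
    ∑ a, ∑ b, R (i, p) (a, b) • (UR.m R s a j * UR.m R s b l) =
      ∑ a, ∑ b, R (a, b) (j, l) • (UR.m R s p b * UR.m R s i a) := by
  have h := RingQuot.mkAlgHom_rel k (URRel.same (R := R) s i j p l)
  simp only [map_sum, map_smul, map_mul] at h
  exact h

theorem UR.rel_cross (R : Mat2 k n) (i j p l : Fin n) :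
    ∑ a, ∑ b, R (i, p) (a, b) • (UR.m R true a j * UR.m R false b l) =
      ∑ a, ∑ b, R (a, b) (j, l) • (UR.m R false p b * UR.m R true i a) := by
  have h := RingQuot.mkAlgHom_rel k (URRel.cross (R := R) i j p l)
  simp only [map_sum, map_smul, map_mul] at h
  exact h

/-- Algebra maps out of `A(R)`. -/
def AR.lift (R : Mat2 k n) {X : Type u} [Ring X] [Algebra k X] (x : Fin n → Fin n → X)
    (h : ∀ i j p l, ∑ a, ∑ b, R (i, p) (a, b) • (x a j * x b l) =
      ∑ a, ∑ b, R (a, b) (j, l) • (x p b * x i a)) : AR R →ₐ[k] X :=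
  RingQuot.liftAlgHom k ⟨FreeAlgebra.lift k (fun z => x z.1 z.2), by
    rintro _ _ ⟨i, j, p, l⟩
    simpa only [map_sum, map_smul, map_mul, FreeAlgebra.lift_ι_apply] using h i j p l⟩

theorem AR.lift_t (R : Mat2 k n) {X : Type u} [Ring X] [Algebra k X] (x : Fin n → Fin n → X)
    (h) (i j : Fin n) : AR.lift R x h (AR.t R i j) = x i j := by
  unfold AR.lift AR.t
  exact (RingQuot.liftAlgHom_mkAlgHom_apply k _ _ _).trans (by simp)

theorem AR.hom_ext (R : Mat2 k n) {X : Type u} [Ring X] [Algebra k X] {f g : AR R →ₐ[k] X}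
    (h : ∀ i j, f (AR.t R i j) = g (AR.t R i j)) : f = g := by
  refine RingQuot.ringQuot_ext' (S := k) (s := ARRel R) f g (FreeAlgebra.hom_ext ?_)
  funext z
  exact h z.1 z.2

/-- Algebra maps out of `Ũ(R)`. -/
def UR.lift (R : Mat2 k n) {X : Type u} [Ring X] [Algebra k X] (x : Bool → Fin n → Fin n → X)
    (h : ∀ s i j p l, ∑ a, ∑ b, R (i, p) (a, b) • (x s a j * x s b l) =
      ∑ a, ∑ b, R (a, b) (j, l) • (x s p b * x s i a))
    (h' : ∀ i j p l, ∑ a, ∑ b, R (i, p) (a, b) • (x true a j * x false b l) =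
      ∑ a, ∑ b, R (a, b) (j, l) • (x false p b * x true i a)) : UR R →ₐ[k] X :=
  RingQuot.liftAlgHom k ⟨FreeAlgebra.lift k (fun z => x z.1 z.2.1 z.2.2), by
    rintro _ _ (⟨s, i, j, p, l⟩ | ⟨i, j, p, l⟩)
    · simpa only [map_sum, map_smul, map_mul, FreeAlgebra.lift_ι_apply] using h s i j p l
    · simpa only [map_sum, map_smul, map_mul, FreeAlgebra.lift_ι_apply] using h' i j p l⟩

theorem UR.lift_m (R : Mat2 k n) {X : Type u} [Ring X] [Algebra k X]
    (x : Bool → Fin n → Fin n → X) (h) (h') (s : Bool) (i j : Fin n) :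
    UR.lift R x h h' (UR.m R s i j) = x s i j := by
  unfold UR.lift UR.m
  exact (RingQuot.liftAlgHom_mkAlgHom_apply k _ _ _).trans (by simp)

theorem UR.hom_ext (R : Mat2 k n) {X : Type u} [Ring X] [Algebra k X] {f g : UR R →ₐ[k] X}
    (h : ∀ s i j, f (UR.m R s i j) = g (UR.m R s i j)) : f = g := by
  refine RingQuot.ringQuot_ext' (S := k) (s := URRel R) f g (FreeAlgebra.hom_ext ?_)
  funext z
  exact h z.1 z.2.1 z.2.2

/-- If two pairs of matrices satisfy an `RTT` relation, so does their matrix product in the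
tensor product algebra. -/
theorem rtt_tmul (R : Mat2 k n) {X Y : Type u} [Ring X] [Algebra k X] [Ring Y] [Algebra k Y]
    (x x' : Fin n → Fin n → X) (y y' : Fin n → Fin n → Y)
    (hx : ∀ i j p l, ∑ a, ∑ b, R (i, p) (a, b) • (x a j * x' b l) =
      ∑ a, ∑ b, R (a, b) (j, l) • (x' p b * x i a))
    (hy : ∀ i j p l, ∑ a, ∑ b, R (i, p) (a, b) • (y a j * y' b l) =
      ∑ a, ∑ b, R (a, b) (j, l) • (y' p b * y i a)) (i j p l : Fin n) :
    ∑ a, ∑ b, R (i, p) (a, b) •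
        ((∑ c, x a c ⊗ₜ[k] y c j) * (∑ d, x' b d ⊗ₜ[k] y' d l)) =
      ∑ a, ∑ b, R (a, b) (j, l) •
        ((∑ d, x' p d ⊗ₜ[k] y' d b) * (∑ c, x i c ⊗ₜ[k] y c a)) := by
  have e1 : ∑ a, ∑ b, R (i, p) (a, b) •
        ((∑ c, x a c ⊗ₜ[k] y c j) * (∑ d, x' b d ⊗ₜ[k] y' d l)) =
      ∑ c, ∑ d, (∑ a, ∑ b, R (i, p) (a, b) • (x a c * x' b d)) ⊗ₜ[k] (y c j * y' d l) := by
    simp only [Finset.sum_mul_sum, Algebra.TensorProduct.tmul_mul_tmul, Finset.smul_sum,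
      TensorProduct.sum_tmul, TensorProduct.smul_tmul']
    calc _ = ∑ a, ∑ c, ∑ b, ∑ d, (R (i, p) (a, b) • (x a c * x' b d)) ⊗ₜ[k] (y c j * y' d l) :=
          Finset.sum_congr rfl fun a _ => Finset.sum_comm
      _ = ∑ c, ∑ a, ∑ b, ∑ d, (R (i, p) (a, b) • (x a c * x' b d)) ⊗ₜ[k] (y c j * y' d l) :=
          Finset.sum_comm
      _ = ∑ c, ∑ a, ∑ d, ∑ b, (R (i, p) (a, b) • (x a c * x' b d)) ⊗ₜ[k] (y c j * y' d l) :=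
          Finset.sum_congr rfl fun c _ => Finset.sum_congr rfl fun a _ => Finset.sum_comm
      _ = _ := Finset.sum_congr rfl fun c _ => Finset.sum_comm
  have e2 : ∑ a, ∑ b, R (a, b) (j, l) •
        ((∑ d, x' p d ⊗ₜ[k] y' d b) * (∑ c, x i c ⊗ₜ[k] y c a)) =
      ∑ c, ∑ d, (x' p d * x i c) ⊗ₜ[k] (∑ a, ∑ b, R (a, b) (j, l) • (y' d b * y c a)) := by
    simp only [Finset.sum_mul_sum, Algebra.TensorProduct.tmul_mul_tmul, Finset.smul_sum,
      TensorProduct.tmul_sum, TensorProduct.tmul_smul]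
    calc _ = ∑ a, ∑ b, ∑ c, ∑ d, R (a, b) (j, l) • (x' p d * x i c) ⊗ₜ[k] (y' d b * y c a) :=
          Finset.sum_congr rfl fun a _ => Finset.sum_congr rfl fun b _ => Finset.sum_comm
      _ = ∑ a, ∑ c, ∑ b, ∑ d, R (a, b) (j, l) • (x' p d * x i c) ⊗ₜ[k] (y' d b * y c a) :=
          Finset.sum_congr rfl fun a _ => Finset.sum_comm
      _ = ∑ c, ∑ a, ∑ b, ∑ d, R (a, b) (j, l) • (x' p d * x i c) ⊗ₜ[k] (y' d b * y c a) :=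
          Finset.sum_comm
      _ = ∑ c, ∑ a, ∑ d, ∑ b, R (a, b) (j, l) • (x' p d * x i c) ⊗ₜ[k] (y' d b * y c a) :=
          Finset.sum_congr rfl fun c _ => Finset.sum_congr rfl fun a _ => Finset.sum_comm
      _ = _ := Finset.sum_congr rfl fun c _ => Finset.sum_comm
  rw [e1, e2]
  simp only [hx, ← hy]
  simp only [TensorProduct.sum_tmul, TensorProduct.tmul_sum, TensorProduct.smul_tmul',
    TensorProduct.tmul_smul]
  calc _ = ∑ c, ∑ a, ∑ d, ∑ b, R (a, b) (c, d) • (x' p b * x i a) ⊗ₜ[k] (y c j * y' d l) :=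
        Finset.sum_congr rfl fun c _ => Finset.sum_comm
    _ = ∑ a, ∑ c, ∑ d, ∑ b, R (a, b) (c, d) • (x' p b * x i a) ⊗ₜ[k] (y c j * y' d l) :=
        Finset.sum_comm
    _ = ∑ a, ∑ c, ∑ b, ∑ d, R (a, b) (c, d) • (x' p b * x i a) ⊗ₜ[k] (y c j * y' d l) :=
        Finset.sum_congr rfl fun a _ => Finset.sum_congr rfl fun c _ => Finset.sum_comm
    _ = _ := Finset.sum_congr rfl fun a _ => Finset.sum_comm

/-- The identity matrix satisfies the `RTT` relation. -/
theorem rtt_one (R : Mat2 k n) (i j p l : Fin n) :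
    ∑ a, ∑ b, R (i, p) (a, b) • ((if a = j then (1 : k) else 0) * (if b = l then 1 else 0)) =
      ∑ a, ∑ b, R (a, b) (j, l) • ((if p = b then (1 : k) else 0) * (if i = a then 1 else 0)) := by
  simp [mul_ite]

/-- The coproduct `Δ t^i_j = ∑ t^i_a ⊗ t^a_j` of `A(R)`. -/
def AR.comulHom (R : Mat2 k n) : AR R →ₐ[k] AR R ⊗[k] AR R :=
  AR.lift R (fun i j => ∑ a, AR.t R i a ⊗ₜ[k] AR.t R a j)
    (rtt_tmul R _ _ _ _ (AR.rel R) (AR.rel R))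

/-- The counit `ε t^i_j = δ^i_j` of `A(R)`. -/
def AR.counitHom (R : Mat2 k n) : AR R →ₐ[k] k :=
  AR.lift R (fun i j => if i = j then 1 else 0) (rtt_one R)

instance (R : Mat2 k n) : Bialgebra k (AR R) :=
  Bialgebra.ofAlgHom (AR.comulHom R) (AR.counitHom R)
    (AR.hom_ext R fun i j => by
      simp only [AlgHom.comp_apply, AR.comulHom, AR.lift_t, map_sum,
        Algebra.TensorProduct.map_tmul, AlgHom.id_apply, TensorProduct.sum_tmul,
        TensorProduct.tmul_sum]
      rw [Finset.sum_comm]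
      rfl)
    (AR.hom_ext R fun i j => by
      simp [AR.comulHom, AR.counitHom, AR.lift_t, TensorProduct.ite_tmul])
    (AR.hom_ext R fun i j => by
      simp [AR.comulHom, AR.counitHom, AR.lift_t, TensorProduct.tmul_ite])

theorem AR.comul_t (R : Mat2 k n) (i j : Fin n) :
    Coalgebra.comul (R := k) (AR.t R i j) = ∑ a, AR.t R i a ⊗ₜ[k] AR.t R a j :=
  AR.lift_t R _ _ i j

theorem AR.counit_t (R : Mat2 k n) (i j : Fin n) :
    Coalgebra.counit (R := k) (AR.t R i j) = if i = j then 1 else 0 :=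
  AR.lift_t R _ _ i j

/-- The flip of the matrix coproduct, `m^i_j ↦ ∑ m^i_a ⊗ m^a_j`, as an algebra map on `Ũ(R)`. -/
def UR.comulFlip (R : Mat2 k n) : UR R →ₐ[k] UR R ⊗[k] UR R :=
  UR.lift R (fun s i j => ∑ a, UR.m R s i a ⊗ₜ[k] UR.m R s a j)
    (fun s => rtt_tmul R _ _ _ _ (UR.rel_same R s) (UR.rel_same R s))
    (rtt_tmul R _ _ _ _ (UR.rel_cross R) (UR.rel_cross R))

/-- The coproduct `Δ m^i_j = ∑ m^a_j ⊗ m^i_a` of `Ũ(R)`. -/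
def UR.comulHom (R : Mat2 k n) : UR R →ₐ[k] UR R ⊗[k] UR R :=
  (Algebra.TensorProduct.comm k (UR R) (UR R)).toAlgHom.comp (UR.comulFlip R)

theorem UR.comulHom_m (R : Mat2 k n) (s : Bool) (i j : Fin n) :
    UR.comulHom R (UR.m R s i j) = ∑ a, UR.m R s a j ⊗ₜ[k] UR.m R s i a := by
  simp [UR.comulHom, UR.comulFlip, UR.lift_m]

/-- The counit `ε m^i_j = δ^i_j` of `Ũ(R)`. -/
def UR.counitHom (R : Mat2 k n) : UR R →ₐ[k] k :=
  UR.lift R (fun _ i j => if i = j then 1 else 0) (fun _ => rtt_one R) (rtt_one R)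

instance (R : Mat2 k n) : Bialgebra k (UR R) :=
  Bialgebra.ofAlgHom (UR.comulHom R) (UR.counitHom R)
    (UR.hom_ext R fun s i j => by
      simp only [AlgHom.comp_apply, UR.comulHom_m, map_sum,
        Algebra.TensorProduct.map_tmul, AlgHom.id_apply, TensorProduct.sum_tmul,
        TensorProduct.tmul_sum]
      rw [Finset.sum_comm]
      rfl)
    (UR.hom_ext R fun s i j => by
      simp [UR.comulHom_m, UR.counitHom, UR.lift_m, TensorProduct.ite_tmul])
    (UR.hom_ext R fun s i j => by
      simp [UR.comulHom_m, UR.counitHom, UR.lift_m, TensorProduct.tmul_ite])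

theorem UR.comul_m (R : Mat2 k n) (s : Bool) (i j : Fin n) :
    Coalgebra.comul (R := k) (UR.m R s i j) = ∑ a, UR.m R s a j ⊗ₜ[k] UR.m R s i a :=
  UR.comulHom_m R s i j

theorem UR.counit_m (R : Mat2 k n) (s : Bool) (i j : Fin n) :
    Coalgebra.counit (R := k) (UR.m R s i j) = if i = j then 1 else 0 :=
  UR.lift_m R _ _ _ s i j

end FRT

/-! ## Quantum-braided planes -/

section Planes

variable {k : Type u} [Field k] {n : ℕ}

/-- The quadratic relations `e^i e^j = ∑ R'^j_a^i_b e^a e^b`. -/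
inductive VRel (R' : Mat2 k n) : FreeAlgebra k (Fin n) → FreeAlgebra k (Fin n) → Prop
  | rel (i j : Fin n) : VRel R' (FreeAlgebra.ι k i * FreeAlgebra.ι k j)
      (∑ a, ∑ b, R' (j, i) (a, b) • (FreeAlgebra.ι k a * FreeAlgebra.ι k b))

/-- The algebra of the vector quantum plane `V(R', R)`: generators `e^i` and relations
`e^i e^j = ∑ R'^j_a^i_b e^a e^b`. -/
def VPlane (R' : Mat2 k n) : Type u := RingQuot (VRel R')

instance (R' : Mat2 k n) : Ring (VPlane R') := inferInstanceAs (Ring (RingQuot (VRel R')))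

instance (R' : Mat2 k n) : Algebra k (VPlane R') :=
  inferInstanceAs (Algebra k (RingQuot (VRel R')))

/-- The generator `e^i` of `V(R', R)`. -/
def VPlane.e (R' : Mat2 k n) (i : Fin n) : VPlane R' :=
  RingQuot.mkAlgHom k (VRel R') (FreeAlgebra.ι k i)

/-- The quadratic relations `f_i f_j = ∑ f_b f_a R'^a_i^b_j`. -/
inductive VCheckRel (R' : Mat2 k n) : FreeAlgebra k (Fin n) → FreeAlgebra k (Fin n) → Prop
  | rel (i j : Fin n) : VCheckRel R' (FreeAlgebra.ι k i * FreeAlgebra.ι k j)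
      (∑ a, ∑ b, R' (a, b) (i, j) • (FreeAlgebra.ι k b * FreeAlgebra.ι k a))

/-- The algebra of the covector quantum plane `V̌(R', R)`: generators `f_i` and relations
`f_i f_j = ∑ f_b f_a R'^a_i^b_j`. -/
def VCheckPlane (R' : Mat2 k n) : Type u := RingQuot (VCheckRel R')

instance (R' : Mat2 k n) : Ring (VCheckPlane R') :=
  inferInstanceAs (Ring (RingQuot (VCheckRel R')))

instance (R' : Mat2 k n) : Algebra k (VCheckPlane R') :=
  inferInstanceAs (Algebra k (RingQuot (VCheckRel R')))

/-- The generator `f_i` of `V̌(R', R)`. -/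
def VCheckPlane.f (R' : Mat2 k n) (i : Fin n) : VCheckPlane R' :=
  RingQuot.mkAlgHom k (VCheckRel R') (FreeAlgebra.ι k i)

end Planes

/-! ## Weakly quasitriangular dual pairs -/

section General

variable {k : Type u} [Field k]

/-- The convolution product `(f * g)(c) = ∑ f(c₁) g(c₂)`. -/
def conv {C X : Type u} [AddCommGroup C] [Module k C] [Coalgebra k C] [Ring X] [Algebra k X]
    (f g : C →ₗ[k] X) : C →ₗ[k] X :=
  LinearMap.mul' k X ∘ₗ TensorProduct.map f g ∘ₗ Coalgebra.comul

/-- The left differentiation operator `(∂^L h)(a) = ∑ ⟨h₁, a⟩ h₂`. -/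
def diffL {H A : Type u} [Ring H] [Ring A] [Bialgebra k H] [Bialgebra k A]
    (pair : H →ₗ[k] A →ₗ[k] k) (h : H) : A →ₗ[k] H :=
  TensorProduct.lift (LinearMap.smulRightₗ ∘ₗ pair) (Coalgebra.comul (R := k) h)

/-- The right differentiation operator `(∂^R h)(a) = ∑ h₁ ⟨h₂, a⟩`. -/
def diffR {H A : Type u} [Ring H] [Ring A] [Bialgebra k H] [Bialgebra k A]
    (pair : H →ₗ[k] A →ₗ[k] k) (h : H) : A →ₗ[k] H :=
  TensorProduct.lift (LinearMap.smulRightₗ ∘ₗ pair).flip (Coalgebra.comul (R := k) h)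

/-- A weakly quasitriangular dual pair `(H, A)` of bialgebras: a duality pairing of bialgebras
`⟨ , ⟩ : H ⊗ A → k` together with algebra and anti-coalgebra maps `Rp = 𝓡` and `Rm = 𝓡̄` from `A`
to `H`. The conditions `⟨𝓡̄(a), b⟩ = ⟨𝓡⁻¹(b), a⟩`, `∂^R h = 𝓡 * ∂^L h * 𝓡⁻¹` and
`∂^R h = 𝓡̄ * ∂^L h * 𝓡̄⁻¹` are written without the convolution inverses in `Hom(A, H)`, which
exist automatically when `A` is a Hopf algebra, and which have to be avoided for bialgebras. -/
structure WeakQTPair (k H A : Type u) [Field k] [Ring H] [Ring A]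
    [Bialgebra k H] [Bialgebra k A] where
  /-- The duality pairing `⟨h, a⟩`. -/
  pair : H →ₗ[k] A →ₗ[k] k
  pair_mul_left : ∀ h g a, pair (h * g) a =
    LinearMap.mul' k k (TensorProduct.map (pair h) (pair g) (Coalgebra.comul a))
  pair_one_left : ∀ a, pair 1 a = Coalgebra.counit a
  pair_mul_right : ∀ h a b, pair h (a * b) =
    LinearMap.mul' k k (TensorProduct.map (pair.flip a) (pair.flip b) (Coalgebra.comul h))
  pair_one_right : ∀ h, pair h 1 = Coalgebra.counit h
  /-- The map `𝓡`. -/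
  Rp : A →ₐ[k] H
  /-- The map `𝓡̄`. -/
  Rm : A →ₐ[k] H
  comul_Rp : ∀ a, Coalgebra.comul (R := k) (Rp a) =
    TensorProduct.map Rp.toLinearMap Rp.toLinearMap
      (TensorProduct.comm k A A (Coalgebra.comul a))
  counit_Rp : ∀ a, Coalgebra.counit (R := k) (Rp a) = Coalgebra.counit (R := k) a
  comul_Rm : ∀ a, Coalgebra.comul (R := k) (Rm a) =
    TensorProduct.map Rm.toLinearMap Rm.toLinearMap
      (TensorProduct.comm k A A (Coalgebra.comul a))
  counit_Rm : ∀ a, Coalgebra.counit (R := k) (Rm a) = Coalgebra.counit (R := k) a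
  /-- The forms `a ⊗ b ↦ ⟨𝓡̄(a), b⟩` and `a ⊗ b ↦ ⟨𝓡(b), a⟩` are mutually inverse for the
  convolution product on the dual of `A ⊗ A`. -/
  inv_left : conv (TensorProduct.lift (pair ∘ₗ Rm.toLinearMap))
    (TensorProduct.lift (pair ∘ₗ Rp.toLinearMap).flip) = Coalgebra.counit (R := k) (A := A ⊗[k] A)
  inv_right : conv (TensorProduct.lift (pair ∘ₗ Rp.toLinearMap).flip)
    (TensorProduct.lift (pair ∘ₗ Rm.toLinearMap)) = Coalgebra.counit (R := k) (A := A ⊗[k] A)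
  diff_Rp : ∀ h, conv (diffR pair h) Rp.toLinearMap = conv Rp.toLinearMap (diffL pair h)
  diff_Rm : ∀ h, conv (diffR pair h) Rm.toLinearMap = conv Rm.toLinearMap (diffL pair h)

/-! ## Braided groups in the categories of comodules -/

variable {H A B D : Type u} [Ring H] [Ring A] [Bialgebra k H] [Bialgebra k A]
  [Ring B] [Algebra k B] [Ring D] [Algebra k D]

/-- The right action `b ⊗ h ↦ b ◁ h = ∑ ⟨h, b^(1)⟩ b^(2)` of `H` induced by a left coaction
`β(b) = ∑ b^(1) ⊗ b^(2)` of `A`. -/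
def rAct (P : WeakQTPair k H A) (β : B →ₐ[k] A ⊗[k] B) : B ⊗[k] H →ₗ[k] B :=
  (TensorProduct.lid k B).toLinearMap ∘ₗ
    (TensorProduct.lift P.pair).rTensor B ∘ₗ
    (TensorProduct.assoc k H A B).symm.toLinearMap ∘ₗ
    (TensorProduct.comm k (A ⊗[k] B) H).toLinearMap ∘ₗ
    β.toLinearMap.rTensor H

/-- The left action `h ⊗ c ↦ h ▷ c = ∑ c^(1) ⟨h, c^(2)⟩` of `H` induced by a right coaction
`δ(c) = ∑ c^(1) ⊗ c^(2)` of `A`. -/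
def lAct (P : WeakQTPair k H A) (δ : D →ₐ[k] D ⊗[k] A) : H ⊗[k] D →ₗ[k] D :=
  (TensorProduct.rid k D).toLinearMap ∘ₗ
    (TensorProduct.lift P.pair).lTensor D ∘ₗ
    (TensorProduct.assoc k D H A).toLinearMap ∘ₗ
    (TensorProduct.comm k H D).toLinearMap.rTensor A ∘ₗ
    (TensorProduct.assoc k H D A).symm.toLinearMap ∘ₗ
    δ.toLinearMap.lTensor H

/-- The braiding `Ψ(v ⊗ w) = ∑ w^(2) ⊗ (v ◁ 𝓡(w^(1)))` of left `A`-comodules. -/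
def braidL (P : WeakQTPair k H A) (β : B →ₐ[k] A ⊗[k] B) : B ⊗[k] B →ₗ[k] B ⊗[k] B :=
  (TensorProduct.comm k B B).toLinearMap ∘ₗ
    (rAct P β ∘ₗ P.Rp.toLinearMap.lTensor B).rTensor B ∘ₗ
    (TensorProduct.assoc k B A B).symm.toLinearMap ∘ₗ
    β.toLinearMap.lTensor B

/-- The map `v ⊗ w ↦ ∑ (ρ(v^(2)) ▷ w) ⊗ v^(1)` for right `A`-comodules. For `ρ = 𝓡` it is the
braiding `Ψ`, and for `ρ = 𝓡̄` it is the inverse braiding `Ψ⁻¹`. -/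
def braidR (P : WeakQTPair k H A) (ρ : A →ₐ[k] H) (δ : D →ₐ[k] D ⊗[k] A) :
    D ⊗[k] D →ₗ[k] D ⊗[k] D :=
  (TensorProduct.comm k D D).toLinearMap ∘ₗ
    (lAct P δ ∘ₗ ρ.toLinearMap.rTensor D).lTensor D ∘ₗ
    (TensorProduct.assoc k D A D).toLinearMap ∘ₗ
    δ.toLinearMap.rTensor D

/-- The product `(b ⊗ c) ⊗ (d ⊗ e) ↦ b · Ψ(c ⊗ d) · e` of the braided tensor product algebra. -/
def braidedMul (Ψ : B ⊗[k] B →ₗ[k] B ⊗[k] B) :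
    (B ⊗[k] B) ⊗[k] (B ⊗[k] B) →ₗ[k] B ⊗[k] B :=
  TensorProduct.map (LinearMap.mul' k B) (LinearMap.mul' k B) ∘ₗ
    (TensorProduct.assoc k B B (B ⊗[k] B)).symm.toLinearMap ∘ₗ
    ((TensorProduct.assoc k B B B).toLinearMap ∘ₗ Ψ.rTensor B ∘ₗ
      (TensorProduct.assoc k B B B).symm.toLinearMap).lTensor B ∘ₗ
    (TensorProduct.assoc k B B (B ⊗[k] B)).toLinearMap

/-- A bialgebra in the braided category of left `A`-comodules, with underlying algebra `B`. -/
structure LeftBraidedGroup (P : WeakQTPair k H A) (B : Type u) [Ring B] [Algebra k B] where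
  /-- The coaction `b ↦ b^(1) ⊗ b^(2)`, an algebra map. -/
  coact : B →ₐ[k] A ⊗[k] B
  coact_coassoc : (TensorProduct.assoc k A A B).toLinearMap ∘ₗ
      (Coalgebra.comul (R := k) (A := A)).rTensor B ∘ₗ coact.toLinearMap =
    coact.toLinearMap.lTensor A ∘ₗ coact.toLinearMap
  coact_counit : (TensorProduct.lid k B).toLinearMap ∘ₗ
      (Coalgebra.counit (R := k) (A := A)).rTensor B ∘ₗ coact.toLinearMap = LinearMap.id
  /-- The braided coproduct. -/
  comul : B →ₗ[k] B ⊗[k] B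
  /-- The braided counit. -/
  counit : B →ₐ[k] k
  coassoc : (TensorProduct.assoc k B B B).toLinearMap ∘ₗ comul.rTensor B ∘ₗ comul =
    comul.lTensor B ∘ₗ comul
  counit_comul : (TensorProduct.lid k B).toLinearMap ∘ₗ
      counit.toLinearMap.rTensor B ∘ₗ comul = LinearMap.id
  comul_counit : (TensorProduct.rid k B).toLinearMap ∘ₗ
      counit.toLinearMap.lTensor B ∘ₗ comul = LinearMap.id
  comul_one : comul 1 = 1 ⊗ₜ[k] 1
  comul_mul : ∀ b d, comul (b * d) = braidedMul (braidL P coact) (comul b ⊗ₜ[k] comul d)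
  /-- The coproduct is a comodule map. -/
  comul_covariant : comul.lTensor A ∘ₗ coact.toLinearMap =
    (LinearMap.mul' k A).rTensor (B ⊗[k] B) ∘ₗ
      (TensorProduct.tensorTensorTensorComm k A B A B).toLinearMap ∘ₗ
      TensorProduct.map coact.toLinearMap coact.toLinearMap ∘ₗ comul
  /-- The counit is a comodule map. -/
  counit_covariant : ∀ b, TensorProduct.rid k A (counit.toLinearMap.lTensor A (coact b)) =
    algebraMap k A (counit b)

/-- A bialgebra in the braided category of right `A`-comodules, with underlying algebra `D`. -/
structure RightBraidedGroup (P : WeakQTPair k H A) (D : Type u) [Ring D] [Algebra k D] where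
  /-- The coaction `c ↦ c^(1) ⊗ c^(2)`, an algebra map. -/
  coact : D →ₐ[k] D ⊗[k] A
  coact_coassoc : (TensorProduct.assoc k D A A).toLinearMap ∘ₗ
      coact.toLinearMap.rTensor A ∘ₗ coact.toLinearMap =
    (Coalgebra.comul (R := k) (A := A)).lTensor D ∘ₗ coact.toLinearMap
  coact_counit : (TensorProduct.rid k D).toLinearMap ∘ₗ
      (Coalgebra.counit (R := k) (A := A)).lTensor D ∘ₗ coact.toLinearMap = LinearMap.id
  /-- The braided coproduct. -/
  comul : D →ₗ[k] D ⊗[k] D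
  /-- The braided counit. -/
  counit : D →ₐ[k] k
  coassoc : (TensorProduct.assoc k D D D).toLinearMap ∘ₗ comul.rTensor D ∘ₗ comul =
    comul.lTensor D ∘ₗ comul
  counit_comul : (TensorProduct.lid k D).toLinearMap ∘ₗ
      counit.toLinearMap.rTensor D ∘ₗ comul = LinearMap.id
  comul_counit : (TensorProduct.rid k D).toLinearMap ∘ₗ
      counit.toLinearMap.lTensor D ∘ₗ comul = LinearMap.id
  comul_one : comul 1 = 1 ⊗ₜ[k] 1
  comul_mul : ∀ c d, comul (c * d) = braidedMul (braidR P P.Rp coact) (comul c ⊗ₜ[k] comul d)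
  /-- The coproduct is a comodule map. -/
  comul_covariant : comul.rTensor A ∘ₗ coact.toLinearMap =
    (LinearMap.mul' k A).lTensor (D ⊗[k] D) ∘ₗ
      (TensorProduct.tensorTensorTensorComm k D A D A).toLinearMap ∘ₗ
      TensorProduct.map coact.toLinearMap coact.toLinearMap ∘ₗ comul
  /-- The counit is a comodule map. -/
  counit_covariant : ∀ c, TensorProduct.lid k A (counit.toLinearMap.rTensor A (coact c)) =
    algebraMap k A (counit c)

/-- The braided-opposite coproduct `Ψ⁻¹ ∘ Δ` of `D`. With this coproduct the algebra `D` is the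
braided group `C̄`, living in the category with inverse braiding. -/
def RightBraidedGroup.barComul {P : WeakQTPair k H A} (D' : RightBraidedGroup P D) :
    D →ₗ[k] D ⊗[k] D :=
  braidR P P.Rm D'.coact ∘ₗ D'.comul

/-- An (ordinary) duality pairing between braided groups `D` and `B`, covariant under `A`. -/
structure BraidedPairing {P : WeakQTPair k H A} (D' : RightBraidedGroup P D)
    (B' : LeftBraidedGroup P B) where
  /-- The pairing `⟨c, b⟩`. -/
  ev : D →ₗ[k] B →ₗ[k] k
  ev_mul_left : ∀ c d b, ev (c * d) b =
    LinearMap.mul' k k (TensorProduct.map (ev c) (ev d) (B'.comul b))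
  ev_one_left : ∀ b, ev 1 b = B'.counit b
  ev_mul_right : ∀ c a b, ev c (a * b) =
    LinearMap.mul' k k (TensorProduct.map (ev.flip a) (ev.flip b) (D'.comul c))
  ev_one_right : ∀ c, ev c 1 = D'.counit c
  /-- `∑ ⟨c^(1), b⟩ c^(2) = ∑ b^(1) ⟨c, b^(2)⟩`. -/
  covariant : ∀ c b, TensorProduct.lid k A ((ev.flip b).rTensor A (D'.coact c)) =
    TensorProduct.rid k A ((ev c).lTensor A (B'.coact b))

/-! ## The double bosonisation -/

section Double

variable {P : WeakQTPair k H A} {D' : RightBraidedGroup P D} {B' : LeftBraidedGroup P B}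
  {U : Type u} [Ring U] [Bialgebra k U]

/-- The map `b ↦ ∑ b₁^(2) ⊗ 𝓡(b₁^(1)) b₂` from `B` to `B ⊗ U`. -/
def bosonB (B' : LeftBraidedGroup P B) (iH : H →ₐc[k] U) (iB : B →ₐ[k] U) :
    B →ₗ[k] B ⊗[k] U :=
  (LinearMap.mul' k U ∘ₗ
      TensorProduct.map ((iH : H →ₐ[k] U).comp P.Rp).toLinearMap iB.toLinearMap).lTensor B ∘ₗ
    (TensorProduct.assoc k B A B).toLinearMap ∘ₗ
    ((TensorProduct.comm k A B).toLinearMap ∘ₗ B'.coact.toLinearMap).rTensor B ∘ₗ B'.comul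

/-- The map `c ↦ ∑ c₁ 𝓡̄(c₂^(2)) ⊗ c₂^(1)` from `C̄` to `U ⊗ C̄`, where `c₁ ⊗ c₂` is the coproduct
of `C̄`. -/
def bosonC (D' : RightBraidedGroup P D) (iC : D →ₐ[k] U) (iH : H →ₐc[k] U) :
    D →ₗ[k] U ⊗[k] D :=
  (LinearMap.mul' k U ∘ₗ
      TensorProduct.map iC.toLinearMap ((iH : H →ₐ[k] U).comp P.Rm).toLinearMap).rTensor D ∘ₗ
    (TensorProduct.assoc k D A D).symm.toLinearMap ∘ₗ
    ((TensorProduct.comm k D A).toLinearMap ∘ₗ D'.coact.toLinearMap).lTensor D ∘ₗ D'.barComul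

/-- The left hand side `∑ b₁ c₁ 𝓡̄(c₂^(2)) ⟨c₂^(1), b₂⟩` of the cross relations. -/
def crossLeft (E : BraidedPairing D' B') (iC : D →ₐ[k] U) (iH : H →ₐc[k] U) (iB : B →ₐ[k] U) :
    B ⊗[k] D →ₗ[k] U :=
  (TensorProduct.rid k U).toLinearMap ∘ₗ
    TensorProduct.map (LinearMap.mul' k U ∘ₗ iB.toLinearMap.rTensor U)
      (TensorProduct.lift E.ev.flip) ∘ₗ
    (TensorProduct.tensorTensorTensorComm k B B U D).toLinearMap ∘ₗ
    TensorProduct.map B'.comul (bosonC D' iC iH)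

/-- The right hand side `∑ ⟨c₁, b₁^(2)⟩ 𝓡(b₁^(1)) c₂ b₂` of the cross relations. -/
def crossRight (E : BraidedPairing D' B') (iC : D →ₐ[k] U) (iH : H →ₐc[k] U) (iB : B →ₐ[k] U) :
    B ⊗[k] D →ₗ[k] U :=
  LinearMap.mul' k U ∘ₗ
    TensorProduct.map
      ((TensorProduct.rid k U).toLinearMap ∘ₗ
        TensorProduct.map ((iH : H →ₐ[k] U).comp P.Rp).toLinearMap
          (TensorProduct.lift E.ev.flip) ∘ₗ
        (TensorProduct.assoc k A B D).toLinearMap)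
      (LinearMap.mul' k U ∘ₗ TensorProduct.map iC.toLinearMap iB.toLinearMap ∘ₗ
        (TensorProduct.comm k B D).toLinearMap) ∘ₗ
    (TensorProduct.tensorTensorTensorComm k (A ⊗[k] B) B D D).toLinearMap ∘ₗ
    TensorProduct.map (B'.coact.toLinearMap.rTensor B ∘ₗ B'.comul) D'.barComul

/-- The product map `c ⊗ h ⊗ b ↦ c h b` from `C̄ ⊗ H ⊗ B` to `U`. -/
def triangularMap (iC : D →ₐ[k] U) (iH : H →ₐc[k] U) (iB : B →ₐ[k] U) :
    (D ⊗[k] H) ⊗[k] B →ₗ[k] U :=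
  LinearMap.mul' k U ∘ₗ
    TensorProduct.map
      (LinearMap.mul' k U ∘ₗ TensorProduct.map iC.toLinearMap (iH : H →ₐ[k] U).toLinearMap)
      iB.toLinearMap

/-- The bialgebra `U`, with the maps `iC`, `iH`, `iB`, is the double bosonisation `U(C̄, H, B)`:
it is built on the vector space `C̄ ⊗ H ⊗ B`, contains the bosonisations of `B` (on `H ⊗ B`) and
of `C̄` (on `C̄ ⊗ H`) as sub-bialgebras, and has the cross relations
`∑ b₁ c₁ 𝓡̄(c₂^(2)) ⟨c₂^(1), b₂⟩ = ∑ ⟨c₁, b₁^(2)⟩ 𝓡(b₁^(1)) c₂ b₂` for all `b` in `B` and `c` in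
`C̄`. Here the algebra and the coaction of `C̄` are those of `D`, and its coproduct is
`D'.barComul`. -/
structure IsDoubleBosonisation (E : BraidedPairing D' B') (iC : D →ₐ[k] U) (iH : H →ₐc[k] U)
    (iB : B →ₐ[k] U) : Prop where
  /-- `U` is `C̄ ⊗ H ⊗ B` as a vector space, through the product map. -/
  triangular : Function.Bijective (triangularMap iC iH iB)
  /-- The product `b h = ∑ h₁ (b ◁ h₂)` of the bosonisation of `B`. -/
  smash_B : ∀ b h, iB b * iH h =
    LinearMap.mul' k U (TensorProduct.map (iH : H →ₐ[k] U).toLinearMap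
      (iB.toLinearMap ∘ₗ rAct P B'.coact ∘ₗ TensorProduct.mk k B H b) (Coalgebra.comul h))
  /-- The product `h c = ∑ (h₁ ▷ c) h₂` of the bosonisation of `C̄`. -/
  smash_C : ∀ h c, iH h * iC c =
    LinearMap.mul' k U (TensorProduct.map
      (iC.toLinearMap ∘ₗ lAct P D'.coact ∘ₗ (TensorProduct.mk k H D).flip c)
      (iH : H →ₐ[k] U).toLinearMap (Coalgebra.comul h))
  /-- The coproduct `Δ b = ∑ b₁^(2) ⊗ 𝓡(b₁^(1)) b₂` of the bosonisation of `B`. -/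
  comul_B : ∀ b, Coalgebra.comul (R := k) (iB b) =
    iB.toLinearMap.rTensor U (bosonB B' iH iB b)
  counit_B : ∀ b, Coalgebra.counit (R := k) (iB b) = B'.counit b
  /-- The coproduct `Δ c = ∑ c₁ 𝓡̄(c₂^(2)) ⊗ c₂^(1)` of the bosonisation of `C̄`. -/
  comul_C : ∀ c, Coalgebra.comul (R := k) (iC c) =
    iC.toLinearMap.lTensor U (bosonC D' iC iH c)
  counit_C : ∀ c, Coalgebra.counit (R := k) (iC c) = D'.counit c
  /-- The cross relations between `B` and `C̄`. -/
  cross : crossLeft E iC iH iB = crossRight E iC iH iB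

end Double

/-- The cross relations between elements `mp = m⁺^i_j`, `mm = m⁻^i_j`, `e^i`, `f_i` of an algebra,
with respect to a matrix `S` in `M_n ⊗ M_n`, a normalisation `κ`, and with
`[e^i, f_j] = (p^i_j - m^i_j) / κ`. -/
structure CrossRelations {n : ℕ} (S : Mat2 k n) (κ : k) {X : Type u} [Ring X] [Algebra k X]
    (mp mm p m : Fin n → Fin n → X) (e f : Fin n → X) : Prop where
  e_mp : ∀ i j l, e i * mp j l = ∑ a, ∑ b, S (j, i) (a, b) • (mp a l * e b)
  mm_e : ∀ i j l, mm i j * e l = ∑ a, ∑ b, S (l, i) (a, b) • (e a * mm b j)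
  mp_f : ∀ i j l, mp i j * f l = ∑ a, ∑ b, S (a, b) (j, l) • (f b * mp i a)
  f_mm : ∀ i j l, f i * mm j l = ∑ a, ∑ b, S (a, b) (i, l) • (mm j b * f a)
  e_f : ∀ i j, e i * f j - f j * e i = κ⁻¹ • (p i j - m i j)

end General

end

end DoubleBosonisation

open DoubleBosonisation

/-! Shortcuts that spare the search for the algebraic structure of linear maps and tensor
products. -/

/-! Both parts are instances of one construction. Its data are a weakly quasitriangular dual pair
`(H, A)`, a matrix `T` in `A` with coproduct `∑ T i a ⊗ T a j`, an RTT relation and `⟨𝓡(T), T⟩ = R`,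
and quadratic algebras `B`, `D` on which `A` coacts through `T` (`PlaneData`). Part 1 takes `R' =
P`, so that `P R' = 1` and the quadratic relations are void. Part 2 takes the pair extended by `c`
and `g`; since `⟨m⁺ c⁻¹, t g⟩ = (λ R) λ⁻¹ = R`, the factor `g` in the coaction removes the
normalisation `λ` and the same construction applies.

The algebraic heart is `add_rel`. If `I` and `J` satisfy the quadratic relations and `J I = (P R) I
J`, then the mixed terms of `(I + J)(I + J)` have the form `(1 + P R) w`. The condition `(1 - P
R')(1 + P R) = 0` makes them fixed by `P R'`, so `I + J` satisfies the relations again. This gives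
the braided coproduct of a plane and the coproducts of `e^i` and `f_i` in `U`; the same condition,
applied directly, treats the braided derivatives and the action of `e^i` on the Fock space. Most
other identities on a plane are proved by induction on words, comparing how both sides respond to
one more letter on the left.

The pairing comes from letting `D` act on `B` by braided derivatives. The Leibniz rules on `B` and
`D` involve transposed matrices, which makes the pairing symmetric in the two planes
(`ev_v_mul_right`).

`U` is presented by generators and relations, so its universal property and its coproduct are
checked on generators. That it is not too small is shown by a representation on `D ⊗ H ⊗ B` in which
`e^i` acts by the formula forced by normal ordering, `e^i c = c e^i + ∑ (∂c) m⁺ - m⁻ (∂'c)`. Applied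
to `1 ⊗ 1 ⊗ 1`, an ordered product `c h b` gives back `c ⊗ h ⊗ b`, so the product map is injective;
reordering gives surjectivity. The cross relations for arbitrary `b` and `c` hold because both sides
obey the same recursion in `b` (`crossLeft_e_mul`, `crossRight_e_mul`). When `H` is a Hopf algebra
the antipode is an algebra map to the opposite algebra, again defined on generators.

For the pair `(Ũ(R), A(R))`, the Yang-Baxter equation says that `R` and `R₂₁⁻¹` give matrix
representations of `A(R)`, and that `R` intertwines their tensor products. The matrix coefficients
therefore satisfy the relations of `Ũ(R)` in the convolution algebra dual to `A(R)`, which defines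
the pairing. -/

namespace DoubleBosonisation.Shortcuts

section Linear

variable {k X Y : Type*} [CommSemiring k] [AddCommMonoid X] [AddCommMonoid Y] [Module k X]
  [Module k Y]

scoped instance (priority := 5000) : ZeroHomClass (X →ₗ[k] Y) X Y := inferInstance

scoped instance (priority := 5000) : AddHomClass (X →ₗ[k] Y) X Y := inferInstance

scoped instance (priority := 5000) : ZeroHomClass (X ≃ₗ[k] Y) X Y := inferInstance

scoped instance (priority := 5000) : AddHomClass (X ≃ₗ[k] Y) X Y := inferInstance

end Linear

section Algebra

variable {k X Y : Type*} [CommSemiring k] [Semiring X] [Semiring Y] [Algebra k X] [Algebra k Y]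

scoped instance (priority := 5000) : ZeroHomClass (X →ₐ[k] Y) X Y := inferInstance

scoped instance (priority := 5000) : AddHomClass (X →ₐ[k] Y) X Y := inferInstance

noncomputable scoped instance (priority := 5000) : NonUnitalNonAssocSemiring (X ⊗[k] Y) :=
  inferInstance

noncomputable scoped instance (priority := 5000) : NonUnitalSemiring (X ⊗[k] Y) := inferInstance

end Algebra

end DoubleBosonisation.Shortcuts


/-! ### Quadratic algebras and their braided coproducts. -/

namespace DoubleBosonisation

noncomputable section

open scoped Shortcuts

/-! ## Matrices acting on vectors with entries in a module -/

section Act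

variable {k : Type u} [Field k] {n : ℕ} {X : Type*} [AddCommGroup X] [Module k X]

/-- The product of a matrix in `M_n ⊗ M_n` and a vector with entries in a module. -/
def act (A : Mat2 k n) (w : Fin n × Fin n → X) : Fin n × Fin n → X :=
  fun x => ∑ y, A x y • w y

theorem act_mul (A B : Mat2 k n) (w : Fin n × Fin n → X) : act (A * B) w = act A (act B w) := by
  funext x
  simp only [act, Matrix.mul_apply, Finset.sum_smul, Finset.smul_sum, mul_smul]
  exact Finset.sum_comm

theorem act_one (w : Fin n × Fin n → X) : act (1 : Mat2 k n) w = w := by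
  funext x
  simp [act, Matrix.one_apply]

theorem act_zero (w : Fin n × Fin n → X) : act (0 : Mat2 k n) w = 0 := by
  funext x
  simp [act]

theorem act_add (A : Mat2 k n) (w z : Fin n × Fin n → X) : act A (w + z) = act A w + act A z := by
  funext x
  simp [act, Finset.sum_add_distrib]

theorem add_act (A B : Mat2 k n) (w : Fin n × Fin n → X) : act (A + B) w = act A w + act B w := by
  funext x
  simp [act, Finset.sum_add_distrib, add_smul]

theorem sub_act (A B : Mat2 k n) (w : Fin n × Fin n → X) : act (A - B) w = act A w - act B w := by
  funext x
  simp [act, Finset.sum_sub_distrib, sub_smul]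

/-- If `(1 - Q)(1 + M) = 0` then `w + M w` is fixed by `Q`. -/
theorem act_add_act_of_mul_eq_zero {Q M : Mat2 k n} (h : (1 - Q) * (1 + M) = 0)
    (w : Fin n × Fin n → X) : w + act M w = act Q (w + act M w) := by
  have h1 : act ((1 - Q) * (1 + M)) w = 0 := by rw [h, act_zero]
  rw [act_mul, add_act, act_one, sub_act, act_one, sub_eq_zero] at h1
  exact h1

end Act

section Planes

variable {k : Type u} [Field k] {n : ℕ}

/-- The algebra `V` is presented by the generators `v i` and the quadratic relations
`v i * v j = ∑ Q (i, j) (a, b) • (v a * v b)`. -/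
structure IsPlane (Q : Mat2 k n) (V : Type u) [Ring V] [Algebra k V] (v : Fin n → V) : Prop where
  rel : ∀ x : Fin n × Fin n, v x.1 * v x.2 = act Q (fun y => v y.1 * v y.2) x
  lift : ∀ {X : Type u} [Ring X] [Algebra k X] (x : Fin n → X),
    (∀ y : Fin n × Fin n, x y.1 * x y.2 = act Q (fun z => x z.1 * x z.2) y) →
      ∃ φ : V →ₐ[k] X, ∀ i, φ (v i) = x i
  adjoin : Algebra.adjoin k (Set.range v) = ⊤

/-- A sum of two solutions of quadratic relations that commute up to a braiding is a solution. -/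
theorem add_rel {Q M : Mat2 k n} (h : (1 - Q) * (1 + M) = 0) {X : Type*} [Ring X] [Algebra k X]
    (I J : Fin n → X) (hI : ∀ x : Fin n × Fin n, I x.1 * I x.2 = act Q (fun y => I y.1 * I y.2) x)
    (hJ : ∀ x : Fin n × Fin n, J x.1 * J x.2 = act Q (fun y => J y.1 * J y.2) x)
    (hc : ∀ x : Fin n × Fin n, J x.1 * I x.2 = act M (fun y => I y.1 * J y.2) x)
    (x : Fin n × Fin n) : (I x.1 + J x.1) * (I x.2 + J x.2) =
      act Q (fun y => (I y.1 + J y.1) * (I y.2 + J y.2)) x := by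
  -- The mixed terms `I J + J I` form a vector `w + M w`, which `h` makes fixed by `Q`; the pure
  -- terms are fixed by `hI` and `hJ`.
  have e : (fun y : Fin n × Fin n => (I y.1 + J y.1) * (I y.2 + J y.2)) =
      (fun y => I y.1 * I y.2) + ((fun y => I y.1 * J y.2) + act M (fun y => I y.1 * J y.2)) +
        (fun y => J y.1 * J y.2) := by
    funext y
    simp only [Pi.add_apply, ← hc]
    noncomm_ring
  rw [e, act_add, act_add, ← act_add_act_of_mul_eq_zero h]
  simp only [Pi.add_apply, ← hI, ← hJ, ← hc]
  noncomm_ring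

namespace IsPlane

variable {Q : Mat2 k n} {V : Type u} [Ring V] [Algebra k V] {v : Fin n → V}

theorem submodule_eq_top (h : IsPlane Q V v) (S : Submodule k V) (h1 : 1 ∈ S)
    (hm : ∀ i, ∀ b ∈ S, v i * b ∈ S) : S = ⊤ := by
  have key : ∀ x ∈ Algebra.adjoin k (Set.range v), ∀ b ∈ S, x * b ∈ S := by
    intro x hx
    induction hx using Algebra.adjoin_induction with
    | mem x hx => obtain ⟨i, rfl⟩ := hx; exact hm i
    | algebraMap r => intro b hb; rw [← Algebra.smul_def]; exact S.smul_mem r hb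
    | add x y _ _ hx hy => intro b hb; rw [add_mul]; exact S.add_mem (hx b hb) (hy b hb)
    | mul x y _ _ hx hy => intro b hb; rw [mul_assoc]; exact hx _ (hy b hb)
  rw [eq_top_iff]
  intro x _
  have := key x (by rw [h.adjoin]; trivial) 1 h1
  rwa [mul_one] at this

/-- Induction on words in the generators. -/
theorem induction (h : IsPlane Q V v) {p : V → Prop} (h1 : p 1)
    (hadd : ∀ x y, p x → p y → p (x + y)) (hsmul : ∀ (r : k) x, p x → p (r • x))
    (hm : ∀ i b, p b → p (v i * b)) (b : V) : p b := by
  let S : Submodule k V :=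
    { carrier := {b | p b}
      add_mem' := fun {a b} ha hb => hadd a b ha hb
      zero_mem' := by
        have := hsmul 0 1 h1
        rwa [zero_smul] at this
      smul_mem' := fun r b hb => hsmul r b hb }
  have : S = ⊤ := h.submodule_eq_top S h1 hm
  have hb : b ∈ S := by rw [this]; trivial
  exact hb

/-- Meant for maps that are not multiplicative, such as coproducts and skew derivations: it suffices
that both sides react in the same way to one more letter on the left. -/
theorem linearMap_ext (h : IsPlane Q V v) {X : Type*} [AddCommGroup X] [Module k X]
    {f g : V →ₗ[k] X} (h1 : f 1 = g 1)
    (hm : ∀ i b, f b = g b → f (v i * b) = g (v i * b)) : f = g := by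
  ext b
  induction b using h.induction with
  | h1 => exact h1
  | hadd x y hx hy => rw [map_add, map_add, hx, hy]
  | hsmul r x hx => rw [map_smul, map_smul, hx]
  | hm i b hb => exact hm i b hb

theorem algHom_ext (h : IsPlane Q V v) {X : Type*} [Ring X] [Algebra k X]
    {f g : V →ₐ[k] X} (hv : ∀ i, f (v i) = g (v i)) : f = g := by
  apply AlgHom.toLinearMap_injective
  refine h.linearMap_ext (by simp) fun i b hb => ?_
  simp only [AlgHom.toLinearMap_apply, map_mul] at hb ⊢
  rw [hb, hv]

/-- The algebra map out of a plane with given values on the generators. -/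
def liftHom (h : IsPlane Q V v) {X : Type u} [Ring X] [Algebra k X] (x : Fin n → X)
    (hx : ∀ y : Fin n × Fin n, x y.1 * x y.2 = act Q (fun z => x z.1 * x z.2) y) : V →ₐ[k] X :=
  (h.lift x hx).choose

@[simp]
theorem liftHom_v (h : IsPlane Q V v) {X : Type u} [Ring X] [Algebra k X] (x : Fin n → X) (hx) (i) :
    h.liftHom x hx (v i) = x i :=
  (h.lift x hx).choose_spec i

end IsPlane

/-! ## The braided coproduct -/

/-- The data from which the braided coproduct of a quadratic algebra `V` is built: operators
`lam i j` with `Ψ (v i ⊗ w) = ∑ lam i j w ⊗ v j`, and the operators `J c = Ψ (c ⊗ -)` on `V ⊗ V`. -/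
structure PlaneCore (Q M : Mat2 k n) (V : Type u) [Ring V] [Algebra k V] where
  /-- The generators. -/
  v : Fin n → V
  isPlane : IsPlane Q V v
  hecke : (1 - Q) * (1 + M) = 0
  /-- The braiding with a generator. -/
  lam : Fin n → Fin n → Module.End k V
  lam_one : ∀ i j, lam i j 1 = if i = j then 1 else 0
  lam_mul : ∀ i j l b, lam i l (v j * b) = ∑ y, M (i, j) y • (v y.1 * lam y.2 l b)
  lam_rtt : ∀ x z : Fin n × Fin n, ∑ y, M x y • (lam y.1 z.1 * lam y.2 z.2) =
    ∑ y, M y z • (lam x.1 y.1 * lam x.2 y.2)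
  /-- The operators `c ↦ Ψ (c ⊗ -)`, followed by a multiplication. -/
  J : V →ₐ[k] Module.End k (V ⊗[k] V)
  J_v : ∀ i, J (v i) = ∑ a, TensorProduct.map (lam i a) (LinearMap.mulLeft k (v a))

namespace PlaneCore

variable {Q M : Mat2 k n} {V : Type u} [Ring V] [Algebra k V] (S : PlaneCore Q M V)

/-- The hexagon identity for moving a generator past a product. The axiom `lam_mul` moves it past
one letter, and induction on the word does the rest. -/
theorem lam_mul_apply (i l : Fin n) (b d : V) :
    S.lam i l (b * d) = ∑ a, S.lam i a b * S.lam a l d := by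
  induction b using S.isPlane.induction generalizing i l with
  | h1 => simp [S.lam_one]
  | hadd x y hx hy => simp only [add_mul, map_add, hx, hy, Finset.sum_add_distrib]
  | hsmul r x hx => simp only [smul_mul_assoc, map_smul, hx, Finset.smul_sum]
  | hm j b hb =>
    simp only [mul_assoc, S.lam_mul, hb, Finset.mul_sum, Finset.smul_sum, Finset.sum_mul,
      smul_mul_assoc]
    exact Finset.sum_comm

theorem lam_v (i j l : Fin n) : S.lam i l (S.v j) = ∑ a, M (i, j) (a, l) • S.v a := by
  have := S.lam_mul i j l 1
  rw [mul_one] at this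
  rw [this]
  simp [S.lam_one, Fintype.sum_prod_type]

/-- Multiplication of the first tensor factor. -/
def I : V →ₐ[k] Module.End k (V ⊗[k] V) :=
  (Module.endTensorEndAlgHom (R := k) (S := k) (A := k)).comp
    (Algebra.TensorProduct.includeLeft.comp (Algebra.lmul k V))

theorem I_tmul (b c d : V) : I (k := k) b (c ⊗ₜ d) = (b * c) ⊗ₜ d := rfl

theorem J_v_tmul (i : Fin n) (c d : V) :
    S.J (S.v i) (c ⊗ₜ d) = ∑ a, S.lam i a c ⊗ₜ (S.v a * d) := by
  simp [S.J_v]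

/-- In the braided tensor square this reads `(1 ⊗ v i)(b ⊗ 1) = Ψ(v i ⊗ b)`. Working with operators
on `V ⊗ V` makes the associativity of that algebra automatic. -/
theorem J_mul_I (i : Fin n) (b : V) :
    S.J (S.v i) * I b = ∑ a, I (S.lam i a b) * S.J (S.v a) := by
  ext c d
  simp only [TensorProduct.AlgebraTensorModule.curry_apply, TensorProduct.curry_apply,
    LinearMap.coe_restrictScalars, Module.End.mul_apply, I_tmul, J_v_tmul, lam_mul_apply,
    LinearMap.sum_apply, map_sum, TensorProduct.sum_tmul]
  exact Finset.sum_comm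

theorem J_mul_I_v (x : Fin n × Fin n) :
    S.J (S.v x.1) * I (S.v x.2) = act M (fun y => I (S.v y.1) * S.J (S.v y.2)) x := by
  simp only [J_mul_I, lam_v, map_sum, map_smul, Finset.sum_mul, smul_mul_assoc, act,
    Fintype.sum_prod_type]
  exact Finset.sum_comm

/-- Left multiplication by the coproduct `v i ⊗ 1 + 1 ⊗ v i` of a generator. -/
def X (i : Fin n) : Module.End k (V ⊗[k] V) := I (S.v i) + S.J (S.v i)

theorem X_tmul (i : Fin n) (c d : V) :
    S.X i (c ⊗ₜ d) = (S.v i * c) ⊗ₜ d + ∑ a, S.lam i a c ⊗ₜ (S.v a * d) := by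
  rw [X, LinearMap.add_apply, I_tmul, J_v_tmul]

theorem hom_rel {Y : Type*} [Ring Y] [Algebra k Y] (f : V →ₐ[k] Y) (x : Fin n × Fin n) :
    f (S.v x.1) * f (S.v x.2) = act Q (fun y => f (S.v y.1) * f (S.v y.2)) x := by
  rw [← map_mul, S.isPlane.rel]
  simp [act]

/-- Left multiplication by coproducts, as a representation of `V` on `V ⊗ V`. -/
def rho : V →ₐ[k] Module.End k (V ⊗[k] V) :=
  -- `I` and `J` are algebra maps, hence satisfy the relations separately, and `J_mul_I_v` is the
  -- commutation rule that `add_rel` asks for.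
  S.isPlane.liftHom S.X
    (add_rel S.hecke (fun i => I (S.v i)) (fun i => S.J (S.v i)) (S.hom_rel I) (S.hom_rel S.J)
      S.J_mul_I_v)

@[simp]
theorem rho_v (i : Fin n) : S.rho (S.v i) = S.X i := S.isPlane.liftHom_v _ _ i

/-- The braided coproduct. -/
def comul : V →ₗ[k] V ⊗[k] V :=
  -- With this choice `Δ(v i b) = X i (Δ b)` holds by construction, which drives all the inductions
  -- on words; multiplicativity in general is a separate matter (`comul_mul`).
  (LinearMap.applyₗ (1 ⊗ₜ[k] 1 : V ⊗[k] V)) ∘ₗ S.rho.toLinearMap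

theorem comul_apply (b : V) : S.comul b = S.rho b (1 ⊗ₜ 1) := rfl

theorem comul_one : S.comul 1 = 1 ⊗ₜ[k] 1 := by simp [comul_apply]

theorem comul_v_mul (i : Fin n) (b : V) : S.comul (S.v i * b) = S.X i (S.comul b) := by
  simp [comul_apply]

theorem comul_v (i : Fin n) : S.comul (S.v i) = S.v i ⊗ₜ[k] 1 + 1 ⊗ₜ[k] S.v i := by
  have := S.comul_v_mul i 1
  rw [mul_one, comul_one, X_tmul] at this
  simpa [S.lam_one, TensorProduct.ite_tmul] using this

/-- The braided counit. -/
def counit : V →ₐ[k] k :=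
  (S.isPlane.lift (X := ULift.{u} k) 0 (by simp [act])).choose |>
    (ULift.algEquiv (R := k) (A := k)).toAlgHom.comp

theorem counit_v (i : Fin n) : S.counit (S.v i) = 0 := by
  unfold counit
  simp only [AlgHom.comp_apply]
  rw [(S.isPlane.lift (X := ULift.{u} k) 0 (by simp [act])).choose_spec i]
  rfl

theorem counit_lam (i j : Fin n) (b : V) :
    S.counit (S.lam i j b) = if i = j then S.counit b else 0 := by
  have : S.counit.toLinearMap ∘ₗ S.lam i j = if i = j then S.counit.toLinearMap else 0 := by
    refine S.isPlane.linearMap_ext ?_ fun l b _ => ?_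
    · by_cases h : i = j <;> simp [S.lam_one, h]
    · by_cases h : i = j <;> simp [S.lam_mul, h, counit_v]
  have h2 := LinearMap.congr_fun this b
  by_cases h : i = j <;> simpa [h] using h2

/-- Applying the counit to the first factor turns `X i` into left multiplication by `v i`, because
the braided summand is killed down to its diagonal term by `counit_lam`. Both sides then agree word
by word. -/
theorem counit_comul : (TensorProduct.lid k V).toLinearMap ∘ₗ
    S.counit.toLinearMap.rTensor V ∘ₗ S.comul = LinearMap.id := by
  have key : ∀ i z, ((TensorProduct.lid k V).toLinearMap ∘ₗ S.counit.toLinearMap.rTensor V)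
      (S.X i z) = S.v i * ((TensorProduct.lid k V).toLinearMap ∘ₗ
        S.counit.toLinearMap.rTensor V) z := by
    intro i z
    induction z using TensorProduct.induction_on with
    | zero => simp
    | add x y hx hy => simp only [map_add, hx, hy, mul_add]
    | tmul c d => simp [X_tmul, counit_v, counit_lam]
  refine S.isPlane.linearMap_ext (by simp [comul_one]) fun i b hb => ?_
  have h1 := key i (S.comul b)
  simp only [LinearMap.comp_apply, LinearMap.id_apply] at h1 hb ⊢
  rw [comul_v_mul, h1, hb]

theorem comul_counit : (TensorProduct.rid k V).toLinearMap ∘ₗ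
    S.counit.toLinearMap.lTensor V ∘ₗ S.comul = LinearMap.id := by
  have key : ∀ i z, ((TensorProduct.rid k V).toLinearMap ∘ₗ S.counit.toLinearMap.lTensor V)
      (S.X i z) = S.v i * ((TensorProduct.rid k V).toLinearMap ∘ₗ
        S.counit.toLinearMap.lTensor V) z := by
    intro i z
    induction z using TensorProduct.induction_on with
    | zero => simp
    | add x y hx hy => simp only [map_add, hx, hy, mul_add]
    | tmul c d => simp [X_tmul, counit_v]
  refine S.isPlane.linearMap_ext (by simp [comul_one]) fun i b hb => ?_
  have h1 := key i (S.comul b)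
  simp only [LinearMap.comp_apply, LinearMap.id_apply] at h1 hb ⊢
  rw [comul_v_mul, h1, hb]

/-- The product `b ⊗ c` of operators. -/
def Op : V ⊗[k] V →ₗ[k] Module.End k (V ⊗[k] V) :=
  LinearMap.mul' k _ ∘ₗ TensorProduct.map I.toLinearMap S.J.toLinearMap

theorem Op_tmul (b c : V) : S.Op (b ⊗ₜ c) = I b * S.J c := rfl

/-- Associativity of the braided tensor square for a product whose first factor is `Δ(v i)`. Only
the exchange rule `J_mul_I` is needed. -/
theorem Op_X (i : Fin n) (z : V ⊗[k] V) : S.Op (S.X i z) = S.X i * S.Op z := by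
  induction z using TensorProduct.induction_on with
  | zero => simp
  | add x y hx hy => simp only [map_add, hx, hy, mul_add]
  | tmul c d =>
    rw [X_tmul]
    simp only [map_add, map_sum, Op_tmul, map_mul, X, add_mul, ← mul_assoc, J_mul_I,
      Finset.sum_mul]

/-- The braided coproduct is multiplicative. -/
theorem comul_mul (b d : V) : S.comul (b * d) = S.Op (S.comul b) (S.comul d) := by
  -- Acting letter by letter with the word `b` is the same as multiplying by the element `Δ b`: the
  -- two operators satisfy the same recursion, by `Op_X`.
  have key : S.rho.toLinearMap = S.Op ∘ₗ S.comul := by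
    refine S.isPlane.linearMap_ext ?_ fun i b hb => ?_
    · simp [comul_one, Op_tmul]
    · simp only [LinearMap.comp_apply, AlgHom.toLinearMap_apply, map_mul, comul_v_mul, rho_v,
        Op_X] at hb ⊢
      rw [hb]
  have := LinearMap.congr_fun key b
  simp only [LinearMap.comp_apply, AlgHom.toLinearMap_apply] at this
  rw [← this, comul_apply, comul_apply, map_mul]
  rfl

/-- The diagonal operators on `V ⊗ V` obey with `X j` the rule that `lam` obeys with left
multiplication by `v j`. In the unbraided summand this is `lam_mul`; in the braided one a `lam` has
to cross another `lam`, which is the RTT relation `lam_rtt`. -/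
theorem X_lam (i j l : Fin n) (z : V ⊗[k] V) :
    ∑ a, TensorProduct.map (S.lam i a) (S.lam a l) (S.X j z) =
      ∑ y, M (i, j) y • S.X y.1 (∑ a, TensorProduct.map (S.lam y.2 a) (S.lam a l) z) := by
  induction z using TensorProduct.induction_on with
  | zero => simp
  | add x y hx hy => simp only [map_add, Finset.sum_add_distrib, hx, hy, smul_add]
  | tmul c d =>
    simp only [X_tmul, map_add, map_sum, TensorProduct.map_tmul, smul_add, Finset.sum_add_distrib]
    congr 1
    · simp only [S.lam_mul, TensorProduct.sum_tmul, Finset.smul_sum, TensorProduct.smul_tmul']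
      exact Finset.sum_comm
    · have e : ∀ a m : Fin n, ∑ y : Fin n × Fin n, M (i, j) y •
          (S.lam y.1 m (S.lam y.2 a c) ⊗ₜ[k] (S.v m * S.lam a l d)) =
          ∑ y : Fin n × Fin n, M y (m, a) •
            (S.lam i y.1 (S.lam j y.2 c) ⊗ₜ[k] (S.v m * S.lam a l d)) := by
        intro a m
        have h := LinearMap.congr_fun (S.lam_rtt (i, j) (m, a)) c
        simp only [LinearMap.sum_apply, LinearMap.smul_apply, Module.End.mul_apply] at h
        simp only [TensorProduct.smul_tmul', ← TensorProduct.sum_tmul, h]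
      simp only [S.lam_mul, TensorProduct.tmul_sum, Finset.smul_sum, TensorProduct.tmul_smul]
      calc _ = ∑ y : Fin n × Fin n, ∑ z : Fin n × Fin n, M y z •
            (S.lam i y.1 (S.lam j y.2 c) ⊗ₜ[k] (S.v z.1 * S.lam z.2 l d)) := by
            rw [Fintype.sum_prod_type]
        _ = ∑ z : Fin n × Fin n, ∑ y : Fin n × Fin n, M y z •
            (S.lam i y.1 (S.lam j y.2 c) ⊗ₜ[k] (S.v z.1 * S.lam z.2 l d)) := Finset.sum_comm
        _ = ∑ z : Fin n × Fin n, ∑ y : Fin n × Fin n, M (i, j) y •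
            (S.lam y.1 z.1 (S.lam y.2 z.2 c) ⊗ₜ[k] (S.v z.1 * S.lam z.2 l d)) :=
            Finset.sum_congr rfl fun z _ => (e z.2 z.1).symm
        _ = ∑ y : Fin n × Fin n, ∑ z : Fin n × Fin n, M (i, j) y •
            (S.lam y.1 z.1 (S.lam y.2 z.2 c) ⊗ₜ[k] (S.v z.1 * S.lam z.2 l d)) := Finset.sum_comm
        _ = _ := Finset.sum_congr rfl fun y _ => by
            rw [Fintype.sum_prod_type, Finset.sum_comm]

/-- Naturality of the braiding with respect to the coproduct. Coassociativity depends on it, since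
there `Δ` is applied to a factor already moved by the braiding. -/
theorem comul_lam (i l : Fin n) (b : V) :
    S.comul (S.lam i l b) = ∑ a, TensorProduct.map (S.lam i a) (S.lam a l) (S.comul b) := by
  induction b using S.isPlane.induction generalizing i l with
  | h1 =>
    by_cases h : i = l <;>
      simp [S.lam_one, comul_one, TensorProduct.ite_tmul, TensorProduct.tmul_ite, h]
  | hadd x y hx hy => simp only [map_add, hx, hy, Finset.sum_add_distrib]
  | hsmul r x hx => simp only [map_smul, hx, Finset.smul_sum]
  | hm j b hb => rw [comul_v_mul, X_lam]; simp only [S.lam_mul, map_sum, map_smul, comul_v_mul, hb]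

theorem coassoc : (TensorProduct.assoc k V V V).toLinearMap ∘ₗ S.comul.rTensor V ∘ₗ S.comul =
    S.comul.lTensor V ∘ₗ S.comul := by
  -- `Y i` is left multiplication by the threefold coproduct `v i ⊗ 1 ⊗ 1 + 1 ⊗ v i ⊗ 1 + 1 ⊗ 1 ⊗ v
  -- i` in the braided tensor cube. Both `id ⊗ Δ` and `Δ ⊗ id` carry `X i` to `Y i`.
  let Y : Fin n → V ⊗[k] (V ⊗[k] V) →ₗ[k] V ⊗[k] (V ⊗[k] V) := fun i =>
    (LinearMap.mulLeft k (S.v i)).rTensor _ + ∑ a, TensorProduct.map (S.lam i a) (S.X a)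
  have hL : ∀ i z, S.comul.lTensor V (S.X i z) = Y i (S.comul.lTensor V z) := by
    intro i z
    induction z using TensorProduct.induction_on with
    | zero => simp
    | add x y hx hy => simp only [map_add, hx, hy]
    | tmul c d => simp [X_tmul, Y, comul_v_mul]
  have hR : ∀ i z, TensorProduct.assoc k V V V (S.comul.rTensor V (S.X i z)) =
      Y i (TensorProduct.assoc k V V V (S.comul.rTensor V z)) := by
    intro i z
    induction z using TensorProduct.induction_on with
    | zero => simp
    | add x y hx hy => simp only [map_add, hx, hy]
    | tmul c d =>
      simp only [X_tmul, map_add, map_sum, LinearMap.rTensor_tmul, comul_v_mul, comul_lam]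
      induction S.comul c using TensorProduct.induction_on with
      | zero => simp
      | add x y hx hy =>
        simp only [map_add, TensorProduct.add_tmul, TensorProduct.sum_tmul, map_sum,
          Finset.sum_add_distrib] at hx hy ⊢
        rw [← hx, ← hy]; abel
      | tmul p q =>
        simp only [Y, X_tmul, TensorProduct.add_tmul, TensorProduct.sum_tmul, map_sum, map_add,
          TensorProduct.assoc_tmul, TensorProduct.map_tmul, LinearMap.add_apply,
          LinearMap.sum_apply, LinearMap.rTensor_tmul, LinearMap.mulLeft_apply,
          TensorProduct.tmul_add, TensorProduct.tmul_sum, Finset.sum_add_distrib, add_assoc]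
        congr 2
        exact Finset.sum_comm
  refine S.isPlane.linearMap_ext (by simp [comul_one]) fun i b hb => ?_
  simp only [LinearMap.comp_apply, LinearEquiv.coe_coe, comul_v_mul, hL, hR] at hb ⊢
  rw [hb]

end PlaneCore

end Planes

end

end DoubleBosonisation

/-! ### Comodule structure and braided differentiation on one plane. -/

namespace DoubleBosonisation

noncomputable section

open scoped Shortcuts

variable {k : Type u} [Field k] {n : ℕ}

namespace PlaneCore

variable {Q M : Mat2 k n} {V : Type u} [Ring V] [Algebra k V] (S : PlaneCore Q M V)

/-! ## Covariance of the braided coproduct -/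

section Covariance

variable {K : Type u} [Ring K] [Algebra k K]

/-- The coaction on a tensor product of comodules. -/
def coact₂ (β : V →ₐ[k] K ⊗[k] V) : V ⊗[k] V →ₗ[k] K ⊗[k] (V ⊗[k] V) :=
  (LinearMap.mul' k K).rTensor (V ⊗[k] V) ∘ₗ
    (TensorProduct.tensorTensorTensorComm k K V K V).toLinearMap ∘ₗ
    TensorProduct.map β.toLinearMap β.toLinearMap

/-- The generators of `V` span a comodule with the matrix of coefficients `T`, which is compatible
with the braiding. -/
structure IsCoaction (β : V →ₐ[k] K ⊗[k] V) (T : Fin n → Fin n → K) : Prop where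
  coact_v : ∀ i, β (S.v i) = ∑ a, T i a ⊗ₜ[k] S.v a
  rtt : ∀ x z : Fin n × Fin n, ∑ y, M x y • (T y.1 z.1 * T y.2 z.2) =
    ∑ y, M y z • (T x.1 y.1 * T x.2 y.2)

variable {S} {β : V →ₐ[k] K ⊗[k] V} {T : Fin n → Fin n → K} (hβ : S.IsCoaction β T)

include hβ

namespace IsCoaction

/-- The braiding with a generator is a comodule map. The RTT relation between `M` and `T` moves the
coefficient of the generator past that of each letter of `b`. -/
theorem coact_lam (i j : Fin n) (b : V) :
    ∑ a, β (S.lam i a b) * (T a j ⊗ₜ 1) =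
      ∑ a, TensorProduct.map (LinearMap.mulLeft k (T i a)) (S.lam a j) (β b) := by
  induction b using S.isPlane.induction generalizing i j with
  | h1 =>
    simp [S.lam_one, Algebra.TensorProduct.one_def, TensorProduct.tmul_ite, apply_ite β,
      ite_mul]
  | hadd x y hx hy => simp only [map_add, add_mul, Finset.sum_add_distrib, hx, hy]
  | hsmul r x hx => simp only [map_smul, smul_mul_assoc, ← Finset.smul_sum, hx]
  | hm l b hb =>
    have e : ∑ a, β (S.lam i a (S.v l * b)) * (T a j ⊗ₜ 1) = ∑ y, M (i, l) y • (β (S.v y.1) *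
        ∑ a, TensorProduct.map (LinearMap.mulLeft k (T y.2 a)) (S.lam a j) (β b)) := by
      simp only [S.lam_mul, ← hb, map_sum, map_smul, map_mul, Finset.sum_mul, smul_mul_assoc,
        mul_assoc, Finset.mul_sum, Finset.smul_sum]
      exact Finset.sum_comm
    rw [e]
    simp only [map_mul, hβ.coact_v]
    induction β b using TensorProduct.induction_on with
    | zero => simp
    | add x y hx hy =>
      simp only [mul_add, map_add, Finset.sum_add_distrib, smul_add, hx, hy]
    | tmul x w =>
      have e2 : ∀ r p : Fin n, ∑ y, M (i, l) y •
          (((T y.1 r * T y.2 p) * x) ⊗ₜ[k] (S.v r * S.lam p j w)) =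
          ∑ y, M y (r, p) • (((T i y.1 * T l y.2) * x) ⊗ₜ[k] (S.v r * S.lam p j w)) := by
        intro r p
        have := hβ.rtt (i, l) (r, p)
        have h2 := congrArg (fun z => (z * x) ⊗ₜ[k] (S.v r * S.lam p j w)) this
        simpa only [Finset.sum_mul, smul_mul_assoc, TensorProduct.sum_tmul,
          ← TensorProduct.smul_tmul'] using h2
      simp only [TensorProduct.map_tmul, LinearMap.mulLeft_apply, Finset.mul_sum,
        Algebra.TensorProduct.tmul_mul_tmul, Finset.sum_mul, map_sum, S.lam_mul,
        TensorProduct.tmul_sum, TensorProduct.tmul_smul, ← mul_assoc]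
      calc _ = ∑ y : Fin n × Fin n, ∑ z : Fin n × Fin n, M (i, l) y •
            (((T y.1 z.1 * T y.2 z.2) * x) ⊗ₜ[k] (S.v z.1 * S.lam z.2 j w)) := by
            simp only [Fintype.sum_prod_type, Finset.smul_sum]
            exact Finset.sum_congr rfl fun _ _ => Finset.sum_congr rfl fun _ _ => Finset.sum_comm
        _ = ∑ z : Fin n × Fin n, ∑ y : Fin n × Fin n, M (i, l) y •
            (((T y.1 z.1 * T y.2 z.2) * x) ⊗ₜ[k] (S.v z.1 * S.lam z.2 j w)) := Finset.sum_comm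
        _ = ∑ z : Fin n × Fin n, ∑ y : Fin n × Fin n, M y z •
            (((T i y.1 * T l y.2) * x) ⊗ₜ[k] (S.v z.1 * S.lam z.2 j w)) :=
            Finset.sum_congr rfl fun z _ => e2 z.1 z.2
        _ = ∑ y : Fin n × Fin n, ∑ z : Fin n × Fin n, M y z •
            (((T i y.1 * T l y.2) * x) ⊗ₜ[k] (S.v z.1 * S.lam z.2 j w)) := Finset.sum_comm
        _ = _ := by simp only [Fintype.sum_prod_type]

theorem coact₂_X (i : Fin n) (z : V ⊗[k] V) :
    coact₂ β (S.X i z) =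
      ∑ a, TensorProduct.map (LinearMap.mulLeft k (T i a)) (S.X a) (coact₂ β z) := by
  induction z using TensorProduct.induction_on with
  | zero => simp
  | add x y hx hy => simp only [map_add, hx, hy, Finset.sum_add_distrib]
  | tmul c d =>
    -- `G y d' r` multiplies by the component `y ⊗ d'` of the coaction on the second tensor factor,
    -- turning the identity `coact_lam` on `V` into the one needed for the braided summand of `X i`.
    let G : K → V → Fin n → K ⊗[k] V →ₗ[k] K ⊗[k] (V ⊗[k] V) := fun y d' r =>
      TensorProduct.map (LinearMap.mulRight k y) ((TensorProduct.mk k V V).flip (S.v r * d'))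
    have h := fun y d' r => congrArg (G y d' r) (hβ.coact_lam i r c)
    simp only [X_tmul, map_add, map_sum, coact₂, LinearMap.comp_apply, TensorProduct.map_tmul,
      AlgHom.toLinearMap_apply, map_mul, LinearEquiv.coe_coe, hβ.coact_v] at h ⊢
    induction β d using TensorProduct.induction_on with
    | zero => simp
    | add x y hx hy =>
      simp only [mul_add, map_add, Finset.sum_add_distrib, TensorProduct.tmul_add] at hx hy ⊢
      have := congrArg₂ (· + ·) hx hy
      rw [← sub_eq_zero] at this ⊢
      rw [← this]
      abel
    | tmul y d' =>
      have e : ∑ a, (LinearMap.mul' k K).rTensor (V ⊗[k] V)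
          (TensorProduct.tensorTensorTensorComm k K V K V
            (β (S.lam i a c) ⊗ₜ ((∑ r, T a r ⊗ₜ[k] S.v r) * y ⊗ₜ d'))) =
          ∑ r, ∑ a, G y d' r (β (S.lam i a c) * T a r ⊗ₜ 1) := by
        rw [Finset.sum_comm]
        refine Finset.sum_congr rfl fun a _ => ?_
        simp only [Finset.sum_mul, Algebra.TensorProduct.tmul_mul_tmul, TensorProduct.tmul_sum,
          map_sum]
        refine Finset.sum_congr rfl fun r _ => ?_
        induction β (S.lam i a c) using TensorProduct.induction_on with
        | zero => simp
        | add x y hx hy => simp only [TensorProduct.add_tmul, map_add, add_mul, hx, hy]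
        | tmul p q => simp [G, mul_assoc]
      have h2 := fun r => h y d' r
      simp only [← map_sum] at e h2 ⊢
      rw [e]
      simp only [h2]
      induction β c using TensorProduct.induction_on with
      | zero => simp
      | add x y hx hy =>
        simp only [mul_add, map_add, Finset.sum_add_distrib, TensorProduct.add_tmul] at hx hy ⊢
        rw [← hx, ← hy]
        abel
      | tmul p q =>
        simp only [Finset.sum_mul, Algebra.TensorProduct.tmul_mul_tmul, TensorProduct.sum_tmul,
          map_sum, TensorProduct.map_tmul, LinearMap.mulLeft_apply, LinearMap.mulRight_apply,
          TensorProduct.tensorTensorTensorComm_tmul, LinearMap.rTensor_tmul, LinearMap.mul'_apply,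
          X_tmul, TensorProduct.tmul_add, Finset.sum_add_distrib, TensorProduct.tmul_sum, G,
          LinearMap.flip_apply, TensorProduct.mk_apply, mul_assoc]
        congr 1
        exact Finset.sum_comm

/-- The braided coproduct is a comodule map. -/
theorem comul_covariant : S.comul.lTensor K ∘ₗ β.toLinearMap = coact₂ β ∘ₗ S.comul := by
  refine S.isPlane.linearMap_ext ?_ fun i b hb => ?_
  · simp [comul_one, coact₂, Algebra.TensorProduct.one_def]
  · simp only [LinearMap.comp_apply, AlgHom.toLinearMap_apply, map_mul, comul_v_mul,
      hβ.coact₂_X] at hb ⊢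
    rw [← hb, hβ.coact_v]
    induction β b using TensorProduct.induction_on with
    | zero => simp
    | add x y hx hy => simp only [mul_add, map_add, Finset.sum_add_distrib, hx, hy]
    | tmul p q => simp [Finset.sum_mul, comul_v_mul]

/-- The counit is a comodule map. -/
theorem counit_covariant (b : V) :
    TensorProduct.rid k K (S.counit.toLinearMap.lTensor K (β b)) = algebraMap k K (S.counit b) := by
  have : ((Algebra.TensorProduct.rid k k K).toAlgHom.comp
      (Algebra.TensorProduct.map (AlgHom.id k K) S.counit)).comp β =
      (Algebra.ofId k K).comp S.counit := by
    refine S.isPlane.algHom_ext fun i => ?_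
    simp [hβ.coact_v, counit_v]
  exact DFunLike.congr_fun this b

end IsCoaction

end Covariance

/-! ## Skew derivations -/

/-- The dual numbers supply the functional. Sending `v j` to a multiple of the nilpotent element
respects any quadratic relations, because products of two nilpotents vanish. The scalar part of this
map is the counit, so its nilpotent part is a derivation along the counit. -/
theorem exists_der (κ : k) (i : Fin n) : ∃ φ : V →ₗ[k] k, φ 1 = 0 ∧
    ∀ j b, φ (S.v j * b) = if i = j then κ⁻¹ * S.counit b else 0 := by
  obtain ⟨F, hF⟩ := S.isPlane.lift (X := TrivSqZeroExt k k)
    (fun j => TrivSqZeroExt.inr (if i = j then κ⁻¹ else 0)) (by simp [act])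
  have h1 : (TrivSqZeroExt.fstHom k k k).comp F = S.counit :=
    S.isPlane.algHom_ext fun j => by simp [hF, counit_v, apply_ite TrivSqZeroExt.fst]
  refine ⟨TrivSqZeroExt.sndHom k k ∘ₗ F.toLinearMap, by simp, fun j b => ?_⟩
  have h2 : (F b).fst = S.counit b := DFunLike.congr_fun h1 b
  by_cases h : i = j <;> simp [hF, h, h2]

/-- The functional dual to a generator, with normalisation `κ⁻¹`. -/
def der (κ : k) (i : Fin n) : V →ₗ[k] k := (S.exists_der κ i).choose

theorem der_one (κ : k) (i : Fin n) : S.der κ i 1 = 0 := (S.exists_der κ i).choose_spec.1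

theorem der_v_mul (κ : k) (i j : Fin n) (b : V) :
    S.der κ i (S.v j * b) = if i = j then κ⁻¹ * S.counit b else 0 :=
  (S.exists_der κ i).choose_spec.2 j b

/-- `der` sees only the linear part of a word, and on that part the braiding is the matrix `M`. -/
theorem der_lam (κ : k) (i j l : Fin n) (b : V) :
    S.der κ i (S.lam j l b) = ∑ a, M (j, a) (i, l) * S.der κ a b := by
  have : S.der κ i ∘ₗ S.lam j l = ∑ a, M (j, a) (i, l) • S.der κ a := by
    refine S.isPlane.linearMap_ext ?_ fun m b _ => ?_
    · simp [S.lam_one, apply_ite (S.der κ i), der_one]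
    · simp [S.lam_mul, der_v_mul, counit_lam, Fintype.sum_prod_type]
  simpa using LinearMap.congr_fun this b

/-- The derivation `b ↦ ∑ φ(b₁) b₂`. -/
def dl (κ : k) (i : Fin n) : V →ₗ[k] V :=
  (TensorProduct.lid k V).toLinearMap ∘ₗ (S.der κ i).rTensor V ∘ₗ S.comul

/-- The derivation `b ↦ ∑ b₁ φ(b₂)`. -/
def dr (κ : k) (i : Fin n) : V →ₗ[k] V :=
  (TensorProduct.rid k V).toLinearMap ∘ₗ (S.der κ i).lTensor V ∘ₗ S.comul

theorem dl_one (κ : k) (i : Fin n) : S.dl κ i 1 = 0 := by simp [dl, comul_one, der_one]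

theorem dr_one (κ : k) (i : Fin n) : S.dr κ i 1 = 0 := by simp [dr, comul_one, der_one]

/-- The braided Leibniz rule for differentiation from the left: the functional hits the first
letter, or the derivative moves past it, which costs a factor of `M`. -/
theorem dl_v_mul (κ : k) (i j : Fin n) (b : V) : S.dl κ i (S.v j * b) =
    (if i = j then κ⁻¹ • b else 0) + ∑ y : Fin n × Fin n,
      M (j, y.1) (i, y.2) • (S.v y.2 * S.dl κ y.1 b) := by
  have h : (TensorProduct.lid k V).toLinearMap (S.counit.toLinearMap.rTensor V (S.comul b)) = b :=
    LinearMap.congr_fun S.counit_comul b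
  simp only [dl, LinearMap.comp_apply, comul_v_mul]
  conv_rhs => enter [1]; rw [← h]
  induction S.comul b using TensorProduct.induction_on with
  | zero => simp
  | add x y hx hy =>
    simp only [map_add, mul_add, smul_add, Finset.sum_add_distrib, hx, hy]
    split_ifs <;> abel
  | tmul c d =>
    simp only [X_tmul, map_add, map_sum, LinearMap.rTensor_tmul, der_v_mul, der_lam,
      LinearEquiv.coe_coe, TensorProduct.lid_tmul, Finset.sum_smul, Fintype.sum_prod_type,
      AlgHom.toLinearMap_apply, mul_smul, mul_smul_comm, ite_smul, zero_smul]
    congr 1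
    exact Finset.sum_comm

/-- The braided Leibniz rule for differentiation from the right: to reach the last place the first
letter is braided past the whole of `b`, hence the operator `lam`. -/
theorem dr_v_mul (κ : k) (i j : Fin n) (b : V) : S.dr κ i (S.v j * b) =
    S.v j * S.dr κ i b + κ⁻¹ • S.lam j i b := by
  have h : (TensorProduct.rid k V).toLinearMap (S.counit.toLinearMap.lTensor V (S.comul b)) = b :=
    LinearMap.congr_fun S.comul_counit b
  simp only [dr, LinearMap.comp_apply, comul_v_mul]
  conv_rhs => enter [2]; rw [← h]
  induction S.comul b using TensorProduct.induction_on with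
  | zero => simp
  | add x y hx hy =>
    simp only [map_add, mul_add, smul_add, hx, hy]
    abel
  | tmul c d =>
    simp [X_tmul, der_v_mul, mul_smul, ite_smul]

/-- Coassociativity, with the functional applied to the first of three factors. The companion
`comul_dr` uses the last factor. -/
theorem comul_dl (κ : k) (i : Fin n) (b : V) :
    S.comul (S.dl κ i b) = (S.dl κ i).rTensor V (S.comul b) := by
  have h := congrArg ((TensorProduct.lid k (V ⊗[k] V)).toLinearMap ∘ₗ
    (S.der κ i).rTensor (V ⊗[k] V)) (LinearMap.congr_fun S.coassoc b)
  simp only [LinearMap.comp_apply, LinearEquiv.coe_coe] at h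
  have e1 : ∀ z : V ⊗[k] V, TensorProduct.lid k (V ⊗[k] V) ((S.der κ i).rTensor (V ⊗[k] V)
      (S.comul.lTensor V z)) =
      S.comul (TensorProduct.lid k V ((S.der κ i).rTensor V z)) := by
    intro z
    induction z using TensorProduct.induction_on with
    | zero => simp
    | add x y hx hy => simp only [map_add, hx, hy]
    | tmul c d => simp
  have e2 : ∀ z : V ⊗[k] V, TensorProduct.lid k (V ⊗[k] V) ((S.der κ i).rTensor (V ⊗[k] V)
      (TensorProduct.assoc k V V V (S.comul.rTensor V z))) = (S.dl κ i).rTensor V z := by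
    intro z
    induction z using TensorProduct.induction_on with
    | zero => simp
    | add x y hx hy => simp only [map_add, hx, hy]
    | tmul c d =>
      simp only [LinearMap.rTensor_tmul, dl, LinearMap.comp_apply]
      induction S.comul c using TensorProduct.induction_on with
      | zero => simp
      | add x y hx hy => simp only [map_add, TensorProduct.add_tmul, hx, hy]
      | tmul p q => simp [TensorProduct.smul_tmul']
  rw [e1, e2] at h
  exact h.symm

theorem comul_dr (κ : k) (i : Fin n) (b : V) :
    S.comul (S.dr κ i b) = (S.dr κ i).lTensor V (S.comul b) := by
  have h := congrArg ((TensorProduct.rid k (V ⊗[k] V)).toLinearMap ∘ₗ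
    (S.der κ i).lTensor (V ⊗[k] V) ∘ₗ (TensorProduct.assoc k V V V).symm.toLinearMap)
    (LinearMap.congr_fun S.coassoc b)
  simp only [LinearMap.comp_apply, LinearEquiv.coe_coe, LinearEquiv.symm_apply_apply] at h
  have e1 : ∀ z : V ⊗[k] V, TensorProduct.rid k (V ⊗[k] V) ((S.der κ i).lTensor (V ⊗[k] V)
      (S.comul.rTensor V z)) =
      S.comul (TensorProduct.rid k V ((S.der κ i).lTensor V z)) := by
    intro z
    induction z using TensorProduct.induction_on with
    | zero => simp
    | add x y hx hy => simp only [map_add, hx, hy]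
    | tmul c d => simp
  have e2 : ∀ z : V ⊗[k] V, TensorProduct.rid k (V ⊗[k] V) ((S.der κ i).lTensor (V ⊗[k] V)
      ((TensorProduct.assoc k V V V).symm (S.comul.lTensor V z))) = (S.dr κ i).lTensor V z := by
    intro z
    induction z using TensorProduct.induction_on with
    | zero => simp
    | add x y hx hy => simp only [map_add, hx, hy]
    | tmul c d =>
      simp only [LinearMap.lTensor_tmul, dr, LinearMap.comp_apply]
      induction S.comul d using TensorProduct.induction_on with
      | zero => simp
      | add x y hx hy => simp only [map_add, TensorProduct.tmul_add, hx, hy]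
      | tmul p q => simp [TensorProduct.tmul_smul]
  rw [e1, e2] at h
  exact h

theorem dr_lam (κ : k) (i j l : Fin n) (b : V) :
    S.dr κ i (S.lam j l b) = ∑ y : Fin n × Fin n, M y (i, l) • S.lam j y.1 (S.dr κ y.2 b) := by
  simp only [dr, LinearMap.comp_apply, comul_lam]
  induction S.comul b using TensorProduct.induction_on with
  | zero => simp
  | add x y hx hy => simp only [map_add, smul_add, Finset.sum_add_distrib, hx, hy]
  | tmul c d =>
    simp [der_lam, Finset.sum_smul, mul_smul, Fintype.sum_prod_type]

/-- The skew derivations are comodule maps. -/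
theorem IsCoaction.coact_dl {K : Type u} [Ring K] [Algebra k K] {β : V →ₐ[k] K ⊗[k] V}
    {T : Fin n → Fin n → K} (hβ : S.IsCoaction β T) (κ : k) (i : Fin n) (b : V) :
    (S.dl κ i).lTensor K (β b) =
      ∑ a, (LinearMap.mulLeft k (T a i)).rTensor V (β (S.dl κ a b)) := by
  -- The functionals `der` form a covariant family: the coaction turns `der i` into `∑ der a` with
  -- coefficients `T a i`. Evaluating them on the first leg of the covariant coproduct then gives
  -- the claim.
  have hder : ∀ c, (S.der κ i).lTensor K (β c) = ∑ a, (S.der κ a c • T a i) ⊗ₜ 1 := by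
    intro c
    have : (S.der κ i).lTensor K ∘ₗ β.toLinearMap =
        ∑ a, (S.der κ a).smulRight (T a i ⊗ₜ[k] (1 : k)) := by
      refine S.isPlane.linearMap_ext ?_ fun m b _ => ?_
      · simp [der_one, Algebra.TensorProduct.one_def]
      · have h := hβ.counit_covariant b
        have e1 : ∀ z : K ⊗[k] V, (S.der κ i).lTensor K (β (S.v m) * z) =
            (κ⁻¹ • (T m i * TensorProduct.rid k K (S.counit.toLinearMap.lTensor K z))) ⊗ₜ 1 := by
          intro z
          induction z using TensorProduct.induction_on with
          | zero => simp
          | add x y hx hy => simp only [map_add, mul_add, smul_add, TensorProduct.add_tmul, hx, hy]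
          | tmul c d =>
            simp [hβ.coact_v, Finset.sum_mul, der_v_mul, TensorProduct.tmul_ite,
              TensorProduct.smul_tmul, mul_comm]
        simp only [LinearMap.comp_apply, AlgHom.toLinearMap_apply, map_mul, e1, h,
          LinearMap.sum_apply, LinearMap.smulRight_apply, der_v_mul]
        simp [Algebra.algebraMap_eq_smul_one, mul_smul, TensorProduct.smul_tmul', ite_smul]
    have h2 := LinearMap.congr_fun this c
    simpa [TensorProduct.smul_tmul'] using h2
  have h := LinearMap.congr_fun hβ.comul_covariant b
  have h2 := congrArg (((TensorProduct.lid k V).toLinearMap ∘ₗ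
    (S.der κ i).rTensor V).lTensor K) h
  simp only [LinearMap.comp_apply, AlgHom.toLinearMap_apply] at h2
  rw [← LinearMap.comp_apply, ← LinearMap.lTensor_comp] at h2
  change (S.dl κ i).lTensor K (β b) = _ at h2
  rw [h2]
  simp only [dl, LinearMap.comp_apply]
  generalize S.comul b = z
  induction z using TensorProduct.induction_on with
  | zero => simp
  | add x y hx hy => simp only [map_add, Finset.sum_add_distrib, hx, hy]
  | tmul c d =>
    have e3 : ∀ (z w : K ⊗[k] V), ((TensorProduct.lid k V).toLinearMap ∘ₗ
        (S.der κ i).rTensor V).lTensor K ((LinearMap.mul' k K).rTensor (V ⊗[k] V)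
          (TensorProduct.tensorTensorTensorComm k K V K V (z ⊗ₜ w))) =
        (LinearMap.mulLeft k (TensorProduct.rid k K ((S.der κ i).lTensor K z))).rTensor V w := by
      intro z w
      induction z using TensorProduct.induction_on with
      | zero => simp
      | add x y hx hy =>
        simp only [TensorProduct.add_tmul, map_add, hx, hy]
        rw [← LinearMap.add_apply, ← LinearMap.rTensor_add]
        congr 2
        ext x
        simp [add_mul]
      | tmul x v =>
        induction w using TensorProduct.induction_on with
        | zero => simp
        | add x y hx hy => simp only [TensorProduct.tmul_add, map_add, hx, hy]
        | tmul y w => simp [TensorProduct.smul_tmul]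
    have e4 : ∀ (x y : K) (w : K ⊗[k] V), (LinearMap.mulLeft k x).rTensor V w = (x ⊗ₜ 1) * w := by
      intro x y w
      induction w using TensorProduct.induction_on with
      | zero => simp
      | add x y hx hy => simp only [map_add, mul_add, hx, hy]
      | tmul x v => simp
    simp only [coact₂, LinearMap.comp_apply, TensorProduct.map_tmul, AlgHom.toLinearMap_apply,
      LinearEquiv.coe_coe, LinearMap.rTensor_tmul, TensorProduct.lid_tmul, map_smul]
    rw [e3, hder]
    simp [e4 _ 1, TensorProduct.sum_tmul, Finset.sum_mul, ← TensorProduct.smul_tmul']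

end PlaneCore

end

end DoubleBosonisation

namespace DoubleBosonisation

noncomputable section

open scoped Shortcuts

variable {k : Type u} [Field k] {n : ℕ}

namespace PlaneCore

/-! ## The pairing of a plane with the dual plane -/

section Pairing

variable {Q M : Mat2 k n} {B D : Type u} [Ring B] [Algebra k B] [Ring D] [Algebra k D]
  (SD : PlaneCore Q.transpose M.transpose D) (SB : PlaneCore Q M B) (κ : k)

include SD in
-- On `v m * b` the mixed terms of two derivatives, given by `dr_v_mul` and `dr_lam`, form a vector
-- `w + Mᵗ w`. The condition `hecke` of the dual plane makes it fixed by `Qᵗ`, so the derivatives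
-- satisfy the relations of `D`.
theorem dr_rel (x : Fin n × Fin n) : (SB.dr κ x.1 : Module.End k B) * SB.dr κ x.2 =
    act Q.transpose (fun y => (SB.dr κ y.1 : Module.End k B) * SB.dr κ y.2) x := by
  refine SB.isPlane.linearMap_ext ?_ fun m b hb => ?_
  · simp [dr_one, act, Finset.sum_apply]
  · let w : Fin n × Fin n → B := fun y => SB.lam m y.1 (SB.dr κ y.2 b)
    have e : ∀ y : Fin n × Fin n, ((SB.dr κ y.1 : Module.End k B) * SB.dr κ y.2) (SB.v m * b) =
        SB.v m * ((SB.dr κ y.1 : Module.End k B) * SB.dr κ y.2) b +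
          κ⁻¹ • (w + act M.transpose w) y := by
      intro y
      simp only [Module.End.mul_apply, dr_v_mul, map_add, map_smul, dr_lam, Pi.add_apply, act, w,
        Matrix.transpose_apply, smul_add, add_assoc]
    have h := congrFun (act_add_act_of_mul_eq_zero SD.hecke w) x
    rw [e, h, hb]
    simp only [act, LinearMap.sum_apply, LinearMap.smul_apply, e, smul_add,
      Finset.sum_add_distrib, Finset.mul_sum, mul_smul_comm, Finset.smul_sum]
    congr 1
    exact Finset.sum_congr rfl fun y _ => smul_comm _ _ _

/-- The action of the dual plane on the plane by braided differentiation. -/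
def diffHom : D →ₐ[k] Module.End k B :=
  SD.isPlane.liftHom (fun i => SB.dr κ i) (dr_rel SD SB κ)

@[simp]
theorem diffHom_v (i : Fin n) : diffHom SD SB κ (SD.v i) = SB.dr κ i :=
  SD.isPlane.liftHom_v _ _ i

/-- The pairing of the dual plane with the plane. -/
def ev : D →ₗ[k] B →ₗ[k] k :=
  (LinearMap.llcomp k B B k SB.counit.toLinearMap) ∘ₗ (diffHom SD SB κ).toLinearMap

theorem ev_apply (c : D) (b : B) : ev SD SB κ c b = SB.counit (diffHom SD SB κ c b) := rfl

theorem counit_dr (i : Fin n) (b : B) : SB.counit (SB.dr κ i b) = SB.der κ i b := by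
  have h : (TensorProduct.lid k B).toLinearMap (SB.counit.toLinearMap.rTensor B (SB.comul b)) = b :=
    LinearMap.congr_fun SB.counit_comul b
  conv_rhs => rw [← h]
  simp only [dr, LinearMap.comp_apply]
  generalize SB.comul b = z
  induction z using TensorProduct.induction_on with
  | zero => simp
  | add x y hx hy => simp only [map_add, hx, hy]
  | tmul c d => simp [mul_comm]

theorem comul_diffHom (c : D) (b : B) :
    SB.comul (diffHom SD SB κ c b) = (diffHom SD SB κ c).lTensor B (SB.comul b) := by
  induction c using SD.isPlane.induction generalizing b with
  | h1 => simp [Module.End.one_eq_id]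
  | hadd x y hx hy => simp only [map_add, LinearMap.add_apply, hx, hy, LinearMap.lTensor_add]
  | hsmul r x hx => simp only [map_smul, LinearMap.smul_apply, hx, LinearMap.lTensor_smul]
  | hm i c hc =>
    simp only [map_mul, diffHom_v, Module.End.mul_apply, comul_dr, hc]
    rw [← LinearMap.comp_apply, ← LinearMap.lTensor_comp]
    rfl

/-- An operator `Z` with `Δ Z = (id ⊗ Z) Δ` is recovered from the functional `ε Z` as `b ↦ ∑ b₁ ε(Z
b₂)`. Here the functional is the pairing with `c`, and `comul_diffHom` is the hypothesis on `Z`. -/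
theorem diffHom_apply (c : D) (b : B) : diffHom SD SB κ c b =
    TensorProduct.rid k B ((ev SD SB κ c).lTensor B (SB.comul b)) := by
  have h : (TensorProduct.rid k B).toLinearMap (SB.counit.toLinearMap.lTensor B
      (SB.comul (diffHom SD SB κ c b))) = diffHom SD SB κ c b :=
    LinearMap.congr_fun SB.comul_counit _
  rw [← h, comul_diffHom, ← LinearMap.comp_apply (SB.counit.toLinearMap.lTensor B),
    ← LinearMap.lTensor_comp]
  rfl

theorem ev_mul_left (c d : D) (b : B) : ev SD SB κ (c * d) b = LinearMap.mul' k k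
    (TensorProduct.map (ev SD SB κ c) (ev SD SB κ d) (SB.comul b)) := by
  rw [ev_apply, map_mul, Module.End.mul_apply, ← ev_apply, diffHom_apply]
  generalize SB.comul b = z
  induction z using TensorProduct.induction_on with
  | zero => simp
  | add x y hx hy => simp only [map_add, hx, hy]
  | tmul c d => simp [mul_comm]

theorem ev_one_left (b : B) : ev SD SB κ 1 b = SB.counit b := by simp [ev_apply]

theorem ev_one_right (c : D) : ev SD SB κ c 1 = SD.counit c := by
  have : ∀ c, diffHom SD SB κ c 1 = algebraMap k B (SD.counit c) := by
    intro c
    induction c using SD.isPlane.induction with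
    | h1 => simp
    | hadd x y hx hy => simp only [map_add, LinearMap.add_apply, hx, hy]
    | hsmul r x hx => simp [hx, Algebra.smul_def]
    | hm i c hc => simp [hc, Algebra.algebraMap_eq_smul_one, dr_one, counit_v]
  rw [ev_apply, this]
  simp

theorem ev_v (i : Fin n) (b : B) : ev SD SB κ (SD.v i) b = SB.der κ i b := by
  rw [ev_apply, diffHom_v, counit_dr]

theorem ev_v_mul_left (i : Fin n) (c : D) (b : B) :
    ev SD SB κ (SD.v i * c) b = ev SD SB κ c (SB.dl κ i b) := by
  rw [ev_mul_left, dl, LinearMap.comp_apply, LinearMap.comp_apply]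
  generalize SB.comul b = z
  induction z using TensorProduct.induction_on with
  | zero => simp
  | add x y hx hy => simp only [map_add, hx, hy]
  | tmul c d => simp [ev_v]

/-- The pairing was defined by letting `D` differentiate `B`; this says that `B` differentiates `D`
just as well. It holds because the Leibniz rules for `dl` on the two planes have transposed
matrices, so stripping a letter from each word in either order gives the same sum. -/
theorem ev_v_mul_right (j : Fin n) (c : D) (b : B) :
    ev SD SB κ c (SB.v j * b) = ev SD SB κ (SD.dl κ j c) b := by
  induction c using SD.isPlane.induction generalizing j b with
  | h1 => simp [ev_one_left, counit_v, dl_one]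
  | hadd x y hx hy => simp only [map_add, LinearMap.add_apply, hx, hy]
  | hsmul r x hx => simp only [map_smul, LinearMap.smul_apply, hx]
  | hm i c hc =>
    rw [ev_v_mul_left, dl_v_mul, dl_v_mul]
    simp only [map_add, map_sum, map_smul, hc, LinearMap.add_apply, LinearMap.sum_apply,
      LinearMap.smul_apply, ev_v_mul_left, Matrix.transpose_apply]
    congr 1
    · simp only [eq_comm (a := i)]
      split_ifs <;> simp
    · simp only [Fintype.sum_prod_type]
      exact Finset.sum_comm

theorem ev_mul_right (c : D) (a b : B) : ev SD SB κ c (a * b) = LinearMap.mul' k k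
    (TensorProduct.map ((ev SD SB κ).flip a) ((ev SD SB κ).flip b) (SD.comul c)) := by
  induction a using SB.isPlane.induction generalizing c with
  | h1 =>
    have h : (TensorProduct.lid k D).toLinearMap (SD.counit.toLinearMap.rTensor D (SD.comul c)) = c :=
      LinearMap.congr_fun SD.counit_comul c
    rw [one_mul]
    conv_lhs => rw [← h]
    generalize SD.comul c = z
    induction z using TensorProduct.induction_on with
    | zero => simp
    | add x y hx hy => simp only [map_add, LinearMap.add_apply, hx, hy]
    | tmul c d => simp [ev_one_right]
  | hadd x y hx hy =>
    simp only [add_mul, map_add, hx, hy, TensorProduct.map_add_left, LinearMap.add_apply]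
  | hsmul r x hx =>
    simp only [smul_mul_assoc, map_smul, hx, TensorProduct.map_smul_left, LinearMap.smul_apply]
  | hm i a ha =>
    rw [mul_assoc, ev_v_mul_right, ha, comul_dl]
    generalize SD.comul c = z
    induction z using TensorProduct.induction_on with
    | zero => simp
    | add x y hx hy => simp only [map_add, hx, hy]
    | tmul c d => simp [ev_v_mul_right]

/-- The pairing is covariant. -/
theorem ev_covariant {K : Type u} [Ring K] [Algebra k K] {β : B →ₐ[k] K ⊗[k] B}
    {δ : D →ₐ[k] K ⊗[k] D} {T : Fin n → Fin n → K} (hβ : SB.IsCoaction β T)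
    (hδ : SD.IsCoaction δ (fun i j => T j i)) (c : D) (b : B) :
    ((ev SD SB κ).flip b).lTensor K (δ c) = (ev SD SB κ c).lTensor K (β b) := by
  induction c using SD.isPlane.induction generalizing b with
  | h1 =>
    have h := hβ.counit_covariant b
    have e : ev SD SB κ 1 = SB.counit.toLinearMap := by
      ext b
      exact ev_one_left SD SB κ b
    rw [e, ← (TensorProduct.rid k K).injective.eq_iff, h]
    simp [Algebra.TensorProduct.one_def, ev_one_left, Algebra.algebraMap_eq_smul_one]
  | hadd x y hx hy =>
    simp only [map_add, LinearMap.lTensor_add, LinearMap.add_apply, hx, hy]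
  | hsmul r x hx => simp only [map_smul, LinearMap.lTensor_smul, LinearMap.smul_apply, hx]
  | hm i c hc =>
    -- Pairing with a word that begins with `f_i` differentiates the other argument by `dl i`. The
    -- coefficients `T a i` picked up on the `D` side are those of `coact_dl` on the `B` side.
    have e1 : ∀ z : K ⊗[k] D, ((ev SD SB κ).flip b).lTensor K (δ (SD.v i) * z) =
        ∑ a, (LinearMap.mulLeft k (T a i)).rTensor k
          (((ev SD SB κ).flip (SB.dl κ a b)).lTensor K z) := by
      intro z
      induction z using TensorProduct.induction_on with
      | zero => simp
      | add x y hx hy => simp only [map_add, mul_add, hx, hy, Finset.sum_add_distrib]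
      | tmul x c => simp [hδ.coact_v, Finset.sum_mul, ev_v_mul_left]
    have e2 : ev SD SB κ (SD.v i * c) = ev SD SB κ c ∘ₗ SB.dl κ i := by
      ext b
      exact ev_v_mul_left SD SB κ i c b
    rw [map_mul, e1, e2, LinearMap.lTensor_comp, LinearMap.comp_apply, hβ.coact_dl]
    simp only [hc, map_sum]
    refine Finset.sum_congr rfl fun a _ => ?_
    rw [← LinearMap.comp_apply, ← LinearMap.comp_apply, LinearMap.lTensor_comp_rTensor,
      LinearMap.rTensor_comp_lTensor]

end Pairing

end PlaneCore

end

end DoubleBosonisation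

/-! ### Braided groups from planes over a weakly quasitriangular dual pair. -/

namespace DoubleBosonisation

noncomputable section

open scoped Shortcuts

variable {k : Type u} [Field k] {n : ℕ} {H A B D : Type u} [Ring H] [Ring A] [Bialgebra k H]
  [Bialgebra k A] [Ring B] [Algebra k B] [Ring D] [Algebra k D]

/-! ## Operators defined by functionals on a comodule -/

/-- The operator `b ↦ ∑ φ (b^(1)) b^(2)` on a left comodule. -/
def cof (β : B →ₐ[k] A ⊗[k] B) (φ : A →ₗ[k] k) : B →ₗ[k] B :=
  (TensorProduct.lid k B).toLinearMap ∘ₗ φ.rTensor B ∘ₗ β.toLinearMap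

/-- The operator `c ↦ ∑ c^(1) φ (c^(2))` on a right comodule. -/
def cofR (δ : D →ₐ[k] D ⊗[k] A) (φ : A →ₗ[k] k) : D →ₗ[k] D :=
  (TensorProduct.rid k D).toLinearMap ∘ₗ φ.lTensor D ∘ₗ δ.toLinearMap

/-- A left comodule is a right module over the convolution algebra of functionals, so operators
written on the left compose in the reversed order. For right comodules (`cofR_cofR`) the order is
preserved. -/
theorem cof_cof {β : B →ₐ[k] A ⊗[k] B}
    (hβ : (TensorProduct.assoc k A A B).toLinearMap ∘ₗ
      (Coalgebra.comul (R := k) (A := A)).rTensor B ∘ₗ β.toLinearMap =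
        β.toLinearMap.lTensor A ∘ₗ β.toLinearMap) (φ ψ : A →ₗ[k] k) (b : B) :
    cof β φ (cof β ψ b) = cof β (conv ψ φ) b := by
  have h := congrArg ((TensorProduct.lid k B).toLinearMap ∘ₗ φ.rTensor B ∘ₗ
    (TensorProduct.lid k (A ⊗[k] B)).toLinearMap ∘ₗ ψ.rTensor (A ⊗[k] B))
    (LinearMap.congr_fun hβ b)
  simp only [LinearMap.comp_apply, LinearEquiv.coe_coe, AlgHom.toLinearMap_apply] at h
  simp only [cof, conv, LinearMap.comp_apply, LinearEquiv.coe_coe, AlgHom.toLinearMap_apply]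
  trans TensorProduct.lid k B (φ.rTensor B (TensorProduct.lid k (A ⊗[k] B)
    (ψ.rTensor (A ⊗[k] B) (β.toLinearMap.lTensor A (β b)))))
  · generalize β b = z
    induction z using TensorProduct.induction_on with
    | zero => simp
    | add x y hx hy => simp only [map_add, hx, hy]
    | tmul x w => simp
  · rw [← h]
    generalize β b = z
    induction z using TensorProduct.induction_on with
    | zero => simp
    | add x y hx hy => simp only [map_add, hx, hy]
    | tmul x w =>
      simp only [LinearMap.rTensor_tmul, LinearMap.comp_apply]
      generalize Coalgebra.comul (R := k) x = y
      induction y using TensorProduct.induction_on with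
      | zero => simp
      | add x y hx hy => simp only [map_add, TensorProduct.add_tmul, hx, hy]
      | tmul x y => simp [mul_smul, TensorProduct.smul_tmul']

theorem cofR_cofR {δ : D →ₐ[k] D ⊗[k] A}
    (hδ : (TensorProduct.assoc k D A A).toLinearMap ∘ₗ
      δ.toLinearMap.rTensor A ∘ₗ δ.toLinearMap =
        (Coalgebra.comul (R := k) (A := A)).lTensor D ∘ₗ δ.toLinearMap) (φ ψ : A →ₗ[k] k) (c : D) :
    cofR δ φ (cofR δ ψ c) = cofR δ (conv φ ψ) c := by
  have h := congrArg ((TensorProduct.rid k D).toLinearMap ∘ₗ φ.lTensor D ∘ₗ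
    (TensorProduct.rid k (D ⊗[k] A)).toLinearMap ∘ₗ ψ.lTensor (D ⊗[k] A) ∘ₗ
      (TensorProduct.assoc k D A A).symm.toLinearMap)
    (LinearMap.congr_fun hδ c)
  simp only [LinearMap.comp_apply, LinearEquiv.coe_coe, AlgHom.toLinearMap_apply,
    LinearEquiv.symm_apply_apply] at h
  simp only [cofR, conv, LinearMap.comp_apply, LinearEquiv.coe_coe, AlgHom.toLinearMap_apply]
  trans TensorProduct.rid k D (φ.lTensor D (TensorProduct.rid k (D ⊗[k] A)
    (ψ.lTensor (D ⊗[k] A) (δ.toLinearMap.rTensor A (δ c)))))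
  · generalize δ c = z
    induction z using TensorProduct.induction_on with
    | zero => simp
    | add x y hx hy => simp only [map_add, hx, hy]
    | tmul x w => simp
  · rw [h]
    generalize δ c = z
    induction z using TensorProduct.induction_on with
    | zero => simp
    | add x y hx hy => simp only [map_add, hx, hy]
    | tmul w x =>
      simp only [LinearMap.lTensor_tmul, LinearMap.comp_apply]
      generalize Coalgebra.comul (R := k) x = y
      induction y using TensorProduct.induction_on with
      | zero => simp
      | add x y hx hy => simp only [map_add, TensorProduct.tmul_add, hx, hy]
      | tmul x y => simp [smul_smul, mul_comm]

theorem rAct_tmul (P : WeakQTPair k H A) (β : B →ₐ[k] A ⊗[k] B) (b : B) (h : H) :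
    rAct P β (b ⊗ₜ h) = cof β (P.pair h) b := by
  simp only [rAct, cof, LinearMap.comp_apply, LinearMap.rTensor_tmul, AlgHom.toLinearMap_apply,
    LinearEquiv.coe_coe]
  generalize β b = z
  induction z using TensorProduct.induction_on with
  | zero => simp
  | add x y hx hy => simp only [map_add, TensorProduct.add_tmul, hx, hy]
  | tmul x w => simp

theorem lAct_tmul (P : WeakQTPair k H A) (δ : D →ₐ[k] D ⊗[k] A) (h : H) (c : D) :
    lAct P δ (h ⊗ₜ c) = cofR δ (P.pair h) c := by
  simp only [lAct, cofR, LinearMap.comp_apply, LinearMap.lTensor_tmul, AlgHom.toLinearMap_apply,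
    LinearEquiv.coe_coe]
  generalize δ c = z
  induction z using TensorProduct.induction_on with
  | zero => simp
  | add x y hx hy => simp only [map_add, TensorProduct.tmul_add, hx, hy]
  | tmul x w => simp

namespace WeakQTPair

variable (P : WeakQTPair k H A)

theorem pair_mul (h g : H) : P.pair (h * g) = conv (P.pair h) (P.pair g) := by
  ext a
  exact P.pair_mul_left h g a

theorem pair_one : P.pair 1 = Coalgebra.counit := by
  ext a
  exact P.pair_one_left a

/-- The order is reversed because `𝓡` reverses coproducts. This cancels the reversal in `cof_cof`,
so `actB` is an algebra map rather than an anti-homomorphism. -/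
theorem flip_mul_Rp (x y : A) : P.pair.flip (x * y) ∘ₗ P.Rp.toLinearMap =
    conv (P.pair.flip y ∘ₗ P.Rp.toLinearMap) (P.pair.flip x ∘ₗ P.Rp.toLinearMap) := by
  ext a
  simp only [LinearMap.comp_apply, LinearMap.flip_apply, AlgHom.toLinearMap_apply,
    P.pair_mul_right, P.comul_Rp, conv]
  generalize Coalgebra.comul (R := k) a = z
  induction z using TensorProduct.induction_on with
  | zero => simp
  | add x y hx hy => simp only [map_add, hx, hy]
  | tmul p q => simp [mul_comm]

theorem flip_one_Rp : P.pair.flip 1 ∘ₗ P.Rp.toLinearMap = Coalgebra.counit (R := k) (A := A) := by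
  ext a
  simp [P.pair_one_right, P.counit_Rp]

end WeakQTPair

/-! ## Quantum-braided planes over a weakly quasitriangular dual pair -/

/-- Covariant quadratic algebras `B`, `D` over a weakly quasitriangular dual pair, with the
braiding given by the matrix `R`. -/
structure PlaneData (P : WeakQTPair k H A) (R R' : Mat2 k n) (B D : Type u) [Ring B] [Algebra k B]
    [Ring D] [Algebra k D] where
  /-- The coefficients of the coaction. -/
  T : Fin n → Fin n → A
  comul_T : ∀ i j, Coalgebra.comul (R := k) (T i j) = ∑ a, T i a ⊗ₜ[k] T a j
  counit_T : ∀ i j, Coalgebra.counit (R := k) (T i j) = if i = j then 1 else 0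
  rtt : ∀ i j p l, ∑ a, ∑ b, R (i, p) (a, b) • (T a j * T b l) =
    ∑ a, ∑ b, R (a, b) (j, l) • (T p b * T i a)
  pair_T : ∀ i j p l, P.pair (P.Rp (T i j)) (T p l) = R (i, p) (j, l)
  hecke : (permMul R + 1) * (permMul R' - 1) = 0
  comm : permMul R * permMul R' = permMul R' * permMul R
  /-- The generators of `B`. -/
  e : Fin n → B
  /-- The generators of `D`. -/
  f : Fin n → D
  planeB : IsPlane (permMul R') B e
  planeD : IsPlane (permMul R').transpose D f
  /-- The coaction on `B`. -/
  β : B →ₐ[k] A ⊗[k] B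
  β_e : ∀ i, β (e i) = ∑ a, T i a ⊗ₜ[k] e a
  /-- The coaction on `D`. -/
  δ : D →ₐ[k] D ⊗[k] A
  δ_f : ∀ i, δ (f i) = ∑ a, f a ⊗ₜ[k] T a i

namespace PlaneData

variable {P : WeakQTPair k H A} {R R' : Mat2 k n} (S : PlaneData P R R' B D)

theorem rtt_perm (x z : Fin n × Fin n) : ∑ y, permMul R x y • (S.T y.1 z.1 * S.T y.2 z.2) =
    ∑ y, permMul R y z • (S.T x.1 y.1 * S.T x.2 y.2) := by
  have h := S.rtt x.2 z.1 x.1 z.2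
  simp only [Fintype.sum_prod_type, permMul]
  rw [h, Finset.sum_comm]

include S in
-- The factors occur here in the opposite order to `hecke`, and the commutation of `P R` with `P R'`
-- exchanges them. For `D` the transposition in `hecke_D` already produces the required order.
theorem hecke_B : (1 - permMul R') * (1 + permMul R) = 0 := by
  have h1 := S.hecke
  have h2 := S.comm
  have : (1 - permMul R') * (1 + permMul R) = -((permMul R + 1) * (permMul R' - 1)) +
      (permMul R * permMul R' - permMul R' * permMul R) := by noncomm_ring
  rw [this, h1, h2]
  simp

include S in
theorem hecke_D : (1 - (permMul R').transpose) * (1 + (permMul R).transpose) = 0 := by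
  have h : (1 + permMul R) * (1 - permMul R') = 0 := by
    have : (1 + permMul R) * (1 - permMul R') = -((permMul R + 1) * (permMul R' - 1)) := by
      noncomm_ring
    rw [this, S.hecke, neg_zero]
  have h2 := congrArg Matrix.transpose h
  rw [Matrix.transpose_mul] at h2
  simpa using h2

theorem coassoc_β : (TensorProduct.assoc k A A B).toLinearMap ∘ₗ
    (Coalgebra.comul (R := k) (A := A)).rTensor B ∘ₗ S.β.toLinearMap =
      S.β.toLinearMap.lTensor A ∘ₗ S.β.toLinearMap := by
  have : ((Algebra.TensorProduct.assoc k k k A A B).toAlgHom.comp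
      (Algebra.TensorProduct.map (Bialgebra.comulAlgHom k A) (AlgHom.id k B))).comp S.β =
      (Algebra.TensorProduct.map (AlgHom.id k A) S.β).comp S.β := by
    refine S.planeB.algHom_ext fun i => ?_
    simp only [AlgHom.comp_apply, S.β_e, map_sum, Algebra.TensorProduct.map_tmul,
      Bialgebra.comulAlgHom_apply, S.comul_T, AlgHom.id_apply, TensorProduct.sum_tmul,
      TensorProduct.tmul_sum]
    rw [Finset.sum_comm]
    rfl
  exact congrArg AlgHom.toLinearMap this

theorem counit_β : (TensorProduct.lid k B).toLinearMap ∘ₗ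
    (Coalgebra.counit (R := k) (A := A)).rTensor B ∘ₗ S.β.toLinearMap = LinearMap.id := by
  have : ((Algebra.TensorProduct.lid k B).toAlgHom.comp
      (Algebra.TensorProduct.map (Bialgebra.counitAlgHom k A) (AlgHom.id k B))).comp S.β =
      AlgHom.id k B := by
    refine S.planeB.algHom_ext fun i => ?_
    simp [S.β_e, S.counit_T]
  exact congrArg AlgHom.toLinearMap this

theorem coassoc_δ : (TensorProduct.assoc k D A A).toLinearMap ∘ₗ
    S.δ.toLinearMap.rTensor A ∘ₗ S.δ.toLinearMap =
      (Coalgebra.comul (R := k) (A := A)).lTensor D ∘ₗ S.δ.toLinearMap := by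
  have : ((Algebra.TensorProduct.assoc k k k D A A).toAlgHom.comp
      (Algebra.TensorProduct.map S.δ (AlgHom.id k A))).comp S.δ =
      (Algebra.TensorProduct.map (AlgHom.id k D) (Bialgebra.comulAlgHom k A)).comp S.δ := by
    refine S.planeD.algHom_ext fun i => ?_
    simp only [AlgHom.comp_apply, S.δ_f, map_sum, Algebra.TensorProduct.map_tmul,
      Bialgebra.comulAlgHom_apply, S.comul_T, AlgHom.id_apply, TensorProduct.sum_tmul,
      TensorProduct.tmul_sum]
    rw [Finset.sum_comm]
    rfl
  exact congrArg AlgHom.toLinearMap this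

theorem counit_δ : (TensorProduct.rid k D).toLinearMap ∘ₗ
    (Coalgebra.counit (R := k) (A := A)).lTensor D ∘ₗ S.δ.toLinearMap = LinearMap.id := by
  have : ((Algebra.TensorProduct.rid k k D).toAlgHom.comp
      (Algebra.TensorProduct.map (AlgHom.id k D) (Bialgebra.counitAlgHom k A))).comp S.δ =
      AlgHom.id k D := by
    refine S.planeD.algHom_ext fun i => ?_
    simp [S.δ_f, S.counit_T]
  exact congrArg AlgHom.toLinearMap this

/-- The left action `x ↦ (b ↦ ∑ ⟨𝓡(b^(1)), x⟩ b^(2))` of `A` on `B`. -/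
def actB : A →ₐ[k] Module.End k B :=
  AlgHom.ofLinearMap
    { toFun := fun x => cof S.β (P.pair.flip x ∘ₗ P.Rp.toLinearMap)
      map_add' := fun x y => by
        simp only [cof, map_add, LinearMap.add_comp, LinearMap.rTensor_add, LinearMap.comp_add]
      map_smul' := fun r x => by
        simp only [cof, map_smul, LinearMap.smul_comp, LinearMap.rTensor_smul, LinearMap.comp_smul,
          RingHom.id_apply] }
    (by
      change cof S.β (P.pair.flip 1 ∘ₗ P.Rp.toLinearMap) = 1
      rw [P.flip_one_Rp]
      exact S.counit_β)
    (fun x y => by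
      ext b
      change cof S.β (P.pair.flip (x * y) ∘ₗ P.Rp.toLinearMap) b = cof S.β _ (cof S.β _ b)
      rw [cof_cof S.coassoc_β, P.flip_mul_Rp])

theorem actB_apply (x : A) : S.actB x = cof S.β (P.pair.flip x ∘ₗ P.Rp.toLinearMap) := rfl

/-- The left action of `H` on `D`. -/
def actD : H →ₐ[k] Module.End k D :=
  AlgHom.ofLinearMap
    { toFun := fun h => cofR S.δ (P.pair h)
      map_add' := fun x y => by
        simp only [cofR, map_add, LinearMap.add_comp, LinearMap.lTensor_add, LinearMap.comp_add]
      map_smul' := fun r x => by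
        simp only [cofR, map_smul, LinearMap.smul_comp, LinearMap.lTensor_smul, LinearMap.comp_smul,
          RingHom.id_apply] }
    (by
      change cofR S.δ (P.pair 1) = 1
      rw [P.pair_one]
      exact S.counit_δ)
    (fun x y => by
      ext b
      change cofR S.δ (P.pair (x * y)) b = cofR S.δ _ (cofR S.δ _ b)
      rw [cofR_cofR S.coassoc_δ, P.pair_mul])

theorem actD_apply (h : H) : S.actD h = cofR S.δ (P.pair h) := rfl

theorem comul_Rp_T (i j : Fin n) : Coalgebra.comul (R := k) (P.Rp (S.T i j)) =
    ∑ a, P.Rp (S.T a j) ⊗ₜ[k] P.Rp (S.T i a) := by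
  simp [P.comul_Rp, S.comul_T]

theorem comul_Rm_T (i j : Fin n) : Coalgebra.comul (R := k) (P.Rm (S.T i j)) =
    ∑ a, P.Rm (S.T a j) ⊗ₜ[k] P.Rm (S.T i a) := by
  simp [P.comul_Rm, S.comul_T]

/-- Pairing a product `𝓡(T j a) 𝓡(x)` with `T i l` splits along the coproduct of `T`; the first
letter contributes an entry of `R` by `pair_T`, and the second the action on `b`. -/
theorem actB_T_mul (i j l : Fin n) (b : B) : S.actB (S.T i l) (S.e j * b) =
    ∑ y, permMul R (i, j) y • (S.e y.1 * S.actB (S.T y.2 l) b) := by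
  simp only [actB_apply, cof, LinearMap.comp_apply, AlgHom.toLinearMap_apply, map_mul, S.β_e,
    LinearEquiv.coe_coe]
  generalize S.β b = z
  induction z using TensorProduct.induction_on with
  | zero => simp
  | add x y hx hy => simp only [map_add, mul_add, hx, hy, Finset.sum_add_distrib, smul_add]
  | tmul x w =>
    simp only [Finset.sum_mul, Algebra.TensorProduct.tmul_mul_tmul, map_sum,
      LinearMap.rTensor_tmul, LinearMap.comp_apply, AlgHom.toLinearMap_apply, map_mul,
      LinearMap.flip_apply, P.pair_mul_left, S.comul_T, TensorProduct.map_tmul,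
      LinearMap.mul'_apply, S.pair_T, TensorProduct.lid_tmul, Finset.sum_smul,
      Fintype.sum_prod_type, permMul, mul_smul_comm, smul_smul]

theorem actD_T_mul (i j l : Fin n) (c : D) : S.actD (P.Rp (S.T l i)) (S.f j * c) =
    ∑ y, (permMul R).transpose (i, j) y • (S.f y.1 * S.actD (P.Rp (S.T l y.2)) c) := by
  simp only [actD_apply, cofR, LinearMap.comp_apply, AlgHom.toLinearMap_apply, map_mul, S.δ_f,
    LinearEquiv.coe_coe]
  generalize S.δ c = z
  induction z using TensorProduct.induction_on with
  | zero => simp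
  | add x y hx hy => simp only [map_add, mul_add, hx, hy, Finset.sum_add_distrib, smul_add]
  | tmul w x =>
    simp only [Finset.sum_mul, Algebra.TensorProduct.tmul_mul_tmul, map_sum,
      LinearMap.lTensor_tmul, P.pair_mul_right, S.comul_Rp_T, TensorProduct.map_tmul,
      LinearMap.mul'_apply, LinearMap.flip_apply, S.pair_T, TensorProduct.rid_tmul, Finset.sum_smul,
      Fintype.sum_prod_type, permMul, mul_smul_comm, smul_smul, Matrix.transpose_apply]

/-- The braided plane `B`. -/
def coreB : PlaneCore (permMul R') (permMul R) B where
  v := S.e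
  isPlane := S.planeB
  hecke := S.hecke_B
  -- Since `e^i ◁ h = ∑ ⟨h, t^i_a⟩ e^a`, the braiding is `Ψ(e^i ⊗ w) = ∑ (t^i_a · w) ⊗ e^a`, with
  -- `A` acting through `⟨𝓡(w^(1)), -⟩`.
  lam i j := S.actB (S.T i j)
  lam_one i j := by
    simp [actB_apply, cof, Algebra.TensorProduct.one_def, P.pair_one_left, S.counit_T, ite_smul]
  lam_mul := S.actB_T_mul
  lam_rtt x z := by simpa using congrArg S.actB (S.rtt_perm x z)
  J := ((Module.endTensorEndAlgHom (R := k) (S := k) (A := k)).comp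
    (Algebra.TensorProduct.map S.actB (Algebra.lmul k B))).comp S.β
  J_v i := by
    simp only [AlgHom.comp_apply, S.β_e, map_sum]
    rfl

/-- The coaction on `D` as a left coaction. -/
def δ' : D →ₐ[k] A ⊗[k] D := (Algebra.TensorProduct.comm k D A).toAlgHom.comp S.δ

theorem δ'_apply (c : D) : S.δ' c = TensorProduct.comm k D A (S.δ c) := rfl

/-- The braided plane `D`. -/
def coreD : PlaneCore (permMul R').transpose (permMul R).transpose D where
  v := S.f
  isPlane := S.planeD
  hecke := S.hecke_D
  -- The coaction on `f_i` has coefficients `t^a_i`, so `Ψ(f_i ⊗ w) = ∑ (𝓡(t^a_i) ▷ w) ⊗ f_a`. The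
  -- indices are swapped relative to `B`, and with them the matrices are transposed.
  lam i j := S.actD (P.Rp (S.T j i))
  lam_one i j := by
    simp [actD_apply, cofR, Algebra.TensorProduct.one_def, P.pair_one_right, S.counit_T, ite_smul,
      P.counit_Rp, eq_comm]
  lam_mul := S.actD_T_mul
  lam_rtt x z := by simpa using (congrArg (S.actD.comp P.Rp) (S.rtt_perm z x)).symm
  J := ((Module.endTensorEndAlgHom (R := k) (S := k) (A := k)).comp
    (Algebra.TensorProduct.map (S.actD.comp P.Rp) (Algebra.lmul k D))).comp S.δ'
  J_v i := by
    simp only [AlgHom.comp_apply, S.δ'_apply, S.δ_f, map_sum, TensorProduct.comm_tmul]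
    rfl

theorem isCoaction_β : S.coreB.IsCoaction S.β S.T where
  coact_v := S.β_e
  rtt := S.rtt_perm

theorem isCoaction_δ : S.coreD.IsCoaction S.δ' (fun i j => S.T j i) where
  coact_v i := by simp [S.δ'_apply, coreD, S.δ_f]
  rtt x z := (S.rtt_perm z x).symm

theorem braidedMul_tmul {V : Type u} [Ring V] [Algebra k V] (Ψ : V ⊗[k] V →ₗ[k] V ⊗[k] V)
    (b c d e : V) : braidedMul Ψ ((b ⊗ₜ c) ⊗ₜ (d ⊗ₜ e)) =
      (LinearMap.mulLeft k b).rTensor V ((LinearMap.mulRight k e).lTensor V (Ψ (c ⊗ₜ d))) := by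
  simp only [braidedMul, LinearMap.comp_apply, LinearEquiv.coe_coe, TensorProduct.assoc_tmul,
    LinearMap.lTensor_tmul, TensorProduct.assoc_symm_tmul, LinearMap.rTensor_tmul]
  generalize Ψ (c ⊗ₜ d) = z
  induction z using TensorProduct.induction_on with
  | zero => simp
  | add x y hx hy => simp only [map_add, TensorProduct.add_tmul, TensorProduct.tmul_add, hx, hy]
  | tmul x w => simp

theorem braidL_tmul (c d : B) : braidL P S.β (c ⊗ₜ d) =
    TensorProduct.map ((LinearMap.applyₗ d) ∘ₗ S.actB.toLinearMap) LinearMap.id (S.β c) := by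
  simp only [braidL, LinearMap.comp_apply, LinearMap.lTensor_tmul, LinearEquiv.coe_coe,
    AlgHom.toLinearMap_apply]
  let G : A →ₗ[k] A ⊗[k] B →ₗ[k] B :=
    (LinearMap.llcomp k (A ⊗[k] B) (k ⊗[k] B) B (TensorProduct.lid k B).toLinearMap) ∘ₗ
      LinearMap.rTensorHom B ∘ₗ (LinearMap.lcomp k k P.Rp.toLinearMap) ∘ₗ P.pair.flip
  have hG : LinearMap.applyₗ d ∘ₗ S.actB.toLinearMap = LinearMap.applyₗ (S.β d) ∘ₗ G := rfl
  rw [hG]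
  generalize S.β d = z
  induction z using TensorProduct.induction_on with
  | zero => simp
  | add x y hx hy =>
    simp only [map_add, TensorProduct.tmul_add, hx, hy, LinearMap.add_comp,
      TensorProduct.map_add_left, LinearMap.add_apply]
  | tmul x w =>
    simp only [TensorProduct.assoc_symm_tmul, LinearMap.rTensor_tmul, LinearMap.comp_apply,
      LinearMap.lTensor_tmul, AlgHom.toLinearMap_apply, rAct_tmul, TensorProduct.comm_tmul, cof,
      LinearEquiv.coe_coe]
    generalize S.β c = z
    induction z using TensorProduct.induction_on with
    | zero => simp
    | add x y hx hy => simp only [map_add, TensorProduct.tmul_add, hx, hy]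
    | tmul y u => simp [G, TensorProduct.smul_tmul]

theorem braidR_tmul (ρ : A →ₐ[k] H) (c d : D) : braidR P ρ S.δ (c ⊗ₜ d) =
    TensorProduct.map ((LinearMap.applyₗ d) ∘ₗ (S.actD.comp ρ).toLinearMap) LinearMap.id
      (S.δ' c) := by
  simp only [braidR, LinearMap.comp_apply, LinearMap.rTensor_tmul, LinearEquiv.coe_coe,
    AlgHom.toLinearMap_apply, δ'_apply]
  generalize S.δ c = z
  induction z using TensorProduct.induction_on with
  | zero => simp
  | add x y hx hy => simp only [map_add, TensorProduct.add_tmul, hx, hy]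
  | tmul x w => simp [lAct_tmul, actD_apply]

/-- Identifies the product of the braided tensor square that occurs in `LeftBraidedGroup` with the
operator product `Op`, for which multiplicativity of the coproduct is known. -/
theorem braidedMul_B (z w : B ⊗[k] B) :
    braidedMul (braidL P S.β) (z ⊗ₜ w) = S.coreB.Op z w := by
  induction z using TensorProduct.induction_on with
  | zero => simp
  | add x y hx hy => simp only [map_add, TensorProduct.add_tmul, hx, hy, LinearMap.add_apply]
  | tmul b c =>
    induction w using TensorProduct.induction_on with
    | zero => simp
    | add x y hx hy => simp only [map_add, TensorProduct.tmul_add, hx, hy]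
    | tmul d e =>
      rw [braidedMul_tmul, braidL_tmul, PlaneCore.Op_tmul, Module.End.mul_apply]
      simp only [coreB, AlgHom.comp_apply]
      generalize S.β c = z
      induction z using TensorProduct.induction_on with
      | zero => simp
      | add x y hx hy => simp only [map_add, hx, hy, LinearMap.add_apply]
      | tmul x w => rfl

theorem braidedMul_D (z w : D ⊗[k] D) :
    braidedMul (braidR P P.Rp S.δ) (z ⊗ₜ w) = S.coreD.Op z w := by
  induction z using TensorProduct.induction_on with
  | zero => simp
  | add x y hx hy => simp only [map_add, TensorProduct.add_tmul, hx, hy, LinearMap.add_apply]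
  | tmul b c =>
    induction w using TensorProduct.induction_on with
    | zero => simp
    | add x y hx hy => simp only [map_add, TensorProduct.tmul_add, hx, hy]
    | tmul d e =>
      rw [braidedMul_tmul, braidR_tmul, PlaneCore.Op_tmul, Module.End.mul_apply]
      simp only [coreD, AlgHom.comp_apply]
      generalize S.δ' c = z
      induction z using TensorProduct.induction_on with
      | zero => simp
      | add x y hx hy => simp only [map_add, hx, hy, LinearMap.add_apply]
      | tmul x w => rfl

/-- The braided group `B`. -/
def groupB : LeftBraidedGroup P B where
  coact := S.β
  coact_coassoc := S.coassoc_β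
  coact_counit := S.counit_β
  comul := S.coreB.comul
  counit := S.coreB.counit
  coassoc := S.coreB.coassoc
  counit_comul := S.coreB.counit_comul
  comul_counit := S.coreB.comul_counit
  comul_one := S.coreB.comul_one
  comul_mul b d := by rw [braidedMul_B, S.coreB.comul_mul]
  comul_covariant := S.isCoaction_β.comul_covariant
  counit_covariant := S.isCoaction_β.counit_covariant

/-- The braided group `D`. -/
def groupD : RightBraidedGroup P D where
  coact := S.δ
  coact_coassoc := S.coassoc_δ
  coact_counit := S.counit_δ
  comul := S.coreD.comul
  counit := S.coreD.counit
  coassoc := S.coreD.coassoc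
  counit_comul := S.coreD.counit_comul
  comul_counit := S.coreD.comul_counit
  comul_one := S.coreD.comul_one
  comul_mul b d := by rw [braidedMul_D, S.coreD.comul_mul]
  comul_covariant := by
    ext c
    -- Covariance is known for the left coaction `δ'`. Flipping the tensor factors returns to `δ`,
    -- and the order of the product in `A` is unaffected.
    have h := congrArg (TensorProduct.comm k A (D ⊗[k] D))
      (LinearMap.congr_fun S.isCoaction_δ.comul_covariant c)
    simp only [LinearMap.comp_apply, AlgHom.toLinearMap_apply, PlaneCore.coact₂,
      LinearEquiv.coe_coe, δ'_apply] at h ⊢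
    trans TensorProduct.comm k A (D ⊗[k] D)
      (S.coreD.comul.lTensor A (TensorProduct.comm k D A (S.δ c)))
    · generalize S.δ c = z
      induction z using TensorProduct.induction_on with
      | zero => simp
      | add x y hx hy => simp only [map_add, hx, hy]
      | tmul x w => simp
    · rw [h]
      generalize S.coreD.comul c = z
      induction z using TensorProduct.induction_on with
      | zero => simp
      | add x y hx hy => simp only [map_add, hx, hy]
      | tmul x w =>
        simp only [TensorProduct.map_tmul, AlgHom.toLinearMap_apply, δ'_apply]
        generalize S.δ x = z
        generalize S.δ w = y
        induction z using TensorProduct.induction_on with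
        | zero => simp
        | add x y hx hy => simp only [map_add, TensorProduct.add_tmul, hx, hy]
        | tmul x w =>
          induction y using TensorProduct.induction_on with
          | zero => simp
          | add x y hx hy => simp only [map_add, TensorProduct.tmul_add, hx, hy]
          | tmul x w => simp
  counit_covariant c := by
    rw [← S.isCoaction_δ.counit_covariant c, δ'_apply]
    generalize S.δ c = z
    induction z using TensorProduct.induction_on with
    | zero => simp
    | add x y hx hy => simp only [map_add, hx, hy]
    | tmul x w => simp

/-- The pairing between the braided groups `D` and `B`. -/
def pairing (κ : k) : BraidedPairing S.groupD S.groupB where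
  ev := PlaneCore.ev S.coreD S.coreB κ
  ev_mul_left := PlaneCore.ev_mul_left _ _ _
  ev_one_left := PlaneCore.ev_one_left _ _ _
  ev_mul_right := PlaneCore.ev_mul_right _ _ _
  ev_one_right := PlaneCore.ev_one_right _ _ _
  covariant c b := by
    have h := congrArg (TensorProduct.rid k A)
      (PlaneCore.ev_covariant S.coreD S.coreB κ S.isCoaction_β S.isCoaction_δ c b)
    refine Eq.trans ?_ h
    simp only [groupD, δ'_apply]
    generalize S.δ c = z
    induction z using TensorProduct.induction_on with
    | zero => simp
    | add x y hx hy => simp only [map_add, hx, hy]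
    | tmul x w => simp

end PlaneData

end

end DoubleBosonisation

/-! ### The matrices `m⁺`, `m⁻` and the algebra presented by the cross relations. -/

namespace DoubleBosonisation

noncomputable section

open scoped Shortcuts

variable {k : Type u} [Field k] {n : ℕ} {H A B D : Type u} [Ring H] [Ring A] [Bialgebra k H]
  [Bialgebra k A] [Ring B] [Algebra k B] [Ring D] [Algebra k D]

/-- `h ↦ ∑ h₁ ⟨h₂, a⟩`. -/
def WeakQTPair.dR (P : WeakQTPair k H A) (a : A) : H →ₗ[k] H :=
  (TensorProduct.rid k H).toLinearMap ∘ₗ (P.pair.flip a).lTensor H ∘ₗ Coalgebra.comul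

theorem WeakQTPair.comul_dR (P : WeakQTPair k H A) (a : A) (h : H) : Coalgebra.comul (R := k) (P.dR a h) =
    (P.dR a).lTensor H (Coalgebra.comul (R := k) h) := by
  have h1 := congrArg ((TensorProduct.rid k (H ⊗[k] H)).toLinearMap ∘ₗ
    (P.pair.flip a).lTensor (H ⊗[k] H) ∘ₗ
      (TensorProduct.assoc k H H H).symm.toLinearMap) (Coalgebra.coassoc_apply (R := k) h)
  simp only [LinearMap.comp_apply, LinearEquiv.coe_coe, LinearEquiv.symm_apply_apply] at h1
  trans TensorProduct.rid k (H ⊗[k] H) ((P.pair.flip a).lTensor (H ⊗[k] H)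
    (Coalgebra.comul.rTensor H (Coalgebra.comul (R := k) h)))
  · simp only [WeakQTPair.dR, LinearMap.comp_apply]
    generalize Coalgebra.comul (R := k) h = z
    induction z using TensorProduct.induction_on with
    | zero => simp
    | add x y hx hy => simp only [map_add, hx, hy]
    | tmul x y => simp
  · rw [h1]
    generalize Coalgebra.comul (R := k) h = z
    induction z using TensorProduct.induction_on with
    | zero => simp
    | add x y hx hy => simp only [map_add, hx, hy]
    | tmul x y =>
      simp only [WeakQTPair.dR, LinearMap.lTensor_tmul, LinearMap.comp_apply]
      generalize Coalgebra.comul (R := k) y = z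
      induction z using TensorProduct.induction_on with
      | zero => simp
      | add x y hx hy => simp only [map_add, TensorProduct.tmul_add, hx, hy]
      | tmul x y => simp

namespace PlaneData

variable {P : WeakQTPair k H A} {R R' : Mat2 k n} (S : PlaneData P R R' B D)

/-! ## Differentiation along the coefficients of the coaction -/

/-- `h ↦ ∑ h₁ ⟨h₂, t^i_j⟩`. -/
def nR (i j : Fin n) : H →ₗ[k] H :=
  (TensorProduct.rid k H).toLinearMap ∘ₗ (P.pair.flip (S.T i j)).lTensor H ∘ₗ Coalgebra.comul

/-- `h ↦ ∑ ⟨h₁, t^i_j⟩ h₂`. -/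
def nL (i j : Fin n) : H →ₗ[k] H :=
  (TensorProduct.lid k H).toLinearMap ∘ₗ (P.pair.flip (S.T i j)).rTensor H ∘ₗ Coalgebra.comul

theorem diffR_T (h : H) (i j : Fin n) : diffR P.pair h (S.T i j) = S.nR i j h := by
  simp only [diffR, nR, LinearMap.comp_apply, LinearEquiv.coe_coe]
  generalize Coalgebra.comul (R := k) h = z
  induction z using TensorProduct.induction_on with
  | zero => simp
  | add x y hx hy => simp only [map_add, LinearMap.add_apply, hx, hy]
  | tmul x y => simp

theorem diffL_T (h : H) (i j : Fin n) : diffL P.pair h (S.T i j) = S.nL i j h := by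
  simp only [diffL, nL, LinearMap.comp_apply, LinearEquiv.coe_coe]
  generalize Coalgebra.comul (R := k) h = z
  induction z using TensorProduct.induction_on with
  | zero => simp
  | add x y hx hy => simp only [map_add, LinearMap.add_apply, hx, hy]
  | tmul x y => simp

/-- The axiom `diff_Rp` evaluated on a matrix entry `T i j`. This and `nR_Rm` are the forms in which
weak quasitriangularity enters the construction of `U`. -/
theorem nR_Rp (h : H) (i j : Fin n) :
    ∑ a, S.nR i a h * P.Rp (S.T a j) = ∑ a, P.Rp (S.T i a) * S.nL a j h := by
  have := LinearMap.congr_fun (P.diff_Rp h) (S.T i j)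
  simpa [conv, S.comul_T, diffR_T, diffL_T] using this

theorem nR_Rm (h : H) (i j : Fin n) :
    ∑ a, S.nR i a h * P.Rm (S.T a j) = ∑ a, P.Rm (S.T i a) * S.nL a j h := by
  have := LinearMap.congr_fun (P.diff_Rm h) (S.T i j)
  simpa [conv, S.comul_T, diffR_T, diffL_T] using this

theorem pair_mul_T (h g : H) (i j : Fin n) :
    P.pair (h * g) (S.T i j) = ∑ a, P.pair h (S.T i a) * P.pair g (S.T a j) := by
  simp [P.pair_mul_left, S.comul_T]

theorem nR_one (i j : Fin n) : S.nR i j 1 = if i = j then 1 else 0 := by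
  simp [nR, Algebra.TensorProduct.one_def, P.pair_one_left, S.counit_T, ite_smul]

theorem nL_one (i j : Fin n) : S.nL i j 1 = if i = j then 1 else 0 := by
  simp [nL, Algebra.TensorProduct.one_def, P.pair_one_left, S.counit_T, ite_smul]

theorem nR_mul (i j : Fin n) (h g : H) : S.nR i j (h * g) = ∑ a, S.nR i a h * S.nR a j g := by
  simp only [nR, LinearMap.comp_apply, Bialgebra.comul_mul]
  generalize Coalgebra.comul (R := k) h = z
  generalize Coalgebra.comul (R := k) g = w
  induction z using TensorProduct.induction_on with
  | zero => simp
  | add x y hx hy => simp only [map_add, add_mul, hx, hy, Finset.sum_add_distrib]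
  | tmul x y =>
    induction w using TensorProduct.induction_on with
    | zero => simp
    | add x y hx hy => simp only [map_add, mul_add, hx, hy, Finset.sum_add_distrib]
    | tmul x' y' => simp [pair_mul_T, Finset.sum_smul, smul_smul, mul_comm]

theorem nL_mul (i j : Fin n) (h g : H) : S.nL i j (h * g) = ∑ a, S.nL i a h * S.nL a j g := by
  simp only [nL, LinearMap.comp_apply, Bialgebra.comul_mul]
  generalize Coalgebra.comul (R := k) h = z
  generalize Coalgebra.comul (R := k) g = w
  induction z using TensorProduct.induction_on with
  | zero => simp
  | add x y hx hy => simp only [map_add, add_mul, hx, hy, Finset.sum_add_distrib]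
  | tmul x y =>
    induction w using TensorProduct.induction_on with
    | zero => simp
    | add x y hx hy => simp only [map_add, mul_add, hx, hy, Finset.sum_add_distrib]
    | tmul x' y' => simp [pair_mul_T, Finset.sum_smul, smul_smul, mul_comm]

theorem comul_nR (i j : Fin n) (h : H) : Coalgebra.comul (R := k) (S.nR i j h) =
    (S.nR i j).lTensor H (Coalgebra.comul (R := k) h) := P.comul_dR (S.T i j) h

theorem comul_nL (i j : Fin n) (h : H) : Coalgebra.comul (R := k) (S.nL i j h) =
    (S.nL i j).rTensor H (Coalgebra.comul (R := k) h) := by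
  have h1 := congrArg ((TensorProduct.lid k (H ⊗[k] H)).toLinearMap ∘ₗ
    (P.pair.flip (S.T i j)).rTensor (H ⊗[k] H)) (Coalgebra.coassoc_apply (R := k) h)
  simp only [LinearMap.comp_apply, LinearEquiv.coe_coe] at h1
  trans TensorProduct.lid k (H ⊗[k] H) ((P.pair.flip (S.T i j)).rTensor (H ⊗[k] H)
    (Coalgebra.comul.lTensor H (Coalgebra.comul (R := k) h)))
  · simp only [nL, LinearMap.comp_apply]
    generalize Coalgebra.comul (R := k) h = z
    induction z using TensorProduct.induction_on with
    | zero => simp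
    | add x y hx hy => simp only [map_add, hx, hy]
    | tmul x y => simp
  · rw [← h1]
    generalize Coalgebra.comul (R := k) h = z
    induction z using TensorProduct.induction_on with
    | zero => simp
    | add x y hx hy => simp only [map_add, hx, hy]
    | tmul x y =>
      simp only [nL, LinearMap.rTensor_tmul, LinearMap.comp_apply]
      generalize Coalgebra.comul (R := k) x = z
      induction z using TensorProduct.induction_on with
      | zero => simp
      | add x y hx hy => simp only [map_add, TensorProduct.add_tmul, hx, hy]
      | tmul x y => simp [TensorProduct.smul_tmul']

theorem nL_nR (i j p l : Fin n) (h : H) :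
    S.nL i j (S.nR p l h) = S.nR p l (S.nL i j h) := by
  have h1 : ∀ z : H ⊗[k] H, TensorProduct.lid k H ((P.pair.flip (S.T i j)).rTensor H
      ((S.nR p l).lTensor H z)) =
        S.nR p l (TensorProduct.lid k H ((P.pair.flip (S.T i j)).rTensor H z)) := by
    intro z
    induction z using TensorProduct.induction_on with
    | zero => simp
    | add x y hx hy => simp only [map_add, hx, hy]
    | tmul x y => simp
  have h2 := h1 (Coalgebra.comul h)
  rw [← S.comul_nR] at h2
  exact h2

/-- Both sides are `∑ h₁ ⟨h₂, T i j⟩ ⊗ h₃`: by coassociativity the middle leg can be split off from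
either neighbour. -/
theorem rTensor_nR (i j : Fin n) (h : H) : (S.nR i j).rTensor H (Coalgebra.comul (R := k) h) =
    (S.nL i j).lTensor H (Coalgebra.comul (R := k) h) := by
  have h1 := congrArg ((TensorProduct.lid k H).toLinearMap.lTensor H ∘ₗ
    ((P.pair.flip (S.T i j)).rTensor H).lTensor H) (Coalgebra.coassoc_apply (R := k) h)
  simp only [LinearMap.comp_apply] at h1
  trans ((TensorProduct.lid k H).toLinearMap.lTensor H) (((P.pair.flip (S.T i j)).rTensor H).lTensor H
    (TensorProduct.assoc k H H H (Coalgebra.comul.rTensor H (Coalgebra.comul (R := k) h))))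
  · generalize Coalgebra.comul (R := k) h = z
    induction z using TensorProduct.induction_on with
    | zero => simp
    | add x y hx hy => simp only [map_add, hx, hy]
    | tmul x y =>
      simp only [nR, LinearMap.rTensor_tmul, LinearMap.comp_apply]
      generalize Coalgebra.comul (R := k) x = z
      induction z using TensorProduct.induction_on with
      | zero => simp
      | add x y hx hy => simp only [map_add, TensorProduct.add_tmul, hx, hy]
      | tmul x y => simp [TensorProduct.smul_tmul]
  · rw [h1, ← LinearMap.comp_apply, ← LinearMap.comp_apply, ← LinearMap.lTensor_comp,
      ← LinearMap.lTensor_comp]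
    rfl

theorem counit_nR (i j : Fin n) (h : H) :
    Coalgebra.counit (R := k) (S.nR i j h) = P.pair h (S.T i j) := by
  have h1 := congrArg (TensorProduct.lid k H) (Coalgebra.rTensor_counit_comul (R := k) h)
  simp only [TensorProduct.lid_tmul, one_smul] at h1
  conv_rhs => rw [← h1]
  simp only [nR, LinearMap.comp_apply]
  generalize Coalgebra.comul (R := k) h = z
  induction z using TensorProduct.induction_on with
  | zero => simp
  | add x y hx hy => simp only [map_add, LinearMap.add_apply, hx, hy]
  | tmul x y => simp [mul_comm]

theorem counit_nL (i j : Fin n) (h : H) :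
    Coalgebra.counit (R := k) (S.nL i j h) = P.pair h (S.T i j) := by
  have h1 := congrArg (TensorProduct.rid k H) (Coalgebra.lTensor_counit_comul (R := k) h)
  simp only [TensorProduct.rid_tmul, one_smul] at h1
  conv_rhs => rw [← h1]
  simp only [nL, LinearMap.comp_apply]
  generalize Coalgebra.comul (R := k) h = z
  induction z using TensorProduct.induction_on with
  | zero => simp
  | add x y hx hy => simp only [map_add, LinearMap.add_apply, hx, hy]
  | tmul x y => simp [mul_comm]

/-- The matrix `m⁺`. -/
def Mp (i j : Fin n) : H := P.Rp (S.T i j)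

/-- The matrix `m⁻`. -/
def Mm (i j : Fin n) : H := P.Rm (S.T i j)

theorem comul_Mp (i j : Fin n) :
    Coalgebra.comul (R := k) (S.Mp i j) = ∑ a, S.Mp a j ⊗ₜ[k] S.Mp i a := S.comul_Rp_T i j

theorem comul_Mm (i j : Fin n) :
    Coalgebra.comul (R := k) (S.Mm i j) = ∑ a, S.Mm a j ⊗ₜ[k] S.Mm i a := S.comul_Rm_T i j

theorem counit_Mp (i j : Fin n) : Coalgebra.counit (R := k) (S.Mp i j) = if i = j then 1 else 0 := by
  rw [Mp, P.counit_Rp, S.counit_T]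

theorem counit_Mm (i j : Fin n) : Coalgebra.counit (R := k) (S.Mm i j) = if i = j then 1 else 0 := by
  rw [Mm, P.counit_Rm, S.counit_T]

/-- The matrix with entries `⟨m⁻^i_j, t^p_l⟩`, the inverse of `R`. -/
def Rbar : Mat2 k n := fun x y => P.pair (S.Mm x.2 y.2) (S.T x.1 y.1)

/-- The convolution inverse in the axiom `inv_left`, evaluated on entries of `T`, is an inverse of
matrices. In particular `R` is invertible for any `PlaneData`. -/
theorem Rbar_mul : S.Rbar * R = 1 := by
  ext ⟨p, i⟩ ⟨l, j⟩
  have h := LinearMap.congr_fun P.inv_left (S.T i j ⊗ₜ S.T p l)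
  simp only [conv, LinearMap.comp_apply, TensorProduct.comul_tmul, S.comul_T,
    TensorProduct.sum_tmul, TensorProduct.tmul_sum, map_sum, TensorProduct.map_tmul,
    TensorProduct.lift.tmul, AlgHom.toLinearMap_apply, LinearMap.flip_apply,
    LinearMap.mul'_apply, TensorProduct.AlgebraTensorModule.tensorTensorTensorComm_tmul,
    S.pair_T, TensorProduct.counit_tmul, S.counit_T] at h
  simp only [Matrix.mul_apply, Fintype.sum_prod_type, Rbar, Mm, h, Matrix.one_apply,
    Prod.mk.injEq, smul_eq_mul]
  by_cases h1 : i = j <;> by_cases h2 : p = l <;> simp [h1, h2]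

theorem mul_Rbar : R * S.Rbar = 1 := mul_eq_one_comm.mp S.Rbar_mul

theorem pair_Mp (i j p l : Fin n) : P.pair (S.Mp i j) (S.T p l) = R (i, p) (j, l) :=
  S.pair_T i j p l

theorem nR_Mp (i j p l : Fin n) :
    S.nR p l (S.Mp i j) = ∑ a, R (i, p) (a, l) • S.Mp a j := by
  simp [nR, comul_Mp, pair_Mp]

theorem nR_Mm (i j p l : Fin n) :
    S.nR p l (S.Mm i j) = ∑ a, S.Rbar (p, i) (l, a) • S.Mm a j := by
  simp [nR, comul_Mm, Rbar]

theorem nL_Mp (i j p l : Fin n) :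
    S.nL p l (S.Mp i j) = ∑ a, R (a, p) (j, l) • S.Mp i a := by
  simp [nL, comul_Mp, pair_Mp]

theorem nL_Mm (i j p l : Fin n) :
    S.nL p l (S.Mm i j) = ∑ a, S.Rbar (p, a) (l, j) • S.Mm i a := by
  simp [nL, comul_Mm, Rbar]

/-! ## The algebra of the double bosonisation -/

/-- The relations between `C̄`, `H` and `B`, for elements `E i`, `F i` of an algebra receiving an
algebra map from `H`. -/
structure Cross (κ : k) {X : Type u} [Ring X] [Algebra k X] (E F : Fin n → X) (η : H →ₐ[k] X) :
    Prop where
  ee : ∀ x : Fin n × Fin n, E x.1 * E x.2 = act (permMul R') (fun y => E y.1 * E y.2) x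
  ff : ∀ x : Fin n × Fin n, F x.1 * F x.2 = act (permMul R').transpose (fun y => F y.1 * F y.2) x
  eh : ∀ i h, E i * η h = ∑ a, η (S.nR i a h) * E a
  hf : ∀ h i, η h * F i = ∑ a, F a * η (S.nL a i h)
  ef : ∀ i j, E i * F j = F j * E i + κ⁻¹ • (η (S.Mp i j) - η (S.Mm i j))

/-- The relations defining the double bosonisation. -/
inductive Rel (κ : k) : FreeAlgebra k (Fin n ⊕ Fin n ⊕ H) → FreeAlgebra k (Fin n ⊕ Fin n ⊕ H) → Prop
  | add (h g : H) : Rel κ (FreeAlgebra.ι k (.inr (.inr (h + g))))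
      (FreeAlgebra.ι k (.inr (.inr h)) + FreeAlgebra.ι k (.inr (.inr g)))
  | smul (r : k) (h : H) : Rel κ (FreeAlgebra.ι k (.inr (.inr (r • h))))
      (r • FreeAlgebra.ι k (.inr (.inr h)))
  | mul (h g : H) : Rel κ (FreeAlgebra.ι k (.inr (.inr (h * g))))
      (FreeAlgebra.ι k (.inr (.inr h)) * FreeAlgebra.ι k (.inr (.inr g)))
  | one : Rel κ (FreeAlgebra.ι k (.inr (.inr 1))) 1
  | ee (x : Fin n × Fin n) : Rel κ (FreeAlgebra.ι k (.inl x.1) * FreeAlgebra.ι k (.inl x.2))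
      (act (permMul R') (fun y => FreeAlgebra.ι k (.inl y.1) * FreeAlgebra.ι k (.inl y.2)) x)
  | ff (x : Fin n × Fin n) :
      Rel κ (FreeAlgebra.ι k (.inr (.inl x.1)) * FreeAlgebra.ι k (.inr (.inl x.2)))
      (act (permMul R').transpose
        (fun y => FreeAlgebra.ι k (.inr (.inl y.1)) * FreeAlgebra.ι k (.inr (.inl y.2))) x)
  | eh (i : Fin n) (h : H) : Rel κ (FreeAlgebra.ι k (.inl i) * FreeAlgebra.ι k (.inr (.inr h)))
      (∑ a, FreeAlgebra.ι k (.inr (.inr (S.nR i a h))) * FreeAlgebra.ι k (.inl a))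
  | hf (h : H) (i : Fin n) :
      Rel κ (FreeAlgebra.ι k (.inr (.inr h)) * FreeAlgebra.ι k (.inr (.inl i)))
      (∑ a, FreeAlgebra.ι k (.inr (.inl a)) * FreeAlgebra.ι k (.inr (.inr (S.nL a i h))))
  | ef (i j : Fin n) : Rel κ (FreeAlgebra.ι k (.inl i) * FreeAlgebra.ι k (.inr (.inl j)))
      (FreeAlgebra.ι k (.inr (.inl j)) * FreeAlgebra.ι k (.inl i) +
        κ⁻¹ • (FreeAlgebra.ι k (.inr (.inr (S.Mp i j))) - FreeAlgebra.ι k (.inr (.inr (S.Mm i j)))))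

/-- The algebra of the double bosonisation. -/
def Double (κ : k) : Type u := RingQuot (S.Rel κ)

instance (κ : k) : Ring (S.Double κ) := inferInstanceAs (Ring (RingQuot (S.Rel κ)))

instance (κ : k) : Algebra k (S.Double κ) := inferInstanceAs (Algebra k (RingQuot (S.Rel κ)))

namespace Double

variable (κ : k)

/-- The quotient map from the free algebra. -/
def mk : FreeAlgebra k (Fin n ⊕ Fin n ⊕ H) →ₐ[k] S.Double κ := RingQuot.mkAlgHom k (S.Rel κ)

theorem mk_rel {x y} (h : S.Rel κ x y) : mk S κ x = mk S κ y := RingQuot.mkAlgHom_rel k h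

/-- The generators `e^i`. -/
def e (i : Fin n) : S.Double κ := mk S κ (FreeAlgebra.ι k (.inl i))

/-- The generators `f_i`. -/
def f (i : Fin n) : S.Double κ := mk S κ (FreeAlgebra.ι k (.inr (.inl i)))

/-- The inclusion of `H`. -/
def inH : H →ₐ[k] S.Double κ :=
  AlgHom.ofLinearMap
    { toFun := fun h => mk S κ (FreeAlgebra.ι k (.inr (.inr h)))
      map_add' := fun h g => by rw [mk_rel S κ (.add h g), map_add]
      map_smul' := fun r h => by rw [mk_rel S κ (.smul r h), map_smul, RingHom.id_apply] }
    (by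
      change mk S κ (FreeAlgebra.ι k (.inr (.inr 1))) = 1
      rw [mk_rel S κ .one, map_one])
    (fun h g => by
      change mk S κ (FreeAlgebra.ι k (.inr (.inr (h * g)))) = _
      rw [mk_rel S κ (.mul h g), map_mul]
      rfl)

theorem cross : S.Cross κ (e S κ) (f S κ) (inH S κ) where
  ee x := by
    have := mk_rel S κ (.ee x)
    simp only [act, map_mul, map_sum, map_smul] at this
    exact this
  ff x := by
    have := mk_rel S κ (.ff x)
    simp only [act, map_mul, map_sum, map_smul] at this
    exact this
  eh i h := by
    have := mk_rel S κ (.eh i h)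
    simp only [map_mul, map_sum] at this
    exact this
  hf h i := by
    have := mk_rel S κ (.hf h i)
    simp only [map_mul, map_sum] at this
    exact this
  ef i j := by
    have := mk_rel S κ (.ef i j)
    simp only [map_mul, map_smul, map_add, map_sub] at this
    exact this

variable {S κ}

/-- Algebra maps out of the double bosonisation. -/
def lift {X : Type u} [Ring X] [Algebra k X] {E F : Fin n → X} {η : H →ₐ[k] X}
    (h : S.Cross κ E F η) : S.Double κ →ₐ[k] X :=
  RingQuot.liftAlgHom k ⟨FreeAlgebra.lift k (Sum.elim E (Sum.elim F η)), by
    intro x y hxy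
    cases hxy with
    | add h g => simp
    | smul r h => simp
    | mul h g => simp
    | one => simp
    | ee x => simpa [act] using h.ee x
    | ff x => simpa [act] using h.ff x
    | eh i g => simpa using h.eh i g
    | hf g i => simpa using h.hf g i
    | ef i j => simpa using h.ef i j⟩

section lift

variable {X : Type u} [Ring X] [Algebra k X] {E F : Fin n → X} {η : H →ₐ[k] X}
  (h : S.Cross κ E F η)

theorem lift_mk (x) : lift h (mk S κ x) = FreeAlgebra.lift k (Sum.elim E (Sum.elim F η)) x :=
  RingQuot.liftAlgHom_mkAlgHom_apply k _ _ _

@[simp]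
theorem lift_e (i : Fin n) : lift h (e S κ i) = E i := (lift_mk h _).trans (by simp)

@[simp]
theorem lift_f (i : Fin n) : lift h (f S κ i) = F i := (lift_mk h _).trans (by simp)

@[simp]
theorem lift_inH (g : H) : lift h (inH S κ g) = η g := (lift_mk h _).trans (by simp)

end lift

theorem hom_ext {X : Type u} [Ring X] [Algebra k X] {φ ψ : S.Double κ →ₐ[k] X}
    (he : ∀ i, φ (e S κ i) = ψ (e S κ i)) (hf : ∀ i, φ (f S κ i) = ψ (f S κ i))
    (hH : ∀ h, φ (inH S κ h) = ψ (inH S κ h)) : φ = ψ := by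
  refine RingQuot.ringQuot_ext' (S := k) (s := S.Rel κ) φ ψ (FreeAlgebra.hom_ext ?_)
  funext z
  rcases z with i | i | h
  · exact he i
  · exact hf i
  · exact hH h

theorem adjoin_eq_top :
    Algebra.adjoin k (Set.range (e S κ) ∪ Set.range (f S κ) ∪ Set.range (inH S κ)) = ⊤ := by
  rw [eq_top_iff]
  intro x _
  obtain ⟨y, rfl⟩ := RingQuot.mkAlgHom_surjective k (S.Rel κ) x
  have hy : y ∈ (Algebra.adjoin k (Set.range (FreeAlgebra.ι k (X := Fin n ⊕ Fin n ⊕ H)))) := by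
    rw [FreeAlgebra.adjoin_range_ι]
    trivial
  have h2 : mk S κ y ∈ (Algebra.adjoin k (Set.range (FreeAlgebra.ι k (X := Fin n ⊕ Fin n ⊕ H)))).map
      (mk S κ) := ⟨y, hy, rfl⟩
  rw [AlgHom.map_adjoin] at h2
  refine Algebra.adjoin_mono ?_ h2
  rintro _ ⟨_, ⟨z, rfl⟩, rfl⟩
  rcases z with i | i | h
  · exact Or.inl (Or.inl ⟨i, rfl⟩)
  · exact Or.inl (Or.inr ⟨i, rfl⟩)
  · exact Or.inr ⟨h, rfl⟩

theorem submodule_eq_top (N : Submodule k (S.Double κ)) (h1 : 1 ∈ N)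
    (he : ∀ i, ∀ x ∈ N, e S κ i * x ∈ N) (hf : ∀ i, ∀ x ∈ N, f S κ i * x ∈ N)
    (hH : ∀ h, ∀ x ∈ N, inH S κ h * x ∈ N) : N = ⊤ := by
  have key : ∀ x ∈ Algebra.adjoin k
      (Set.range (e S κ) ∪ Set.range (f S κ) ∪ Set.range (inH S κ)), ∀ b ∈ N, x * b ∈ N := by
    intro x hx
    induction hx using Algebra.adjoin_induction with
    | mem x hx =>
      rcases hx with (⟨i, rfl⟩ | ⟨i, rfl⟩) | ⟨h, rfl⟩
      · exact he i
      · exact hf i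
      · exact hH h
    | algebraMap r => intro b hb; rw [← Algebra.smul_def]; exact N.smul_mem r hb
    | add x y _ _ hx hy => intro b hb; rw [add_mul]; exact N.add_mem (hx b hb) (hy b hb)
    | mul x y _ _ hx hy => intro b hb; rw [mul_assoc]; exact hx _ (hy b hb)
  rw [eq_top_iff]
  intro x _
  have := key x (by rw [adjoin_eq_top]; trivial) 1 h1
  rwa [mul_one] at this

end Double

end PlaneData

end

end DoubleBosonisation

/-! ### Consequences of the cross relations and the bialgebra structure. -/

namespace DoubleBosonisation

noncomputable section

open scoped Shortcuts

variable {k : Type u} [Field k] {n : ℕ} {H A B D : Type u} [Ring H] [Ring A] [Bialgebra k H]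
  [Bialgebra k A] [Ring B] [Algebra k B] [Ring D] [Algebra k D]

theorem map_rel {X Y : Type*} [Ring X] [Algebra k X] [Ring Y] [Algebra k Y] (φ : X →ₐ[k] Y)
    {Q : Mat2 k n} {E : Fin n → X} {x : Fin n × Fin n}
    (h : E x.1 * E x.2 = act Q (fun y => E y.1 * E y.2) x) :
    φ (E x.1) * φ (E x.2) = act Q (fun y => φ (E y.1) * φ (E y.2)) x := by
  rw [← map_mul, h]
  simp [act]

theorem sum_swap_pairs {M : Type*} [AddCommMonoid M] (g : Fin n → Fin n → Fin n → Fin n → M) :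
    ∑ a, ∑ b, ∑ c, ∑ d, g c d a b = ∑ a, ∑ b, ∑ c, ∑ d, g a b c d := by
  calc _ = ∑ a, ∑ c, ∑ b, ∑ d, g c d a b := Finset.sum_congr rfl fun a _ => Finset.sum_comm
    _ = ∑ c, ∑ a, ∑ b, ∑ d, g c d a b := Finset.sum_comm
    _ = ∑ c, ∑ a, ∑ d, ∑ b, g c d a b :=
      Finset.sum_congr rfl fun c _ => Finset.sum_congr rfl fun a _ => Finset.sum_comm
    _ = _ := Finset.sum_congr rfl fun c _ => Finset.sum_comm

namespace PlaneData

variable {P : WeakQTPair k H A} {R R' : Mat2 k n} {S : PlaneData P R R' B D}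

/-! ## Consequences of the cross relations -/

/-- Only the relation between the `E i` and `H` is assumed, not all of `Cross`, because this rule is
already needed for the Fock operators while their remaining relations are being proved. -/
theorem e_mp_of_eh {X : Type*} [Ring X] [Algebra k X] {E : Fin n → X} {η : H →ₐ[k] X}
    (h : ∀ i h, E i * η h = ∑ a, η (S.nR i a h) * E a) (i j l : Fin n) :
    E i * η (S.Mp j l) = ∑ a, ∑ b, R (j, i) (a, b) • (η (S.Mp a l) * E b) := by
  simp only [h, S.nR_Mp, map_sum, map_smul, Finset.sum_mul, smul_mul_assoc]
  exact Finset.sum_comm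

theorem mp_f_of_hf {X : Type*} [Ring X] [Algebra k X] {F : Fin n → X} {η : H →ₐ[k] X}
    (h : ∀ h i, η h * F i = ∑ a, F a * η (S.nL a i h)) (i j l : Fin n) :
    η (S.Mp i j) * F l = ∑ a, ∑ b, R (a, b) (j, l) • (F b * η (S.Mp i a)) := by
  simp only [h, S.nL_Mp, map_sum, map_smul, Finset.mul_sum, mul_smul_comm]
  exact Finset.sum_comm

/-- The relation with `H` expresses `e m⁻` through `m⁻ e` with coefficients `R⁻¹`; multiplying the
vector of these relations by `R` yields the stated form. -/
theorem mm_e_of_eh {X : Type*} [Ring X] [Algebra k X] {E : Fin n → X} {η : H →ₐ[k] X}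
    (h : ∀ i h, E i * η h = ∑ a, η (S.nR i a h) * E a) (i j l : Fin n) :
    η (S.Mm i j) * E l = ∑ a, ∑ b, R (l, i) (a, b) • (E a * η (S.Mm b j)) := by
  have h1 : (fun x : Fin n × Fin n => E x.1 * η (S.Mm x.2 j)) =
      act S.Rbar (fun y => η (S.Mm y.2 j) * E y.1) := by
    funext x
    simp only [h, S.nR_Mm, map_sum, map_smul, Finset.sum_mul, smul_mul_assoc, act,
      Fintype.sum_prod_type]
  have h2 := congrFun (congrArg (act R) h1) (l, i)
  rw [← act_mul, S.mul_Rbar, act_one] at h2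
  simp only [act, Fintype.sum_prod_type] at h2
  exact h2.symm

theorem f_mm_of_hf {X : Type*} [Ring X] [Algebra k X] {F : Fin n → X} {η : H →ₐ[k] X}
    (h : ∀ h i, η h * F i = ∑ a, F a * η (S.nL a i h)) (i j l : Fin n) :
    F i * η (S.Mm j l) = ∑ a, ∑ b, R (a, b) (i, l) • (η (S.Mm j b) * F a) := by
  have h1 : (fun x : Fin n × Fin n => η (S.Mm j x.2) * F x.1) =
      act S.Rbar.transpose (fun y => F y.1 * η (S.Mm j y.2)) := by
    funext x
    simp only [h, S.nL_Mm, map_sum, map_smul, Finset.mul_sum, mul_smul_comm, act,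
      Fintype.sum_prod_type, Matrix.transpose_apply]
  have h2 := congrFun (congrArg (act R.transpose) h1) (i, l)
  rw [← act_mul, ← Matrix.transpose_mul, S.Rbar_mul, Matrix.transpose_one, act_one] at h2
  simp only [act, Fintype.sum_prod_type, Matrix.transpose_apply] at h2
  exact h2.symm

namespace Cross

variable {κ : k} {X : Type u} [Ring X] [Algebra k X] {E F : Fin n → X} {η : H →ₐ[k] X}
  (h : S.Cross κ E F η)

include h in
theorem e_mp (i j l : Fin n) :
    E i * η (S.Mp j l) = ∑ a, ∑ b, R (j, i) (a, b) • (η (S.Mp a l) * E b) :=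
  e_mp_of_eh h.eh i j l

include h in
theorem mp_f (i j l : Fin n) :
    η (S.Mp i j) * F l = ∑ a, ∑ b, R (a, b) (j, l) • (F b * η (S.Mp i a)) :=
  mp_f_of_hf h.hf i j l

include h in
theorem mm_e (i j l : Fin n) :
    η (S.Mm i j) * E l = ∑ a, ∑ b, R (l, i) (a, b) • (E a * η (S.Mm b j)) :=
  mm_e_of_eh h.eh i j l

include h in
theorem f_mm (i j l : Fin n) :
    F i * η (S.Mm j l) = ∑ a, ∑ b, R (a, b) (i, l) • (η (S.Mm j b) * F a) :=
  f_mm_of_hf h.hf i j l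

include h in
theorem e_f (i j : Fin n) :
    E i * F j - F j * E i = κ⁻¹ • (η (S.Mp i j) - η (S.Mm i j)) := by
  rw [h.ef, add_sub_cancel_left]

/-- The algebra map from `B`. -/
def homB : B →ₐ[k] X := S.planeB.liftHom E h.ee

/-- The algebra map from `D`. -/
def homD : D →ₐ[k] X := S.planeD.liftHom F h.ff

@[simp]
theorem homB_e (i : Fin n) : h.homB (S.e i) = E i := S.planeB.liftHom_v ..

@[simp]
theorem homD_f (i : Fin n) : h.homD (S.f i) = F i := S.planeD.liftHom_v ..

end Cross

/-! ## The bialgebra structure -/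

namespace Double

variable (S) (κ : k)

/-- The inclusion of `B`. -/
def inB : B →ₐ[k] S.Double κ := (cross S κ).homB

/-- The inclusion of `C̄`. -/
def inC : D →ₐ[k] S.Double κ := (cross S κ).homD

@[simp]
theorem inB_e (i : Fin n) : inB S κ (S.e i) = e S κ i := (cross S κ).homB_e i

@[simp]
theorem inC_f (i : Fin n) : inC S κ (S.f i) = f S κ i := (cross S κ).homD_f i

/-- The coproduct of `e^i`. -/
def comulE (i : Fin n) : S.Double κ ⊗[k] S.Double κ :=
  ∑ a, e S κ a ⊗ₜ inH S κ (S.Mp i a) + 1 ⊗ₜ e S κ i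

/-- The coproduct of `f_i`. -/
def comulF (i : Fin n) : S.Double κ ⊗[k] S.Double κ :=
  ∑ a, inH S κ (S.Mm a i) ⊗ₜ f S κ a + f S κ i ⊗ₜ 1

/-- The tensor square of the inclusion of `H`. -/
def inHH : H ⊗[k] H →ₐ[k] S.Double κ ⊗[k] S.Double κ :=
  Algebra.TensorProduct.map (inH S κ) (inH S κ)

@[simp]
theorem inHH_tmul (h g : H) : inHH S κ (h ⊗ₜ g) = inH S κ h ⊗ₜ inH S κ g := rfl

variable {S κ}

theorem e_tmul_one_mul (i : Fin n) (z : H ⊗[k] H) : (e S κ i ⊗ₜ[k] (1 : S.Double κ)) * inHH S κ z =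
    ∑ a, inHH S κ ((S.nR i a).rTensor H z) * (e S κ a ⊗ₜ 1) := by
  induction z using TensorProduct.induction_on with
  | zero => simp
  | add x y hx hy => simp only [map_add, mul_add, add_mul, hx, hy, Finset.sum_add_distrib]
  | tmul x y => simp [(cross S κ).eh, TensorProduct.sum_tmul]

theorem one_tmul_e_mul (i : Fin n) (z : H ⊗[k] H) : ((1 : S.Double κ) ⊗ₜ[k] e S κ i) * inHH S κ z =
    ∑ a, inHH S κ ((S.nR i a).lTensor H z) * (1 ⊗ₜ e S κ a) := by
  induction z using TensorProduct.induction_on with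
  | zero => simp
  | add x y hx hy => simp only [map_add, mul_add, add_mul, hx, hy, Finset.sum_add_distrib]
  | tmul x y => simp [(cross S κ).eh, TensorProduct.tmul_sum]

theorem mul_f_tmul_one (i : Fin n) (z : H ⊗[k] H) : inHH S κ z * (f S κ i ⊗ₜ[k] (1 : S.Double κ)) =
    ∑ a, (f S κ a ⊗ₜ 1) * inHH S κ ((S.nL a i).rTensor H z) := by
  induction z using TensorProduct.induction_on with
  | zero => simp
  | add x y hx hy => simp only [map_add, mul_add, add_mul, hx, hy, Finset.sum_add_distrib]
  | tmul x y => simp [(cross S κ).hf, TensorProduct.sum_tmul]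

theorem mul_one_tmul_f (i : Fin n) (z : H ⊗[k] H) : inHH S κ z * ((1 : S.Double κ) ⊗ₜ[k] f S κ i) =
    ∑ a, (1 ⊗ₜ f S κ a) * inHH S κ ((S.nL a i).lTensor H z) := by
  induction z using TensorProduct.induction_on with
  | zero => simp
  | add x y hx hy => simp only [map_add, mul_add, add_mul, hx, hy, Finset.sum_add_distrib]
  | tmul x y => simp [(cross S κ).hf, TensorProduct.tmul_sum]

theorem lTensor_nR_mul (i j : Fin n) (z : H ⊗[k] H) :
    ∑ a, (S.nR i a).lTensor H z * (1 ⊗ₜ[k] S.Mp a j) =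
      ∑ a, (1 ⊗ₜ[k] S.Mp i a) * (S.nL a j).lTensor H z := by
  induction z using TensorProduct.induction_on with
  | zero => simp
  | add x y hx hy => simp only [map_add, mul_add, add_mul, hx, hy, Finset.sum_add_distrib]
  | tmul x y =>
    simp only [LinearMap.lTensor_tmul, Algebra.TensorProduct.tmul_mul_tmul, mul_one, one_mul,
      ← TensorProduct.tmul_sum]
    exact congrArg _ (S.nR_Rp y i j)

theorem rTensor_nR_mul (i j : Fin n) (z : H ⊗[k] H) :
    ∑ a, (S.nR i a).rTensor H z * (S.Mm a j ⊗ₜ[k] 1) =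
      ∑ a, (S.Mm i a ⊗ₜ[k] 1) * (S.nL a j).rTensor H z := by
  induction z using TensorProduct.induction_on with
  | zero => simp
  | add x y hx hy => simp only [map_add, mul_add, add_mul, hx, hy, Finset.sum_add_distrib]
  | tmul x y =>
    simp only [LinearMap.rTensor_tmul, Algebra.TensorProduct.tmul_mul_tmul, mul_one, one_mul,
      ← TensorProduct.sum_tmul]
    exact congrArg (· ⊗ₜ[k] y) (S.nR_Rm x i j)

/-- Another use of `add_rel`. The elements `∑ e_a ⊗ m⁺^i_a` satisfy the relations as images of `e^i`
under the algebra map `b ↦ ∑ b^(2) ⊗ 𝓡(b^(1))`, the elements `1 ⊗ e^i` do so trivially, and `e_mp`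
is the required commutation rule. -/
theorem comulE_rel (x : Fin n × Fin n) : comulE S κ x.1 * comulE S κ x.2 =
    act (permMul R') (fun y => comulE S κ y.1 * comulE S κ y.2) x := by
  refine add_rel (M := permMul R) S.hecke_B (fun i => ∑ a, e S κ a ⊗ₜ inH S κ (S.Mp i a))
    (fun i => 1 ⊗ₜ e S κ i) ?_ ?_ ?_ x
  · intro x
    let ψ : B →ₐ[k] S.Double κ ⊗[k] S.Double κ :=
      ((Algebra.TensorProduct.comm k (S.Double κ) (S.Double κ)).toAlgHom.comp
        (Algebra.TensorProduct.map ((inH S κ).comp P.Rp) (inB S κ))).comp S.β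
    have hψ : ∀ i, ∑ a, e S κ a ⊗ₜ inH S κ (S.Mp i a) = ψ (S.e i) := by
      intro i
      simp [ψ, S.β_e, Mp]
    simp only [hψ]
    exact map_rel ψ (S.planeB.rel x)
  · intro x
    exact map_rel (Algebra.TensorProduct.includeRight (R := k) (A := S.Double κ))
      ((cross S κ).ee x)
  · intro x
    simp only [Finset.mul_sum, Finset.sum_mul, Algebra.TensorProduct.tmul_mul_tmul, one_mul,
      mul_one, act, permMul, (cross S κ).e_mp, TensorProduct.tmul_sum, TensorProduct.tmul_smul,
      Finset.smul_sum, Fintype.sum_prod_type]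
    rw [Finset.sum_comm]
    exact Finset.sum_congr rfl fun _ _ => Finset.sum_comm

/-- The mirror image of `comulE_rel`, with `𝓡̄`, the transposed matrices and the commutation rule
`f_mm`. -/
theorem comulF_rel (x : Fin n × Fin n) : comulF S κ x.1 * comulF S κ x.2 =
    act (permMul R').transpose (fun y => comulF S κ y.1 * comulF S κ y.2) x := by
  refine add_rel (M := (permMul R).transpose) S.hecke_D
    (fun i => ∑ a, inH S κ (S.Mm a i) ⊗ₜ f S κ a) (fun i => f S κ i ⊗ₜ 1) ?_ ?_ ?_ x
  · intro x
    let ψ : D →ₐ[k] S.Double κ ⊗[k] S.Double κ :=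
      ((Algebra.TensorProduct.comm k (S.Double κ) (S.Double κ)).toAlgHom.comp
        (Algebra.TensorProduct.map (inC S κ) ((inH S κ).comp P.Rm))).comp S.δ
    have hψ : ∀ i, ∑ a, inH S κ (S.Mm a i) ⊗ₜ f S κ a = ψ (S.f i) := by
      intro i
      simp [ψ, S.δ_f, Mm]
    simp only [hψ]
    exact map_rel ψ (S.planeD.rel x)
  · intro x
    exact map_rel (Algebra.TensorProduct.includeLeft (R := k) (S := k) (B := S.Double κ))
      ((cross S κ).ff x)
  · intro x
    simp only [Finset.mul_sum, Finset.sum_mul, Algebra.TensorProduct.tmul_mul_tmul, one_mul,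
      mul_one, act, permMul, (cross S κ).f_mm, TensorProduct.sum_tmul, TensorProduct.smul_tmul',
      Finset.smul_sum, Fintype.sum_prod_type, Matrix.transpose_apply]
    rw [Finset.sum_comm (t := Finset.univ)]
    refine (Finset.sum_congr rfl fun _ _ => Finset.sum_comm).trans ?_
    rw [Finset.sum_comm]

variable (S κ)

theorem comul_cross : S.Cross κ (comulE S κ) (comulF S κ)
    ((inHH S κ).comp (Bialgebra.comulAlgHom k H)) where
  ee := comulE_rel
  ff := comulF_rel
  eh i h := by
    simp only [AlgHom.comp_apply, Bialgebra.comulAlgHom_apply, comulE, add_mul, mul_add,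
      Finset.sum_add_distrib, S.comul_nR, one_tmul_e_mul]
    congr 1
    -- For the summand `e_a ⊗ m⁺^i_a`, moving `e_a` past `h₁` differentiates `h₁` on the right. By
    -- `rTensor_nR` this becomes a derivative of `h₂` on the left, and `lTensor_nR_mul` exchanges
    -- that with `m⁺`.
    have h1 : ∀ i a, e S κ a ⊗ₜ inH S κ (S.Mp i a) =
        inHH S κ (1 ⊗ₜ S.Mp i a) * (e S κ a ⊗ₜ 1) := by
      intro i a; simp
    simp only [h1, Finset.sum_mul, mul_assoc, e_tmul_one_mul, Finset.mul_sum, S.rTensor_nR]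
    simp only [← mul_assoc, ← map_mul]
    rw [Finset.sum_comm]
    nth_rw 2 [Finset.sum_comm]
    refine Finset.sum_congr rfl fun c _ => ?_
    rw [← Finset.sum_mul, ← Finset.sum_mul, ← map_sum, ← map_sum, lTensor_nR_mul]
  hf h i := by
    simp only [AlgHom.comp_apply, Bialgebra.comulAlgHom_apply, comulF, add_mul, mul_add,
      Finset.sum_add_distrib, S.comul_nL, mul_f_tmul_one]
    congr 1
    have h1 : ∀ i a, inH S κ (S.Mm a i) ⊗ₜ f S κ a =
        (1 ⊗ₜ f S κ a) * inHH S κ (S.Mm a i ⊗ₜ 1) := by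
      intro i a; simp
    simp only [h1, ← mul_assoc, mul_one_tmul_f, Finset.sum_mul, Finset.mul_sum, ← S.rTensor_nR]
    simp only [mul_assoc, ← map_mul]
    rw [Finset.sum_comm]
    nth_rw 2 [Finset.sum_comm]
    refine Finset.sum_congr rfl fun c _ => ?_
    rw [← Finset.mul_sum, ← Finset.mul_sum, ← map_sum, ← map_sum, rTensor_nR_mul]
  ef i j := by
    -- The products of `e_a ⊗ m⁺^i_a` with `m⁻^b_j ⊗ f_b` commute after summation: reordering the
    -- first factor by `mm_e` and the second by `mp_f` brings in the same coefficients of `R`.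
    have h1 : ∑ b, ∑ a, (e S κ a * inH S κ (S.Mm b j)) ⊗ₜ[k] (inH S κ (S.Mp i a) * f S κ b) =
        ∑ a, ∑ b, (inH S κ (S.Mm b j) * e S κ a) ⊗ₜ[k] (f S κ b * inH S κ (S.Mp i a)) := by
      simp only [(cross S κ).mm_e, (cross S κ).mp_f, TensorProduct.sum_tmul,
        TensorProduct.tmul_sum, TensorProduct.smul_tmul', TensorProduct.tmul_smul]
      rw [Finset.sum_comm]
      exact sum_swap_pairs fun a b c d => (R (a, b) (c, d) • (e S κ c * inH S κ (S.Mm d j))) ⊗ₜ[k]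
        (f S κ b * inH S κ (S.Mp i a))
    -- The remaining commutators are `[e_a, f_j] ⊗ m⁺^i_a` and `m⁻^b_j ⊗ [e_i, f_b]`. Their terms
    -- `m⁻ ⊗ m⁺` cancel, leaving `κ⁻¹ (Δ m⁺^i_j - Δ m⁻^i_j)`.
    simp only [AlgHom.comp_apply, Bialgebra.comulAlgHom_apply, comulE, comulF, add_mul, mul_add,
      Finset.sum_mul, Finset.mul_sum, Algebra.TensorProduct.tmul_mul_tmul, one_mul, mul_one,
      S.comul_Mp, S.comul_Mm, map_sum, inHH_tmul, (cross S κ).ef]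
    simp only [TensorProduct.tmul_add, TensorProduct.add_tmul, TensorProduct.tmul_smul,
      ← TensorProduct.smul_tmul', TensorProduct.tmul_sub, TensorProduct.sub_tmul,
      Finset.sum_add_distrib, Finset.sum_sub_distrib, smul_sub, ← Finset.smul_sum, h1]
    abel


/-- The coproduct of the double bosonisation. -/
def comulHom : S.Double κ →ₐ[k] S.Double κ ⊗[k] S.Double κ := lift (comul_cross S κ)

theorem counit_cross : S.Cross κ (fun _ => (0 : k)) (fun _ => 0) (Bialgebra.counitAlgHom k H) where
  ee x := by simp [act]
  ff x := by simp [act]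
  eh i h := by simp
  hf h i := by simp
  ef i j := by simp [S.counit_Mp, S.counit_Mm]

/-- The counit of the double bosonisation. -/
def counitHom : S.Double κ →ₐ[k] k := lift (counit_cross S κ)

theorem comulHom_map_inHH_left (z : H ⊗[k] H) :
    Algebra.TensorProduct.map (comulHom S κ) (.id k (S.Double κ)) (inHH S κ z) =
      Algebra.TensorProduct.map (inHH S κ) (inH S κ) (Coalgebra.comul.rTensor H z) := by
  induction z using TensorProduct.induction_on with
  | zero => simp
  | add x y hx hy => simp only [map_add, hx, hy]
  | tmul x y => simp [comulHom]

theorem comulHom_map_inHH_right (z : H ⊗[k] H) :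
    Algebra.TensorProduct.map (.id k (S.Double κ)) (comulHom S κ) (inHH S κ z) =
      Algebra.TensorProduct.map (inH S κ) (inHH S κ) (Coalgebra.comul.lTensor H z) := by
  induction z using TensorProduct.induction_on with
  | zero => simp
  | add x y hx hy => simp only [map_add, hx, hy]
  | tmul x y => simp [comulHom]

theorem assoc_map_inHH (w : (H ⊗[k] H) ⊗[k] H) :
    Algebra.TensorProduct.assoc k k k (S.Double κ) (S.Double κ) (S.Double κ)
        (Algebra.TensorProduct.map (inHH S κ) (inH S κ) w) =
      Algebra.TensorProduct.map (inH S κ) (inHH S κ) (TensorProduct.assoc k H H H w) := by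
  induction w using TensorProduct.induction_on with
  | zero => simp
  | add x y hx hy => simp only [map_add, hx, hy]
  | tmul x y =>
    induction x using TensorProduct.induction_on with
    | zero => simp
    | add x y hx hy => simp only [map_add, TensorProduct.add_tmul, hx, hy]
    | tmul x z => simp

instance : Bialgebra k (S.Double κ) :=
  Bialgebra.ofAlgHom (comulHom S κ) (counitHom S κ)
    (by
      refine hom_ext (fun i => ?_) (fun i => ?_) (fun h => ?_)
      · simp [comulHom, comulE, S.comul_Mp, TensorProduct.add_tmul, TensorProduct.tmul_add,
          TensorProduct.sum_tmul, TensorProduct.tmul_sum, Algebra.TensorProduct.one_def]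
        rw [Finset.sum_add_distrib, Finset.sum_comm, add_assoc]
      · simp [comulHom, comulF, S.comul_Mm, TensorProduct.add_tmul, TensorProduct.tmul_add,
          TensorProduct.sum_tmul, TensorProduct.tmul_sum, Algebra.TensorProduct.one_def]
        rw [Finset.sum_add_distrib, Finset.sum_comm, add_assoc]
      · simp only [AlgHom.comp_apply]
        rw [comulHom, lift_inH]
        simp only [AlgHom.comp_apply, Bialgebra.comulAlgHom_apply]
        exact (congrArg _ (comulHom_map_inHH_left S κ _)).trans ((assoc_map_inHH S κ _).trans
          ((congrArg _ (Coalgebra.coassoc_apply h)).trans (comulHom_map_inHH_right S κ _).symm)))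
    (by
      refine hom_ext (fun i => ?_) (fun i => ?_) (fun h => ?_)
      · simp [comulHom, counitHom, comulE]
      · simp [comulHom, counitHom, comulF, S.counit_Mm, TensorProduct.ite_tmul]
      · simp only [AlgHom.comp_apply]
        rw [comulHom, lift_inH]
        have h1 : ∀ z, Algebra.TensorProduct.map (counitHom S κ) (.id k (S.Double κ)) (inHH S κ z) =
            (inH S κ).toLinearMap.lTensor k (Coalgebra.counit.rTensor H z) := by
          intro z
          induction z using TensorProduct.induction_on with
          | zero => simp
          | add x y hx hy => simp only [map_add, hx, hy]
          | tmul x y => simp [counitHom]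
        exact (h1 _).trans (by simp))
    (by
      refine hom_ext (fun i => ?_) (fun i => ?_) (fun h => ?_)
      · simp [comulHom, counitHom, comulE, S.counit_Mp, TensorProduct.tmul_ite]
      · simp [comulHom, counitHom, comulF]
      · simp only [AlgHom.comp_apply]
        rw [comulHom, lift_inH]
        have h1 : ∀ z, Algebra.TensorProduct.map (.id k (S.Double κ)) (counitHom S κ) (inHH S κ z) =
            (inH S κ).toLinearMap.rTensor k (Coalgebra.counit.lTensor H z) := by
          intro z
          induction z using TensorProduct.induction_on with
          | zero => simp
          | add x y hx hy => simp only [map_add, hx, hy]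
          | tmul x y => simp [counitHom]
        exact (h1 _).trans (by simp))

@[simp]
theorem comul_e (i : Fin n) : Coalgebra.comul (R := k) (e S κ i) =
    ∑ a, e S κ a ⊗ₜ inH S κ (S.Mp i a) + 1 ⊗ₜ e S κ i := lift_e (comul_cross S κ) i

@[simp]
theorem comul_f (i : Fin n) : Coalgebra.comul (R := k) (f S κ i) =
    f S κ i ⊗ₜ 1 + ∑ a, inH S κ (S.Mm a i) ⊗ₜ f S κ a :=
  (lift_f (comul_cross S κ) i).trans (add_comm _ _)

theorem comul_inH (h : H) : Coalgebra.comul (R := k) (inH S κ h) =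
    inHH S κ (Coalgebra.comul h) := lift_inH (comul_cross S κ) h

@[simp]
theorem counit_e (i : Fin n) : Coalgebra.counit (R := k) (e S κ i) = 0 :=
  lift_e (counit_cross S κ) i

@[simp]
theorem counit_f (i : Fin n) : Coalgebra.counit (R := k) (f S κ i) = 0 :=
  lift_f (counit_cross S κ) i

@[simp]
theorem counit_inH (h : H) : Coalgebra.counit (R := k) (inH S κ h) = Coalgebra.counit (R := k) h :=
  lift_inH (counit_cross S κ) h

/-- The inclusion of `H` as a map of bialgebras. -/
def incH : H →ₐc[k] S.Double κ :=
  .ofAlgHom (inH S κ) (by ext h; exact counit_inH S κ h)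
    (by ext h; exact (comul_inH S κ h).symm)

@[simp]
theorem incH_apply (h : H) : incH S κ h = inH S κ h := rfl

end Double

end PlaneData

end

end DoubleBosonisation

/-! ### The Fock representation and the triangular decomposition. -/

namespace DoubleBosonisation

noncomputable section

open scoped Shortcuts

variable {k : Type u} [Field k] {n : ℕ} {H A B D : Type u} [Ring H] [Ring A] [Bialgebra k H]
  [Bialgebra k A] [Ring B] [Algebra k B] [Ring D] [Algebra k D]

/-- The representation of `A` on `H` by `h ↦ ∑ h₁ ⟨h₂, a⟩`. -/
def WeakQTPair.dRHom (P : WeakQTPair k H A) : A →ₐ[k] Module.End k H :=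
  AlgHom.ofLinearMap
    { toFun := P.dR
      map_add' := fun a b => by simp [WeakQTPair.dR, LinearMap.lTensor_add, LinearMap.add_comp,
        LinearMap.comp_add]
      map_smul' := fun r a => by simp [WeakQTPair.dR, LinearMap.lTensor_smul, LinearMap.smul_comp,
        LinearMap.comp_smul] }
    (by
      have h1 : P.pair.flip 1 = Coalgebra.counit := by ext h; exact P.pair_one_right h
      ext h
      change P.dR 1 h = h
      simp [WeakQTPair.dR, h1])
    (fun a b => by
      have h1 : P.pair.flip (a * b) = P.pair.flip a ∘ₗ P.dR b := by
        ext h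
        simp only [LinearMap.flip_apply, P.pair_mul_right, WeakQTPair.dR, LinearMap.comp_apply]
        generalize Coalgebra.comul (R := k) h = z
        induction z using TensorProduct.induction_on with
        | zero => simp
        | add x y hx hy => simp only [map_add, hx, hy, LinearMap.add_apply]
        | tmul x y => simp [mul_comm]
      ext h
      change P.dR (a * b) h = P.dR a (P.dR b h)
      conv_rhs => unfold WeakQTPair.dR
      rw [LinearMap.comp_apply, LinearMap.comp_apply]
      have h2 := P.comul_dR b h
      unfold WeakQTPair.dR at h2 ⊢
      rw [h2, h1]
      conv_lhs => rw [LinearMap.lTensor_comp]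
      rfl)

namespace PlaneData

variable {P : WeakQTPair k H A} {R R' : Mat2 k n} (S : PlaneData P R R' B D)

theorem actD_one (h : H) : S.actD h 1 = Coalgebra.counit (R := k) h • (1 : D) := by
  simp [actD_apply, cofR, Algebra.TensorProduct.one_def, P.pair_one_right]

theorem actD_f_mul (h : H) (j : Fin n) (c : D) :
    S.actD h (S.f j * c) = ∑ a, S.f a * S.actD (S.nL a j h) c := by
  have h1 : ∀ a x, P.pair h (S.T a j * x) = P.pair (S.nL a j h) x := by
    intro a x
    simp only [P.pair_mul_right, nL, LinearMap.comp_apply]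
    generalize Coalgebra.comul (R := k) h = z
    induction z using TensorProduct.induction_on with
    | zero => simp
    | add x y hx hy => simp only [map_add, hx, hy, LinearMap.add_apply]
    | tmul x y => simp
  simp only [actD_apply, cofR, LinearMap.comp_apply, AlgHom.toLinearMap_apply, map_mul, S.δ_f]
  generalize S.δ c = z
  induction z using TensorProduct.induction_on with
  | zero => simp
  | add x y hx hy => simp only [map_add, mul_add, hx, hy, Finset.sum_add_distrib]
  | tmul x y => simp [Finset.sum_mul, h1]

/-! ## The representation on `C̄ ⊗ H ⊗ B` -/

namespace Fock

/-- The operators of left multiplication by `C̄`. -/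
def opC : D →ₐ[k] Module.End k (D ⊗[k] (H ⊗[k] B)) :=
  (Module.endTensorEndAlgHom (R := k) (S := k) (A := k)).comp
    (Algebra.TensorProduct.includeLeft.comp (Algebra.lmul k D))

@[simp]
theorem opC_tmul (c d : D) (x : H ⊗[k] B) : opC (k := k) c (d ⊗ₜ x) = (c * d) ⊗ₜ x := rfl

/-- Left multiplication by `H` on `H ⊗ B`. -/
def opHB : H →ₐ[k] Module.End k (H ⊗[k] B) :=
  (Module.endTensorEndAlgHom (R := k) (S := k) (A := k)).comp
    (Algebra.TensorProduct.includeLeft.comp (Algebra.lmul k H))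

@[simp]
theorem opHB_tmul (h g : H) (b : B) : opHB (k := k) h (g ⊗ₜ b) = (h * g) ⊗ₜ b := rfl

/-- The operators of left multiplication by elements `∑ (h₁ ▷ c) ⊗ h₂`. -/
def opHH : H ⊗[k] H →ₐ[k] Module.End k (D ⊗[k] (H ⊗[k] B)) :=
  (Module.endTensorEndAlgHom (R := k) (S := k) (A := k)).comp
    (Algebra.TensorProduct.map S.actD opHB)

@[simp]
theorem opHH_tmul (h g : H) (d : D) (x : H ⊗[k] B) :
    opHH S (h ⊗ₜ g) (d ⊗ₜ x) = S.actD h d ⊗ₜ opHB g x := rfl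

/-- The operators of left multiplication by `H`. -/
def opH : H →ₐ[k] Module.End k (D ⊗[k] (H ⊗[k] B)) :=
  (opHH S).comp (Bialgebra.comulAlgHom k H)

theorem opH_apply (h : H) : opH S h = opHH S (Coalgebra.comul h) := rfl

theorem opH_one_tmul (h : H) (x : H ⊗[k] B) : opH S h ((1 : D) ⊗ₜ x) = 1 ⊗ₜ opHB h x := by
  have h1 : ∀ z : H ⊗[k] H, opHH S z ((1 : D) ⊗ₜ x) =
      1 ⊗ₜ opHB (TensorProduct.lid k H (Coalgebra.counit.rTensor H z)) x := by
    intro z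
    induction z using TensorProduct.induction_on with
    | zero => simp
    | add x y hx hy => simp only [map_add, LinearMap.add_apply, TensorProduct.tmul_add, hx, hy]
    | tmul x y => simp [actD_one, TensorProduct.smul_tmul]
  rw [opH_apply, h1]
  simp

theorem opH_opC (h : H) (j : Fin n) :
    opH S h * opC (S.f j) = ∑ a, opC (S.f a) * opH S (S.nL a j h) := by
  simp only [opH_apply, S.comul_nL]
  generalize Coalgebra.comul (R := k) h = z
  induction z using TensorProduct.induction_on with
  | zero => simp
  | add x y hx hy => simp only [map_add, add_mul, mul_add, hx, hy, Finset.sum_add_distrib]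
  | tmul x y =>
    refine TensorProduct.ext' fun d w => ?_
    simp [LinearMap.sum_apply, actD_f_mul, TensorProduct.sum_tmul]

/-- The operators of left multiplication by `B` on `H ⊗ B`. -/
def opB : B →ₐ[k] Module.End k (H ⊗[k] B) :=
  ((Module.endTensorEndAlgHom (R := k) (S := k) (A := k)).comp
    (Algebra.TensorProduct.map P.dRHom (Algebra.lmul k B))).comp S.β

theorem opB_e_tmul (i : Fin n) (g : H) (b : B) :
    opB S (S.e i) (g ⊗ₜ b) = ∑ a, S.nR i a g ⊗ₜ (S.e a * b) := by
  rw [opB, AlgHom.comp_apply, S.β_e, map_sum, LinearMap.sum_apply]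
  rfl

variable (κ : k)

/-- The operators of left multiplication by `e^i`. -/
def opE (i : Fin n) : Module.End k (D ⊗[k] (H ⊗[k] B)) :=
  -- The formula is forced by normal ordering: in `U` one must have `e^i c = c e^i + ∑ ((dr a c)
  -- m⁺^i_a - m⁻^i_a (dl a c))`, which is proved afterwards as `Double.e_mul_inC`.
  (opB S (S.e i)).lTensor D +
    ∑ a, (TensorProduct.map (S.coreD.dr κ a) (opHB (S.Mp i a)) -
      opH S (S.Mm i a) * (S.coreD.dl κ a).rTensor (H ⊗[k] B))

variable {S κ}

theorem opE_tmul (i : Fin n) (d : D) (x : H ⊗[k] B) : opE S κ i (d ⊗ₜ x) =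
    d ⊗ₜ opB S (S.e i) x + ∑ a, (S.coreD.dr κ a d ⊗ₜ opHB (S.Mp i a) x -
      opH S (S.Mm i a) (S.coreD.dl κ a d ⊗ₜ x)) := by
  simp [opE, LinearMap.sum_apply]

theorem opE_one_tmul (i : Fin n) (x : H ⊗[k] B) :
    opE S κ i ((1 : D) ⊗ₜ x) = 1 ⊗ₜ opB S (S.e i) x := by
  simp [opE_tmul, PlaneCore.dl_one, PlaneCore.dr_one]

theorem opH_Mp_tmul (i j : Fin n) (d : D) (x : H ⊗[k] B) : opH S (S.Mp i j) (d ⊗ₜ x) =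
    ∑ a, S.actD (S.Mp a j) d ⊗ₜ opHB (S.Mp i a) x := by
  simp [opH_apply, S.comul_Mp, LinearMap.sum_apply]

/-- The two Leibniz rules produce the commutator. The term of `dr` with `lam` assembles to the
action of `m⁺^i_j`, the delta term of `dl` gives that of `m⁻^i_j`, and the factors of `R` in the
rest of `dl` are absorbed by moving `f` past `m⁻`. -/
theorem opE_opC (i j : Fin n) : opE S κ i * opC (S.f j) =
    opC (S.f j) * opE S κ i + κ⁻¹ • (opH S (S.Mp i j) - opH S (S.Mm i j)) := by
  refine TensorProduct.ext' fun d x => ?_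
  have hdr : ∀ a, S.coreD.dr κ a (S.f j * d) =
      S.f j * S.coreD.dr κ a d + κ⁻¹ • S.actD (S.Mp a j) d := fun a =>
    S.coreD.dr_v_mul κ a j d
  have hdl : ∀ a, S.coreD.dl κ a (S.f j * d) = (if a = j then κ⁻¹ • d else 0) +
      ∑ b, ∑ c, R (c, a) (j, b) • (S.f c * S.coreD.dl κ b d) := fun a =>
    (S.coreD.dl_v_mul κ a j d).trans (by rw [Fintype.sum_prod_type]; rfl)
  have hmm : ∀ b w, opC (S.f j) (opH S (S.Mm i b) w) =
      ∑ c, ∑ a, R (c, a) (j, b) • (opH S (S.Mm i a) (opC (S.f c) w)) := fun b w => by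
    have := LinearMap.congr_fun (f_mm_of_hf (F := fun i => opC (S.f i)) (opH_opC S) j i b) w
    simpa [LinearMap.sum_apply] using this
  simp only [Module.End.mul_apply, opC_tmul, LinearMap.add_apply, LinearMap.smul_apply,
    LinearMap.sub_apply, opE_tmul, hdr, hdl, map_add, TensorProduct.add_tmul,
    Finset.sum_sub_distrib, Finset.sum_add_distrib, map_sum, map_sub, hmm, opH_Mp_tmul]
  have h1 : ∑ a, opH S (S.Mm i a) ((if a = j then κ⁻¹ • d else 0) ⊗ₜ[k] x) =
      κ⁻¹ • opH S (S.Mm i j) (d ⊗ₜ x) := by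
    rw [Finset.sum_eq_single j]
    · simp [← TensorProduct.smul_tmul']
    · intro a _ h; simp [h]
    · simp
  have h2 : ∑ a, opH S (S.Mm i a) ((∑ b, ∑ c, R (c, a) (j, b) • (S.f c * S.coreD.dl κ b d)) ⊗ₜ[k] x) =
      ∑ b, ∑ c, ∑ a, R (c, a) (j, b) • opH S (S.Mm i a) ((S.f c * S.coreD.dl κ b d) ⊗ₜ x) := by
    simp only [TensorProduct.sum_tmul, map_sum, ← TensorProduct.smul_tmul', map_smul]
    rw [Finset.sum_comm]
    exact Finset.sum_congr rfl fun _ _ => Finset.sum_comm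
  simp only [h1, h2, smul_sub, ← TensorProduct.smul_tmul', ← Finset.smul_sum]
  abel

/-- Induction on the operators of multiplication by `f_j`. -/
theorem induction {p : D ⊗[k] (H ⊗[k] B) → Prop} (h1 : ∀ x, p (1 ⊗ₜ x))
    (hadd : ∀ x y, p x → p y → p (x + y)) (hm : ∀ j w, p w → p (opC (S.f j) w))
    (w : D ⊗[k] (H ⊗[k] B)) : p w := by
  induction w using TensorProduct.induction_on with
  | zero => simpa using h1 0
  | add x y hx hy => exact hadd x y hx hy
  | tmul d x =>
    induction d using S.planeD.induction generalizing x with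
    | h1 => exact h1 x
    | hadd a b ha hb => rw [TensorProduct.add_tmul]; exact hadd _ _ (ha x) (hb x)
    | hsmul r a ha => rw [TensorProduct.smul_tmul]; exact ha (r • x)
    | hm i b hb => exact hm i _ (hb x)

theorem opB_opHB (i : Fin n) (h : H) (x : H ⊗[k] B) :
    opB S (S.e i) (opHB h x) = ∑ a, opHB (S.nR i a h) (opB S (S.e a) x) := by
  induction x using TensorProduct.induction_on with
  | zero => simp
  | add x y hx hy => simp only [map_add, hx, hy, Finset.sum_add_distrib]
  | tmul g b =>
    simp only [opHB_tmul, opB_e_tmul, S.nR_mul, TensorProduct.sum_tmul, map_sum]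
    exact Finset.sum_comm

/-- Induction on words in the `f_j`. Passing `e^i` and `h` through `f_j` leaves a main term, where
derivatives of `h` from the two sides commute (`nL_nR`), and commutator terms, which match by
`nR_Rp` and `nR_Rm`. -/
theorem opE_opH_apply (w : D ⊗[k] (H ⊗[k] B)) (i : Fin n) (h : H) :
    opE S κ i (opH S h w) = ∑ a, opH S (S.nR i a h) (opE S κ a w) := by
  induction w using induction (S := S) generalizing i h with
  | h1 x => simp [opE_one_tmul, opH_one_tmul, opB_opHB, TensorProduct.tmul_sum]
  | hadd x y hx hy => simp only [map_add, hx, hy, Finset.sum_add_distrib]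
  | hm j w hw =>
    have hH : ∀ g w, opH S g (opC (S.f j) w) = ∑ a, opC (S.f a) (opH S (S.nL a j g) w) := by
      intro g w
      simpa [LinearMap.sum_apply] using LinearMap.congr_fun (opH_opC S g j) w
    have hE : ∀ i j w, opE S κ i (opC (S.f j) w) = opC (S.f j) (opE S κ i w) +
        κ⁻¹ • (opH S (S.Mp i j) w - opH S (S.Mm i j) w) := by
      intro i j w
      simpa using LinearMap.congr_fun (opE_opC (κ := κ) (S := S) i j) w
    have hp := congrArg (fun g => opH S g w) (S.nR_Rp h i j)
    have hm := congrArg (fun g => opH S g w) (S.nR_Rm h i j)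
    simp only [map_sum, map_mul, LinearMap.sum_apply, Module.End.mul_apply] at hp hm
    simp only [hH, hE, map_sum, map_add, map_smul, map_sub, hw, Finset.sum_add_distrib,
      ← Finset.smul_sum, Finset.sum_sub_distrib]
    congr 1
    · rw [Finset.sum_comm]
      simp only [S.nL_nR]
    · simp only [Mp, Mm, hp, hm]

/-- The relations between the `e^i` are also carried through words in the `f_p`. The terms created
by commutators with `f_p` group into two vectors of the form `z + (P R) z`, one for `m⁺` and one for
`m⁻`, and `hecke_B` makes each fixed by `P R'`. -/
theorem opE_opE_apply (w : D ⊗[k] (H ⊗[k] B)) (x : Fin n × Fin n) :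
    opE S κ x.1 (opE S κ x.2 w) =
      act (permMul R') (fun y => opE S κ y.1 (opE S κ y.2 w)) x := by
  induction w using induction (S := S) generalizing x with
  | h1 z =>
    have h1 := map_rel (opB S) (S.planeB.rel x)
    have h2 := congrArg (fun T => (1 : D) ⊗ₜ[k] T z) h1
    simpa [opE_one_tmul, act, LinearMap.sum_apply, TensorProduct.tmul_sum] using h2
  | hadd a b ha hb =>
    simp only [map_add]
    rw [ha, hb]
    exact congrFun (act_add (permMul R') _ _).symm x
  | hm p w hw =>
    have hE : ∀ i j w, opE S κ i (opC (S.f j) w) = opC (S.f j) (opE S κ i w) +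
        κ⁻¹ • (opH S (S.Mp i j) w - opH S (S.Mm i j) w) := by
      intro i j w
      simpa using LinearMap.congr_fun (opE_opC (κ := κ) (S := S) i j) w
    have heh : ∀ i h, opE S κ i * opH S h = ∑ a, opH S (S.nR i a h) * opE S κ a := by
      intro i h
      refine LinearMap.ext fun w => ?_
      simpa [LinearMap.sum_apply] using opE_opH_apply w i h
    -- In `w₁` the inner `e` meets `f_p` unhindered and the outer one produces `m⁺`; in `w₂` the
    -- inner one produces `m⁻`. The complementary terms are `P R` times these, by the exchange rules
    -- of `e` with `m⁺` and `m⁻`.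
    let w₁ : Fin n × Fin n → D ⊗[k] (H ⊗[k] B) := fun y =>
      κ⁻¹ • opH S (S.Mp y.1 p) (opE S κ y.2 w)
    let w₂ : Fin n × Fin n → D ⊗[k] (H ⊗[k] B) := fun y =>
      -(κ⁻¹ • opE S κ y.1 (opH S (S.Mm y.2 p) w))
    have h₁ : ∀ y : Fin n × Fin n,
        κ⁻¹ • opE S κ y.1 (opH S (S.Mp y.2 p) w) = act (permMul R) w₁ y := by
      intro y
      have := LinearMap.congr_fun (e_mp_of_eh (S := S) (E := opE S κ) (η := opH S) heh y.1 y.2 p) w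
      simp only [Module.End.mul_apply, LinearMap.sum_apply, LinearMap.smul_apply] at this
      simp [act, permMul, w₁, this, Fintype.sum_prod_type, Finset.smul_sum, smul_comm κ⁻¹]
    have h₂ : ∀ y : Fin n × Fin n,
        -(κ⁻¹ • opH S (S.Mm y.1 p) (opE S κ y.2 w)) = act (permMul R) w₂ y := by
      intro y
      have := LinearMap.congr_fun (mm_e_of_eh (S := S) (E := opE S κ) (η := opH S) heh y.1 p y.2) w
      simp only [Module.End.mul_apply, LinearMap.sum_apply, LinearMap.smul_apply] at this
      simp [act, permMul, w₂, this, Fintype.sum_prod_type, Finset.smul_sum, smul_comm κ⁻¹]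
    have key : (fun y : Fin n × Fin n => opE S κ y.1 (opE S κ y.2 (opC (S.f p) w))) =
        (fun y => opC (S.f p) (opE S κ y.1 (opE S κ y.2 w))) + (w₁ + act (permMul R) w₁) +
          (w₂ + act (permMul R) w₂) := by
      funext y
      simp only [Pi.add_apply, ← h₁, ← h₂, w₁, w₂, hE, map_add, map_smul, map_sub, smul_sub]
      abel
    rw [key, act_add, act_add, ← act_add_act_of_mul_eq_zero S.hecke_B,
      ← act_add_act_of_mul_eq_zero S.hecke_B, congrFun key x]
    simp only [Pi.add_apply, hw x]
    congr 2
    simp [act]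

variable (S κ)

theorem cross : S.Cross κ (opE S κ) (fun i => opC (S.f i)) (opH S) where
  ee x := by
    refine LinearMap.ext fun w => ?_
    simpa [act, LinearMap.sum_apply] using opE_opE_apply w x
  ff x := by
    have h := map_rel (k := k) (Y := Module.End k (D ⊗[k] (H ⊗[k] B))) (E := S.f) (opC (k := k) (H := H) (B := B) (D := D))
      (S.planeD.rel x)
    exact h
  eh i h := by
    refine LinearMap.ext fun w => ?_
    simpa [LinearMap.sum_apply] using opE_opH_apply w i h
  hf h i := opH_opC S h i
  ef := opE_opC

/-- The representation of the double bosonisation on `C̄ ⊗ H ⊗ B`. -/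
def rep : S.Double κ →ₐ[k] Module.End k (D ⊗[k] (H ⊗[k] B)) := Double.lift (cross S κ)

theorem rep_inC (c : D) : rep S κ (Double.inC S κ c) = opC c := by
  induction c using S.planeD.induction with
  | h1 => simp
  | hadd a b ha hb => simp only [map_add, ha, hb]
  | hsmul r a ha => simp only [map_smul, ha]
  | hm i b hb =>
    simp only [map_mul, hb, Double.inC_f]
    simp [rep]

theorem rep_inB_one_tmul (b : B) (x : H ⊗[k] B) :
    rep S κ (Double.inB S κ b) (1 ⊗ₜ x) = 1 ⊗ₜ opB S b x := by
  induction b using S.planeB.induction generalizing x with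
  | h1 => simp
  | hadd a b ha hb => simp only [map_add, LinearMap.add_apply, ha, hb, TensorProduct.tmul_add]
  | hsmul r a ha => simp only [map_smul, LinearMap.smul_apply, ha, TensorProduct.tmul_smul]
  | hm i b hb =>
    simp only [map_mul, Module.End.mul_apply, hb, Double.inB_e]
    simp [rep, opE_one_tmul]

theorem opB_tmul_one (b d : B) : opB S b (1 ⊗ₜ d) = 1 ⊗ₜ (b * d) := by
  induction b using S.planeB.induction generalizing d with
  | h1 => simp
  | hadd a b ha hb => simp only [map_add, LinearMap.add_apply, add_mul, ha, hb,
      TensorProduct.tmul_add]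
  | hsmul r a ha => simp only [map_smul, LinearMap.smul_apply, ha, smul_mul_assoc,
      TensorProduct.tmul_smul]
  | hm i b hb =>
    simp [hb, opB_e_tmul, S.nR_one, TensorProduct.ite_tmul, mul_assoc]

/-- The vector `1 ⊗ 1 ⊗ 1` separates ordered products, so the map it defines on `U` is a left
inverse of the product map. -/
theorem rep_triangular (c : D) (h : H) (b : B) :
    rep S κ (Double.inC S κ c * Double.inH S κ h * Double.inB S κ b) (1 ⊗ₜ (1 ⊗ₜ 1)) =
      c ⊗ₜ (h ⊗ₜ b) := by
  simp only [map_mul, Module.End.mul_apply, rep_inB_one_tmul, opB_tmul_one, rep_inC, mul_one]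
  have : rep S κ (Double.inH S κ h) = opH S h := by simp [rep]
  rw [this, opH_one_tmul, opC_tmul, opHB_tmul, mul_one, mul_one]

end Fock

namespace Double

variable (κ : k)

theorem triangularMap_tmul (c : D) (h : H) (b : B) :
    triangularMap (inC S κ) (incH S κ) (inB S κ) ((c ⊗ₜ h) ⊗ₜ b) =
      inC S κ c * inH S κ h * inB S κ b := rfl

theorem triangularMap_injective :
    Function.Injective (triangularMap (inC S κ) (incH S κ) (inB S κ)) := by
  have h : (TensorProduct.assoc k D H B).symm.toLinearMap ∘ₗ
      (LinearMap.applyₗ (1 ⊗ₜ (1 ⊗ₜ 1)) ∘ₗ (Fock.rep S κ).toLinearMap) ∘ₗ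
        triangularMap (inC S κ) (incH S κ) (inB S κ) = LinearMap.id := by
    refine TensorProduct.ext_threefold fun c h b => ?_
    simp only [LinearMap.comp_apply, triangularMap_tmul]
    exact congrArg (TensorProduct.assoc k D H B).symm (Fock.rep_triangular S κ c h b)
  exact Function.LeftInverse.injective (g := (TensorProduct.assoc k D H B).symm.toLinearMap ∘ₗ
      (LinearMap.applyₗ (1 ⊗ₜ (1 ⊗ₜ 1)) ∘ₗ (Fock.rep S κ).toLinearMap))
    (LinearMap.congr_fun h)

/-- The span of ordered products contains `1` and is stable under left multiplication by every
generator: the cross relations move `h` and `e^i` to the right past the word in the `f_j` one letter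
at a time. -/
theorem triangularMap_surjective :
    Function.Surjective (triangularMap (inC S κ) (incH S κ) (inB S κ)) := by
  set N := LinearMap.range (triangularMap (inC S κ) (incH S κ) (inB S κ)) with hN
  have hmem : ∀ c h b, inC S κ c * inH S κ h * inB S κ b ∈ N := fun c h b =>
    ⟨(c ⊗ₜ h) ⊗ₜ b, triangularMap_tmul S κ c h b⟩
  have hind : ∀ u : S.Double κ, (∀ c h b, u * (inC S κ c * inH S κ h * inB S κ b) ∈ N) →
      ∀ x ∈ N, u * x ∈ N := by
    rintro u hu _ ⟨x, rfl⟩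
    induction x using TensorProduct.induction_on with
    | zero => simp
    | add x y hx hy => rw [map_add, mul_add]; exact N.add_mem hx hy
    | tmul x b =>
      induction x using TensorProduct.induction_on with
      | zero => simp
      | add x y hx hy => rw [TensorProduct.add_tmul, map_add, mul_add]; exact N.add_mem hx hy
      | tmul c h => exact hu c h b
  have hf : ∀ i, ∀ x ∈ N, f S κ i * x ∈ N := fun i => hind _ fun c h b => by
    rw [← inC_f, ← mul_assoc, ← mul_assoc, ← map_mul]
    exact hmem _ _ _
  have hH : ∀ g, ∀ x ∈ N, inH S κ g * x ∈ N := fun g => hind _ fun c h b => by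
    induction c using S.planeD.induction generalizing g with
    | h1 =>
      rw [map_one, one_mul, ← mul_assoc, ← map_mul]
      simpa using hmem 1 (g * h) b
    | hadd x y hx hy => simp only [map_add, add_mul, mul_add]; exact N.add_mem (hx g) (hy g)
    | hsmul r x hx =>
      simp only [map_smul, smul_mul_assoc, mul_smul_comm]; exact N.smul_mem r (hx g)
    | hm i c hc =>
      simp only [map_mul, inC_f, mul_assoc]
      simp only [← mul_assoc (inH S κ g), (cross S κ).hf, Finset.sum_mul]
      refine N.sum_mem fun a _ => ?_
      rw [mul_assoc]
      exact hf a _ (by simpa [mul_assoc] using hc (S.nL a i g))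
  have he : ∀ i, ∀ x ∈ N, e S κ i * x ∈ N := fun i => hind _ fun c h b => by
    induction c using S.planeD.induction generalizing i with
    | h1 =>
      rw [map_one, one_mul, ← mul_assoc, (cross S κ).eh, Finset.sum_mul]
      refine N.sum_mem fun a _ => ?_
      rw [mul_assoc, ← inB_e, ← map_mul]
      simpa using hmem 1 (S.nR i a h) (S.e a * b)
    | hadd x y hx hy => simp only [map_add, add_mul, mul_add]; exact N.add_mem (hx i) (hy i)
    | hsmul r x hx =>
      simp only [map_smul, smul_mul_assoc, mul_smul_comm]; exact N.smul_mem r (hx i)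
    | hm j c hc =>
      have hx := hmem c h b
      simp only [map_mul, inC_f, mul_assoc] at hx ⊢
      rw [← mul_assoc, (cross S κ).ef, add_mul, smul_mul_assoc, sub_mul, mul_assoc]
      exact N.add_mem (hf j _ (by simpa [mul_assoc] using hc i))
        (N.smul_mem _ (N.sub_mem (hH _ _ hx) (hH _ _ hx)))
  have htop := submodule_eq_top N (by simpa using hmem 1 1 1) he hf hH
  exact LinearMap.range_eq_top.mp htop

theorem triangularMap_bijective :
    Function.Bijective (triangularMap (inC S κ) (incH S κ) (inB S κ)) :=
  ⟨triangularMap_injective S κ, triangularMap_surjective S κ⟩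

end Double

end PlaneData

end

end DoubleBosonisation

/-! ### Smash products and coproducts on all of `B` and `C̄`. -/

namespace DoubleBosonisation

noncomputable section

open scoped Shortcuts

variable {k : Type u} [Field k] {n : ℕ} {H A B D : Type u} [Ring H] [Ring A] [Bialgebra k H]
  [Bialgebra k A] [Ring B] [Algebra k B] [Ring D] [Algebra k D]

namespace PlaneData

variable {P : WeakQTPair k H A} {R R' : Mat2 k n} (S : PlaneData P R R' B D)

theorem rAct_one (h : H) : rAct P S.β (1 ⊗ₜ h) = Coalgebra.counit (R := k) h • (1 : B) := by
  simp [rAct_tmul, cof, Algebra.TensorProduct.one_def, P.pair_one_right]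

theorem rAct_e_mul (h : H) (i : Fin n) (b : B) :
    rAct P S.β ((S.e i * b) ⊗ₜ h) = ∑ a, S.e a * rAct P S.β (b ⊗ₜ S.nL i a h) := by
  have h1 : ∀ a x, P.pair h (S.T i a * x) = P.pair (S.nL i a h) x := by
    intro a x
    simp only [P.pair_mul_right, nL, LinearMap.comp_apply]
    generalize Coalgebra.comul (R := k) h = z
    induction z using TensorProduct.induction_on with
    | zero => simp
    | add x y hx hy => simp only [map_add, hx, hy, LinearMap.add_apply]
    | tmul x y => simp
  simp only [rAct_tmul, cof, LinearMap.comp_apply, AlgHom.toLinearMap_apply, map_mul, S.β_e]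
  generalize S.β b = z
  induction z using TensorProduct.induction_on with
  | zero => simp
  | add x y hx hy => simp only [map_add, mul_add, hx, hy, Finset.sum_add_distrib]
  | tmul x y => simp [Finset.sum_mul, h1]

theorem lAct_eq (h : H) (c : D) : lAct P S.δ (h ⊗ₜ c) = S.actD h c := lAct_tmul P S.δ h c

theorem lam_B_e (i j l : Fin n) : S.coreB.lam i l (S.e j) = ∑ a, R (j, i) (a, l) • S.e a :=
  S.coreB.lam_v i j l

theorem lam_D_f (i j l : Fin n) : S.coreD.lam i l (S.f j) = ∑ a, R (l, a) (i, j) • S.f a :=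
  S.coreD.lam_v i j l

namespace Double

variable (κ : k)

/-! ### The products -/

/-- The map `g ⊗ h ↦ g (b ◁ h)`. -/
def smashB (b : B) : H ⊗[k] H →ₗ[k] S.Double κ :=
  LinearMap.mul' k _ ∘ₗ TensorProduct.map (inH S κ).toLinearMap
    ((inB S κ).toLinearMap ∘ₗ rAct P S.β ∘ₗ TensorProduct.mk k B H b)

@[simp]
theorem smashB_tmul (b : B) (g h : H) : smashB S κ b (g ⊗ₜ h) =
    inH S κ g * inB S κ (rAct P S.β (b ⊗ₜ h)) := rfl

/-- The map `h ⊗ g ↦ (h ▷ c) g`. -/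
def smashC (c : D) : H ⊗[k] H →ₗ[k] S.Double κ :=
  LinearMap.mul' k _ ∘ₗ TensorProduct.map
    ((inC S κ).toLinearMap ∘ₗ lAct P S.δ ∘ₗ (TensorProduct.mk k H D).flip c)
    (inH S κ).toLinearMap

@[simp]
theorem smashC_tmul (c : D) (g h : H) : smashC S κ c (g ⊗ₜ h) =
    inC S κ (S.actD g c) * inH S κ h := by
  rw [← lAct_eq]
  rfl

/-- Induction on the word `b`. Moving the first letter past `h₁` differentiates `h₁` on the right,
while acting by `h₂` on that letter differentiates `h₂` on the left; `rTensor_nR` says these agree.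
-/
theorem inB_mul_inH (b : B) (h : H) :
    inB S κ b * inH S κ h = smashB S κ b (Coalgebra.comul h) := by
  induction b using S.planeB.induction generalizing h with
  | h1 =>
    have h1 : ∀ z, smashB S κ 1 z = inH S κ (TensorProduct.rid k H (Coalgebra.counit.lTensor H z)) := by
      intro z
      induction z using TensorProduct.induction_on with
      | zero => simp
      | add x y hx hy => simp only [map_add, hx, hy]
      | tmul x y => simp [rAct_one]
    rw [h1]
    simp
  | hadd x y hx hy =>
    rw [map_add, add_mul, hx, hy]
    simp [smashB, LinearMap.comp_add, TensorProduct.map_add_right]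
  | hsmul r x hx =>
    rw [map_smul, smul_mul_assoc, hx]
    simp [smashB, LinearMap.comp_smul, TensorProduct.map_smul_right]
  | hm i b hb =>
    have h1 : ∀ z, smashB S κ (S.e i * b) z =
        ∑ a, LinearMap.mul' k _ (TensorProduct.map (inH S κ).toLinearMap
          (LinearMap.mulLeft k (e S κ a) ∘ₗ
            (inB S κ).toLinearMap ∘ₗ rAct P S.β ∘ₗ TensorProduct.mk k B H b)
          ((S.nL i a).lTensor H z)) := by
      intro z
      induction z using TensorProduct.induction_on with
      | zero => simp
      | add x y hx hy => simp only [map_add, hx, hy, Finset.sum_add_distrib]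
      | tmul x y => simp [rAct_e_mul, Finset.mul_sum]
    have h2 : ∀ z, e S κ i * smashB S κ b z =
        ∑ a, LinearMap.mul' k _ (TensorProduct.map (inH S κ).toLinearMap
          (LinearMap.mulLeft k (e S κ a) ∘ₗ
            (inB S κ).toLinearMap ∘ₗ rAct P S.β ∘ₗ TensorProduct.mk k B H b)
          ((S.nR i a).rTensor H z)) := by
      intro z
      induction z using TensorProduct.induction_on with
      | zero => simp
      | add x y hx hy => simp only [map_add, mul_add, hx, hy, Finset.sum_add_distrib]
      | tmul x y => simp [← mul_assoc, (cross S κ).eh, Finset.sum_mul]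
    rw [map_mul, inB_e, mul_assoc, hb, h1, h2]
    simp only [S.rTensor_nR]

theorem inH_mul_inC (h : H) (c : D) :
    inH S κ h * inC S κ c = smashC S κ c (Coalgebra.comul h) := by
  induction c using S.planeD.induction generalizing h with
  | h1 =>
    have h1 : ∀ z, smashC S κ 1 z = inH S κ (TensorProduct.lid k H (Coalgebra.counit.rTensor H z)) := by
      intro z
      induction z using TensorProduct.induction_on with
      | zero => simp
      | add x y hx hy => simp only [map_add, hx, hy]
      | tmul x y => simp [actD_one]
    rw [h1]
    simp
  | hadd x y hx hy =>
    rw [map_add, mul_add, hx, hy]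
    simp [smashC, LinearMap.comp_add, TensorProduct.map_add_left]
  | hsmul r x hx =>
    rw [map_smul, mul_smul_comm, hx]
    simp [smashC, LinearMap.comp_smul, TensorProduct.map_smul_left]
  | hm i c hc =>
    rw [map_mul, inC_f, ← mul_assoc, (cross S κ).hf, Finset.sum_mul]
    simp only [mul_assoc, hc, S.comul_nL]
    generalize Coalgebra.comul (R := k) h = z
    induction z using TensorProduct.induction_on with
    | zero => simp
    | add x y hx hy => simp only [map_add, mul_add, ← hx, ← hy, Finset.sum_add_distrib]
    | tmul x y => simp [actD_f_mul, Finset.sum_mul, mul_assoc]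

theorem Mm_mul_inC (i j : Fin n) (c : D) : inH S κ (S.Mm i j) * inC S κ c =
    ∑ a, inC S κ (S.actD (S.Mm a j) c) * inH S κ (S.Mm i a) := by
  simp [inH_mul_inC, S.comul_Mm]

theorem Mp_mul_inC (i j : Fin n) (c : D) : inH S κ (S.Mp i j) * inC S κ c =
    ∑ a, inC S κ (S.actD (S.Mp a j) c) * inH S κ (S.Mp i a) := by
  simp [inH_mul_inC, S.comul_Mp]

/-- Commuting `m⁻` with an element of `B` implements the braiding operators `lam`. For a letter it
is `mm_e`, and both sides are compatible with products as matrices. -/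
theorem inB_lam_mul_Mm (i j : Fin n) (b : B) :
    ∑ a, inB S κ (S.coreB.lam i a b) * inH S κ (S.Mm a j) = inH S κ (S.Mm i j) * inB S κ b := by
  induction b using S.planeB.induction generalizing i j with
  | h1 => simp [S.coreB.lam_one, apply_ite (inB S κ)]
  | hadd x y hx hy => simp only [map_add, add_mul, mul_add, Finset.sum_add_distrib, hx, hy]
  | hsmul r x hx => simp only [map_smul, smul_mul_assoc, mul_smul_comm, ← Finset.smul_sum, hx]
  | hm l b hb =>
    simp only [S.coreB.lam_mul_apply, map_sum, map_mul, Finset.sum_mul]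
    rw [Finset.sum_comm]
    simp only [mul_assoc, ← Finset.mul_sum, hb, inB_e]
    simp only [← mul_assoc, (cross S κ).mm_e, lam_B_e, map_sum, map_smul, inB_e, Finset.sum_mul,
      smul_mul_assoc]
    exact Finset.sum_comm

/-! ### The coproducts -/

/-- The algebra map `b ↦ ∑ b^(2) ⊗ 𝓡(b^(1))`. -/
def omegaB : B →ₐ[k] B ⊗[k] S.Double κ :=
  ((Algebra.TensorProduct.comm k (S.Double κ) B).toAlgHom.comp
    (Algebra.TensorProduct.map ((inH S κ).comp P.Rp) (.id k B))).comp S.β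

/-- The algebra map `c ↦ ∑ 𝓡̄(c^(2)) ⊗ c^(1)`. -/
def omegaC : D →ₐ[k] S.Double κ ⊗[k] D :=
  (Algebra.TensorProduct.map ((inH S κ).comp P.Rm) (.id k D)).comp S.δ'

theorem omegaB_e (i : Fin n) : omegaB S κ (S.e i) = ∑ a, S.e a ⊗ₜ inH S κ (S.Mp i a) := by
  simp [omegaB, S.β_e, Mp]

theorem omegaC_f (i : Fin n) : omegaC S κ (S.f i) = ∑ a, inH S κ (S.Mm a i) ⊗ₜ S.f a := by
  simp [omegaC, S.δ'_apply, S.δ_f, Mm]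

/-- Moving `e^i` past `𝓡(b^(1))` reproduces the braiding of `e^i` with `b`. This is why bosonisation
turns the braided coproduct into an ordinary one. -/
theorem one_tmul_e_mul_omegaB (i : Fin n) (b : B) : (1 ⊗ₜ[k] e S κ i) * omegaB S κ b =
    ∑ a, omegaB S κ (S.coreB.lam i a b) * (1 ⊗ₜ e S κ a) := by
  induction b using S.planeB.induction generalizing i with
  | h1 => simp [S.coreB.lam_one, apply_ite (omegaB S κ)]
  | hadd x y hx hy => simp only [map_add, add_mul, mul_add, Finset.sum_add_distrib, hx, hy]
  | hsmul r x hx => simp only [map_smul, smul_mul_assoc, mul_smul_comm, ← Finset.smul_sum, hx]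
  | hm l b hb =>
    have h1 : (1 ⊗ₜ[k] e S κ i) * omegaB S κ (S.e l) =
        ∑ a, omegaB S κ (S.coreB.lam i a (S.e l)) * (1 ⊗ₜ e S κ a) := by
      simp only [omegaB_e, lam_B_e, map_sum, map_smul, Finset.mul_sum, Finset.sum_mul,
        smul_mul_assoc, Algebra.TensorProduct.tmul_mul_tmul, one_mul, mul_one, (cross S κ).e_mp,
        TensorProduct.tmul_sum, TensorProduct.tmul_smul, Finset.smul_sum]
      rw [Finset.sum_comm]
      refine (Finset.sum_congr rfl fun _ _ => Finset.sum_comm).trans ?_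
      rw [Finset.sum_comm]
    rw [map_mul, ← mul_assoc, h1, Finset.sum_mul]
    simp only [mul_assoc, hb, S.coreB.lam_mul_apply, map_sum, map_mul, Finset.sum_mul,
      Finset.mul_sum]
    exact Finset.sum_comm

theorem f_tmul_one_mul_omegaC (i : Fin n) (c : D) : (f S κ i ⊗ₜ[k] 1) * omegaC S κ c =
    ∑ a, omegaC S κ (S.coreD.lam i a c) * (f S κ a ⊗ₜ 1) := by
  induction c using S.planeD.induction generalizing i with
  | h1 => simp [S.coreD.lam_one, apply_ite (omegaC S κ)]
  | hadd x y hx hy => simp only [map_add, add_mul, mul_add, Finset.sum_add_distrib, hx, hy]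
  | hsmul r x hx => simp only [map_smul, smul_mul_assoc, mul_smul_comm, ← Finset.smul_sum, hx]
  | hm l b hb =>
    have h1 : (f S κ i ⊗ₜ[k] 1) * omegaC S κ (S.f l) =
        ∑ a, omegaC S κ (S.coreD.lam i a (S.f l)) * (f S κ a ⊗ₜ 1) := by
      simp only [omegaC_f, lam_D_f, map_sum, map_smul, Finset.mul_sum, Finset.sum_mul,
        smul_mul_assoc, Algebra.TensorProduct.tmul_mul_tmul, one_mul, mul_one, (cross S κ).f_mm,
        TensorProduct.sum_tmul, ← TensorProduct.smul_tmul', Finset.smul_sum]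
      rw [Finset.sum_comm]
      refine (Finset.sum_congr rfl fun _ _ => Finset.sum_comm).trans ?_
      rfl
    rw [map_mul, ← mul_assoc, h1, Finset.sum_mul]
    simp only [mul_assoc, hb, S.coreD.lam_mul_apply, map_sum, map_mul, Finset.sum_mul,
      Finset.mul_sum]
    exact Finset.sum_comm

/-- The map `b ⊗ d ↦ ∑ b^(2) ⊗ 𝓡(b^(1)) d`. -/
def gammaB : B ⊗[k] B →ₗ[k] B ⊗[k] S.Double κ :=
  TensorProduct.lift ((LinearMap.mul k (B ⊗[k] S.Double κ)).compl₁₂ (omegaB S κ).toLinearMap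
    ((Algebra.TensorProduct.includeRight (R := k) (A := B)).comp (inB S κ)).toLinearMap)

@[simp]
theorem gammaB_tmul (b d : B) :
    gammaB S κ (b ⊗ₜ d) = omegaB S κ b * (1 ⊗ₜ inB S κ d) := rfl

/-- The map `c ⊗ d ↦ ∑ 𝓡̄(c^(2)) d ⊗ c^(1)`. -/
def gammaC : D ⊗[k] D →ₗ[k] S.Double κ ⊗[k] D :=
  TensorProduct.lift ((LinearMap.mul k (S.Double κ ⊗[k] D)).compl₁₂ (omegaC S κ).toLinearMap
    ((Algebra.TensorProduct.includeLeft (R := k) (S := k) (B := D)).comp (inC S κ)).toLinearMap)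

@[simp]
theorem gammaC_tmul (c d : D) :
    gammaC S κ (c ⊗ₜ d) = omegaC S κ c * (inC S κ d ⊗ₜ 1) := rfl

/-- Translates left multiplication by the braided coproduct of `e^i` into left multiplication by its
coproduct in `U`, so the formula for `Δ b` follows letter by letter. -/
theorem gammaB_X (i : Fin n) (z : B ⊗[k] B) : gammaB S κ (S.coreB.X i z) =
    (omegaB S κ (S.e i) + 1 ⊗ₜ e S κ i) * gammaB S κ z := by
  induction z using TensorProduct.induction_on with
  | zero => simp
  | add x y hx hy => simp only [map_add, mul_add, hx, hy]
  | tmul b d =>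
    rw [PlaneCore.X_tmul, map_add, map_sum]
    simp only [gammaB_tmul, add_mul]
    congr 1
    · rw [← mul_assoc, ← map_mul]; rfl
    · rw [← mul_assoc, one_tmul_e_mul_omegaB, Finset.sum_mul]
      refine Finset.sum_congr rfl fun a _ => ?_
      rw [mul_assoc, show S.coreB.v a = S.e a from rfl, map_mul, inB_e]
      simp

theorem gammaC_X (i : Fin n) (z : D ⊗[k] D) : gammaC S κ (S.coreD.X i z) =
    (omegaC S κ (S.f i) + f S κ i ⊗ₜ 1) * gammaC S κ z := by
  induction z using TensorProduct.induction_on with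
  | zero => simp
  | add x y hx hy => simp only [map_add, mul_add, hx, hy]
  | tmul b d =>
    rw [PlaneCore.X_tmul, map_add, map_sum]
    simp only [gammaC_tmul, add_mul]
    congr 1
    · rw [← mul_assoc, ← map_mul]; rfl
    · rw [← mul_assoc, f_tmul_one_mul_omegaC, Finset.sum_mul]
      refine Finset.sum_congr rfl fun a _ => ?_
      rw [mul_assoc, show S.coreD.v a = S.f a from rfl, map_mul, inC_f]
      simp

theorem bosonB_eq (b : B) : bosonB S.groupB (incH S κ) (inB S κ) b =
    gammaB S κ (S.coreB.comul b) := by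
  change _ = gammaB S κ (S.groupB.comul b)
  simp only [bosonB, LinearMap.comp_apply]
  generalize S.groupB.comul b = z
  induction z using TensorProduct.induction_on with
  | zero => simp
  | add x y hx hy => simp only [map_add, hx, hy]
  | tmul b d =>
    have : omegaB S κ b = TensorProduct.map LinearMap.id ((inH S κ).comp P.Rp).toLinearMap
        (TensorProduct.comm k A B (S.β b)) := by
      simp only [omegaB, AlgHom.comp_apply]
      generalize S.β b = z
      induction z using TensorProduct.induction_on with
      | zero => simp
      | add x y hx hy => simp only [map_add, hx, hy]
      | tmul b d => simp
    simp only [LinearMap.rTensor_tmul, LinearMap.comp_apply, gammaB_tmul, this]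
    change _ = TensorProduct.map LinearMap.id ((inH S κ).comp P.Rp).toLinearMap
        (TensorProduct.comm k A B (S.groupB.coact b)) * _
    simp only [AlgHom.toLinearMap_apply, LinearEquiv.coe_coe]
    generalize TensorProduct.comm k A B (S.groupB.coact b) = z
    induction z using TensorProduct.induction_on with
    | zero => simp
    | add x y hx hy => simp only [map_add, hx, hy, TensorProduct.add_tmul, add_mul]
    | tmul x y => simp

theorem comul_inB (b : B) : Coalgebra.comul (R := k) (inB S κ b) =
    (inB S κ).toLinearMap.rTensor (S.Double κ) (gammaB S κ (S.coreB.comul b)) := by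
  have hmul : ∀ z w, (inB S κ).toLinearMap.rTensor (S.Double κ) (z * w) =
      (inB S κ).toLinearMap.rTensor (S.Double κ) z * (inB S κ).toLinearMap.rTensor (S.Double κ) w :=
    map_mul (Algebra.TensorProduct.map (inB S κ) (.id k (S.Double κ)))
  induction b using S.planeB.induction with
  | h1 =>
    rw [S.coreB.comul_one]
    simp [Algebra.TensorProduct.one_def]
  | hadd x y hx hy => simp only [map_add, hx, hy]
  | hsmul r x hx => simp only [map_smul, hx]
  | hm i b hb =>
    have h : S.coreB.comul (S.e i * b) = S.coreB.X i (S.coreB.comul b) := S.coreB.comul_v_mul i b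
    rw [map_mul, Bialgebra.comul_mul, hb, h, gammaB_X, hmul]
    congr 1
    simp [omegaB_e]

theorem comul_inC (c : D) : Coalgebra.comul (R := k) (inC S κ c) =
    (inC S κ).toLinearMap.lTensor (S.Double κ) (gammaC S κ (S.coreD.comul c)) := by
  have hmul : ∀ z w, (inC S κ).toLinearMap.lTensor (S.Double κ) (z * w) =
      (inC S κ).toLinearMap.lTensor (S.Double κ) z * (inC S κ).toLinearMap.lTensor (S.Double κ) w :=
    map_mul (Algebra.TensorProduct.map (.id k (S.Double κ)) (inC S κ))
  induction c using S.planeD.induction with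
  | h1 =>
    rw [S.coreD.comul_one]
    simp [Algebra.TensorProduct.one_def]
  | hadd x y hx hy => simp only [map_add, hx, hy]
  | hsmul r x hx => simp only [map_smul, hx]
  | hm i b hb =>
    have h : S.coreD.comul (S.f i * b) = S.coreD.X i (S.coreD.comul b) := S.coreD.comul_v_mul i b
    rw [map_mul, Bialgebra.comul_mul, hb, h, gammaC_X, hmul]
    congr 1
    simp [omegaC_f, add_comm]

/-- The map `c ⊗ d ↦ ∑ c 𝓡̄(d^(2)) ⊗ d^(1)`. -/
def gammaC' : D ⊗[k] D →ₗ[k] S.Double κ ⊗[k] D :=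
  TensorProduct.lift ((LinearMap.mul k (S.Double κ ⊗[k] D)).compl₁₂
    ((Algebra.TensorProduct.includeLeft (R := k) (S := k) (B := D)).comp (inC S κ)).toLinearMap
    (omegaC S κ).toLinearMap)

@[simp]
theorem gammaC'_tmul (c d : D) :
    gammaC' S κ (c ⊗ₜ d) = (inC S κ c ⊗ₜ 1) * omegaC S κ d := rfl

theorem omegaC_f_mul (i : Fin n) (d : D) : omegaC S κ (S.f i) * (inC S κ d ⊗ₜ 1) =
    ∑ a, (inC S κ (S.actD (S.Mm a i) d) ⊗ₜ 1) * omegaC S κ (S.f a) := by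
  simp only [omegaC_f, Finset.sum_mul, Finset.mul_sum, Algebra.TensorProduct.tmul_mul_tmul,
    mul_one, one_mul, Mm_mul_inC, TensorProduct.sum_tmul]
  exact Finset.sum_comm

/-- The inverse braiding contained in the coproduct of `C̄` is undone by moving `𝓡̄(c^(2))` to the
left of `d`. Hence `bosonC` can be computed from the coproduct of `D` itself, to which induction on
words applies. -/
theorem gammaC'_braidR (c d : D) : gammaC' S κ (braidR P P.Rm S.δ (c ⊗ₜ d)) =
    omegaC S κ c * (inC S κ d ⊗ₜ 1) := by
  rw [braidR_tmul]
  induction c using S.planeD.induction with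
  | h1 => simp [Algebra.TensorProduct.one_def]
  | hadd x y hx hy => simp only [map_add, hx, hy, add_mul]
  | hsmul r x hx => simp only [map_smul, hx, smul_mul_assoc]
  | hm i c hc =>
    rw [map_mul S.δ', map_mul (omegaC S κ), mul_assoc, ← hc]
    generalize S.δ' c = z
    induction z using TensorProduct.induction_on with
    | zero => simp
    | add x y hx hy => simp only [map_add, mul_add, hx, hy]
    | tmul x w =>
      simp only [S.δ'_apply, S.δ_f, map_sum, TensorProduct.comm_tmul, Finset.sum_mul,
        Algebra.TensorProduct.tmul_mul_tmul, TensorProduct.map_tmul, gammaC'_tmul,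
        LinearMap.comp_apply, LinearMap.applyₗ_apply_apply, AlgHom.toLinearMap_apply, map_mul,
        AlgHom.comp_apply, LinearMap.id_apply, Module.End.mul_apply]
      rw [← mul_assoc (omegaC S κ (S.f i)), omegaC_f_mul, Finset.sum_mul]
      exact Finset.sum_congr rfl fun a _ => (mul_assoc _ _ _).symm

theorem bosonC_eq (c : D) : bosonC S.groupD (inC S κ) (incH S κ) c =
    gammaC S κ (S.coreD.comul c) := by
  have h1 : ∀ z : D ⊗[k] D, (LinearMap.mul' k (S.Double κ) ∘ₗ
      TensorProduct.map (inC S κ).toLinearMap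
        ((incH S κ : H →ₐ[k] S.Double κ).comp P.Rm).toLinearMap).rTensor D
      ((TensorProduct.assoc k D A D).symm
        (((TensorProduct.comm k D A).toLinearMap ∘ₗ S.δ.toLinearMap).lTensor D z)) =
      gammaC' S κ z := by
    intro z
    induction z using TensorProduct.induction_on with
    | zero => simp
    | add x y hx hy => simp only [map_add, hx, hy]
    | tmul c d =>
      simp only [LinearMap.lTensor_tmul, LinearMap.comp_apply, gammaC'_tmul, omegaC,
        AlgHom.comp_apply, δ'_apply, AlgHom.toLinearMap_apply, LinearEquiv.coe_coe]
      generalize TensorProduct.comm k D A (S.δ d) = z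
      induction z using TensorProduct.induction_on with
      | zero => simp
      | add x y hx hy => simp only [map_add, hx, hy, TensorProduct.tmul_add, mul_add]
      | tmul x y => simp
  have h2 : ∀ z : D ⊗[k] D, gammaC' S κ (braidR P P.Rm S.δ z) = gammaC S κ z := by
    intro z
    induction z using TensorProduct.induction_on with
    | zero => simp
    | add x y hx hy => simp only [map_add, hx, hy]
    | tmul c d => exact gammaC'_braidR S κ c d
  exact (h1 _).trans (h2 _)

theorem counit_inB (b : B) : Coalgebra.counit (R := k) (inB S κ b) = S.coreB.counit b := by
  induction b using S.planeB.induction with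
  | h1 => simp
  | hadd x y hx hy => simp only [map_add, hx, hy]
  | hsmul r x hx => simp only [map_smul, hx]
  | hm i b hb =>
    rw [map_mul, Bialgebra.counit_mul, map_mul, show S.coreB.counit (S.e i) = 0 from
      S.coreB.counit_v i]
    simp

theorem counit_inC (c : D) : Coalgebra.counit (R := k) (inC S κ c) = S.coreD.counit c := by
  induction c using S.planeD.induction with
  | h1 => simp
  | hadd x y hx hy => simp only [map_add, hx, hy]
  | hsmul r x hx => simp only [map_smul, hx]
  | hm i b hb =>
    rw [map_mul, Bialgebra.counit_mul, map_mul, show S.coreD.counit (S.f i) = 0 from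
      S.coreD.counit_v i]
    simp

end Double

end PlaneData

end

end DoubleBosonisation

/-! ### The cross relations for arbitrary elements of `B` and `C̄`. -/

namespace DoubleBosonisation

noncomputable section

open scoped Shortcuts

variable {k : Type u} [Field k] {n : ℕ} {H A B D : Type u} [Ring H] [Ring A] [Bialgebra k H]
  [Bialgebra k A] [Ring B] [Algebra k B] [Ring D] [Algebra k D]

/-- By coassociativity both sides are the threefold coproduct with the functional applied to its
middle leg. This is the identity that removes the surplus terms in `crossRight_e_mul`. -/
theorem PlaneCore.lTensor_dl {Q M : Mat2 k n} {V : Type u} [Ring V] [Algebra k V]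
    (S : PlaneCore Q M V) (κ : k) (i : Fin n) (b : V) :
    (S.dl κ i).lTensor V (S.comul b) = (S.dr κ i).rTensor V (S.comul b) := by
  have h := congrArg ((TensorProduct.lid k V).toLinearMap.lTensor V ∘ₗ
    ((S.der κ i).rTensor V).lTensor V) (LinearMap.congr_fun S.coassoc b)
  simp only [LinearMap.comp_apply, LinearEquiv.coe_coe] at h
  have e1 : ∀ z : V ⊗[k] V, (TensorProduct.lid k V).toLinearMap.lTensor V
      (((S.der κ i).rTensor V).lTensor V (S.comul.lTensor V z)) = (S.dl κ i).lTensor V z := by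
    intro z
    rw [← LinearMap.comp_apply, ← LinearMap.comp_apply, ← LinearMap.lTensor_comp,
      ← LinearMap.lTensor_comp]
    rfl
  have e2 : ∀ z : V ⊗[k] V, (TensorProduct.lid k V).toLinearMap.lTensor V
      (((S.der κ i).rTensor V).lTensor V (TensorProduct.assoc k V V V (S.comul.rTensor V z))) =
      (S.dr κ i).rTensor V z := by
    intro z
    induction z using TensorProduct.induction_on with
    | zero => simp
    | add x y hx hy => simp only [map_add, hx, hy]
    | tmul x y =>
      simp only [dr, LinearMap.rTensor_tmul, LinearMap.comp_apply]
      generalize S.comul x = z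
      induction z using TensorProduct.induction_on with
      | zero => simp
      | add x y hx hy => simp only [map_add, TensorProduct.add_tmul, hx, hy]
      | tmul x y => simp [TensorProduct.smul_tmul]
  rw [← e1, ← e2]
  exact h.symm

namespace PlaneData

variable {P : WeakQTPair k H A} {R R' : Mat2 k n} (S : PlaneData P R R' B D)

/-- The axiom `inv_right` with its first argument fixed to a matrix entry. -/
theorem conv_pair_Rp_Rm (i j : Fin n) :
    ∑ a, conv (P.pair.flip (S.T i a) ∘ₗ P.Rp.toLinearMap) (P.pair (S.Mm a j)) =
      (if i = j then (1 : k) else 0) • (Coalgebra.counit : A →ₗ[k] k) := by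
  ext x
  have h := LinearMap.congr_fun P.inv_right (S.T i j ⊗ₜ x)
  simp only [conv, LinearMap.comp_apply, TensorProduct.comul_tmul, S.comul_T,
    TensorProduct.counit_tmul, S.counit_T] at h
  rw [LinearMap.smul_apply, smul_eq_mul, mul_comm, ← smul_eq_mul, ← h]
  simp only [conv, LinearMap.sum_apply, LinearMap.comp_apply]
  generalize Coalgebra.comul (R := k) x = z
  induction z using TensorProduct.induction_on with
  | zero => simp
  | add x y hx hy =>
    simp only [map_add, TensorProduct.tmul_add, Finset.sum_add_distrib, hx, hy]
  | tmul x y => simp [TensorProduct.sum_tmul, Mm]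

/-- The action of `m⁻` inverts the braiding operators, since the functionals defining the two are
convolution inverse as matrices. -/
theorem sum_rAct_lam (i j : Fin n) (b : B) :
    ∑ a, cof S.β (P.pair (S.Mm a j)) (S.coreB.lam i a b) = if i = j then b else 0 := by
  have h1 : ∀ a, cof S.β (P.pair (S.Mm a j)) (S.coreB.lam i a b) =
      cof S.β (conv (P.pair.flip (S.T i a) ∘ₗ P.Rp.toLinearMap) (P.pair (S.Mm a j))) b :=
    fun a => cof_cof S.coassoc_β _ _ b
  have h2 : ∀ φ : Fin n → A →ₗ[k] k, ∑ a, cof S.β (φ a) b = cof S.β (∑ a, φ a) b := by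
    intro φ
    simp only [cof, LinearMap.comp_apply]
    generalize S.β.toLinearMap b = z
    induction z using TensorProduct.induction_on with
    | zero => simp
    | add x y hx hy => simp only [map_add, Finset.sum_add_distrib, hx, hy]
    | tmul x y => simp [LinearMap.sum_apply, Finset.sum_smul]
  simp only [h1]
  rw [h2, conv_pair_Rp_Rm]
  have h3 : cof S.β (Coalgebra.counit : A →ₗ[k] k) b = b := LinearMap.congr_fun S.counit_β b
  by_cases h : i = j
  · simpa [h] using h3
  · simp [h, cof]

/-- Covariance of the pairing, evaluated by `⟨h, -⟩`, makes the two actions of `H` adjoint to each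
other. -/
theorem ev_actD (κ : k) (h : H) (c : D) (b : B) : (S.pairing κ).ev (S.actD h c) b =
    (S.pairing κ).ev c (cof S.β (P.pair h) b) := by
  have h1 := congrArg (P.pair h) ((S.pairing κ).covariant c b)
  have h2 : ∀ z : D ⊗[k] A, P.pair h (TensorProduct.lid k A
      (((S.pairing κ).ev.flip b).rTensor A z)) =
      (S.pairing κ).ev (TensorProduct.rid k D ((P.pair h).lTensor D z)) b := by
    intro z
    induction z using TensorProduct.induction_on with
    | zero => simp
    | add x y hx hy => simp only [map_add, LinearMap.add_apply, hx, hy]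
    | tmul x y => simp [mul_comm]
  have h3 : ∀ z : A ⊗[k] B, P.pair h (TensorProduct.rid k A
      (((S.pairing κ).ev c).lTensor A z)) =
      (S.pairing κ).ev c (TensorProduct.lid k B ((P.pair h).rTensor B z)) := by
    intro z
    induction z using TensorProduct.induction_on with
    | zero => simp
    | add x y hx hy => simp only [map_add, hx, hy]
    | tmul x y => simp [mul_comm]
  rw [h2, h3] at h1
  exact h1

theorem sum_ev_actD_lam (κ : k) (i j : Fin n) (c : D) (b : B) :
    ∑ a, (S.pairing κ).ev (S.actD (S.Mm a j) c) (S.coreB.lam i a b) =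
      if i = j then (S.pairing κ).ev c b else 0 := by
  simp only [ev_actD, ← map_sum, sum_rAct_lam]
  split_ifs <;> simp

theorem ev_e_mul (κ : k) (i : Fin n) (c : D) (b : B) :
    (S.pairing κ).ev c (S.e i * b) = (S.pairing κ).ev (S.coreD.dl κ i c) b :=
  PlaneCore.ev_v_mul_right S.coreD S.coreB κ i c b

namespace Double

variable (κ : k)

/-- The commutation of `e^i` with a whole word in the `f_j`, by the same bookkeeping as in
`Fock.opE_opC` but now inside `U`. -/
theorem e_mul_inC (i : Fin n) (c : D) : e S κ i * inC S κ c = inC S κ c * e S κ i +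
    ∑ a, (inC S κ (S.coreD.dr κ a c) * inH S κ (S.Mp i a) -
      inH S κ (S.Mm i a) * inC S κ (S.coreD.dl κ a c)) := by
  induction c using S.planeD.induction generalizing i with
  | h1 => simp [PlaneCore.dl_one, PlaneCore.dr_one]
  | hadd x y hx hy =>
    simp only [map_add, add_mul, mul_add, hx, hy, Finset.sum_add_distrib, Finset.sum_sub_distrib]
    abel
  | hsmul r x hx =>
    simp only [map_smul, smul_mul_assoc, mul_smul_comm, hx, smul_add, ← smul_sub,
      Finset.smul_sum]
  | hm j c hc =>
    have hdr : ∀ a, S.coreD.dr κ a (S.f j * c) =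
        S.f j * S.coreD.dr κ a c + κ⁻¹ • S.actD (S.Mp a j) c := fun a =>
      S.coreD.dr_v_mul κ a j c
    have hdl : ∀ a, S.coreD.dl κ a (S.f j * c) = (if a = j then κ⁻¹ • c else 0) +
        ∑ b, ∑ d, R (d, a) (j, b) • (S.f d * S.coreD.dl κ b c) := fun a =>
      (S.coreD.dl_v_mul κ a j c).trans (by rw [Fintype.sum_prod_type]; rfl)
    have h1 : ∑ a, inH S κ (S.Mm i a) * inC S κ (if a = j then κ⁻¹ • c else 0) =
        κ⁻¹ • (inH S κ (S.Mm i j) * inC S κ c) := by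
      simp [apply_ite (inC S κ)]
    have h2 : ∑ a, inH S κ (S.Mm i a) *
          ∑ b, ∑ d, R (d, a) (j, b) • (f S κ d * inC S κ (S.coreD.dl κ b c)) =
        ∑ b, f S κ j * (inH S κ (S.Mm i b) * inC S κ (S.coreD.dl κ b c)) := by
      simp only [← mul_assoc, (cross S κ).f_mm, Finset.mul_sum, Finset.sum_mul, mul_smul_comm,
        smul_mul_assoc]
      rw [Finset.sum_comm]
      exact Finset.sum_congr rfl fun _ _ => Finset.sum_comm
    simp only [Finset.mul_sum] at h2
    have h3 : ∑ a, inC S κ (S.actD (S.Mp a j) c) * inH S κ (S.Mp i a) =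
        inH S κ (S.Mp i j) * inC S κ c := (Mp_mul_inC S κ i j c).symm
    rw [map_mul, inC_f, ← mul_assoc, (cross S κ).ef, add_mul, mul_assoc, hc]
    simp only [hdr, hdl, map_add, map_mul, map_sum, map_smul, inC_f, mul_add, add_mul,
      smul_mul_assoc, mul_assoc, Finset.sum_sub_distrib, Finset.sum_add_distrib, h1, h2,
      ← Finset.smul_sum, h3, Finset.mul_sum, mul_sub, sub_mul, smul_sub]
    abel

/-! ### The left hand side of the cross relations -/

/-- The map `(b ⊗ b') ⊗ (u ⊗ d) ↦ ⟨d, b'⟩ b u`. -/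
def crossL : (B ⊗[k] B) ⊗[k] (S.Double κ ⊗[k] D) →ₗ[k] S.Double κ :=
  (TensorProduct.rid k (S.Double κ)).toLinearMap ∘ₗ
    TensorProduct.map (LinearMap.mul' k (S.Double κ) ∘ₗ (inB S κ).toLinearMap.rTensor (S.Double κ))
      (TensorProduct.lift (S.pairing κ).ev.flip) ∘ₗ
    (TensorProduct.tensorTensorTensorComm k B B (S.Double κ) D).toLinearMap

@[simp]
theorem crossL_tmul (b d : B) (u : S.Double κ) (c : D) : crossL S κ ((b ⊗ₜ d) ⊗ₜ (u ⊗ₜ c)) =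
    (S.pairing κ).ev c d • (inB S κ b * u) := rfl

theorem crossLeft_tmul (b : B) (c : D) :
    crossLeft (S.pairing κ) (inC S κ) (incH S κ) (inB S κ) (b ⊗ₜ c) =
      crossL S κ (S.coreB.comul b ⊗ₜ gammaC S κ (S.coreD.comul c)) := by
  rw [← bosonC_eq]
  rfl

/-- The two summands of `X i` play different roles: in the first `e^i` stands in front, and in the
second it enters the pairing, where it becomes the derivation `dl` of the other argument. -/
theorem crossL_X (i : Fin n) (z : B ⊗[k] B) (w : S.Double κ ⊗[k] D) :
    crossL S κ (S.coreB.X i z ⊗ₜ w) = e S κ i * crossL S κ (z ⊗ₜ w) +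
      ∑ a, crossL S κ ((S.coreB.lam i a).rTensor B z ⊗ₜ (S.coreD.dl κ a).lTensor _ w) := by
  induction z using TensorProduct.induction_on with
  | zero => simp
  | add x y hx hy =>
    simp only [map_add, TensorProduct.add_tmul, mul_add, hx, hy, Finset.sum_add_distrib]
    abel
  | tmul b d =>
    induction w using TensorProduct.induction_on with
    | zero => simp
    | add x y hx hy =>
      simp only [map_add, TensorProduct.tmul_add, mul_add, hx, hy, Finset.sum_add_distrib]
      abel
    | tmul u c =>
      rw [PlaneCore.X_tmul, show S.coreB.v = S.e from rfl]
      simp [TensorProduct.add_tmul, TensorProduct.sum_tmul, ev_e_mul, mul_assoc]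

theorem crossL_lam (i j : Fin n) (z : B ⊗[k] B) (w : S.Double κ ⊗[k] D) :
    ∑ a, crossL S κ ((S.coreB.lam i a).rTensor B z ⊗ₜ ((inH S κ (S.Mm a j) ⊗ₜ 1) * w)) =
      inH S κ (S.Mm i j) * crossL S κ (z ⊗ₜ w) := by
  induction z using TensorProduct.induction_on with
  | zero => simp
  | add x y hx hy =>
    simp only [map_add, TensorProduct.add_tmul, mul_add, hx, hy, Finset.sum_add_distrib]
  | tmul b d =>
    induction w using TensorProduct.induction_on with
    | zero => simp
    | add x y hx hy =>
      simp only [map_add, TensorProduct.tmul_add, mul_add, hx, hy, Finset.sum_add_distrib]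
    | tmul u c =>
      simp only [LinearMap.rTensor_tmul, Algebra.TensorProduct.tmul_mul_tmul, one_mul,
        crossL_tmul, ← Finset.smul_sum, ← mul_assoc, mul_smul_comm]
      rw [← inB_lam_mul_Mm, Finset.sum_mul]

/-- Covariance of the skew derivation (`coact_dl`), with the coefficients in `A` sent to `U` by
`𝓡̄`. -/
theorem lTensor_dl_omegaC (i : Fin n) (c : D) : (S.coreD.dl κ i).lTensor _ (omegaC S κ c) =
    ∑ a, (inH S κ (S.Mm i a) ⊗ₜ 1) * omegaC S κ (S.coreD.dl κ a c) := by
  have h := congrArg (TensorProduct.map ((inH S κ).comp P.Rm).toLinearMap LinearMap.id)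
    (S.isCoaction_δ.coact_dl S.coreD κ i c)
  have h1 : ∀ z : A ⊗[k] D, (S.coreD.dl κ i).lTensor _
      (Algebra.TensorProduct.map ((inH S κ).comp P.Rm) (.id k D) z) =
      TensorProduct.map ((inH S κ).comp P.Rm).toLinearMap LinearMap.id
        ((S.coreD.dl κ i).lTensor A z) := by
    intro z
    induction z using TensorProduct.induction_on with
    | zero => simp
    | add x y hx hy => simp only [map_add, hx, hy]
    | tmul x y => simp
  have h2 : ∀ x (z : A ⊗[k] D), TensorProduct.map ((inH S κ).comp P.Rm).toLinearMap LinearMap.id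
      ((LinearMap.mulLeft k x).rTensor D z) = (inH S κ (P.Rm x) ⊗ₜ 1) *
        Algebra.TensorProduct.map ((inH S κ).comp P.Rm) (.id k D) z := by
    intro x z
    induction z using TensorProduct.induction_on with
    | zero => simp
    | add x y hx hy => simp only [map_add, mul_add, hx, hy]
    | tmul x y => simp
  rw [← h1, map_sum] at h
  simp only [h2] at h
  exact h

theorem lTensor_dl_gammaC (i : Fin n) (c : D) :
    (S.coreD.dl κ i).lTensor _ (gammaC S κ (S.coreD.comul c)) =
      ∑ a, (inH S κ (S.Mm i a) ⊗ₜ 1) * gammaC S κ (S.coreD.comul (S.coreD.dl κ a c)) := by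
  simp only [PlaneCore.comul_dl]
  have hr : ∀ (z : S.Double κ ⊗[k] D) (u : S.Double κ), (S.coreD.dl κ i).lTensor _ (z * (u ⊗ₜ 1)) =
      (S.coreD.dl κ i).lTensor _ z * (u ⊗ₜ 1) := by
    intro z u
    induction z using TensorProduct.induction_on with
    | zero => simp
    | add x y hx hy => simp only [map_add, add_mul, hx, hy]
    | tmul x y => simp
  generalize S.coreD.comul c = z
  induction z using TensorProduct.induction_on with
  | zero => simp
  | add x y hx hy => simp only [map_add, mul_add, hx, hy, Finset.sum_add_distrib]
  | tmul c d =>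
    simp only [gammaC_tmul, LinearMap.rTensor_tmul, hr, lTensor_dl_omegaC, Finset.sum_mul,
      mul_assoc]

/-- A recursion in the word `b` which, together with the value at `b = 1`, determines the left hand
side. The braided summand of the coproduct leaves factors `lam` and `m⁻`, and `crossL_lam` pulls
`m⁻` out to the front. -/
theorem crossLeft_e_mul (i : Fin n) (b : B) (c : D) :
    crossLeft (S.pairing κ) (inC S κ) (incH S κ) (inB S κ) ((S.e i * b) ⊗ₜ c) =
      e S κ i * crossLeft (S.pairing κ) (inC S κ) (incH S κ) (inB S κ) (b ⊗ₜ c) +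
        ∑ a, inH S κ (S.Mm i a) *
          crossLeft (S.pairing κ) (inC S κ) (incH S κ) (inB S κ) (b ⊗ₜ S.coreD.dl κ a c) := by
  have h : S.coreB.comul (S.e i * b) = S.coreB.X i (S.coreB.comul b) := S.coreB.comul_v_mul i b
  simp only [crossLeft_tmul, h, crossL_X, lTensor_dl_gammaC, TensorProduct.tmul_sum, map_sum]
  congr 1
  rw [Finset.sum_comm]
  simp only [crossL_lam]

theorem crossLeft_one (c : D) :
    crossLeft (S.pairing κ) (inC S κ) (incH S κ) (inB S κ) (1 ⊗ₜ c) = inC S κ c := by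
  have h1 : ∀ c, TensorProduct.rid k (S.Double κ) (S.coreD.counit.toLinearMap.lTensor _
      (omegaC S κ c)) = algebraMap k _ (S.coreD.counit c) := by
    have hmul : ∀ z w, TensorProduct.rid k (S.Double κ) (S.coreD.counit.toLinearMap.lTensor _
        (z * w)) = TensorProduct.rid k (S.Double κ) (S.coreD.counit.toLinearMap.lTensor _ z) *
          TensorProduct.rid k (S.Double κ) (S.coreD.counit.toLinearMap.lTensor _ w) :=
      map_mul ((Algebra.TensorProduct.rid k k (S.Double κ)).toAlgHom.comp
        (Algebra.TensorProduct.map (.id k (S.Double κ)) S.coreD.counit))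
    have hf : ∀ i, S.coreD.counit (S.f i) = 0 := S.coreD.counit_v
    intro c
    induction c using S.planeD.induction with
    | h1 => simp [Algebra.TensorProduct.one_def]
    | hadd x y hx hy => simp only [map_add, hx, hy]
    | hsmul r x hx => simp only [map_smul, hx]; simp [Algebra.smul_def]
    | hm i b hb =>
      rw [map_mul, hmul, hb, map_mul, hf]
      simp [omegaC_f, hf]
  have h2 : ∀ w, crossL S κ ((1 ⊗ₜ 1) ⊗ₜ w) =
      TensorProduct.rid k (S.Double κ) (S.coreD.counit.toLinearMap.lTensor _ w) := by
    intro w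
    induction w using TensorProduct.induction_on with
    | zero => simp
    | add x y hx hy => simp only [map_add, TensorProduct.tmul_add, hx, hy]
    | tmul u c =>
      rw [crossL_tmul, (S.pairing κ).ev_one_right]
      simp
      rfl
  have h3 : ∀ z, TensorProduct.rid k (S.Double κ) (S.coreD.counit.toLinearMap.lTensor _
      (gammaC S κ z)) =
        inC S κ (TensorProduct.lid k D (S.coreD.counit.toLinearMap.rTensor D z)) := by
    have hmul : ∀ z u, TensorProduct.rid k (S.Double κ) (S.coreD.counit.toLinearMap.lTensor _
        (z * (u ⊗ₜ 1))) = TensorProduct.rid k (S.Double κ)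
          (S.coreD.counit.toLinearMap.lTensor _ z) * u := by
      intro z u
      induction z using TensorProduct.induction_on with
      | zero => simp
      | add x y hx hy => simp only [map_add, add_mul, hx, hy]
      | tmul u c => simp
    intro z
    induction z using TensorProduct.induction_on with
    | zero => simp
    | add x y hx hy => simp only [map_add, hx, hy]
    | tmul u c =>
      rw [gammaC_tmul, hmul, h1]
      simp [Algebra.smul_def]
  rw [crossLeft_tmul, S.coreB.comul_one, h2, h3]
  exact congrArg (inC S κ) (LinearMap.congr_fun S.coreD.counit_comul c)

/-! ### The right hand side of the cross relations -/

/-- The map `b ⊗ u ↦ ⟨c, b⟩ u`. -/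
def evR : D →ₗ[k] B ⊗[k] S.Double κ →ₗ[k] S.Double κ where
  toFun c := TensorProduct.lift ((LinearMap.lsmul k (S.Double κ) : k →ₗ[k] _) ∘ₗ
    (S.pairing κ).ev c)
  map_add' c d := by ext b u; simp
  map_smul' r c := by ext b u; simp [mul_smul]

@[simp]
theorem evR_tmul (c : D) (b : B) (u : S.Double κ) :
    evR S κ c (b ⊗ₜ u) = (S.pairing κ).ev c b • u := rfl

theorem evR_mul_one_tmul (c : D) (z : B ⊗[k] S.Double κ) (u : S.Double κ) :
    evR S κ c (z * (1 ⊗ₜ u)) = evR S κ c z * u := by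
  induction z using TensorProduct.induction_on with
  | zero => simp
  | add x y hx hy => simp only [map_add, add_mul, hx, hy]
  | tmul b v => simp

theorem evR_one_tmul_mul (c : D) (z : B ⊗[k] S.Double κ) (u : S.Double κ) :
    evR S κ c ((1 ⊗ₜ u) * z) = u * evR S κ c z := by
  induction z using TensorProduct.induction_on with
  | zero => simp
  | add x y hx hy => simp only [map_add, mul_add, hx, hy]
  | tmul b v => simp

/-- The rule `mp_f` extended from letters to all of `B`: moving `f` to the left past `𝓡(b^(1))`
braids it with `b^(2)`. -/
theorem omegaB_mul_one_tmul_f (i : Fin n) (b : B) : omegaB S κ b * (1 ⊗ₜ f S κ i) =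
    ∑ a, (1 ⊗ₜ f S κ a) * (S.coreB.lam a i).rTensor _ (omegaB S κ b) := by
  have hmul : ∀ (i j : Fin n) (z w : B ⊗[k] S.Double κ), (S.coreB.lam i j).rTensor _ (z * w) =
      ∑ a, (S.coreB.lam i a).rTensor _ z * (S.coreB.lam a j).rTensor _ w := by
    intro i j z w
    induction z using TensorProduct.induction_on with
    | zero => simp
    | add x y hx hy => simp only [map_add, add_mul, hx, hy, Finset.sum_add_distrib]
    | tmul b u =>
      induction w using TensorProduct.induction_on with
      | zero => simp
      | add x y hx hy => simp only [map_add, mul_add, hx, hy, Finset.sum_add_distrib]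
      | tmul d v => simp [S.coreB.lam_mul_apply, TensorProduct.sum_tmul]
  induction b using S.planeB.induction generalizing i with
  | h1 => simp [Algebra.TensorProduct.one_def, S.coreB.lam_one, TensorProduct.ite_tmul]
  | hadd x y hx hy => simp only [map_add, add_mul, mul_add, hx, hy, Finset.sum_add_distrib]
  | hsmul r x hx => simp only [map_smul, smul_mul_assoc, mul_smul_comm, hx, Finset.smul_sum]
  | hm l b hb =>
    have h1 : ∀ i, omegaB S κ (S.e l) * (1 ⊗ₜ f S κ i) =
        ∑ a, (1 ⊗ₜ f S κ a) * (S.coreB.lam a i).rTensor _ (omegaB S κ (S.e l)) := by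
      intro i
      simp only [omegaB_e, Finset.sum_mul, Algebra.TensorProduct.tmul_mul_tmul, mul_one, one_mul,
        (cross S κ).mp_f, map_sum, LinearMap.rTensor_tmul, lam_B_e, TensorProduct.sum_tmul,
        TensorProduct.tmul_sum, Finset.mul_sum, TensorProduct.tmul_smul,
        ← TensorProduct.smul_tmul', mul_smul_comm]
      rw [Finset.sum_comm]
      refine (Finset.sum_congr rfl fun _ _ => Finset.sum_comm).trans ?_
      rw [Finset.sum_comm]
    rw [map_mul, mul_assoc, hb, Finset.mul_sum]
    simp only [← mul_assoc, h1, Finset.sum_mul, hmul, Finset.mul_sum]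
    exact Finset.sum_comm

theorem sum_evR_actD (i j : Fin n) (c : D) (z : B ⊗[k] S.Double κ) :
    ∑ a, evR S κ (S.actD (S.Mm a j) c) ((S.coreB.lam i a).rTensor _ z) =
      if i = j then evR S κ c z else 0 := by
  induction z using TensorProduct.induction_on with
  | zero => simp
  | add x y hx hy =>
    simp only [map_add, Finset.sum_add_distrib, hx, hy]
    split_ifs <;> simp
  | tmul b u =>
    simp only [LinearMap.rTensor_tmul, evR_tmul, ← Finset.sum_smul, sum_ev_actD_lam]
    split_ifs <;> simp

/-- The braiding created by moving `f` past `𝓡(b^(1))` is cancelled by the action of `m⁻` on the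
other argument of the pairing, through `sum_ev_actD_lam`. -/
theorem sum_evR_mul_f (i : Fin n) (c : D) (b : B) :
    ∑ a, evR S κ (S.actD (S.Mm a i) c) (omegaB S κ b) * f S κ a =
      f S κ i * evR S κ c (omegaB S κ b) := by
  simp only [← evR_mul_one_tmul, omegaB_mul_one_tmul_f, map_sum, evR_one_tmul_mul]
  rw [Finset.sum_comm]
  simp [← Finset.mul_sum, sum_evR_actD]

/-- The map `d ⊗ c ↦ ∑ ⟨d, b^(2)⟩ 𝓡(b^(1)) c u`. -/
def evOmega (b : B) (u : S.Double κ) : D ⊗[k] D →ₗ[k] S.Double κ :=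
  LinearMap.mul' k (S.Double κ) ∘ₗ TensorProduct.map
    (LinearMap.applyₗ (omegaB S κ b) ∘ₗ evR S κ) (LinearMap.mulRight k u ∘ₗ (inC S κ).toLinearMap)

@[simp]
theorem evOmega_tmul (b : B) (u : S.Double κ) (d c : D) : evOmega S κ b u (d ⊗ₜ c) =
    evR S κ d (omegaB S κ b) * (inC S κ c * u) := rfl

/-- As in `gammaC'_braidR`, the inverse braiding of `C̄` is absorbed by a commutation in `U`, here
of `c` with `𝓡(b^(1))`, one letter of `c` at a time. -/
theorem evOmega_braidR (b : B) (u : S.Double κ) (c d : D) :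
    evOmega S κ b u (braidR P P.Rm S.δ (c ⊗ₜ d)) =
      inC S κ c * (evR S κ d (omegaB S κ b) * u) := by
  rw [braidR_tmul]
  induction c using S.planeD.induction with
  | h1 => simp [Algebra.TensorProduct.one_def]
  | hadd x y hx hy => simp only [map_add, hx, hy, add_mul]
  | hsmul r x hx => simp only [map_smul, hx, smul_mul_assoc]
  | hm i c hc =>
    rw [map_mul S.δ', map_mul (inC S κ), mul_assoc, ← hc]
    generalize S.δ' c = z
    induction z using TensorProduct.induction_on with
    | zero => simp
    | add x y hx hy => simp only [map_add, mul_add, hx, hy]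
    | tmul x w =>
      simp only [S.δ'_apply, S.δ_f, map_sum, TensorProduct.comm_tmul, Finset.sum_mul,
        Algebra.TensorProduct.tmul_mul_tmul, TensorProduct.map_tmul, evOmega_tmul,
        LinearMap.comp_apply, LinearMap.applyₗ_apply_apply, AlgHom.toLinearMap_apply, map_mul,
        AlgHom.comp_apply, LinearMap.id_apply, Module.End.mul_apply, inC_f]
      rw [← mul_assoc (f S κ i), ← sum_evR_mul_f, Finset.sum_mul]
      exact Finset.sum_congr rfl fun a _ => by simp only [mul_assoc]; rfl

/-- The map `c ⊗ d ↦ (b ⊗ u ↦ ⟨d, b⟩ c u)`. -/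
def crossR : D ⊗[k] D →ₗ[k] B ⊗[k] S.Double κ →ₗ[k] S.Double κ :=
  TensorProduct.lift (LinearMap.mk₂ k
    (fun c d => LinearMap.mulLeft k (inC S κ c) ∘ₗ evR S κ d)
    (fun c c' d => by ext b u; simp [add_mul])
    (fun r c d => by ext b u; simp [smul_comm r])
    (fun c d d' => by ext b u; simp [mul_add])
    (fun r c d => by ext b u; simp))

@[simp]
theorem crossR_tmul (c d : D) (z : B ⊗[k] S.Double κ) :
    crossR S κ (c ⊗ₜ d) z = inC S κ c * evR S κ d z := rfl

/-- Rewrites the right hand side with the coproduct of `D` in place of that of `C̄`, which prepares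
it for induction on words. -/
theorem crossRight_tmul (b : B) (c : D) :
    crossRight (S.pairing κ) (inC S κ) (incH S κ) (inB S κ) (b ⊗ₜ c) =
      crossR S κ (S.coreD.comul c) (gammaB S κ (S.coreB.comul b)) := by
  let W : ((A ⊗[k] B) ⊗[k] B) ⊗[k] (D ⊗[k] D) →ₗ[k] S.Double κ := LinearMap.mul' k (S.Double κ) ∘ₗ
    TensorProduct.map
      ((TensorProduct.rid k (S.Double κ)).toLinearMap ∘ₗ
        TensorProduct.map ((incH S κ : H →ₐ[k] S.Double κ).comp P.Rp).toLinearMap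
          (TensorProduct.lift (S.pairing κ).ev.flip) ∘ₗ
        (TensorProduct.assoc k A B D).toLinearMap)
      (LinearMap.mul' k (S.Double κ) ∘ₗ TensorProduct.map (inC S κ).toLinearMap
        (inB S κ).toLinearMap ∘ₗ (TensorProduct.comm k B D).toLinearMap) ∘ₗ
    (TensorProduct.tensorTensorTensorComm k (A ⊗[k] B) B D D).toLinearMap
  have hW : ∀ (y : A ⊗[k] B) (b : B) (d c : D), W ((y ⊗ₜ b) ⊗ₜ (d ⊗ₜ c)) =
      evR S κ d (Algebra.TensorProduct.comm k (S.Double κ) B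
        (Algebra.TensorProduct.map ((inH S κ).comp P.Rp) (.id k B) y)) *
          (inC S κ c * inB S κ b) := by
    intro y b d c
    induction y using TensorProduct.induction_on with
    | zero => simp
    | add x y hx hy => simp only [map_add, add_mul, TensorProduct.add_tmul, hx, hy]
    | tmul x y => simp [W]
  have h1 : ∀ (b b' : B) (w : D ⊗[k] D), W ((S.β b ⊗ₜ b') ⊗ₜ w) = evOmega S κ b (inB S κ b') w := by
    intro b b' w
    induction w using TensorProduct.induction_on with
    | zero => simp
    | add x y hx hy => simp only [map_add, TensorProduct.tmul_add, hx, hy]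
    | tmul d c => exact hW _ _ _ _
  have h2 : ∀ (z : B ⊗[k] B) (w : D ⊗[k] D),
      W (S.β.toLinearMap.rTensor B z ⊗ₜ braidR P P.Rm S.δ w) = crossR S κ w (gammaB S κ z) := by
    intro z w
    induction z using TensorProduct.induction_on with
    | zero => simp
    | add x y hx hy => simp only [map_add, TensorProduct.add_tmul, hx, hy]
    | tmul b b' =>
      induction w using TensorProduct.induction_on with
      | zero => simp
      | add x y hx hy => simp only [map_add, TensorProduct.tmul_add, LinearMap.add_apply, hx, hy]
      | tmul c d =>
        rw [LinearMap.rTensor_tmul, AlgHom.toLinearMap_apply, h1, evOmega_braidR, crossR_tmul,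
          gammaB_tmul, evR_mul_one_tmul]
  exact h2 _ _

/-- Moving `e^i` to the front past `c` by `e_mul_inC` creates the terms with `m⁻` and further terms
with `m⁺`. The latter are collected in the last sum, which vanishes on a coproduct by `lTensor_dl`.
-/
theorem crossR_e_mul (i : Fin n) (w : D ⊗[k] D) (z : B ⊗[k] S.Double κ) :
    crossR S κ w ((omegaB S κ (S.e i) + 1 ⊗ₜ e S κ i) * z) = e S κ i * crossR S κ w z +
      ∑ a, inH S κ (S.Mm i a) * crossR S κ ((S.coreD.dl κ a).rTensor D w) z +
      ∑ a, crossR S κ ((S.coreD.dl κ a).lTensor D w - (S.coreD.dr κ a).rTensor D w)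
        ((1 ⊗ₜ inH S κ (S.Mp i a)) * z) := by
  induction w using TensorProduct.induction_on with
  | zero => simp
  | add x y hx hy =>
    simp only [map_add, LinearMap.add_apply, mul_add, hx, hy, Finset.sum_add_distrib, map_sub,
      LinearMap.sub_apply, Finset.sum_sub_distrib]
    abel
  | tmul c d =>
    induction z using TensorProduct.induction_on with
    | zero => simp
    | add x y hx hy =>
      simp only [map_add, mul_add, hx, hy, Finset.sum_add_distrib]
      abel
    | tmul b u =>
      have h := congrArg (· * u) (e_mul_inC S κ i c)
      simp only [add_mul, Finset.sum_mul, sub_mul, mul_assoc, Finset.sum_sub_distrib] at h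
      simp only [omegaB_e, add_mul, Finset.sum_mul, Algebra.TensorProduct.tmul_mul_tmul, one_mul,
        map_add, map_sum, map_sub, LinearMap.sub_apply, LinearMap.lTensor_tmul,
        LinearMap.rTensor_tmul, crossR_tmul, evR_tmul, ev_e_mul, mul_smul_comm, h, smul_add,
        smul_sub, Finset.smul_sum, Finset.sum_sub_distrib]
      abel

theorem crossRight_e_mul (i : Fin n) (b : B) (c : D) :
    crossRight (S.pairing κ) (inC S κ) (incH S κ) (inB S κ) ((S.e i * b) ⊗ₜ c) =
      e S κ i * crossRight (S.pairing κ) (inC S κ) (incH S κ) (inB S κ) (b ⊗ₜ c) +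
        ∑ a, inH S κ (S.Mm i a) *
          crossRight (S.pairing κ) (inC S κ) (incH S κ) (inB S κ) (b ⊗ₜ S.coreD.dl κ a c) := by
  have h : S.coreB.comul (S.e i * b) = S.coreB.X i (S.coreB.comul b) := S.coreB.comul_v_mul i b
  simp only [crossRight_tmul, h, gammaB_X, crossR_e_mul, PlaneCore.comul_dl,
    PlaneCore.lTensor_dl, sub_self, map_zero, LinearMap.zero_apply, Finset.sum_const_zero, add_zero]

theorem crossRight_one (c : D) :
    crossRight (S.pairing κ) (inC S κ) (incH S κ) (inB S κ) (1 ⊗ₜ c) = inC S κ c := by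
  have h1 : ∀ w : D ⊗[k] D, crossR S κ w (gammaB S κ (1 ⊗ₜ 1)) =
      inC S κ (TensorProduct.rid k D (S.coreD.counit.toLinearMap.lTensor D w)) := by
    intro w
    induction w using TensorProduct.induction_on with
    | zero => simp
    | add x y hx hy => simp only [map_add, LinearMap.add_apply, hx, hy]
    | tmul c d =>
      have h : (S.pairing κ).ev d 1 = S.coreD.counit d := (S.pairing κ).ev_one_right d
      simp [Algebra.TensorProduct.one_def, h]
  rw [crossRight_tmul, S.coreB.comul_one, h1]
  exact congrArg (inC S κ) (LinearMap.congr_fun S.coreD.comul_counit c)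

/-- Both sides agree at `b = 1` and satisfy the same recursion in the word `b`, for all `c` at once;
the recursion changes `c`, so `c` has to be general in the induction. -/
theorem crossLeft_eq_crossRight : crossLeft (S.pairing κ) (inC S κ) (incH S κ) (inB S κ) =
    crossRight (S.pairing κ) (inC S κ) (incH S κ) (inB S κ) := by
  refine TensorProduct.ext' fun b c => ?_
  induction b using S.planeB.induction generalizing c with
  | h1 => rw [crossLeft_one, crossRight_one]
  | hadd x y hx hy => simp only [TensorProduct.add_tmul, map_add, hx, hy]
  | hsmul r x hx => simp only [← TensorProduct.smul_tmul', map_smul, hx]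
  | hm i b hb => simp only [crossLeft_e_mul, crossRight_e_mul, hb]

theorem isDoubleBosonisation :
    IsDoubleBosonisation (S.pairing κ) (inC S κ) (incH S κ) (inB S κ) where
  triangular := triangularMap_bijective S κ
  smash_B := inB_mul_inH S κ
  smash_C := inH_mul_inC S κ
  comul_B b := by rw [bosonB_eq, comul_inB]
  counit_B := counit_inB S κ
  comul_C c := by rw [bosonC_eq, comul_inC]
  counit_C := counit_inC S κ
  cross := crossLeft_eq_crossRight S κ

end Double

end PlaneData

end

end DoubleBosonisation

/-! ### The antipode when `H` is a Hopf algebra. -/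

namespace DoubleBosonisation

noncomputable section

open scoped Shortcuts

variable {k : Type u} [Field k] {n : ℕ} {H A B D : Type u} [Ring H] [Ring A] [HopfAlgebra k H]
  [Bialgebra k A] [Ring B] [Algebra k B] [Ring D] [Algebra k D]

section Antihom

variable {C X : Type*} [Ring C] [Bialgebra k C] [Ring X] [Algebra k X] (G : C →ₗ[k] X)
  (F : C →ₐ[k] X)

/-- An antimultiplicative map which is a left convolution inverse of an algebra map on generators
is a left convolution inverse. -/
theorem antihom_conv_algHom (h1 : G 1 = 1) (hG : ∀ x y, G (x * y) = G y * G x) {s : Set C}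
    (hs : Algebra.adjoin k s = ⊤) (h : ∀ x ∈ s, LinearMap.mul' k X (TensorProduct.map G F.toLinearMap
      (Coalgebra.comul x)) = algebraMap k X (Coalgebra.counit x)) (x : C) :
    LinearMap.mul' k X (TensorProduct.map G F.toLinearMap (Coalgebra.comul x)) =
      algebraMap k X (Coalgebra.counit x) := by
  have hx : x ∈ Algebra.adjoin k s := by
    rw [hs]
    trivial
  induction hx using Algebra.adjoin_induction with
  | mem x hx => exact h x hx
  | algebraMap r => simp [Algebra.TensorProduct.one_def, h1, Algebra.algebraMap_eq_smul_one]
  | add x y _ _ hx hy => simp only [map_add, hx, hy]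
  | mul x y _ _ hx hy =>
    rw [Bialgebra.comul_mul, Bialgebra.counit_mul, map_mul (algebraMap k _), ← hy,
      ← Algebra.smul_def]
    have h1 : ∀ z w : C ⊗[k] C,
        LinearMap.mul' k _ (TensorProduct.map G F.toLinearMap z) =
          algebraMap k X (Coalgebra.counit x) →
        LinearMap.mul' k _ (TensorProduct.map G F.toLinearMap (z * w)) =
          Coalgebra.counit (R := k) x •
            LinearMap.mul' k _ (TensorProduct.map G F.toLinearMap w) := by
      intro z w hz
      induction w using TensorProduct.induction_on with
      | zero => simp
      | add x y hx hy => simp only [map_add, mul_add, smul_add, hx, hy]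
      | tmul p q =>
        -- Antimultiplicativity nests the products as `G(w₁) G(z₁) F(z₂) F(w₂)`, so the inner
        -- convolution collapses to a scalar.
        trans G p * LinearMap.mul' k _ (TensorProduct.map G F.toLinearMap z) * F q
        · clear hz
          induction z using TensorProduct.induction_on with
          | zero => simp
          | add x y hx hy => simp only [map_add, mul_add, add_mul, hx, hy]
          | tmul x y => simp [hG, mul_assoc]
        · rw [hz, ← Algebra.commutes, mul_assoc, ← Algebra.smul_def]
          simp
    exact h1 _ _ hx

/-- An antimultiplicative map which is a right convolution inverse of an algebra map on generators
is a right convolution inverse. -/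
theorem algHom_conv_antihom (h1 : G 1 = 1) (hG : ∀ x y, G (x * y) = G y * G x) {s : Set C}
    (hs : Algebra.adjoin k s = ⊤) (h : ∀ x ∈ s, LinearMap.mul' k X (TensorProduct.map F.toLinearMap G
      (Coalgebra.comul x)) = algebraMap k X (Coalgebra.counit x)) (x : C) :
    LinearMap.mul' k X (TensorProduct.map F.toLinearMap G (Coalgebra.comul x)) =
      algebraMap k X (Coalgebra.counit x) := by
  have hx : x ∈ Algebra.adjoin k s := by
    rw [hs]
    trivial
  induction hx using Algebra.adjoin_induction with
  | mem x hx => exact h x hx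
  | algebraMap r => simp [Algebra.TensorProduct.one_def, h1, Algebra.algebraMap_eq_smul_one]
  | add x y _ _ hx hy => simp only [map_add, hx, hy]
  | mul x y _ _ hx hy =>
    rw [Bialgebra.comul_mul, Bialgebra.counit_mul, map_mul (algebraMap k _), ← hx,
      ← Algebra.commutes, ← Algebra.smul_def]
    have h1 : ∀ z w : C ⊗[k] C,
        LinearMap.mul' k _ (TensorProduct.map F.toLinearMap G w) =
          algebraMap k X (Coalgebra.counit y) →
        LinearMap.mul' k _ (TensorProduct.map F.toLinearMap G (z * w)) =
          Coalgebra.counit (R := k) y •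
            LinearMap.mul' k _ (TensorProduct.map F.toLinearMap G z) := by
      intro z w hw
      induction z using TensorProduct.induction_on with
      | zero => simp
      | add x y hx hy => simp only [map_add, add_mul, smul_add, hx, hy]
      | tmul p q =>
        trans F p * LinearMap.mul' k _ (TensorProduct.map F.toLinearMap G w) * G q
        · clear hw
          induction w using TensorProduct.induction_on with
          | zero => simp
          | add x y hx hy => simp only [map_add, mul_add, add_mul, hx, hy]
          | tmul x y => simp [hG, mul_assoc]
        · rw [hw, ← Algebra.commutes, mul_assoc, ← Algebra.smul_def]
          simp
    exact h1 _ _ hy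

end Antihom

namespace PlaneData

variable {P : WeakQTPair k H A} {R R' : Mat2 k n} (S : PlaneData P R R' B D)

theorem antipode_mul_nR (i j : Fin n) (h : H) : LinearMap.mul' k H
    ((HopfAlgebra.antipode k).rTensor H ((S.nR i j).lTensor H (Coalgebra.comul h))) =
      algebraMap k H (P.pair h (S.T i j)) := by
  rw [← S.comul_nR, HopfAlgebra.mul_antipode_rTensor_comul_apply, S.counit_nR]

theorem nL_mul_antipode (i j : Fin n) (h : H) : LinearMap.mul' k H
    ((HopfAlgebra.antipode k).lTensor H ((S.nL i j).rTensor H (Coalgebra.comul h))) =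
      algebraMap k H (P.pair h (S.T i j)) := by
  rw [← S.comul_nL, HopfAlgebra.mul_antipode_lTensor_comul_apply, S.counit_nL]

/-- The coproduct of `m⁺` is the flipped matrix coproduct, so the row index varies under the
antipode and the column index outside it. The next three lemmas have the same shape. -/
theorem antipode_Mp_mul (i j : Fin n) :
    ∑ a, HopfAlgebra.antipode k (S.Mp a j) * S.Mp i a = if i = j then 1 else 0 := by
  have := HopfAlgebra.mul_antipode_rTensor_comul_apply (R := k) (S.Mp i j)
  rw [S.comul_Mp, S.counit_Mp] at this
  simpa [apply_ite (algebraMap k H)] using this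

theorem Mp_mul_antipode (i j : Fin n) :
    ∑ a, S.Mp a j * HopfAlgebra.antipode k (S.Mp i a) = if i = j then 1 else 0 := by
  have := HopfAlgebra.mul_antipode_lTensor_comul_apply (R := k) (S.Mp i j)
  rw [S.comul_Mp, S.counit_Mp] at this
  simpa [apply_ite (algebraMap k H)] using this

theorem antipode_Mm_mul (i j : Fin n) :
    ∑ a, HopfAlgebra.antipode k (S.Mm a j) * S.Mm i a = if i = j then 1 else 0 := by
  have := HopfAlgebra.mul_antipode_rTensor_comul_apply (R := k) (S.Mm i j)
  rw [S.comul_Mm, S.counit_Mm] at this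
  simpa [apply_ite (algebraMap k H)] using this

theorem Mm_mul_antipode (i j : Fin n) :
    ∑ a, S.Mm a j * HopfAlgebra.antipode k (S.Mm i a) = if i = j then 1 else 0 := by
  have := HopfAlgebra.mul_antipode_lTensor_comul_apply (R := k) (S.Mm i j)
  rw [S.comul_Mm, S.counit_Mm] at this
  simpa [apply_ite (algebraMap k H)] using this

namespace Double

variable (κ : k)

/-- The antipode of `H`, with values in the double bosonisation. -/
def sigma : H →ₗ[k] S.Double κ := (inH S κ).toLinearMap ∘ₗ HopfAlgebra.antipode k

theorem sigma_mul (h g : H) : sigma S κ (h * g) = sigma S κ g * sigma S κ h := by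
  simp [sigma, HopfAlgebra.antipode_mul_antidistrib]

theorem sigma_one : sigma S κ 1 = 1 := by simp [sigma]

open WithConv in
theorem inH_conv_sigma : toConv (inH S κ).toLinearMap * toConv (sigma S κ) = 1 := by
  have h := LinearMap.algHom_comp_convMul_distrib (inH S κ) (toConv (LinearMap.id (R := k) (M := H)))
    (toConv (HopfAlgebra.antipode k))
  rw [LinearMap.id_mul_antipode] at h
  refine ofConv_injective (h.symm.trans ?_)
  ext x
  simp

open WithConv in
theorem sigma_conv_inH : toConv (sigma S κ) * toConv (inH S κ).toLinearMap = 1 := by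
  have h := LinearMap.algHom_comp_convMul_distrib (inH S κ) (toConv (HopfAlgebra.antipode k))
    (toConv (LinearMap.id (R := k) (M := H)))
  rw [LinearMap.antipode_mul_id] at h
  refine ofConv_injective (h.symm.trans ?_)
  ext x
  simp

open WithConv in
-- Convolution with `inH` on the right gives `∑ S(h₁) e_a h₂ = ∑ ⟨h, t^a_b⟩ e_b`, by the cross
-- relation and the antipode axiom. Convolving this with the antipode then isolates `S(h) e_a`.
theorem sigma_mul_e (h : H) (a : Fin n) :
    sigma S κ h * e S κ a = ∑ b, e S κ b * sigma S κ (S.nL a b h) := by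
  have e1 : toConv (LinearMap.mulRight k (e S κ a) ∘ₗ sigma S κ) * toConv (inH S κ).toLinearMap =
      toConv (∑ b, (P.pair.flip (S.T a b)).smulRight (e S κ b)) := by
    refine ofConv_injective (LinearMap.ext fun h => ?_)
    have h1 : ∀ z : H ⊗[k] H, LinearMap.mul' k _ (TensorProduct.map
        (LinearMap.mulRight k (e S κ a) ∘ₗ sigma S κ) (inH S κ).toLinearMap z) =
        ∑ b, inH S κ (LinearMap.mul' k H ((HopfAlgebra.antipode k).rTensor H
          ((S.nR a b).lTensor H z))) * e S κ b := by
      intro z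
      induction z using TensorProduct.induction_on with
      | zero => simp
      | add x y hx hy => simp only [map_add, add_mul, hx, hy, Finset.sum_add_distrib]
      | tmul x y => simp [mul_assoc, (cross S κ).eh, sigma, Finset.mul_sum]
    refine (h1 _).trans ?_
    simp [S.antipode_mul_nR, Algebra.smul_def]
  have e2 := congrArg (· * toConv (sigma S κ)) e1
  simp only [mul_assoc, inH_conv_sigma, mul_one] at e2
  refine (LinearMap.congr_fun (congrArg ofConv e2) h).trans ?_
  simp only [LinearMap.convMul_apply, nL, LinearMap.comp_apply]
  generalize Coalgebra.comul (R := k) h = z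
  induction z using TensorProduct.induction_on with
  | zero => simp
  | add x y hx hy => simp only [map_add, mul_add, hx, hy, Finset.sum_add_distrib]
  | tmul x y => simp [Finset.sum_mul]

open WithConv in
-- Mirror image of `sigma_mul_e`: convolve with `inH` on the left, then remove it with the antipode.
theorem f_mul_sigma (h : H) (i : Fin n) :
    f S κ i * sigma S κ h = ∑ a, sigma S κ (S.nR a i h) * f S κ a := by
  have e1 : toConv (inH S κ).toLinearMap * toConv (LinearMap.mulLeft k (f S κ i) ∘ₗ sigma S κ) =
      toConv (∑ a, (P.pair.flip (S.T a i)).smulRight (f S κ a)) := by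
    refine ofConv_injective (LinearMap.ext fun h => ?_)
    have h1 : ∀ z : H ⊗[k] H, LinearMap.mul' k _ (TensorProduct.map (inH S κ).toLinearMap
        (LinearMap.mulLeft k (f S κ i) ∘ₗ sigma S κ) z) =
        ∑ a, f S κ a * inH S κ (LinearMap.mul' k H ((HopfAlgebra.antipode k).lTensor H
          ((S.nL a i).rTensor H z))) := by
      intro z
      induction z using TensorProduct.induction_on with
      | zero => simp
      | add x y hx hy => simp only [map_add, mul_add, hx, hy, Finset.sum_add_distrib]
      | tmul x y => simp [← mul_assoc, (cross S κ).hf, sigma, Finset.sum_mul]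
    refine (h1 _).trans ?_
    simp [S.nL_mul_antipode, Algebra.smul_def, Algebra.commutes]
  have e2 := congrArg (toConv (sigma S κ) * ·) e1
  simp only [← mul_assoc, sigma_conv_inH, one_mul] at e2
  refine (LinearMap.congr_fun (congrArg ofConv e2) h).trans ?_
  simp only [LinearMap.convMul_apply, nR, LinearMap.comp_apply]
  generalize Coalgebra.comul (R := k) h = z
  induction z using TensorProduct.induction_on with
  | zero => simp
  | add x y hx hy => simp only [map_add, add_mul, hx, hy, Finset.sum_add_distrib]
  | tmul x y => simp [Finset.mul_sum]

/-- The antipode of `e^i`, up to sign. -/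
def antiE (i : Fin n) : S.Double κ := ∑ l, e S κ l * sigma S κ (S.Mp i l)

/-- The antipode of `f_i`, up to sign. -/
def antiF (i : Fin n) : S.Double κ := ∑ a, sigma S κ (S.Mm a i) * f S κ a

/-- After `S(h)` has been moved past `e`, the antipodes combine into the antipode of a product, on
which `nR_Rp` acts. -/
theorem sigma_mul_antiE (h : H) (i : Fin n) :
    sigma S κ h * antiE S κ i = ∑ a, antiE S κ a * sigma S κ (S.nR i a h) := by
  simp only [antiE, Finset.mul_sum, ← mul_assoc, sigma_mul_e, Finset.sum_mul]
  simp only [mul_assoc, ← sigma_mul]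
  rw [Finset.sum_comm]
  conv_rhs => rw [Finset.sum_comm]
  refine Finset.sum_congr rfl fun m _ => ?_
  simp only [← Finset.mul_sum, ← map_sum]
  exact congrArg (e S κ m * sigma S κ ·) (S.nR_Rp h i m).symm

theorem antiF_mul_sigma (h : H) (i : Fin n) :
    antiF S κ i * sigma S κ h = ∑ a, sigma S κ (S.nL a i h) * antiF S κ a := by
  simp only [antiF, Finset.sum_mul, mul_assoc, f_mul_sigma, Finset.mul_sum]
  simp only [← mul_assoc, ← sigma_mul]
  rw [Finset.sum_comm]
  conv_rhs => rw [Finset.sum_comm]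
  refine Finset.sum_congr rfl fun m _ => ?_
  simp only [← Finset.sum_mul, ← map_sum]
  exact congrArg (sigma S κ · * f S κ m) (S.nR_Rm h m i)

/-- The products in reversed order form `P R` times a vector that is linear in `e^i e^j`, hence
fixed by `P R'`. As `P R` commutes with `P R'`, the result is fixed too. -/
theorem antiE_rel (x : Fin n × Fin n) : antiE S κ x.2 * antiE S κ x.1 =
    act (permMul R') (fun y => antiE S κ y.2 * antiE S κ y.1) x := by
  let ω : A ⊗[k] B →ₗ[k] S.Double κ := LinearMap.mul' k _ ∘ₗ
    TensorProduct.map (inB S κ).toLinearMap (sigma S κ ∘ₗ P.Rp.toLinearMap) ∘ₗ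
      (TensorProduct.comm k A B).toLinearMap
  have hy : (fun x : Fin n × Fin n => ω (S.β (S.e x.1 * S.e x.2))) =
      act (permMul R') fun x => ω (S.β (S.e x.1 * S.e x.2)) := by
    funext x
    conv_lhs => rw [S.planeB.rel]
    simp [act]
  have hw : (fun x : Fin n × Fin n => antiE S κ x.2 * antiE S κ x.1) =
      act (permMul R) fun x => ω (S.β (S.e x.1 * S.e x.2)) := by
    funext ⟨a, b⟩
    have h1 : ∀ c d, ω (S.β (S.e c * S.e d)) = ∑ p, ∑ m, e S κ p * e S κ m *
        sigma S κ (S.Mp c p * S.Mp d m) := by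
      intro c d
      simp [ω, S.β_e, Finset.sum_mul_sum, Mp]
    simp only [act, Fintype.sum_prod_type, h1, permMul]
    simp only [antiE, Finset.sum_mul_sum]
    simp only [mul_assoc]
    simp only [← mul_assoc (sigma S κ _) (e S κ _), sigma_mul_e, Finset.sum_mul, Finset.mul_sum]
    simp only [mul_assoc, ← sigma_mul]
    have h2 : ∀ p m, ∑ l, S.Mp a l * S.nL l m (S.Mp b p) =
        ∑ c, ∑ d, R (b, a) (c, d) • (S.Mp c p * S.Mp d m) := by
      intro p m
      refine (S.nR_Rp (S.Mp b p) a m).symm.trans ?_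
      simp only [S.nR_Mp, Finset.sum_mul, smul_mul_assoc]
      exact Finset.sum_comm
    calc _ = ∑ p, ∑ m, e S κ p * (e S κ m * sigma S κ (∑ l, S.Mp a l * S.nL l m (S.Mp b p))) := by
          simp only [map_sum, Finset.mul_sum]
          exact Finset.sum_congr rfl fun _ _ => Finset.sum_comm
      _ = _ := by
          simp only [h2, map_sum, map_smul, Finset.mul_sum, Finset.smul_sum, mul_smul_comm]
          exact sum_swap_pairs fun c d p m =>
            R (b, a) (c, d) • (e S κ p * (e S κ m * sigma S κ (S.Mp c p * S.Mp d m)))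
  have h3 : (fun x : Fin n × Fin n => antiE S κ x.2 * antiE S κ x.1) =
      act (permMul R') (fun x => antiE S κ x.2 * antiE S κ x.1) := by
    rw [hw, ← act_mul, ← S.comm, act_mul, ← hy]
  exact congrFun h3 x

/-- The inverse of `P R`. -/
def permBar (S : PlaneData P R R' B D) : Mat2 k n := fun x y => S.Rbar x y.swap

theorem permMul_mul_permBar : permMul R * permBar S = 1 := by
  ext ⟨a, b⟩ ⟨c, d⟩
  have h := congrFun (congrFun S.mul_Rbar (b, a)) (d, c)
  simp only [Matrix.mul_apply, permMul, permBar, Prod.swap_prod_mk, Matrix.one_apply,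
    Prod.mk.injEq] at h ⊢
  rw [h]
  simp only [and_comm]

include S in
-- The inverse of a matrix commuting with `P R'` commutes with it; for `f` the inverse of `P R`
-- occurs where `e` has `P R`.
theorem permBar_comm : permBar S * permMul R' = permMul R' * permBar S := by
  have h1 := permMul_mul_permBar S
  have h2 := mul_eq_one_comm.mp h1
  calc _ = permBar S * permMul R' * (permMul R * permBar S) := by rw [h1, mul_one]
    _ = permBar S * (permMul R' * permMul R) * permBar S := by simp only [mul_assoc]
    _ = permBar S * permMul R * permMul R' * permBar S := by rw [← S.comm]; simp only [mul_assoc]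
    _ = _ := by rw [h2, one_mul]

/-- The argument of `antiE_rel` with all matrices transposed and with `(P R)⁻¹`, because `𝓡̄` pairs
with the inverse of `R`. -/
theorem antiF_rel (x : Fin n × Fin n) : antiF S κ x.2 * antiF S κ x.1 =
    act (permMul R').transpose (fun y => antiF S κ y.2 * antiF S κ y.1) x := by
  let ω : D ⊗[k] A →ₗ[k] S.Double κ := LinearMap.mul' k _ ∘ₗ
    TensorProduct.map (sigma S κ ∘ₗ P.Rm.toLinearMap) (inC S κ).toLinearMap ∘ₗ
      (TensorProduct.comm k D A).toLinearMap
  have hy : (fun x : Fin n × Fin n => ω (S.δ (S.f x.1 * S.f x.2))) =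
      act (permMul R').transpose fun x => ω (S.δ (S.f x.1 * S.f x.2)) := by
    funext x
    conv_lhs => rw [S.planeD.rel]
    simp [act]
  have hw : (fun x : Fin n × Fin n => antiF S κ x.2 * antiF S κ x.1) =
      act (permBar S).transpose fun x => ω (S.δ (S.f x.1 * S.f x.2)) := by
    funext ⟨a, b⟩
    have h1 : ∀ c d, ω (S.δ (S.f c * S.f d)) = ∑ p, ∑ m, sigma S κ (S.Mm p c * S.Mm m d) *
        (f S κ p * f S κ m) := by
      intro c d
      simp [ω, S.δ_f, Finset.sum_mul_sum, Mm]
    simp only [act, Fintype.sum_prod_type, h1, permBar, Matrix.transpose_apply, Prod.swap_prod_mk]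
    simp only [antiF, Finset.sum_mul_sum]
    simp only [mul_assoc]
    simp only [← mul_assoc (f S κ _) (sigma S κ _), f_mul_sigma, Finset.sum_mul, Finset.mul_sum]
    simp only [← mul_assoc, ← sigma_mul]
    have h2 : ∀ r q, ∑ p, S.nR r p (S.Mm q a) * S.Mm p b =
        ∑ c, ∑ d, S.Rbar (c, d) (b, a) • (S.Mm r c * S.Mm q d) := by
      intro r q
      refine (S.nR_Rm (S.Mm q a) r b).trans ?_
      simp only [S.nL_Mm, Finset.mul_sum, mul_smul_comm]
      rfl
    calc _ = ∑ r, ∑ q, sigma S κ (∑ p, S.nR r p (S.Mm q a) * S.Mm p b) * f S κ r * f S κ q := by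
          simp only [map_sum, Finset.sum_mul]
          rw [Finset.sum_comm]
          conv_rhs => rw [Finset.sum_comm]
          exact Finset.sum_congr rfl fun _ _ => Finset.sum_comm
      _ = _ := by
          simp only [h2, map_sum, map_smul, Finset.sum_mul, Finset.smul_sum, smul_mul_assoc]
          exact sum_swap_pairs fun c d r q =>
            S.Rbar (c, d) (b, a) • (sigma S κ (S.Mm r c * S.Mm q d) * f S κ r * f S κ q)
  have h3 : (fun x : Fin n × Fin n => antiF S κ x.2 * antiF S κ x.1) =
      act (permMul R').transpose (fun x => antiF S κ x.2 * antiF S κ x.1) := by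
    rw [hw, ← act_mul, ← Matrix.transpose_mul, permBar_comm, Matrix.transpose_mul, act_mul, ← hy]
  exact congrFun h3 x

theorem antiF_mul_antiE (i j : Fin n) : antiF S κ j * antiE S κ i =
    antiE S κ i * antiF S κ j + κ⁻¹ • (sigma S κ (S.Mp i j) - sigma S κ (S.Mm i j)) := by
  -- The derivative of `m⁺` produces a factor `R` and that of `m⁻` a factor `R⁻¹`; after `nR_Rm` has
  -- reordered the two matrices, these factors cancel.
  have h1 : ∀ m b, ∑ a, ∑ l, S.nR b a (S.Mp i l) * S.nL l m (S.Mm a j) = S.Mm b j * S.Mp i m := by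
    intro m b
    have h2 : ∀ l s, ∑ a, S.nR b a (S.Mp i l) * S.Mm a s =
        ∑ a, ∑ c, R (c, a) (l, s) • (S.Mm b a * S.Mp i c) := by
      intro l s
      refine (S.nR_Rm (S.Mp i l) b s).trans ?_
      simp only [S.nL_Mp, Finset.mul_sum, mul_smul_comm]
      rfl
    have h3 : ∀ c a, ∑ l, ∑ s, R (c, a) (l, s) * S.Rbar (l, s) (m, j) =
        if c = m ∧ a = j then 1 else 0 := by
      intro c a
      have := congrFun (congrFun S.mul_Rbar (c, a)) (m, j)
      simpa only [Matrix.mul_apply, Matrix.one_apply, Prod.mk.injEq, Fintype.sum_prod_type]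
        using this
    calc _ = ∑ l, ∑ s, S.Rbar (l, s) (m, j) • ∑ a, S.nR b a (S.Mp i l) * S.Mm a s := by
          simp only [S.nL_Mm, Finset.mul_sum, mul_smul_comm, Finset.smul_sum]
          rw [Finset.sum_comm]
          exact Finset.sum_congr rfl fun _ _ => Finset.sum_comm
      _ = ∑ a, ∑ c, (∑ l, ∑ s, R (c, a) (l, s) * S.Rbar (l, s) (m, j)) • (S.Mm b a * S.Mp i c) := by
          simp only [h2, Finset.smul_sum, smul_smul, Finset.sum_smul, mul_comm (R _ _)]
          exact sum_swap_pairs fun a c l s =>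
            (S.Rbar (l, s) (m, j) * R (c, a) (l, s)) • (S.Mm b a * S.Mp i c)
      _ = _ := by
          simp only [h3, ite_smul, one_smul, zero_smul, ite_and, Finset.sum_ite_eq',
            Finset.mem_univ, if_true]
  have h4 : ∑ a, ∑ l, sigma S κ (S.Mm a j) * (e S κ l * f S κ a) * sigma S κ (S.Mp i l) =
      antiE S κ i * antiF S κ j := by
    simp only [← mul_assoc, sigma_mul_e, Finset.sum_mul]
    simp only [mul_assoc, f_mul_sigma, Finset.mul_sum]
    calc _ = ∑ m, ∑ b, e S κ m * (sigma S κ (∑ a, ∑ l, S.nR b a (S.Mp i l) *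
          S.nL l m (S.Mm a j)) * f S κ b) := by
          simp only [map_sum, Finset.sum_mul, Finset.mul_sum, sigma_mul, mul_assoc]
          exact (sum_swap_pairs fun m b a l => e S κ m * (sigma S κ (S.nL l m (S.Mm a j)) *
            (sigma S κ (S.nR b a (S.Mp i l)) * f S κ b)))
      _ = _ := by
          simp only [h1, antiE, antiF, Finset.sum_mul_sum, sigma_mul, mul_assoc]
  -- In the commutator terms one of the two antipodes meets the matrix it inverts. For `m⁺` the
  -- right hand one collapses here, and for `m⁻` the left hand one in `h7`. The roles of `m⁺` and
  -- `m⁻` are thereby exchanged, which is the sign change required.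
  have h5 : ∑ a, ∑ l, sigma S κ (S.Mm a j) * inH S κ (S.Mp l a) * sigma S κ (S.Mp i l) =
      sigma S κ (S.Mm i j) := by
    have h6 : ∀ a, ∑ l, inH S κ (S.Mp l a) * sigma S κ (S.Mp i l) = if i = a then 1 else 0 := by
      intro a
      have := congrArg (inH S κ) (S.Mp_mul_antipode i a)
      simpa [sigma, apply_ite (inH S κ)] using this
    simp [mul_assoc, ← Finset.mul_sum, h6]
  have h7 : ∑ a, ∑ l, sigma S κ (S.Mm a j) * inH S κ (S.Mm l a) * sigma S κ (S.Mp i l) =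
      sigma S κ (S.Mp i j) := by
    have h6 : ∀ l, ∑ a, sigma S κ (S.Mm a j) * inH S κ (S.Mm l a) = if l = j then 1 else 0 := by
      intro l
      have := congrArg (inH S κ) (S.antipode_Mm_mul l j)
      simpa [sigma, apply_ite (inH S κ)] using this
    rw [Finset.sum_comm]
    simp [← Finset.sum_mul, h6]
  have h8 : ∀ l a, f S κ a * e S κ l = e S κ l * f S κ a -
      κ⁻¹ • (inH S κ (S.Mp l a) - inH S κ (S.Mm l a)) := by
    intro l a
    rw [(cross S κ).ef, add_sub_cancel_right]
  calc _ = ∑ a, ∑ l, sigma S κ (S.Mm a j) * (f S κ a * e S κ l) * sigma S κ (S.Mp i l) := by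
        simp only [antiE, antiF, Finset.sum_mul_sum, mul_assoc]
    _ = antiE S κ i * antiF S κ j - κ⁻¹ • (sigma S κ (S.Mm i j) - sigma S κ (S.Mp i j)) := by
        simp only [h8, mul_sub, sub_mul, Finset.sum_sub_distrib, h4, mul_smul_comm,
          smul_mul_assoc, ← Finset.smul_sum, smul_sub, h5, h7]
    _ = _ := by rw [sub_eq_add_neg, ← smul_neg, neg_sub]

/-- The antipode of `H`, as an algebra map to the opposite algebra. -/
def sigmaHom : H →ₐ[k] (S.Double κ)ᵐᵒᵖ :=
  AlgHom.ofLinearMap ((MulOpposite.opLinearEquiv k).toLinearMap ∘ₗ sigma S κ)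
    (by simp [sigma_one]) (fun h g => by simp [sigma_mul])

theorem sigmaHom_apply (h : H) : sigmaHom S κ h = MulOpposite.op (sigma S κ h) := rfl

open MulOpposite in
theorem cross_op : S.Cross κ (fun i => op (-antiE S κ i)) (fun i => op (-antiF S κ i))
    (sigmaHom S κ) where
  ee x := by
    have := congrArg op (antiE_rel S κ x)
    simpa [act, ← op_mul] using this
  ff x := by
    have := congrArg op (antiF_rel S κ x)
    simpa [act, ← op_mul] using this
  eh i h := by
    have := congrArg (fun x => -op x) (sigma_mul_antiE S κ h i)
    simpa [sigmaHom_apply, ← op_mul] using this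
  hf h i := by
    have := congrArg (fun x => -op x) (antiF_mul_sigma S κ h i)
    simpa [sigmaHom_apply, ← op_mul] using this
  ef i j := by
    have := congrArg op (antiF_mul_antiE S κ i j)
    simpa [sigmaHom_apply, ← op_mul] using this

/-- The antipode of the double bosonisation. -/
def anti : S.Double κ →ₗ[k] S.Double κ :=
  (MulOpposite.opLinearEquiv k).symm.toLinearMap ∘ₗ (lift (cross_op S κ)).toLinearMap

theorem anti_mul (x y : S.Double κ) : anti S κ (x * y) = anti S κ y * anti S κ x := by
  simp [anti]

theorem anti_one : anti S κ 1 = 1 := by simp [anti]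

theorem anti_e (i : Fin n) : anti S κ (e S κ i) = -antiE S κ i := by simp [anti]

theorem anti_f (i : Fin n) : anti S κ (f S κ i) = -antiF S κ i := by simp [anti]

theorem anti_inH (h : H) : anti S κ (inH S κ h) = inH S κ (HopfAlgebra.antipode k h) := by
  simp [anti, sigmaHom, sigma]

/-- Enough to check on generators by `antihom_conv_algHom`. For `f_i` the identity is the definition
of `antiF`, and for `e^i` it is the inversion of `m⁺` by the antipode of `H`. -/
theorem anti_rTensor (x : S.Double κ) : LinearMap.mul' k _
    ((anti S κ).rTensor _ (Coalgebra.comul x)) = algebraMap k _ (Coalgebra.counit x) := by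
  refine antihom_conv_algHom (anti S κ) (.id k _) (anti_one S κ) (anti_mul S κ) adjoin_eq_top ?_ x
  rintro x ((⟨i, rfl⟩ | ⟨i, rfl⟩) | ⟨h, rfl⟩)
  · simp only [comul_e, counit_e, map_add, map_sum, TensorProduct.map_tmul,
      LinearMap.mul'_apply, anti_e, anti_one, antiE, map_zero, neg_mul, Finset.sum_neg_distrib,
      one_mul, Finset.sum_mul, mul_assoc, AlgHom.toLinearMap_apply, AlgHom.id_apply]
    rw [Finset.sum_comm]
    simp only [← Finset.mul_sum]
    have h6 : ∀ l, ∑ a, sigma S κ (S.Mp a l) * inH S κ (S.Mp i a) = if i = l then 1 else 0 := by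
      intro l
      have := congrArg (inH S κ) (S.antipode_Mp_mul i l)
      simpa [sigma, apply_ite (inH S κ)] using this
    simp [h6]
  · simp only [comul_f, counit_f, map_add, map_sum, TensorProduct.map_tmul,
      LinearMap.mul'_apply, anti_f, anti_inH, mul_one, map_zero, AlgHom.toLinearMap_apply,
      AlgHom.id_apply]
    exact neg_add_cancel _
  · simp only [comul_inH, counit_inH]
    rw [← AlgHom.commutes (inH S κ), ← HopfAlgebra.mul_antipode_rTensor_comul_apply]
    generalize Coalgebra.comul (R := k) h = z
    induction z using TensorProduct.induction_on with
    | zero => simp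
    | add x y hx hy => simp only [map_add, hx, hy]
    | tmul x y => simp [anti_inH]

theorem anti_lTensor (x : S.Double κ) : LinearMap.mul' k _
    ((anti S κ).lTensor _ (Coalgebra.comul x)) = algebraMap k _ (Coalgebra.counit x) := by
  refine algHom_conv_antihom (anti S κ) (.id k _) (anti_one S κ) (anti_mul S κ) adjoin_eq_top ?_ x
  rintro x ((⟨i, rfl⟩ | ⟨i, rfl⟩) | ⟨h, rfl⟩)
  · simp only [comul_e, counit_e, map_add, map_sum, TensorProduct.map_tmul,
      LinearMap.mul'_apply, anti_e, anti_inH, one_mul, map_zero, AlgHom.toLinearMap_apply,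
      AlgHom.id_apply]
    exact add_neg_cancel _
  · simp only [comul_f, counit_f, map_add, map_sum, TensorProduct.map_tmul,
      LinearMap.mul'_apply, anti_f, anti_one, antiF, map_zero, mul_neg, Finset.sum_neg_distrib,
      mul_one, Finset.mul_sum, ← mul_assoc, AlgHom.toLinearMap_apply, AlgHom.id_apply]
    rw [Finset.sum_comm]
    simp only [← Finset.sum_mul]
    have h6 : ∀ l, ∑ a, inH S κ (S.Mm a i) * sigma S κ (S.Mm l a) = if l = i then 1 else 0 := by
      intro l
      have := congrArg (inH S κ) (S.Mm_mul_antipode l i)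
      simpa [sigma, apply_ite (inH S κ)] using this
    simp [h6]
  · simp only [comul_inH, counit_inH]
    rw [← AlgHom.commutes (inH S κ), ← HopfAlgebra.mul_antipode_lTensor_comul_apply]
    generalize Coalgebra.comul (R := k) h = z
    induction z using TensorProduct.induction_on with
    | zero => simp
    | add x y hx hy => simp only [map_add, hx, hy]
    | tmul x y => simp [anti_inH]

instance : HopfAlgebra k (S.Double κ) :=
  { (inferInstance : Bialgebra k (S.Double κ)) with
    antipode := anti S κ
    mul_antipode_rTensor_comul := LinearMap.ext (anti_rTensor S κ)
    mul_antipode_lTensor_comul := LinearMap.ext (anti_lTensor S κ) }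

end Double

end PlaneData

end

end DoubleBosonisation

/-! ### Forms of the Yang-Baxter equation on three tensor legs. -/

namespace DoubleBosonisation

noncomputable section

open scoped Shortcuts

section Legs

variable {k : Type u} [Field k] {n : ℕ}

theorem leg12_mul (X Y : Mat2 k n) : leg12 (X * Y) = leg12 X * leg12 Y := by
  ext ⟨a, b, c⟩ ⟨d, e, f⟩
  simp [leg12, Matrix.mul_apply, Fintype.sum_prod_type, ite_mul, mul_ite]

theorem leg13_mul (X Y : Mat2 k n) : leg13 (X * Y) = leg13 X * leg13 Y := by
  ext ⟨a, b, c⟩ ⟨d, e, f⟩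
  simp only [leg13, Matrix.mul_apply, Fintype.sum_prod_type, Finset.sum_mul]
  refine Finset.sum_congr rfl fun x _ => ?_
  rw [Finset.sum_comm]
  refine Finset.sum_congr rfl fun y _ => ?_
  rw [Finset.sum_eq_single b (fun _ _ h => by simp [h.symm]) (by simp)]
  simp

theorem leg23_mul (X Y : Mat2 k n) : leg23 (X * Y) = leg23 X * leg23 Y := by
  ext ⟨a, b, c⟩ ⟨d, e, f⟩
  simp [leg23, Matrix.mul_apply, Fintype.sum_prod_type, ite_mul, mul_ite]

theorem leg12_one : leg12 (1 : Mat2 k n) = 1 := by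
  ext ⟨a, b, c⟩ ⟨d, e, f⟩
  simp only [leg12, Matrix.one_apply, Prod.mk.injEq]
  split_ifs <;> simp_all

theorem leg13_one : leg13 (1 : Mat2 k n) = 1 := by
  ext ⟨a, b, c⟩ ⟨d, e, f⟩
  simp only [leg13, Matrix.one_apply, Prod.mk.injEq]
  split_ifs <;> simp_all

theorem leg23_one : leg23 (1 : Mat2 k n) = 1 := by
  ext ⟨a, b, c⟩ ⟨d, e, f⟩
  simp only [leg23, Matrix.one_apply, Prod.mk.injEq]
  split_ifs <;> simp_all

/-- `R₂₁`. -/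
def flipMat (R : Mat2 k n) : Mat2 k n := fun x y => R x.swap y.swap

theorem flipMat_mul (X Y : Mat2 k n) : flipMat (X * Y) = flipMat X * flipMat Y := by
  ext ⟨a, b⟩ ⟨c, d⟩
  simp only [flipMat, Matrix.mul_apply, Fintype.sum_prod_type, Prod.swap_prod_mk]
  exact Finset.sum_comm

theorem flipMat_one : flipMat (1 : Mat2 k n) = 1 := by
  ext ⟨a, b⟩ ⟨c, d⟩
  simp [flipMat, Matrix.one_apply, and_comm]

/-- The Yang-Baxter equation with its three tensor legs relabelled. `cyclic'` and `transposition`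
come from the other cyclic relabelling and from exchanging the last two legs. -/
theorem QYBE.cyclic {R : Mat2 k n} (h : QYBE R) :
    leg23 R * leg12 (flipMat R) * leg13 (flipMat R) =
      leg13 (flipMat R) * leg12 (flipMat R) * leg23 R := by
  let e : Fin n × Fin n × Fin n ≃ Fin n × Fin n × Fin n :=
    ⟨fun x => (x.2.1, x.2.2, x.1), fun x => (x.2.2, x.1, x.2.1), fun _ => rfl, fun _ => rfl⟩
  have h1 : (leg12 R).submatrix e e = leg23 R := rfl
  have h2 : (leg13 R).submatrix e e = leg12 (flipMat R) := rfl
  have h3 : (leg23 R).submatrix e e = leg13 (flipMat R) := rfl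
  have := congrArg (fun M => Matrix.submatrix M e e) h
  simpa only [← Matrix.submatrix_mul_equiv _ _ e e e, h1, h2, h3] using this

theorem QYBE.cyclic' {R : Mat2 k n} (h : QYBE R) :
    leg13 (flipMat R) * leg23 (flipMat R) * leg12 R =
      leg12 R * leg23 (flipMat R) * leg13 (flipMat R) := by
  let e : Fin n × Fin n × Fin n ≃ Fin n × Fin n × Fin n :=
    ⟨fun x => (x.2.2, x.1, x.2.1), fun x => (x.2.1, x.2.2, x.1), fun _ => rfl, fun _ => rfl⟩
  have h1 : (leg12 R).submatrix e e = leg13 (flipMat R) := rfl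
  have h2 : (leg13 R).submatrix e e = leg23 (flipMat R) := rfl
  have h3 : (leg23 R).submatrix e e = leg12 R := rfl
  have := congrArg (fun M => Matrix.submatrix M e e) h
  simpa only [← Matrix.submatrix_mul_equiv _ _ e e e, h1, h2, h3] using this

theorem QYBE.transposition {R : Mat2 k n} (h : QYBE R) :
    leg13 R * leg12 R * leg23 (flipMat R) = leg23 (flipMat R) * leg12 R * leg13 R := by
  let e : Fin n × Fin n × Fin n ≃ Fin n × Fin n × Fin n :=
    ⟨fun x => (x.1, x.2.2, x.2.1), fun x => (x.1, x.2.2, x.2.1), fun _ => rfl, fun _ => rfl⟩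
  have h1 : (leg12 R).submatrix e e = leg13 R := rfl
  have h2 : (leg13 R).submatrix e e = leg12 R := rfl
  have h3 : (leg23 R).submatrix e e = leg23 (flipMat R) := rfl
  have := congrArg (fun M => Matrix.submatrix M e e) h
  simpa only [← Matrix.submatrix_mul_equiv _ _ e e e, h1, h2, h3] using this

/-- The matrices `⟨m^±^i_j, t^p_l⟩`: `R` for `m⁺` and `R₂₁⁻¹` for `m⁻`. -/
def signMat (R : Mat2 k n) (s : Bool) : Mat2 k n := if s then R else flipMat R⁻¹

@[simp] theorem signMat_true (R : Mat2 k n) : signMat R true = R := rfl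

@[simp] theorem signMat_false (R : Mat2 k n) : signMat R false = flipMat R⁻¹ := rfl

variable {R : Mat2 k n}

theorem mul_inv_of_isUnit (hR : IsUnit R) : R * R⁻¹ = 1 :=
  Matrix.mul_nonsing_inv _ ((Matrix.isUnit_iff_isUnit_det R).mp hR)

theorem inv_mul_of_isUnit (hR : IsUnit R) : R⁻¹ * R = 1 :=
  Matrix.nonsing_inv_mul _ ((Matrix.isUnit_iff_isUnit_det R).mp hR)

theorem flipMat_mul_inv (hR : IsUnit R) : flipMat R * flipMat R⁻¹ = 1 := by
  rw [← flipMat_mul, mul_inv_of_isUnit hR, flipMat_one]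

theorem flipMat_inv_mul (hR : IsUnit R) : flipMat R⁻¹ * flipMat R = 1 := by
  rw [← flipMat_mul, inv_mul_of_isUnit hR, flipMat_one]

/-- `S₁₂ S₁₃ R₂₃ = R₂₃ S₁₃ S₁₂` for `S = R` and `S = R₂₁⁻¹`. -/
theorem leg_signMat_signMat (h : QYBE R) (hR : IsUnit R) (s : Bool) :
    leg12 (signMat R s) * leg13 (signMat R s) * leg23 R =
      leg23 R * leg13 (signMat R s) * leg12 (signMat R s) := by
  cases s
  · have a1 : leg12 (flipMat R) * leg12 (flipMat R⁻¹) = 1 := by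
      rw [← leg12_mul, flipMat_mul_inv hR, leg12_one]
    have a2 : leg12 (flipMat R⁻¹) * leg12 (flipMat R) = 1 := by
      rw [← leg12_mul, flipMat_inv_mul hR, leg12_one]
    have b1 : leg13 (flipMat R) * leg13 (flipMat R⁻¹) = 1 := by
      rw [← leg13_mul, flipMat_mul_inv hR, leg13_one]
    have b2 : leg13 (flipMat R⁻¹) * leg13 (flipMat R) = 1 := by
      rw [← leg13_mul, flipMat_inv_mul hR, leg13_one]
    have h1 := h.cyclic
    simp only [signMat_false]
    -- The relabelled equation for `R₂₁` is multiplied on both sides by the inverses of its outer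
    -- factors, which turns it into the equation for `R₂₁⁻¹`.
    calc _ = leg12 (flipMat R⁻¹) * leg13 (flipMat R⁻¹) *
          (leg23 R * leg12 (flipMat R) * leg13 (flipMat R)) *
          leg13 (flipMat R⁻¹) * leg12 (flipMat R⁻¹) := by
          grind
      _ = _ := by
          rw [h1]
          simp only [mul_assoc, ← mul_assoc (leg13 (flipMat R⁻¹)) (leg13 (flipMat R)), b2, one_mul, ← mul_assoc (leg12 (flipMat R⁻¹)) (leg12 (flipMat R)), a2]
  · exact h

/-- `R₁₂ S₁₃ S'₂₃ = S'₂₃ S₁₃ R₁₂` for `S = S' = R`, for `S = S' = R₂₁⁻¹`, and for `S = R`,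
`S' = R₂₁⁻¹`. -/
theorem leg_signMat (h : QYBE R) (hR : IsUnit R) (s s' : Bool) (hs : s' = true → s = true) :
    leg12 R * leg13 (signMat R s) * leg23 (signMat R s') =
      leg23 (signMat R s') * leg13 (signMat R s) * leg12 R := by
  have a1 : leg23 (flipMat R) * leg23 (flipMat R⁻¹) = 1 := by
    rw [← leg23_mul, flipMat_mul_inv hR, leg23_one]
  have a2 : leg23 (flipMat R⁻¹) * leg23 (flipMat R) = 1 := by
    rw [← leg23_mul, flipMat_inv_mul hR, leg23_one]
  have b1 : leg13 (flipMat R) * leg13 (flipMat R⁻¹) = 1 := by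
    rw [← leg13_mul, flipMat_mul_inv hR, leg13_one]
  have b2 : leg13 (flipMat R⁻¹) * leg13 (flipMat R) = 1 := by
    rw [← leg13_mul, flipMat_inv_mul hR, leg13_one]
  cases s <;> cases s'
  · have h1 := h.cyclic'
    simp only [signMat_false]
    calc _ = leg23 (flipMat R⁻¹) * (leg13 (flipMat R⁻¹) *
          (leg13 (flipMat R) * leg23 (flipMat R) * leg12 R)) *
          leg13 (flipMat R⁻¹) * leg23 (flipMat R⁻¹) := by
          grind
      _ = _ := by
          rw [h1]
          grind
  · simp at hs
  · have h1 := h.transposition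
    simp only [signMat_false, signMat_true]
    calc _ = leg23 (flipMat R⁻¹) * (leg23 (flipMat R) * leg12 R * leg13 R) *
          leg23 (flipMat R⁻¹) := by
          grind
      _ = _ := by
          rw [← h1]
          grind
  · exact h

theorem leg_leg_leg_apply (X Y Z : Mat2 k n) (i p x j l y : Fin n) :
    (leg12 X * leg13 Y * leg23 Z) (i, p, x) (j, l, y) =
      ∑ a, ∑ b, ∑ z, X (i, p) (a, b) * Y (a, x) (j, z) * Z (b, z) (l, y) := by
  have h1 : ∀ w : Fin n × Fin n × Fin n, (leg12 X * leg13 Y) (i, p, x) w =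
      ∑ a, X (i, p) (a, w.2.1) * Y (a, x) (w.1, w.2.2) := by
    intro w
    simp [leg12, leg13, Matrix.mul_apply, Fintype.sum_prod_type]
  rw [Matrix.mul_apply]
  simp only [h1, leg23, Fintype.sum_prod_type]
  rw [Finset.sum_eq_single j (fun _ _ h => by simp [h]) (by simp)]
  simp only [if_true, mul_one, Finset.sum_mul]
  exact (Finset.sum_congr rfl fun b _ => Finset.sum_comm).trans Finset.sum_comm

theorem leg_leg_leg_apply' (X Y Z : Mat2 k n) (i p x j l y : Fin n) :
    (leg23 Z * leg13 Y * leg12 X) (i, p, x) (j, l, y) =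
      ∑ a, ∑ b, ∑ z, Z (p, x) (b, z) * Y (i, z) (a, y) * X (a, b) (j, l) := by
  have h1 : ∀ w : Fin n × Fin n × Fin n, (leg23 Z * leg13 Y) (i, p, x) w =
      ∑ z, Z (p, x) (w.2.1, z) * Y (i, z) (w.1, w.2.2) := by
    intro w
    simp [leg23, leg13, Matrix.mul_apply, Fintype.sum_prod_type]
  rw [Matrix.mul_apply]
  simp only [h1, leg12, Fintype.sum_prod_type]
  refine Finset.sum_congr rfl fun a _ => Finset.sum_congr rfl fun b _ => ?_
  rw [Finset.sum_eq_single y (fun _ _ h => by simp [h]) (by simp)]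
  simp [Finset.sum_mul]

end Legs

end

end DoubleBosonisation

/-! ### Matrix representations of `A(R)` and their intertwiners. -/

namespace DoubleBosonisation

noncomputable section

open scoped Shortcuts

variable {k : Type u} [Field k] {n : ℕ} {R : Mat2 k n}

theorem AR.adjoin_eq_top (R : Mat2 k n) :
    Algebra.adjoin k {x | ∃ i j, x = AR.t R i j} = ⊤ := by
  let N := Algebra.adjoin k {x | ∃ i j, x = AR.t R i j}
  let φ : AR R →ₐ[k] N := AR.lift R
    (fun i j => ⟨AR.t R i j, Algebra.subset_adjoin ⟨i, j, rfl⟩⟩) (fun i j p l =>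
      Subtype.ext (by simpa using AR.rel R i j p l))
  have h : N.val.comp φ = AlgHom.id k _ := AR.hom_ext R fun i j => by simp [φ, AR.lift_t]
  rw [eq_top_iff]
  intro x _
  rw [← AlgHom.id_apply (R := k) x, ← h]
  exact (φ x).2

theorem UR.adjoin_eq_top (R : Mat2 k n) :
    Algebra.adjoin k {x | ∃ s i j, x = UR.m R s i j} = ⊤ := by
  let N := Algebra.adjoin k {x | ∃ s i j, x = UR.m R s i j}
  let φ : UR R →ₐ[k] N := UR.lift R
    (fun s i j => ⟨UR.m R s i j, Algebra.subset_adjoin ⟨s, i, j, rfl⟩⟩) (fun s i j p l =>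
      Subtype.ext (by simpa using UR.rel_same R s i j p l)) (fun i j p l =>
      Subtype.ext (by simpa using UR.rel_cross R i j p l))
  have h : N.val.comp φ = AlgHom.id k _ := UR.hom_ext R fun s i j => by simp [φ, UR.lift_m]
  rw [eq_top_iff]
  intro x _
  rw [← AlgHom.id_apply (R := k) x, ← h]
  exact (φ x).2

/-- An intertwiner of the images of the generators is an intertwiner. -/
theorem AR.intertwine {Y : Type*} [Ring Y] [Algebra k Y] (f g : AR R →ₐ[k] Y) (y : Y)
    (h : ∀ i j, f (AR.t R i j) * y = y * g (AR.t R i j)) (x : AR R) : f x * y = y * g x := by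
  have hx : x ∈ Algebra.adjoin k {x | ∃ i j, x = AR.t R i j} := by
    rw [AR.adjoin_eq_top]
    trivial
  induction hx using Algebra.adjoin_induction with
  | mem x hx => obtain ⟨i, j, rfl⟩ := hx; exact h i j
  | algebraMap r => simp [Algebra.commutes]
  | add x y _ _ hx hy => simp only [map_add, add_mul, mul_add, hx, hy]
  | mul x z _ _ hx hz => rw [map_mul, map_mul, mul_assoc, hz, ← mul_assoc, hx, mul_assoc]

/-- With `W` and `W'` holding the two orders of the products, the hypothesis is `M W = W' M` for a
scalar matrix `M`. Multiplication by `M⁻¹` on both sides exchanges the roles of `W` and `W'`. -/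
theorem rtt_inv {X : Type*} [Ring X] [Algebra k X] {M : Mat2 k n} (hM : IsUnit M)
    (x y : Fin n → Fin n → X) (h : ∀ i j p l, ∑ a, ∑ b, M (i, p) (a, b) • (x a j * y b l) =
      ∑ a, ∑ b, M (a, b) (j, l) • (y p b * x i a)) (i j p l : Fin n) :
    ∑ a, ∑ b, M⁻¹ (i, p) (a, b) • (y b l * x a j) =
      ∑ a, ∑ b, M⁻¹ (a, b) (j, l) • (x i a * y p b) := by
  let W : Matrix (Fin n × Fin n) (Fin n × Fin n) X :=
    Matrix.of fun u v => x u.1 v.1 * y u.2 v.2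
  let W' : Matrix (Fin n × Fin n) (Fin n × Fin n) X :=
    Matrix.of fun u v => y u.2 v.2 * x u.1 v.1
  let N := M.map (algebraMap k X)
  let N' := M⁻¹.map (algebraMap k X)
  have h1 : N * N' = 1 := by
    rw [← Matrix.map_mul, mul_inv_of_isUnit hM]
    simp
  have h2 : N' * N = 1 := by
    rw [← Matrix.map_mul, inv_mul_of_isUnit hM]
    simp
  have h3 : N * W = W' * N := by
    ext ⟨i, p⟩ ⟨j, l⟩
    have := h i j p l
    simpa [Matrix.mul_apply, N, W, W', Fintype.sum_prod_type, Algebra.smul_def,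
      Algebra.commutes] using this
  have h4 : N' * W' = W * N' := by
    calc _ = N' * (W' * N) * N' := by simp only [mul_assoc, h1, mul_one]
      _ = _ := by rw [← h3, ← mul_assoc, h2, one_mul]
  have := congrFun (congrFun h4 (i, p)) (j, l)
  simpa [Matrix.mul_apply, N', W, W', Fintype.sum_prod_type, Algebra.smul_def,
      Algebra.commutes] using this

/-- All relations of `Ũ(R)` in a single form, including the order `m⁻ m⁺`, for which the relation
must be inverted and `R₂₁⁻¹` replaces `R`. -/
theorem UR.rel_signMat (hR : IsUnit R) (s s' : Bool) (i j p l : Fin n) :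
    ∑ a, ∑ b, signMat R s (i, p) (a, b) • (UR.m R s a j * UR.m R s' b l) =
      ∑ a, ∑ b, signMat R s (a, b) (j, l) • (UR.m R s' p b * UR.m R s i a) := by
  cases s
  · have h := rtt_inv hR (UR.m R s') (UR.m R false)
      (by cases s'; exacts [UR.rel_same R false, UR.rel_cross R]) p l i j
    simp only [signMat_false, flipMat, Prod.swap_prod_mk]
    rw [Finset.sum_comm, h, Finset.sum_comm]
  · cases s'
    · exact UR.rel_cross R i j p l
    · exact UR.rel_same R true i j p l

section Pair

variable (hY : QYBE R) (hR : IsUnit R)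

/-- The representation `t^p_l ↦ (⟨m^±^i_j, t^p_l⟩)_{ji}` of `A(R)` by matrices. -/
def AR.rep (s : Bool) : AR R →ₐ[k] Matrix (Fin n) (Fin n) k :=
  AR.lift R (fun p l => Matrix.of fun j i => signMat R s (i, p) (j, l)) fun p l q m => by
    ext j i
    -- Leg 1 carries the matrix indices, and legs 2 and 3 the two copies of `t`. The matrix is
    -- written with transposed indices `(j, i)`, which reverses products, so the two sides of the
    -- leg identity end up exchanged.
    have := congrFun (congrFun (leg_signMat_signMat hY hR s) (i, p, q)) (j, l, m)
    rw [leg_leg_leg_apply, leg_leg_leg_apply'] at this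
    simp only [Matrix.sum_apply, Matrix.smul_apply, Matrix.mul_apply, Matrix.of_apply,
      smul_eq_mul, Finset.mul_sum]
    refine ((Finset.sum_congr rfl fun _ _ => Finset.sum_comm).trans Finset.sum_comm).trans
      (Eq.trans ?_ ((Finset.sum_congr rfl fun _ _ => Finset.sum_comm).trans Finset.sum_comm).symm)
    simp only [mul_assoc, mul_comm, mul_left_comm] at this ⊢
    exact this.symm

@[simp]
theorem AR.rep_t (s : Bool) (p l j i : Fin n) :
    AR.rep hY hR s (AR.t R p l) j i = signMat R s (i, p) (j, l) := by
  rw [AR.rep, AR.lift_t, Matrix.of_apply]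

variable {X : Type u} [Ring X] [Algebra k X]

/-- The convolution product of a matrix representation with an algebra map. -/
def AR.convRep (α : AR R →ₐ[k] Matrix (Fin n) (Fin n) k) (ρ : AR R →ₐ[k] X) :
    AR R →ₐ[k] Matrix (Fin n) (Fin n) X :=
  (matrixEquivTensor (Fin n) k X).symm.toAlgHom.comp
    ((Algebra.TensorProduct.map ρ α).comp
      ((Algebra.TensorProduct.comm k _ _).toAlgHom.comp (Bialgebra.comulAlgHom k (AR R))))

/-- The convolution product of an algebra map with a matrix representation. -/
def AR.repConv (α : AR R →ₐ[k] Matrix (Fin n) (Fin n) k) (ρ : AR R →ₐ[k] X) :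
    AR R →ₐ[k] Matrix (Fin n) (Fin n) X :=
  (matrixEquivTensor (Fin n) k X).symm.toAlgHom.comp
    ((Algebra.TensorProduct.map ρ α).comp (Bialgebra.comulAlgHom k (AR R)))

/-- The matrix coefficients of a representation. -/
def AR.coeff (α : AR R →ₐ[k] Matrix (Fin n) (Fin n) k) (i j : Fin n) : AR R →ₗ[k] k :=
  Matrix.entryLinearMap k k j i ∘ₗ α.toLinearMap

theorem AR.coeff_apply (α : AR R →ₐ[k] Matrix (Fin n) (Fin n) k) (i j : Fin n) (x) :
  AR.coeff α i j x = α x j i := rfl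

theorem AR.convRep_apply (α : AR R →ₐ[k] Matrix (Fin n) (Fin n) k) (ρ : AR R →ₐ[k] X) (x : AR R)
    (i j : Fin n) : AR.convRep α ρ x i j = TensorProduct.lid k X
      (TensorProduct.map (AR.coeff α j i) ρ.toLinearMap (Coalgebra.comul x)) := by
  simp only [AR.convRep, AlgHom.comp_apply, Bialgebra.comulAlgHom_apply]
  generalize Coalgebra.comul (R := k) x = z
  induction z using TensorProduct.induction_on with
  | zero => simp
  | add x y hx hy => simp only [map_add, Matrix.add_apply, hx, hy]
  | tmul x y => simp [AR.coeff_apply, Algebra.smul_def, Algebra.commutes]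

theorem AR.repConv_apply (α : AR R →ₐ[k] Matrix (Fin n) (Fin n) k) (ρ : AR R →ₐ[k] X) (x : AR R)
    (i j : Fin n) : AR.repConv α ρ x i j = TensorProduct.rid k X
      (TensorProduct.map ρ.toLinearMap (AR.coeff α j i) (Coalgebra.comul x)) := by
  simp only [AR.repConv, AlgHom.comp_apply, Bialgebra.comulAlgHom_apply]
  generalize Coalgebra.comul (R := k) x = z
  induction z using TensorProduct.induction_on with
  | zero => simp
  | add x y hx hy => simp only [map_add, Matrix.add_apply, hx, hy]
  | tmul x y => simp [AR.coeff_apply, Algebra.smul_def, Algebra.commutes]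

theorem AR.convRep_t (α : AR R →ₐ[k] Matrix (Fin n) (Fin n) k) (ρ : AR R →ₐ[k] X)
    (p l i j : Fin n) : AR.convRep α ρ (AR.t R p l) i j =
      ∑ c, α (AR.t R p c) i j • ρ (AR.t R c l) := by
  simp [AR.convRep_apply, AR.comul_t, AR.coeff_apply]

theorem AR.repConv_t (α : AR R →ₐ[k] Matrix (Fin n) (Fin n) k) (ρ : AR R →ₐ[k] X)
    (p l i j : Fin n) : AR.repConv α ρ (AR.t R p l) i j =
      ∑ c, α (AR.t R c l) i j • ρ (AR.t R p c) := by
  simp [AR.repConv_apply, AR.comul_t, AR.coeff_apply]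

/-- The relation says that `R` intertwines the two orders of tensor product of two matrix
representations of `A(R)`. By `AR.intertwine` it is enough to test this on the `t^i_j`, where it is
`leg_signMat`. -/
theorem AR.coeff_rel (s s' : Bool) (hs : s' = true → s = true) (i j p l : Fin n) :
    ∑ a, ∑ b, R (i, p) (a, b) • (WithConv.toConv (AR.coeff (AR.rep hY hR s) a j) *
      WithConv.toConv (AR.coeff (AR.rep hY hR s') b l)) =
    ∑ a, ∑ b, R (a, b) (j, l) • (WithConv.toConv (AR.coeff (AR.rep hY hR s') p b) *
      WithConv.toConv (AR.coeff (AR.rep hY hR s) i a)) := by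
  let f := AR.convRep (AR.rep hY hR s) (AR.rep hY hR s')
  let g := AR.repConv (AR.rep hY hR s) (AR.rep hY hR s')
  let y : Matrix (Fin n) (Fin n) (Matrix (Fin n) (Fin n) k) :=
    Matrix.of fun j i => Matrix.of fun l p => R (i, p) (j, l)
  have hf : ∀ (i j p l : Fin n) (x : AR R), f x j i l p =
      (WithConv.toConv (AR.coeff (AR.rep hY hR s) i j) *
      WithConv.toConv (AR.coeff (AR.rep hY hR s') p l)) x := by
    intro i j p l x
    simp only [f, AR.convRep_apply, LinearMap.convMul_apply]
    generalize Coalgebra.comul (R := k) x = z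
    induction z using TensorProduct.induction_on with
    | zero => simp
    | add x y hx hy => simp only [map_add, Matrix.add_apply, hx, hy]
    | tmul x y => simp [AR.coeff_apply]
  have hg : ∀ (i j p l : Fin n) (x : AR R), g x j i l p =
      (WithConv.toConv (AR.coeff (AR.rep hY hR s') p l) *
      WithConv.toConv (AR.coeff (AR.rep hY hR s) i j)) x := by
    intro i j p l x
    simp only [g, AR.repConv_apply, LinearMap.convMul_apply]
    generalize Coalgebra.comul (R := k) x = z
    induction z using TensorProduct.induction_on with
    | zero => simp
    | add x y hx hy => simp only [map_add, Matrix.add_apply, hx, hy]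
    | tmul x y => simp [AR.coeff_apply, mul_comm]
  have key := AR.intertwine f g y fun x z => by
    ext j i l p
    have := congrFun (congrFun (leg_signMat hY hR s s' hs) (i, p, x)) (j, l, z)
    rw [leg_leg_leg_apply, leg_leg_leg_apply'] at this
    simp only [Matrix.mul_apply, f, g, AR.convRep_t, AR.repConv_t, Matrix.sum_apply, AR.rep_t, y,
      Matrix.smul_apply, Matrix.of_apply, smul_eq_mul, Finset.mul_sum, Finset.sum_mul]
    refine (Finset.sum_congr rfl fun _ _ => Finset.sum_comm).trans
      (Eq.trans ?_ (Finset.sum_congr rfl fun _ _ => Finset.sum_comm).symm)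
    simp only [mul_assoc, mul_comm, mul_left_comm] at this ⊢
    exact this
  ext x
  have h2 := congrFun (congrFun (congrFun (congrFun (key x) j) i) l) p
  simp only [Matrix.mul_apply, Matrix.sum_apply, hf, hg, y, Matrix.of_apply] at h2
  simp only [WithConv.ofConv_sum, WithConv.ofConv_smul, LinearMap.sum_apply, LinearMap.smul_apply,
    smul_eq_mul]
  simpa only [mul_comm] using h2

end Pair

end

end DoubleBosonisation

/-! ### The weakly quasitriangular dual pair `(Ũ(R), A(R))`. -/

namespace DoubleBosonisation

noncomputable section

open scoped Shortcuts

variable {k : Type u} [Field k] {n : ℕ} {R : Mat2 k n} (hY : QYBE R) (hR : IsUnit R)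

open WithConv

theorem sum_swap_sums {ι₁ ι₂ ι₃ ι₄ M : Type*} [AddCommMonoid M] (s₁ : Finset ι₁) (s₂ : Finset ι₂)
    (s₃ : Finset ι₃) (s₄ : Finset ι₄) (g : ι₁ → ι₂ → ι₃ → ι₄ → M) :
    ∑ a ∈ s₁, ∑ b ∈ s₂, ∑ c ∈ s₃, ∑ d ∈ s₄, g a b c d =
      ∑ c ∈ s₃, ∑ d ∈ s₄, ∑ a ∈ s₁, ∑ b ∈ s₂, g a b c d := by
  calc _ = ∑ a ∈ s₁, ∑ c ∈ s₃, ∑ b ∈ s₂, ∑ d ∈ s₄, g a b c d :=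
        Finset.sum_congr rfl fun a _ => Finset.sum_comm
    _ = ∑ c ∈ s₃, ∑ a ∈ s₁, ∑ b ∈ s₂, ∑ d ∈ s₄, g a b c d := Finset.sum_comm
    _ = ∑ c ∈ s₃, ∑ a ∈ s₁, ∑ d ∈ s₄, ∑ b ∈ s₂, g a b c d :=
      Finset.sum_congr rfl fun c _ => Finset.sum_congr rfl fun a _ => Finset.sum_comm
    _ = _ := Finset.sum_congr rfl fun c _ => Finset.sum_comm

namespace UR

/-- The pairing of `Ũ(R)` and `A(R)`, as an algebra map to the dual of `A(R)`. -/
def toDual : UR R →ₐ[k] WithConv (AR R →ₗ[k] k) :=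
  UR.lift R (fun s i j => toConv (AR.coeff (AR.rep hY hR s) i j))
    (fun s => AR.coeff_rel hY hR s s id) (AR.coeff_rel hY hR true false (fun _ => rfl))

/-- The pairing of `Ũ(R)` and `A(R)`. -/
def pair : UR R →ₗ[k] AR R →ₗ[k] k :=
  (WithConv.linearEquiv k (AR R →ₗ[k] k)).toLinearMap ∘ₗ (toDual hY hR).toLinearMap

theorem pair_m (s : Bool) (i j : Fin n) :
    pair hY hR (UR.m R s i j) = AR.coeff (AR.rep hY hR s) i j := by
  simp [pair, toDual, UR.lift_m]

theorem pair_mul_left (h g : UR R) (a : AR R) : pair hY hR (h * g) a =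
    LinearMap.mul' k k (TensorProduct.map (pair hY hR h) (pair hY hR g) (Coalgebra.comul a)) := by
  simp [pair, LinearMap.convMul_def]

theorem pair_one_left (a : AR R) : pair hY hR 1 a = Coalgebra.counit a := by
  simp [pair, LinearMap.convOne_def]

theorem pair_mul_right (h : UR R) (a b : AR R) : pair hY hR h (a * b) =
    LinearMap.mul' k k (TensorProduct.map ((pair hY hR).flip a) ((pair hY hR).flip b)
      (Coalgebra.comul h)) := by
  have hx : h ∈ Algebra.adjoin k {x | ∃ s i j, x = UR.m R s i j} := by
    rw [UR.adjoin_eq_top]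
    trivial
  induction hx using Algebra.adjoin_induction generalizing a b with
  | mem x hx =>
    obtain ⟨s, i, j, rfl⟩ := hx
    simp [UR.comul_m, pair_m, AR.coeff_apply, Matrix.mul_apply]
  | algebraMap r =>
    simp [Algebra.TensorProduct.one_def, Algebra.algebraMap_eq_smul_one, pair_one_left]
  | add x y _ _ hx hy => simp only [map_add, LinearMap.add_apply, hx, hy]
  | mul h g _ _ hh hg =>
    let ra := Coalgebra.Repr.arbitrary k a
    let rb := Coalgebra.Repr.arbitrary k b
    let rh := Coalgebra.Repr.arbitrary k h
    let rg := Coalgebra.Repr.arbitrary k g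
    rw [pair_mul_left, Bialgebra.comul_mul, Bialgebra.comul_mul, ← ra.eq, ← rb.eq]
    simp only [Finset.sum_mul_sum, Algebra.TensorProduct.tmul_mul_tmul, map_sum,
      TensorProduct.map_tmul, LinearMap.mul'_apply, hh, hg]
    rw [← rh.eq, ← rg.eq]
    simp only [Finset.sum_mul_sum, Algebra.TensorProduct.tmul_mul_tmul, map_sum,
      TensorProduct.map_tmul, LinearMap.mul'_apply, LinearMap.flip_apply, pair_mul_left]
    rw [← ra.eq, ← rb.eq]
    simp only [Finset.sum_mul_sum, map_sum, TensorProduct.map_tmul, LinearMap.mul'_apply]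
    rw [sum_swap_sums]
    exact Finset.sum_congr rfl fun _ _ => Finset.sum_congr rfl fun _ _ => Finset.sum_congr rfl
      fun _ _ => Finset.sum_congr rfl fun _ _ => mul_mul_mul_comm _ _ _ _

theorem pair_one_right (h : UR R) : pair hY hR h 1 = Coalgebra.counit h := by
  have hx : h ∈ Algebra.adjoin k {x | ∃ s i j, x = UR.m R s i j} := by
    rw [UR.adjoin_eq_top]
    trivial
  induction hx using Algebra.adjoin_induction with
  | mem x hx =>
    obtain ⟨s, i, j, rfl⟩ := hx
    simp [UR.counit_m, pair_m, AR.coeff_apply, Matrix.one_apply, eq_comm]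
  | algebraMap r =>
    simp [Algebra.algebraMap_eq_smul_one, pair_one_left]
  | add x y _ _ hx hy => simp only [map_add, LinearMap.add_apply, hx, hy]
  | mul h g _ _ hh hg => simp [pair_mul_left, Algebra.TensorProduct.one_def, hh, hg]

/-- The maps `𝓡` and `𝓡̄`. -/
def ofAR (R : Mat2 k n) (s : Bool) : AR R →ₐ[k] UR R :=
  AR.lift R (UR.m R s) (UR.rel_same R s)

@[simp]
theorem ofAR_t (s : Bool) (i j : Fin n) : ofAR R s (AR.t R i j) = UR.m R s i j := AR.lift_t ..

theorem comul_ofAR (s : Bool) (a : AR R) : Coalgebra.comul (R := k) (ofAR R s a) =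
    TensorProduct.map (ofAR R s).toLinearMap (ofAR R s).toLinearMap
      (TensorProduct.comm k (AR R) (AR R) (Coalgebra.comul a)) := by
  have : (Bialgebra.comulAlgHom k (UR R)).comp (ofAR R s) =
      (Algebra.TensorProduct.map (ofAR R s) (ofAR R s)).comp
        ((Algebra.TensorProduct.comm k (AR R) (AR R)).toAlgHom.comp
          (Bialgebra.comulAlgHom k (AR R))) := by
    refine AR.hom_ext R fun i j => ?_
    simp [UR.comul_m, AR.comul_t]
  exact congrArg (fun f => f a) this

theorem counit_ofAR (s : Bool) (a : AR R) :
    Coalgebra.counit (R := k) (ofAR R s a) = Coalgebra.counit (R := k) a := by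
  have : (Bialgebra.counitAlgHom k (UR R)).comp (ofAR R s) = Bialgebra.counitAlgHom k (AR R) := by
    refine AR.hom_ext R fun i j => ?_
    simp [UR.counit_m, AR.counit_t]
  exact congrArg (fun f => f a) this

/-- The map `a ↦ (b ↦ ⟨𝓡(b), a⟩)`. -/
def coform : AR R →ₗ[k] WithConv (AR R →ₗ[k] k) :=
  (WithConv.linearEquiv k (AR R →ₗ[k] k)).symm.toLinearMap ∘ₗ
    (pair hY hR ∘ₗ (ofAR R true).toLinearMap).flip

theorem coform_apply (a : AR R) :
    coform hY hR a = toConv ((pair hY hR).flip a ∘ₗ (ofAR R true).toLinearMap) := rfl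

theorem coform_one : coform hY hR 1 = 1 := by
  rw [coform_apply]
  refine WithConv.ext (LinearMap.ext fun b => ?_)
  simp [pair_one_right, counit_ofAR, LinearMap.convOne_def]

/-- `𝓡` reverses coproducts, so this map into the convolution dual is antimultiplicative, while
`form` is multiplicative. This is the situation of `antihom_conv_algHom`. -/
theorem coform_mul (a b : AR R) : coform hY hR (a * b) = coform hY hR b * coform hY hR a := by
  refine WithConv.ext (LinearMap.ext fun x => ?_)
  simp only [coform_apply, LinearMap.comp_apply, LinearMap.flip_apply, AlgHom.toLinearMap_apply,
    pair_mul_right, comul_ofAR, LinearMap.convMul_def]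
  generalize Coalgebra.comul (R := k) x = z
  induction z using TensorProduct.induction_on with
  | zero => simp
  | add x y hx hy => simp only [map_add, hx, hy]
  | tmul x y => simp [mul_comm]

/-- The map `a ↦ (b ↦ ⟨𝓡̄(a), b⟩)`. -/
def form : AR R →ₐ[k] WithConv (AR R →ₗ[k] k) := (toDual hY hR).comp (ofAR R false)

theorem form_apply (a : AR R) : form hY hR a = toConv (pair hY hR (ofAR R false a)) := rfl

/-- The representation of `A(R)` by `b ↦ (⟨𝓡(b), t^i_j⟩)_{ij}`. -/
def coformRep : AR R →ₐ[k] Matrix (Fin n) (Fin n) k :=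
  AlgHom.ofLinearMap
    { toFun := fun b => Matrix.of fun i j => (coform hY hR (AR.t R i j)).ofConv b
      map_add' := fun x y => by ext; simp
      map_smul' := fun r x => by ext; simp }
    (by
      ext i j
      simp [coform_apply, pair_one_left, AR.counit_t, Matrix.one_apply])
    (fun x y => by
      ext i j
      simp [coform_apply, pair_mul_left, AR.comul_t, Matrix.mul_apply])

theorem coformRep_apply (b : AR R) (i j : Fin n) :
    coformRep hY hR b i j = (coform hY hR (AR.t R i j)).ofConv b := rfl

/-- The antirepresentation of `A(R)` by `b ↦ (⟨𝓡̄(t^i_j), b⟩)_{ij}`. -/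
def formRep : AR R →ₗ[k] Matrix (Fin n) (Fin n) k :=
  (Matrix.transposeLinearEquiv (Fin n) (Fin n) k k).toLinearMap ∘ₗ (AR.rep hY hR false).toLinearMap

theorem formRep_apply (b : AR R) (i j : Fin n) :
    formRep hY hR b i j = (form hY hR (AR.t R i j)).ofConv b := by
  rw [form_apply, ofAR_t, ofConv_toConv, pair_m]
  rfl

theorem formRep_one : formRep hY hR 1 = 1 := by
  simp [formRep]

theorem formRep_mul (x y : AR R) :
    formRep hY hR (x * y) = formRep hY hR y * formRep hY hR x := by
  simp [formRep]

/-- The inverse property is extended from generators in two stages. With `t^i_j` in the first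
argument it becomes a statement about matrix valued maps of the second (`h1`), which on generators
is `R⁻¹ R = 1`. Then it is extended to all first arguments. -/
theorem form_conv_coform (a : AR R) : LinearMap.mul' k _
    (TensorProduct.map (form hY hR).toLinearMap (coform hY hR) (Coalgebra.comul a)) =
      algebraMap k _ (Coalgebra.counit a) := by
  have h1 : ∀ b, LinearMap.mul' k _ (TensorProduct.map (formRep hY hR)
      (coformRep hY hR).toLinearMap (Coalgebra.comul b)) =
        algebraMap k _ (Coalgebra.counit (R := k) b) := by
    refine antihom_conv_algHom _ _ (formRep_one hY hR) (formRep_mul hY hR)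
      (AR.adjoin_eq_top R) ?_
    rintro _ ⟨p, l, rfl⟩
    ext i j
    have h := congrFun (congrFun (inv_mul_of_isUnit hR) (p, i)) (l, j)
    simp only [Matrix.mul_apply, Fintype.sum_prod_type, Matrix.one_apply, Prod.mk.injEq] at h
    simp only [AR.comul_t, AR.counit_t, map_sum, TensorProduct.map_tmul, LinearMap.mul'_apply,
      Matrix.sum_apply, Matrix.mul_apply, AlgHom.toLinearMap_apply, formRep_apply,
      coformRep_apply, form_apply, coform_apply, ofAR_t, LinearMap.comp_apply,
      LinearMap.flip_apply, pair_m, AR.coeff_apply, AR.rep_t, signMat_true, signMat_false, flipMat,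
      Prod.swap_prod_mk, h, Matrix.algebraMap_matrix_apply, Algebra.algebraMap_self,
      RingHom.id_apply]
    by_cases h1 : p = l <;> by_cases h2 : i = j <;> simp [h1, h2]
  refine algHom_conv_antihom _ _ (coform_one hY hR) (coform_mul hY hR) (AR.adjoin_eq_top R) ?_ a
  rintro _ ⟨i, j, rfl⟩
  refine WithConv.ext (LinearMap.ext fun b => ?_)
  have h2 := congrFun (congrFun (h1 b) i) j
  trans (LinearMap.mul' k _ (TensorProduct.map (formRep hY hR)
      (coformRep hY hR).toLinearMap (Coalgebra.comul b))) i j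
  · simp only [AR.comul_t, map_sum, TensorProduct.map_tmul, LinearMap.mul'_apply,
      WithConv.ofConv_sum, LinearMap.sum_apply, LinearMap.convMul_def, LinearMap.comp_apply]
    generalize Coalgebra.comul (R := k) b = z
    induction z using TensorProduct.induction_on with
    | zero => simp
    | add x y hx hy => simp only [map_add, Matrix.add_apply, Finset.sum_add_distrib, hx, hy]
    | tmul x y => simp [Matrix.mul_apply, formRep_apply, coformRep_apply]
  · rw [h2]
    by_cases hij : i = j <;>
      simp [hij, AR.counit_t, Matrix.algebraMap_matrix_apply, LinearMap.convOne_def]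

theorem coform_conv_form (a : AR R) : LinearMap.mul' k _
    (TensorProduct.map (coform hY hR) (form hY hR).toLinearMap (Coalgebra.comul a)) =
      algebraMap k _ (Coalgebra.counit a) := by
  have h1 : ∀ b, LinearMap.mul' k _ (TensorProduct.map (coformRep hY hR).toLinearMap
      (formRep hY hR) (Coalgebra.comul b)) =
        algebraMap k _ (Coalgebra.counit (R := k) b) := by
    refine algHom_conv_antihom _ _ (formRep_one hY hR) (formRep_mul hY hR)
      (AR.adjoin_eq_top R) ?_
    rintro _ ⟨p, l, rfl⟩
    ext i j
    have h := congrFun (congrFun (mul_inv_of_isUnit hR) (p, i)) (l, j)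
    simp only [Matrix.mul_apply, Fintype.sum_prod_type, Matrix.one_apply, Prod.mk.injEq] at h
    simp only [AR.comul_t, AR.counit_t, map_sum, TensorProduct.map_tmul, LinearMap.mul'_apply,
      Matrix.sum_apply, Matrix.mul_apply, AlgHom.toLinearMap_apply, formRep_apply,
      coformRep_apply, form_apply, coform_apply, ofAR_t, LinearMap.comp_apply,
      LinearMap.flip_apply, pair_m, AR.coeff_apply, AR.rep_t, signMat_true, signMat_false, flipMat,
      Prod.swap_prod_mk, h, Matrix.algebraMap_matrix_apply, Algebra.algebraMap_self,
      RingHom.id_apply]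
    by_cases h1 : p = l <;> by_cases h2 : i = j <;> simp [h1, h2]
  refine antihom_conv_algHom _ _ (coform_one hY hR) (coform_mul hY hR) (AR.adjoin_eq_top R) ?_ a
  rintro _ ⟨i, j, rfl⟩
  refine WithConv.ext (LinearMap.ext fun b => ?_)
  have h2 := congrFun (congrFun (h1 b) i) j
  trans (LinearMap.mul' k _ (TensorProduct.map (coformRep hY hR).toLinearMap
      (formRep hY hR) (Coalgebra.comul b))) i j
  · simp only [AR.comul_t, map_sum, TensorProduct.map_tmul, LinearMap.mul'_apply,
      WithConv.ofConv_sum, LinearMap.sum_apply, LinearMap.convMul_def, LinearMap.comp_apply]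
    generalize Coalgebra.comul (R := k) b = z
    induction z using TensorProduct.induction_on with
    | zero => simp
    | add x y hx hy => simp only [map_add, Matrix.add_apply, Finset.sum_add_distrib, hx, hy]
    | tmul x y => simp [Matrix.mul_apply, formRep_apply, coformRep_apply]
  · rw [h2]
    by_cases hij : i = j <;>
      simp [hij, AR.counit_t, Matrix.algebraMap_matrix_apply, LinearMap.convOne_def]

theorem inv_left : conv (TensorProduct.lift (pair hY hR ∘ₗ (ofAR R false).toLinearMap))
    (TensorProduct.lift (pair hY hR ∘ₗ (ofAR R true).toLinearMap).flip) =
      Coalgebra.counit (R := k) (A := AR R ⊗[k] AR R) := by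
  refine TensorProduct.ext' fun a b => ?_
  trans (LinearMap.mul' k _ (TensorProduct.map (form hY hR).toLinearMap (coform hY hR)
    (Coalgebra.comul a))).ofConv b
  · simp only [conv, LinearMap.comp_apply, TensorProduct.comul_tmul]
    generalize Coalgebra.comul (R := k) a = z
    induction z using TensorProduct.induction_on with
    | zero => simp
    | add x y hx hy =>
      simp only [map_add, TensorProduct.add_tmul, hx, hy, WithConv.ofConv_add, LinearMap.add_apply]
    | tmul x y =>
      simp only [TensorProduct.map_tmul, LinearMap.mul'_apply, LinearMap.convMul_def,
        LinearMap.comp_apply]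
      generalize Coalgebra.comul (R := k) b = w
      induction w using TensorProduct.induction_on with
      | zero => simp
      | add x y hx hy => simp only [map_add, TensorProduct.tmul_add, hx, hy]
      | tmul x y => simp [form_apply, coform_apply]
  · rw [form_conv_coform]
    simp [Algebra.algebraMap_eq_smul_one, LinearMap.convOne_def, mul_comm]

theorem inv_right : conv (TensorProduct.lift (pair hY hR ∘ₗ (ofAR R true).toLinearMap).flip)
    (TensorProduct.lift (pair hY hR ∘ₗ (ofAR R false).toLinearMap)) =
      Coalgebra.counit (R := k) (A := AR R ⊗[k] AR R) := by
  refine TensorProduct.ext' fun a b => ?_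
  trans (LinearMap.mul' k _ (TensorProduct.map (coform hY hR) (form hY hR).toLinearMap
    (Coalgebra.comul a))).ofConv b
  · simp only [conv, LinearMap.comp_apply, TensorProduct.comul_tmul]
    generalize Coalgebra.comul (R := k) a = z
    induction z using TensorProduct.induction_on with
    | zero => simp
    | add x y hx hy =>
      simp only [map_add, TensorProduct.add_tmul, hx, hy, WithConv.ofConv_add, LinearMap.add_apply]
    | tmul x y =>
      simp only [TensorProduct.map_tmul, LinearMap.mul'_apply, LinearMap.convMul_def,
        LinearMap.comp_apply]
      generalize Coalgebra.comul (R := k) b = w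
      induction w using TensorProduct.induction_on with
      | zero => simp
      | add x y hx hy => simp only [map_add, TensorProduct.tmul_add, hx, hy]
      | tmul x y => simp [form_apply, coform_apply]
  · rw [coform_conv_form]
    simp [Algebra.algebraMap_eq_smul_one, LinearMap.convOne_def, mul_comm]

/-- Multiplicativity of the differentiation operators for convolution reduces the axioms `diff_Rp`
and `diff_Rm` to the generators of `Ũ(R)`. -/
theorem diffR_mul (h g : UR R) : toConv (diffR (pair hY hR) (h * g)) =
    toConv (diffR (pair hY hR) h) * toConv (diffR (pair hY hR) g) := by
  refine WithConv.ext (LinearMap.ext fun a => ?_)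
  simp only [diffR, Bialgebra.comul_mul, LinearMap.convMul_def, LinearMap.comp_apply]
  generalize Coalgebra.comul (R := k) h = z
  generalize Coalgebra.comul (R := k) g = w
  induction z using TensorProduct.induction_on with
  | zero => simp
  | add x y hx hy =>
    simp only [map_add, add_mul, LinearMap.add_apply, hx, hy, TensorProduct.map_add_left]
  | tmul x y =>
    induction w using TensorProduct.induction_on with
    | zero => simp
    | add x y hx hy =>
      simp only [map_add, mul_add, LinearMap.add_apply, hx, hy, TensorProduct.map_add_right]
    | tmul x' y' =>
      simp only [Algebra.TensorProduct.tmul_mul_tmul, TensorProduct.lift.tmul,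
        LinearMap.flip_apply, LinearMap.comp_apply, LinearMap.smulRightₗ_apply, LinearMap.smulRight_apply,
        pair_mul_left]
      generalize Coalgebra.comul (R := k) a = v
      induction v using TensorProduct.induction_on with
      | zero => simp
      | add x y hx hy => simp only [map_add, add_smul, hx, hy]
      | tmul p q => simp [smul_smul, mul_comm]

theorem diffL_mul (h g : UR R) : toConv (diffL (pair hY hR) (h * g)) =
    toConv (diffL (pair hY hR) h) * toConv (diffL (pair hY hR) g) := by
  refine WithConv.ext (LinearMap.ext fun a => ?_)
  simp only [diffL, Bialgebra.comul_mul, LinearMap.convMul_def, LinearMap.comp_apply]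
  generalize Coalgebra.comul (R := k) h = z
  generalize Coalgebra.comul (R := k) g = w
  induction z using TensorProduct.induction_on with
  | zero => simp
  | add x y hx hy =>
    simp only [map_add, add_mul, LinearMap.add_apply, hx, hy, TensorProduct.map_add_left]
  | tmul x y =>
    induction w using TensorProduct.induction_on with
    | zero => simp
    | add x y hx hy =>
      simp only [map_add, mul_add, LinearMap.add_apply, hx, hy, TensorProduct.map_add_right]
    | tmul x' y' =>
      simp only [Algebra.TensorProduct.tmul_mul_tmul, TensorProduct.lift.tmul,
        LinearMap.comp_apply, LinearMap.smulRightₗ_apply, LinearMap.smulRight_apply,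
        pair_mul_left]
      generalize Coalgebra.comul (R := k) a = v
      induction v using TensorProduct.induction_on with
      | zero => simp
      | add x y hx hy => simp only [map_add, add_smul, hx, hy]
      | tmul p q => simp [smul_smul, mul_comm]

theorem diffR_one : toConv (diffR (pair hY hR) 1) = 1 := by
  refine WithConv.ext (LinearMap.ext fun a => ?_)
  simp [diffR, Algebra.TensorProduct.one_def, pair_one_left, LinearMap.convOne_def,
    Algebra.algebraMap_eq_smul_one]

theorem diffL_one : toConv (diffL (pair hY hR) 1) = 1 := by
  refine WithConv.ext (LinearMap.ext fun a => ?_)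
  simp [diffL, Algebra.TensorProduct.one_def, pair_one_left, LinearMap.convOne_def,
    Algebra.algebraMap_eq_smul_one]

theorem diffR_m (s : Bool) (i j : Fin n) (a : AR R) : diffR (pair hY hR) (UR.m R s i j) a =
    ∑ c, AR.coeff (AR.rep hY hR s) i c a • UR.m R s c j := by
  simp [diffR, UR.comul_m, pair_m]

theorem diffL_m (s : Bool) (i j : Fin n) (a : AR R) : diffL (pair hY hR) (UR.m R s i j) a =
    ∑ c, AR.coeff (AR.rep hY hR s) c j a • UR.m R s i c := by
  simp [diffL, UR.comul_m, pair_m]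

/-- For fixed generators of `Ũ(R)` this says that a matrix with entries in `Ũ(R)` intertwines two
maps out of `A(R)`. On the `t^i_j` it is `rel_signMat`, and `AR.intertwine` extends it. -/
theorem diff_m (s s' : Bool) (i j : Fin n) :
    conv (diffR (pair hY hR) (UR.m R s i j)) (ofAR R s').toLinearMap =
      conv (ofAR R s').toLinearMap (diffL (pair hY hR) (UR.m R s i j)) := by
  let y : Matrix (Fin n) (Fin n) (UR R) := Matrix.of fun j c => UR.m R s c j
  have key := AR.intertwine (AR.repConv (AR.rep hY hR s) (ofAR R s'))
    (AR.convRep (AR.rep hY hR s) (ofAR R s')) y fun p l => by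
      ext j i
      have := UR.rel_signMat hR s s' i j p l
      simp only [Matrix.mul_apply, AR.repConv_t, AR.convRep_t, AR.rep_t, ofAR_t, y,
        Matrix.of_apply, Finset.sum_mul, Finset.mul_sum, smul_mul_assoc, mul_smul_comm]
      exact this.symm
  ext a
  have h := congrFun (congrFun (key a) j) i
  simp only [Matrix.mul_apply, AR.repConv_apply, AR.convRep_apply, y, Matrix.of_apply] at h
  simp only [conv, LinearMap.comp_apply]
  refine Eq.trans ?_ (h.symm.trans ?_)
  · generalize Coalgebra.comul (R := k) a = z
    induction z using TensorProduct.induction_on with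
    | zero => simp
    | add x y hx hy => simp only [map_add, mul_add, hx, hy, Finset.sum_add_distrib]
    | tmul x y => simp [diffR_m, Finset.sum_mul]
  · generalize Coalgebra.comul (R := k) a = z
    induction z using TensorProduct.induction_on with
    | zero => simp
    | add x y hx hy => simp only [map_add, add_mul, hx, hy, Finset.sum_add_distrib]
    | tmul x y => simp [diffL_m, Finset.mul_sum]

theorem diff (s : Bool) (h : UR R) :
    conv (diffR (pair hY hR) h) (ofAR R s).toLinearMap =
      conv (ofAR R s).toLinearMap (diffL (pair hY hR) h) := by
  suffices H : toConv (diffR (pair hY hR) h) * toConv (ofAR R s).toLinearMap =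
      toConv (ofAR R s).toLinearMap * toConv (diffL (pair hY hR) h) from
    WithConv.toConv_injective H
  have hx : h ∈ Algebra.adjoin k {x | ∃ s i j, x = UR.m R s i j} := by
    rw [UR.adjoin_eq_top]
    trivial
  induction hx using Algebra.adjoin_induction with
  | mem x hx =>
    obtain ⟨s', i, j, rfl⟩ := hx
    exact congrArg toConv (diff_m hY hR s' s i j)
  | algebraMap r =>
    have h1 : toConv (diffR (pair hY hR) (algebraMap k _ r)) = r • 1 := by
      rw [← diffR_one hY hR, Algebra.algebraMap_eq_smul_one, diffR, diffR, map_smul, map_smul]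
      rfl
    have h2 : toConv (diffL (pair hY hR) (algebraMap k _ r)) = r • 1 := by
      rw [← diffL_one hY hR, Algebra.algebraMap_eq_smul_one, diffL, diffL, map_smul, map_smul]
      rfl
    rw [h1, h2, smul_mul_assoc, mul_smul_comm, one_mul, mul_one]
  | add x y _ _ hx hy =>
    have h1 : toConv (diffR (pair hY hR) (x + y)) =
        toConv (diffR (pair hY hR) x) + toConv (diffR (pair hY hR) y) := by
      rw [diffR, diffR, diffR, map_add, map_add, toConv_add]
    have h2 : toConv (diffL (pair hY hR) (x + y)) =
        toConv (diffL (pair hY hR) x) + toConv (diffL (pair hY hR) y) := by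
      rw [diffL, diffL, diffL, map_add, map_add, toConv_add]
    rw [h1, h2, add_mul, mul_add, hx, hy]
  | mul x y _ _ hx hy => rw [diffR_mul, diffL_mul, mul_assoc, hy, ← mul_assoc, hx, mul_assoc]

/-- The weakly quasitriangular dual pair `(Ũ(R), A(R))`. -/
def weakQTPair : WeakQTPair k (UR R) (AR R) where
  pair := pair hY hR
  pair_mul_left := pair_mul_left hY hR
  pair_one_left := pair_one_left hY hR
  pair_mul_right := pair_mul_right hY hR
  pair_one_right := pair_one_right hY hR
  Rp := ofAR R true
  Rm := ofAR R false
  comul_Rp := comul_ofAR true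
  counit_Rp := counit_ofAR true
  comul_Rm := comul_ofAR false
  counit_Rm := counit_ofAR false
  inv_left := inv_left hY hR
  inv_right := inv_right hY hR
  diff_Rp := diff hY hR true
  diff_Rm := diff hY hR false

end UR

end

end DoubleBosonisation

/-! ### Universal property of the double bosonisation and the free planes. -/

namespace DoubleBosonisation

noncomputable section

open scoped Shortcuts

section CrossForms

variable {k : Type u} [Field k] {n : ℕ} {X : Type*} [Ring X] [Algebra k X]

/-- Passes between the exchange rule for `E y` with the inverse matrix, as derivatives on `H`
produce it, and the rule for `y E` used in `CrossRelations`. -/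
theorem mul_comm_form_iff {N N' : Mat2 k n} (h : N * N' = 1) (E : Fin n → X)
    (y : Fin n → Fin n → X) :
    (∀ i j l, E l * y i j = ∑ a, ∑ b, N' (l, i) (a, b) • (y b j * E a)) ↔
      ∀ i j l, y i j * E l = ∑ a, ∑ b, N (l, i) (a, b) • (E a * y b j) := by
  have h' := mul_eq_one_comm.mp h
  constructor
  · intro H i j l
    have h1 : (fun x : Fin n × Fin n => E x.1 * y x.2 j) =
        act N' (fun x => y x.2 j * E x.1) := by
      funext x
      simp only [H, act, Fintype.sum_prod_type]
    have h2 := congrFun (congrArg (act N) h1) (l, i)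
    rw [← act_mul, h, act_one] at h2
    simp only [act, Fintype.sum_prod_type] at h2
    exact h2.symm
  · intro H i j l
    have h1 : (fun x : Fin n × Fin n => y x.2 j * E x.1) =
        act N (fun x => E x.1 * y x.2 j) := by
      funext x
      simp only [H, act, Fintype.sum_prod_type]
    have h2 := congrFun (congrArg (act N') h1) (l, i)
    rw [← act_mul, h', act_one] at h2
    simp only [act, Fintype.sum_prod_type] at h2
    exact h2.symm

theorem mul_comm_form_iff' {N N' : Mat2 k n} (h : N * N' = 1) (F : Fin n → X)
    (y : Fin n → Fin n → X) :
    (∀ i j l, y j l * F i = ∑ a, ∑ b, N' (a, b) (i, l) • (F a * y j b)) ↔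
      ∀ i j l, F i * y j l = ∑ a, ∑ b, N (a, b) (i, l) • (y j b * F a) := by
  have h' := mul_eq_one_comm.mp h
  constructor
  · intro H i j l
    have h1 : (fun x : Fin n × Fin n => y j x.2 * F x.1) =
        act N'.transpose (fun x => F x.1 * y j x.2) := by
      funext x
      simp only [H, act, Fintype.sum_prod_type, Matrix.transpose_apply]
    have h2 := congrFun (congrArg (act N.transpose) h1) (i, l)
    rw [← act_mul, ← Matrix.transpose_mul, h', Matrix.transpose_one, act_one] at h2
    simp only [act, Fintype.sum_prod_type, Matrix.transpose_apply] at h2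
    exact h2.symm
  · intro H i j l
    have h1 : (fun x : Fin n × Fin n => F x.1 * y j x.2) =
        act N.transpose (fun x => y j x.2 * F x.1) := by
      funext x
      simp only [H, act, Fintype.sum_prod_type, Matrix.transpose_apply]
    have h2 := congrFun (congrArg (act N'.transpose) h1) (i, l)
    rw [← act_mul, ← Matrix.transpose_mul, h, Matrix.transpose_one, act_one] at h2
    simp only [act, Fintype.sum_prod_type, Matrix.transpose_apply] at h2
    exact h2.symm

end CrossForms

namespace PlaneData

variable {k : Type u} [Field k] {n : ℕ} {H A B D : Type u} [Ring H] [Ring A] [Bialgebra k H]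
  [Bialgebra k A] [Ring B] [Algebra k B] [Ring D] [Algebra k D]
  {P : WeakQTPair k H A} {R R' : Mat2 k n} (S : PlaneData P R R' B D) (κ : k)

theorem groupB_comul_e (i : Fin n) : S.groupB.comul (S.e i) = S.e i ⊗ₜ[k] 1 + 1 ⊗ₜ[k] S.e i :=
  S.coreB.comul_v i

theorem groupD_comul_f (i : Fin n) : S.groupD.comul (S.f i) = S.f i ⊗ₜ[k] 1 + 1 ⊗ₜ[k] S.f i :=
  S.coreD.comul_v i

theorem pairing_f_e (i j : Fin n) : (S.pairing κ).ev (S.f i) (S.e j) = if i = j then κ⁻¹ else 0 := by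
  have h := PlaneCore.ev_v S.coreD S.coreB κ i (S.e j)
  have h2 := S.coreB.der_v_mul κ i j 1
  simp only [mul_one, map_one] at h2
  exact h.trans h2

/-- Cross relations between `B` and a generating set of `H` imply those with all of `H`. -/
theorem eh_of_adjoin {X : Type*} [Ring X] [Algebra k X] {E : Fin n → X} {η : H →ₐ[k] X} {s : Set H}
    (hs : Algebra.adjoin k s = ⊤) (h : ∀ i, ∀ g ∈ s, E i * η g = ∑ a, η (S.nR i a g) * E a)
    (i : Fin n) (g : H) : E i * η g = ∑ a, η (S.nR i a g) * E a := by
  have hg : g ∈ Algebra.adjoin k s := by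
    rw [hs]
    trivial
  induction hg using Algebra.adjoin_induction generalizing i with
  | mem x hx => exact h i x hx
  | algebraMap r =>
    simp [Algebra.algebraMap_eq_smul_one, S.nR_one, apply_ite η, ite_mul]
  | add x y _ _ hx hy => simp only [map_add, mul_add, add_mul, hx, hy, Finset.sum_add_distrib]
  | mul x y _ _ hx hy =>
    simp only [map_mul, ← mul_assoc, hx, S.nR_mul, map_sum, Finset.sum_mul]
    simp only [mul_assoc, hy, Finset.mul_sum]
    exact Finset.sum_comm

/-- Cross relations between `C̄` and a generating set of `H` imply those with all of `H`. -/
theorem hf_of_adjoin {X : Type*} [Ring X] [Algebra k X] {F : Fin n → X} {η : H →ₐ[k] X} {s : Set H}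
    (hs : Algebra.adjoin k s = ⊤) (h : ∀ g ∈ s, ∀ i, η g * F i = ∑ a, F a * η (S.nL a i g))
    (g : H) (i : Fin n) : η g * F i = ∑ a, F a * η (S.nL a i g) := by
  have hg : g ∈ Algebra.adjoin k s := by
    rw [hs]
    trivial
  induction hg using Algebra.adjoin_induction generalizing i with
  | mem x hx => exact h x hx i
  | algebraMap r =>
    simp [Algebra.algebraMap_eq_smul_one, S.nL_one, apply_ite η, mul_ite]
  | add x y _ _ hx hy => simp only [map_add, mul_add, add_mul, hx, hy, Finset.sum_add_distrib]
  | mul x y _ _ hx hy =>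
    simp only [map_mul, mul_assoc, hy, S.nL_mul, map_sum, Finset.mul_sum]
    simp only [← mul_assoc, hx, Finset.sum_mul]
    exact Finset.sum_comm

namespace Double

theorem inH_injective : Function.Injective (inH S κ) := by
  -- Applying the counits of `D` and `B` recovers `h` from `1 ⊗ h ⊗ 1`, so injectivity of the
  -- product map restricts to `H`.
  let ψ : (D ⊗[k] H) ⊗[k] B →ₗ[k] H := (TensorProduct.rid k H).toLinearMap ∘ₗ
    TensorProduct.map ((TensorProduct.lid k H).toLinearMap ∘ₗ
      S.groupD.counit.toLinearMap.rTensor H) S.groupB.counit.toLinearMap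
  intro h h' hh
  have h1 : (1 ⊗ₜ[k] h) ⊗ₜ[k] 1 = ((1 : D) ⊗ₜ[k] h') ⊗ₜ[k] (1 : B) := by
    refine triangularMap_injective S κ ?_
    simpa [triangularMap] using hh
  simpa [ψ] using congrArg ψ h1

/-- The quadratic relations of `Cross` need not be assumed: they hold for the images of the
generators because `jB` and `jC` are algebra maps. -/
theorem existsUnique_hom {X : Type u} [Ring X] [Algebra k X] (jC : D →ₐ[k] X) (jH : H →ₐ[k] X)
    (jB : B →ₐ[k] X)
    (heh : ∀ i h, jB (S.e i) * jH h = ∑ a, jH (S.nR i a h) * jB (S.e a))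
    (hhf : ∀ h i, jH h * jC (S.f i) = ∑ a, jC (S.f a) * jH (S.nL a i h))
    (hef : ∀ i j, jB (S.e i) * jC (S.f j) - jC (S.f j) * jB (S.e i) =
      κ⁻¹ • (jH (S.Mp i j) - jH (S.Mm i j))) :
    ∃! φ : S.Double κ →ₐ[k] X, (∀ x, φ (inC S κ x) = jC x) ∧ (∀ h, φ (incH S κ h) = jH h) ∧
      ∀ x, φ (inB S κ x) = jB x := by
  have hc : S.Cross κ (fun i => jB (S.e i)) (fun i => jC (S.f i)) jH :=
    { ee := fun x => map_rel jB (S.planeB.rel x)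
      ff := fun x => map_rel jC (S.planeD.rel x)
      eh := heh
      hf := hhf
      ef := fun i j => by rw [← hef, add_sub_cancel] }
  refine ⟨lift hc, ⟨fun x => ?_, fun h => ?_, fun x => ?_⟩, ?_⟩
  · have : (lift hc).comp (inC S κ) = jC := S.planeD.algHom_ext fun i => by simp
    exact congrArg (fun f => f x) this
  · simp
  · have : (lift hc).comp (inB S κ) = jB := S.planeB.algHom_ext fun i => by simp
    exact congrArg (fun f => f x) this
  · rintro φ ⟨h1, h2, h3⟩
    refine hom_ext (fun i => ?_) (fun i => ?_) (fun h => ?_)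
    · rw [← inB_e, h3]
      simp
    · rw [← inC_f, h1]
      simp
    · rw [← incH_apply, h2]
      simp

end Double

end PlaneData

/-! ## The free braided plane -/

section Free

variable {k : Type u} [Field k] {n : ℕ}

theorem permMul_permMul {k : Type u} {n : ℕ} (R : Mat2 k n) : permMul (permMul R) = R := rfl

theorem isPlane_freeAlgebra :
    IsPlane (1 : Mat2 k n) (FreeAlgebra k (Fin n)) (FreeAlgebra.ι k) where
  rel x := by rw [act_one]
  lift x _ := ⟨FreeAlgebra.lift k x, fun i => by simp⟩
  adjoin := FreeAlgebra.adjoin_range_ι k (Fin n)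

variable {R : Mat2 k n} (hY : QYBE R) (hR : IsUnit R)

/-- The braided vector algebra `V(R)` and its dual. -/
def freePlaneData : PlaneData (UR.weakQTPair hY hR) R (permMul 1) (FreeAlgebra k (Fin n))
    (FreeAlgebra k (Fin n)) where
  T := AR.t R
  comul_T := AR.comul_t R
  counit_T := AR.counit_t R
  rtt := AR.rel R
  pair_T i j p l := by
    simp [UR.weakQTPair, UR.pair_m, AR.coeff_apply]
  -- The choice `R' = P` gives `P R' = 1`: the quadratic relations are void, one factor of the Hecke
  -- condition vanishes, and commutation with `P R` is trivial.
  hecke := by simp [permMul_permMul]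
  comm := by simp [permMul_permMul]
  e := FreeAlgebra.ι k
  f := FreeAlgebra.ι k
  planeB := isPlane_freeAlgebra
  planeD := by
    rw [permMul_permMul, Matrix.transpose_one]
    exact isPlane_freeAlgebra
  β := FreeAlgebra.lift k fun i => ∑ a, AR.t R i a ⊗ₜ[k] FreeAlgebra.ι k a
  β_e i := by simp
  δ := FreeAlgebra.lift k fun i => ∑ a, FreeAlgebra.ι k a ⊗ₜ[k] AR.t R a i
  δ_f i := by simp

theorem freePlaneData_Mp (i j : Fin n) : (freePlaneData hY hR).Mp i j = UR.mp R i j :=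
  UR.ofAR_t true i j

theorem freePlaneData_Mm (i j : Fin n) : (freePlaneData hY hR).Mm i j = UR.mm R i j :=
  UR.ofAR_t false i j

theorem freePlaneData_Rbar : (freePlaneData hY hR).Rbar = R⁻¹ :=
  (Matrix.inv_eq_left_inv (freePlaneData hY hR).Rbar_mul).symm

theorem UR.adjoin_mp_mm (R : Mat2 k n) :
    Algebra.adjoin k {x | ∃ i j, x = UR.mp R i j ∨ x = UR.mm R i j} = ⊤ := by
  rw [← UR.adjoin_eq_top]
  congr 1
  ext x
  constructor
  · rintro ⟨i, j, rfl | rfl⟩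
    exacts [⟨true, i, j, rfl⟩, ⟨false, i, j, rfl⟩]
  · rintro ⟨s | s, i, j, rfl⟩
    exacts [⟨i, j, Or.inr rfl⟩, ⟨i, j, Or.inl rfl⟩]

open PlaneData in
theorem freePlaneData_crossRelations (κ : k) :
    CrossRelations R κ (fun i j => Double.inH (freePlaneData hY hR) κ (UR.mp R i j))
      (fun i j => Double.inH (freePlaneData hY hR) κ (UR.mm R i j))
      (fun i j => Double.inH (freePlaneData hY hR) κ (UR.mp R i j))
      (fun i j => Double.inH (freePlaneData hY hR) κ (UR.mm R i j))
      (Double.e (freePlaneData hY hR) κ) (Double.f (freePlaneData hY hR) κ) := by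
  have h := Double.cross (freePlaneData hY hR) κ
  simp only [← freePlaneData_Mp hY hR, ← freePlaneData_Mm hY hR]
  exact ⟨h.e_mp, h.mm_e, h.mp_f, h.f_mm, h.e_f⟩

theorem freePlaneData_nR_mp (i a j l : Fin n) :
    (freePlaneData hY hR).nR i a (UR.mp R j l) = ∑ c, R (j, i) (c, a) • UR.mp R c l := by
  simpa only [freePlaneData_Mp] using (freePlaneData hY hR).nR_Mp j l i a

theorem freePlaneData_nR_mm (i a j l : Fin n) :
    (freePlaneData hY hR).nR i a (UR.mm R j l) = ∑ c, R⁻¹ (i, j) (a, c) • UR.mm R c l := by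
  simpa only [freePlaneData_Mm, freePlaneData_Rbar] using (freePlaneData hY hR).nR_Mm j l i a

theorem freePlaneData_nL_mp (i a j l : Fin n) :
    (freePlaneData hY hR).nL a i (UR.mp R j l) = ∑ c, R (c, a) (l, i) • UR.mp R j c := by
  simpa only [freePlaneData_Mp] using (freePlaneData hY hR).nL_Mp j l a i

theorem freePlaneData_nL_mm (i a j l : Fin n) :
    (freePlaneData hY hR).nL a i (UR.mm R j l) = ∑ c, R⁻¹ (a, c) (i, l) • UR.mm R j c := by
  simpa only [freePlaneData_Mm, freePlaneData_Rbar] using (freePlaneData hY hR).nL_Mm j l a i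

open PlaneData in
theorem freePlaneData_existsUnique_hom (κ : k) (X : Type u) [Ring X] [Algebra k X]
    (jC : FreeAlgebra k (Fin n) →ₐ[k] X) (jH : UR R →ₐ[k] X) (jB : FreeAlgebra k (Fin n) →ₐ[k] X)
    (h : CrossRelations R κ (fun i j => jH (UR.mp R i j)) (fun i j => jH (UR.mm R i j))
      (fun i j => jH (UR.mp R i j)) (fun i j => jH (UR.mm R i j))
      (fun i => jB (FreeAlgebra.ι k i)) (fun i => jC (FreeAlgebra.ι k i))) :
    ∃! φ : (freePlaneData hY hR).Double κ →ₐ[k] X,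
      (∀ x, φ (Double.inC (freePlaneData hY hR) κ x) = jC x) ∧
      (∀ g, φ (Double.incH (freePlaneData hY hR) κ g) = jH g) ∧
      (∀ x, φ (Double.inB (freePlaneData hY hR) κ x) = jB x) := by
  have hinv := mul_inv_of_isUnit hR
  refine Double.existsUnique_hom _ κ jC jH jB
    (eh_of_adjoin _ (UR.adjoin_mp_mm R) (E := fun i => jB (FreeAlgebra.ι k i)) ?_)
    (hf_of_adjoin _ (UR.adjoin_mp_mm R) (F := fun i => jC (FreeAlgebra.ι k i)) ?_) ?_
  · rintro i _ ⟨j, l, rfl | rfl⟩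
    · rw [h.e_mp]
      simp only [freePlaneData_nR_mp, map_sum, map_smul, Finset.sum_mul, smul_mul_assoc]
      exact Finset.sum_comm
    · rw [(mul_comm_form_iff hinv _ _).mpr h.mm_e]
      simp only [freePlaneData_nR_mm, map_sum, map_smul, Finset.sum_mul, smul_mul_assoc]
  · rintro _ ⟨j, l, rfl | rfl⟩ i
    · rw [h.mp_f]
      simp only [freePlaneData_nL_mp, map_sum, map_smul, Finset.mul_sum, mul_smul_comm]
      exact Finset.sum_comm
    · rw [(mul_comm_form_iff' hinv _ _).mpr h.f_mm]
      simp only [freePlaneData_nL_mm, map_sum, map_smul, Finset.mul_sum, mul_smul_comm]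
  · intro i j
    rw [freePlaneData_Mp, freePlaneData_Mm]
    exact h.e_f i j

open PlaneData in
theorem freePlaneData_adjoin (κ : k) :
    Algebra.adjoin k ({x | ∃ i j, x = Double.inH (freePlaneData hY hR) κ (UR.mp R i j) ∨
        x = Double.inH (freePlaneData hY hR) κ (UR.mm R i j)} ∪
      Set.range (Double.e (freePlaneData hY hR) κ) ∪
      Set.range (Double.f (freePlaneData hY hR) κ)) = ⊤ := by
  rw [eq_top_iff, ← Double.adjoin_eq_top, Algebra.adjoin_le_iff]
  rintro _ ((hx | hx) | ⟨g, rfl⟩)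
  · exact Algebra.subset_adjoin (Or.inl (Or.inr hx))
  · exact Algebra.subset_adjoin (Or.inr hx)
  · have hg : g ∈ Algebra.adjoin k {x | ∃ i j, x = UR.mp R i j ∨ x = UR.mm R i j} := by
      rw [UR.adjoin_mp_mm]
      trivial
    have h2 : Double.inH (freePlaneData hY hR) κ g ∈
        (Algebra.adjoin k {x | ∃ i j, x = UR.mp R i j ∨ x = UR.mm R i j}).map
          (Double.inH (freePlaneData hY hR) κ) := ⟨g, hg, rfl⟩
    rw [AlgHom.map_adjoin] at h2
    refine Algebra.adjoin_mono ?_ h2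
    rintro _ ⟨_, ⟨i, j, rfl | rfl⟩, rfl⟩
    · exact Or.inl (Or.inl ⟨i, j, Or.inl rfl⟩)
    · exact Or.inl (Or.inl ⟨i, j, Or.inr rfl⟩)

end Free

end

end DoubleBosonisation

/-! ### Central extension of a weakly quasitriangular dual pair. -/

namespace DoubleBosonisation

noncomputable section

open scoped Shortcuts

open LaurentPolynomial (T)

section Convolution

variable {k : Type u} [Field k] {C C' X Y : Type u} [AddCommGroup C] [Module k C] [Coalgebra k C]
  [AddCommGroup C'] [Module k C'] [Coalgebra k C'] [Ring X] [Algebra k X] [Ring Y] [Algebra k Y]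

theorem conv_comp_coalgHom (f g : C →ₗ[k] X) (φ : C' →ₗc[k] C) :
    conv f g ∘ₗ φ.toLinearMap = conv (f ∘ₗ φ.toLinearMap) (g ∘ₗ φ.toLinearMap) := by
  simp only [conv, LinearMap.comp_assoc, ← φ.map_comp_comul]
  rw [TensorProduct.map_comp, LinearMap.comp_assoc]

theorem conv_smul_smul (r s : k) (f g : C →ₗ[k] X) :
    conv (r • f) (s • g) = (r * s) • conv f g := by
  simp only [conv, TensorProduct.map_smul_left, TensorProduct.map_smul_right, LinearMap.smul_comp,
    LinearMap.comp_smul, smul_smul, mul_comm]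

theorem conv_add_left (f f' g : C →ₗ[k] X) : conv (f + f') g = conv f g + conv f' g := by
  simp only [conv, TensorProduct.map_add_left, LinearMap.add_comp, LinearMap.comp_add]

theorem conv_add_right (f g g' : C →ₗ[k] X) : conv f (g + g') = conv f g + conv f g' := by
  simp only [conv, TensorProduct.map_add_right, LinearMap.add_comp, LinearMap.comp_add]

end Convolution

section Laurent

variable (k : Type u) [Field k] (H A : Type u) [Ring H] [Ring A] [Bialgebra k H] [Bialgebra k A]

/-- The map `a ↦ a ⊗ T j`. -/
def tmulT (j : ℤ) : A →ₗc[k] A ⊗[k] LaurentPolynomial k :=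
  { (TensorProduct.mk k A (LaurentPolynomial k)).flip (T j) with
    counit_comp := by
      ext a
      simp
    map_comp_comul := by
      ext a
      simp only [LinearMap.comp_apply, LinearMap.flip_apply, TensorProduct.mk_apply,
        TensorProduct.comul_tmul, LaurentPolynomial.comul_T]
      generalize Coalgebra.comul (R := k) a = z
      induction z using TensorProduct.induction_on with
      | zero => simp
      | add x y hx hy => simp only [map_add, TensorProduct.add_tmul, hx, hy]
      | tmul x y => simp }

variable {k H A}

@[simp]
theorem tmulT_apply (j : ℤ) (a : A) : tmulT k A j a = a ⊗ₜ[k] T j := rfl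

@[elab_as_elim]
theorem tmulT_induction {p : A ⊗[k] LaurentPolynomial k → Prop} (x : A ⊗[k] LaurentPolynomial k)
    (tmul : ∀ a j, p (a ⊗ₜ T j)) (add : ∀ x y, p x → p y → p (x + y)) : p x := by
  induction x using TensorProduct.induction_on with
  | zero => simpa using tmul 0 0
  | add x y hx hy => exact add x y hx hy
  | tmul a q =>
    induction q using LaurentPolynomial.induction_on' with
    | add q r hq hr =>
      rw [TensorProduct.tmul_add]
      exact add _ _ hq hr
    | C_mul_T j r =>
      rw [← LaurentPolynomial.smul_eq_C_mul, ← TensorProduct.smul_tmul]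
      exact tmul _ _

/-- As a coalgebra, `A ⊗ k[g, g⁻¹]` is a direct sum of copies `A g^j` of `A`. Identities between
convolution products are checked on each copy, where the extended structure is the old one up to
powers of `lam`. -/
theorem hom_ext_tmulT {M : Type*} [AddCommMonoid M] [Module k M]
    {f g : A ⊗[k] LaurentPolynomial k →ₗ[k] M}
    (h : ∀ j, f ∘ₗ (tmulT k A j).toLinearMap = g ∘ₗ (tmulT k A j).toLinearMap) : f = g := by
  refine LinearMap.ext fun x => ?_
  induction x using tmulT_induction with
  | tmul a j => exact LinearMap.congr_fun (h j) a
  | add x y hx hy => rw [map_add, map_add, hx, hy]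

theorem comul_tmul_T (a : A) (j : ℤ) : Coalgebra.comul (R := k) (a ⊗ₜ[k] (T j : LaurentPolynomial k)) =
    TensorProduct.map (tmulT k A j).toLinearMap (tmulT k A j).toLinearMap
      (Coalgebra.comul (R := k) a) :=
  (LinearMap.congr_fun (tmulT k A j).map_comp_comul a).symm

theorem conv_tmulT {C : Type u} [AddCommGroup C] [Module k C] [Coalgebra k C]
    (f g : C →ₗ[k] A) (i j : ℤ) :
    conv ((tmulT k A i).toLinearMap ∘ₗ f) ((tmulT k A j).toLinearMap ∘ₗ g) =
      (tmulT k A (i + j)).toLinearMap ∘ₗ conv f g := by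
  ext c
  simp only [conv, LinearMap.comp_apply]
  generalize Coalgebra.comul (R := k) c = z
  induction z using TensorProduct.induction_on with
  | zero => simp
  | add x y hx hy => simp only [map_add, hx, hy]
  | tmul x y =>
    change (f x ⊗ₜ[k] (T i : LaurentPolynomial k)) * (g y ⊗ₜ[k] (T j : LaurentPolynomial k)) =
      (f x * g y) ⊗ₜ[k] (T (i + j) : LaurentPolynomial k)
    rw [Algebra.TensorProduct.tmul_mul_tmul, LaurentPolynomial.T_add]

/-- The pairing of `k[c, c⁻¹]` with `k[g, g⁻¹]` given by `⟨c^i, g^j⟩ = lam^(i * j)`. -/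
def powPair (lam : k) : LaurentPolynomial k →ₗ[k] LaurentPolynomial k →ₗ[k] k :=
  Finsupp.linearCombination k (fun i : ℤ =>
    Finsupp.linearCombination k (fun j : ℤ => lam ^ (i * j)) ∘ₗ
      (AddMonoidAlgebra.coeffLinearEquiv k).toLinearMap) ∘ₗ
    (AddMonoidAlgebra.coeffLinearEquiv k).toLinearMap

theorem powPair_T (lam : k) (i j : ℤ) : powPair lam (T i) (T j) = lam ^ (i * j) := by
  simp [powPair, LaurentPolynomial.T, -LaurentPolynomial.single_eq_C_mul_T]

/-- The pairing `⟨h c^i, a g^j⟩ = ⟨h, a⟩ lam^(i * j)`. -/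
def extPair (p : H →ₗ[k] A →ₗ[k] k) (lam : k) :
    H ⊗[k] LaurentPolynomial k →ₗ[k] A ⊗[k] LaurentPolynomial k →ₗ[k] k :=
  (TensorProduct.map₂ p (powPair lam)).compr₂ (TensorProduct.lid k k).toLinearMap

theorem extPair_tmul (p : H →ₗ[k] A →ₗ[k] k) (lam : k) (h : H) (a : A) (i j : ℤ) :
    extPair p lam (h ⊗ₜ T i) (a ⊗ₜ T j) = p h a * lam ^ (i * j) := by
  simp [extPair, powPair_T]

theorem extPair_comp (p : H →ₗ[k] A →ₗ[k] k) (lam : k) (h : H) (i j : ℤ) :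
    extPair p lam (h ⊗ₜ T i) ∘ₗ (tmulT k A j).toLinearMap = lam ^ (i * j) • p h := by
  ext a
  simp [extPair_tmul, mul_comm]

theorem extPair_flip_comp (p : H →ₗ[k] A →ₗ[k] k) (lam : k) (a : A) (i j : ℤ) :
    (extPair p lam).flip (a ⊗ₜ T j) ∘ₗ (tmulT k H i).toLinearMap = lam ^ (i * j) • p.flip a := by
  ext h
  simp [extPair_tmul, mul_comm]

theorem diffR_extPair (p : H →ₗ[k] A →ₗ[k] k) (lam : k) (h : H) (i j : ℤ) :
    diffR (extPair p lam) (h ⊗ₜ T i) ∘ₗ (tmulT k A j).toLinearMap =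
      (tmulT k H i).toLinearMap ∘ₗ (lam ^ (i * j) • diffR p h) := by
  ext a
  simp only [diffR, LinearMap.comp_apply, comul_tmul_T, LinearMap.smul_apply, map_smul]
  generalize Coalgebra.comul (R := k) h = z
  induction z using TensorProduct.induction_on with
  | zero => simp
  | add x y hx hy => simp only [map_add, LinearMap.add_apply, smul_add, hx, hy]
  | tmul x y => simp [extPair_tmul, TensorProduct.smul_tmul', smul_smul, mul_comm]

theorem diffL_extPair (p : H →ₗ[k] A →ₗ[k] k) (lam : k) (h : H) (i j : ℤ) :
    diffL (extPair p lam) (h ⊗ₜ T i) ∘ₗ (tmulT k A j).toLinearMap =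
      (tmulT k H i).toLinearMap ∘ₗ (lam ^ (i * j) • diffL p h) := by
  ext a
  simp only [diffL, LinearMap.comp_apply, comul_tmul_T, LinearMap.smul_apply, map_smul]
  generalize Coalgebra.comul (R := k) h = z
  induction z using TensorProduct.induction_on with
  | zero => simp
  | add x y hx hy => simp only [map_add, LinearMap.add_apply, smul_add, hx, hy]
  | tmul x y => simp [extPair_tmul, TensorProduct.smul_tmul', smul_smul, mul_comm]

/-- The algebra map `a g^j ↦ ρ(a) c^(-j)`. -/
def extInv (ρ : A →ₐ[k] H) : A ⊗[k] LaurentPolynomial k →ₐ[k] H ⊗[k] LaurentPolynomial k :=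
  Algebra.TensorProduct.map ρ (LaurentPolynomial.invert (R := k)).toAlgHom

/-- The algebra map `a g^j ↦ ρ(a) c^j`. -/
def extId (ρ : A →ₐ[k] H) : A ⊗[k] LaurentPolynomial k →ₐ[k] H ⊗[k] LaurentPolynomial k :=
  Algebra.TensorProduct.map ρ (AlgHom.id k _)

theorem extInv_comp (ρ : A →ₐ[k] H) (j : ℤ) : (extInv ρ).toLinearMap ∘ₗ (tmulT k A j).toLinearMap =
    (tmulT k H (-j)).toLinearMap ∘ₗ ρ.toLinearMap := by
  ext a
  simp [extInv]

theorem extId_comp (ρ : A →ₐ[k] H) (j : ℤ) : (extId ρ).toLinearMap ∘ₗ (tmulT k A j).toLinearMap =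
    (tmulT k H j).toLinearMap ∘ₗ ρ.toLinearMap := by
  ext a
  simp [extId]

/-- The function `s` records the effect on exponents, `j ↦ -j` for the extension of `𝓡` and the
identity for that of `𝓡̄`, so one proof serves both maps. -/
theorem comul_ext {ρ : A →ₐ[k] H} {ρ' : A ⊗[k] LaurentPolynomial k →ₐ[k] H ⊗[k] LaurentPolynomial k}
    {s : ℤ → ℤ} (hρ' : ∀ j, ρ'.toLinearMap ∘ₗ (tmulT k A j).toLinearMap =
      (tmulT k H (s j)).toLinearMap ∘ₗ ρ.toLinearMap)
    (hρ : ∀ a, Coalgebra.comul (R := k) (ρ a) = TensorProduct.map ρ.toLinearMap ρ.toLinearMap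
      (TensorProduct.comm k A A (Coalgebra.comul a))) (a : A ⊗[k] LaurentPolynomial k) :
    Coalgebra.comul (R := k) (ρ' a) = TensorProduct.map ρ'.toLinearMap ρ'.toLinearMap
      (TensorProduct.comm k _ _ (Coalgebra.comul a)) := by
  refine LinearMap.congr_fun (f := Coalgebra.comul ∘ₗ ρ'.toLinearMap)
    (g := TensorProduct.map ρ'.toLinearMap ρ'.toLinearMap ∘ₗ
      (TensorProduct.comm k _ _).toLinearMap ∘ₗ Coalgebra.comul) (hom_ext_tmulT fun j => ?_) a
  rw [LinearMap.comp_assoc, hρ' j]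
  ext a
  have h1 : ∀ a, ρ' (a ⊗ₜ T j) = ρ a ⊗ₜ T (s j) := LinearMap.congr_fun (hρ' j)
  simp only [LinearMap.comp_apply, CoalgHom.toLinearMap_eq_coe, LinearMap.coe_coe,
    tmulT_apply, comul_tmul_T, AlgHom.toLinearMap_apply, hρ, LinearEquiv.coe_coe]
  generalize Coalgebra.comul (R := k) a = z
  induction z using TensorProduct.induction_on with
  | zero => simp
  | add x y hx hy => simp only [map_add, hx, hy]
  | tmul x y => simp [h1]

theorem counit_ext {ρ : A →ₐ[k] H} {ρ' : A ⊗[k] LaurentPolynomial k →ₐ[k] H ⊗[k] LaurentPolynomial k}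
    {s : ℤ → ℤ} (hρ' : ∀ j, ρ'.toLinearMap ∘ₗ (tmulT k A j).toLinearMap =
      (tmulT k H (s j)).toLinearMap ∘ₗ ρ.toLinearMap)
    (hρ : ∀ a, Coalgebra.counit (R := k) (ρ a) = Coalgebra.counit (R := k) a)
    (a : A ⊗[k] LaurentPolynomial k) :
    Coalgebra.counit (R := k) (ρ' a) = Coalgebra.counit (R := k) a := by
  refine LinearMap.congr_fun (f := Coalgebra.counit ∘ₗ ρ'.toLinearMap) (g := Coalgebra.counit)
    (hom_ext_tmulT fun j => ?_) a
  rw [LinearMap.comp_assoc, hρ' j]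
  ext a
  simp [hρ]

/-- On `h c^i` and `A g^j` both differentiation operators are rescaled by the same factor `lam ^ (i
* j)`, and the powers of the central element `c` can be collected, so the axiom for `(H, A)`
suffices. -/
theorem diff_ext {p : H →ₗ[k] A →ₗ[k] k} {lam : k} {ρ : A →ₐ[k] H}
    {ρ' : A ⊗[k] LaurentPolynomial k →ₐ[k] H ⊗[k] LaurentPolynomial k}
    {s : ℤ → ℤ} (hρ' : ∀ j, ρ'.toLinearMap ∘ₗ (tmulT k A j).toLinearMap =
      (tmulT k H (s j)).toLinearMap ∘ₗ ρ.toLinearMap)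
    (hρ : ∀ h, conv (diffR p h) ρ.toLinearMap = conv ρ.toLinearMap (diffL p h))
    (h : H ⊗[k] LaurentPolynomial k) : conv (diffR (extPair p lam) h) ρ'.toLinearMap =
      conv ρ'.toLinearMap (diffL (extPair p lam) h) := by
  induction h using tmulT_induction with
  | add x y hx hy =>
    have h1 : diffR (extPair p lam) (x + y) = diffR (extPair p lam) x + diffR (extPair p lam) y := by
      simp only [diffR, map_add]
    have h2 : diffL (extPair p lam) (x + y) = diffL (extPair p lam) x + diffL (extPair p lam) y := by
      simp only [diffL, map_add]
    rw [h1, h2, conv_add_left, conv_add_right, hx, hy]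
  | tmul h i =>
    refine hom_ext_tmulT fun j => ?_
    rw [conv_comp_coalgHom, conv_comp_coalgHom, diffR_extPair, diffL_extPair, hρ', conv_tmulT,
      conv_tmulT, add_comm i]
    congr 1
    have h1 := conv_smul_smul (lam ^ (i * j)) 1 (diffR p h) ρ.toLinearMap
    have h2 := conv_smul_smul 1 (lam ^ (i * j)) ρ.toLinearMap (diffL p h)
    simp only [one_smul, mul_one, one_mul] at h1 h2
    rw [h1, h2, hρ]

end Laurent

namespace WeakQTPair

variable {k : Type u} [Field k] {H A : Type u} [Ring H] [Ring A] [Bialgebra k H] [Bialgebra k A]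
  (P : WeakQTPair k H A) {lam : k} (hlam : lam ≠ 0)

theorem extPair_Rm_comp (a b : ℤ) : TensorProduct.lift (extPair P.pair lam ∘ₗ (extId P.Rm).toLinearMap) ∘ₗ
    (TensorProduct.map (tmulT k A a).toLinearMap (tmulT k A b).toLinearMap) =
      lam ^ (a * b) • TensorProduct.lift (P.pair ∘ₗ P.Rm.toLinearMap) := by
  ext x y
  simp [extId, extPair_tmul, mul_comm]

theorem extPair_Rp_comp (a b : ℤ) :
    TensorProduct.lift (extPair P.pair lam ∘ₗ (extInv P.Rp).toLinearMap).flip ∘ₗ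
    (TensorProduct.map (tmulT k A a).toLinearMap (tmulT k A b).toLinearMap) =
      lam ^ (-(a * b)) • TensorProduct.lift (P.pair ∘ₗ P.Rp.toLinearMap).flip := by
  ext x y
  simp [extInv, extPair_tmul, mul_comm]

/-- The central extension of a weakly quasitriangular dual pair by `k[c, c⁻¹]` and `k[g, g⁻¹]`. -/
def centralExt : WeakQTPair k (H ⊗[k] LaurentPolynomial k) (A ⊗[k] LaurentPolynomial k) where
  pair := extPair P.pair lam
  pair_mul_left h g a := by
    induction h using tmulT_induction with
    | add x y hx hy =>
      simp only [add_mul, map_add, LinearMap.add_apply, TensorProduct.map_add_left, hx, hy]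
    | tmul h i =>
      induction g using tmulT_induction with
      | add x y hx hy =>
        simp only [mul_add, map_add, LinearMap.add_apply, TensorProduct.map_add_right, hx, hy]
      | tmul g l =>
        induction a using tmulT_induction with
        | add x y hx hy => simp only [map_add, hx, hy]
        | tmul a j =>
          rw [Algebra.TensorProduct.tmul_mul_tmul, ← LaurentPolynomial.T_add, extPair_tmul,
            comul_tmul_T, ← LinearMap.comp_apply (TensorProduct.map _ _), ← TensorProduct.map_comp,
            extPair_comp, extPair_comp, P.pair_mul_left]
          simp only [TensorProduct.map_smul_left, TensorProduct.map_smul_right,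
            LinearMap.smul_apply, map_smul, smul_smul, add_mul, zpow_add₀ hlam, smul_eq_mul]
          ring
  pair_one_left a := by
    induction a using tmulT_induction with
    | add x y hx hy => simp only [map_add, hx, hy]
    | tmul a j =>
      rw [Algebra.TensorProduct.one_def, ← LaurentPolynomial.T_zero, extPair_tmul]
      simp [P.pair_one_left]
  pair_mul_right h a b := by
    induction a using tmulT_induction with
    | add x y hx hy =>
      simp only [add_mul, map_add, LinearMap.add_apply, TensorProduct.map_add_left, hx, hy]
    | tmul a i =>
      induction b using tmulT_induction with
      | add x y hx hy =>
        simp only [mul_add, map_add, LinearMap.add_apply, TensorProduct.map_add_right, hx, hy]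
      | tmul b l =>
        induction h using tmulT_induction with
        | add x y hx hy => simp only [map_add, LinearMap.add_apply, hx, hy]
        | tmul h j =>
          rw [Algebra.TensorProduct.tmul_mul_tmul, ← LaurentPolynomial.T_add, extPair_tmul,
            comul_tmul_T, ← LinearMap.comp_apply (TensorProduct.map _ _), ← TensorProduct.map_comp,
            extPair_flip_comp, extPair_flip_comp, P.pair_mul_right]
          simp only [TensorProduct.map_smul_left, TensorProduct.map_smul_right,
            LinearMap.smul_apply, map_smul, smul_smul, mul_add, zpow_add₀ hlam, smul_eq_mul]
          ring
  pair_one_right h := by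
    induction h using tmulT_induction with
    | add x y hx hy => simp only [map_add, LinearMap.add_apply, hx, hy]
    | tmul h j =>
      rw [Algebra.TensorProduct.one_def, ← LaurentPolynomial.T_zero, extPair_tmul]
      simp [P.pair_one_right]
  Rp := extInv P.Rp
  Rm := extId P.Rm
  comul_Rp := comul_ext (extInv_comp P.Rp) P.comul_Rp
  counit_Rp := counit_ext (extInv_comp P.Rp) P.counit_Rp
  comul_Rm := comul_ext (s := id) (extId_comp P.Rm) P.comul_Rm
  counit_Rm := counit_ext (s := id) (extId_comp P.Rm) P.counit_Rm
  inv_left := by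
    refine TensorProduct.ext' fun x y => ?_
    induction x using tmulT_induction with
    | add x x' hx hx' => simp only [TensorProduct.add_tmul, map_add, hx, hx']
    | tmul x i =>
      induction y using tmulT_induction with
      | add x x' hx hx' => simp only [TensorProduct.tmul_add, map_add, hx, hx']
      | tmul y j =>
        have h := LinearMap.congr_fun (conv_comp_coalgHom (k := k) (X := k) (C' := A ⊗[k] A)
          (C := (A ⊗[k] LaurentPolynomial k) ⊗[k] (A ⊗[k] LaurentPolynomial k))
          (TensorProduct.lift (extPair P.pair lam ∘ₗ (extId P.Rm).toLinearMap))
          (TensorProduct.lift (extPair P.pair lam ∘ₗ (extInv P.Rp).toLinearMap).flip)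
          (Coalgebra.TensorProduct.map (tmulT k A i) (tmulT k A j))) (x ⊗ₜ y)
        have e : (Coalgebra.TensorProduct.map (tmulT k A i) (tmulT k A j)).toLinearMap =
          TensorProduct.map (tmulT k A i).toLinearMap (tmulT k A j).toLinearMap := rfl
        -- The extension of `𝓡̄` contributes `lam ^ (i * j)` and that of `𝓡` its inverse, because
        -- `𝓡(g) = c⁻¹`.
        rw [e, extPair_Rm_comp, extPair_Rp_comp, conv_smul_smul, P.inv_left, ← zpow_add₀ hlam] at h
        simpa using h
  inv_right := by
    refine TensorProduct.ext' fun x y => ?_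
    induction x using tmulT_induction with
    | add x x' hx hx' => simp only [TensorProduct.add_tmul, map_add, hx, hx']
    | tmul x i =>
      induction y using tmulT_induction with
      | add x x' hx hx' => simp only [TensorProduct.tmul_add, map_add, hx, hx']
      | tmul y j =>
        have h := LinearMap.congr_fun (conv_comp_coalgHom (k := k) (X := k) (C' := A ⊗[k] A)
          (C := (A ⊗[k] LaurentPolynomial k) ⊗[k] (A ⊗[k] LaurentPolynomial k))
          (TensorProduct.lift (extPair P.pair lam ∘ₗ (extInv P.Rp).toLinearMap).flip)
          (TensorProduct.lift (extPair P.pair lam ∘ₗ (extId P.Rm).toLinearMap))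
          (Coalgebra.TensorProduct.map (tmulT k A i) (tmulT k A j))) (x ⊗ₜ y)
        have e : (Coalgebra.TensorProduct.map (tmulT k A i) (tmulT k A j)).toLinearMap =
          TensorProduct.map (tmulT k A i).toLinearMap (tmulT k A j).toLinearMap := rfl
        rw [e, extPair_Rm_comp, extPair_Rp_comp, conv_smul_smul, P.inv_right,
          ← zpow_add₀ hlam] at h
        simpa using h
  diff_Rp := diff_ext (extInv_comp P.Rp) P.diff_Rp
  diff_Rm := diff_ext (s := id) (extId_comp P.Rm) P.diff_Rm

end WeakQTPair

end

end DoubleBosonisation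

/-! ### Quadratic planes over quotients with a dilaton. -/

namespace DoubleBosonisation

noncomputable section

open scoped Shortcuts

open LaurentPolynomial (T)

section Planes

variable {k : Type u} [Field k] {n : ℕ}

theorem isPlane_VPlane (R' : Mat2 k n) : IsPlane (permMul R') (VPlane R') (VPlane.e R') where
  rel x := by
    have h := RingQuot.mkAlgHom_rel k (VRel.rel (R' := R') x.1 x.2)
    simp only [map_sum, map_smul, map_mul] at h
    simp only [act, Fintype.sum_prod_type]
    exact h
  lift x h := by
    let φ : VPlane R' →ₐ[k] _ := RingQuot.liftAlgHom k (s := VRel R') ⟨FreeAlgebra.lift k x, by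
      rintro _ _ ⟨i, j⟩
      simp only [map_sum, map_smul, map_mul, FreeAlgebra.lift_ι_apply]
      refine (h (i, j)).trans ?_
      simp only [act, Fintype.sum_prod_type]
      rfl⟩
    exact ⟨φ, fun i => (RingQuot.liftAlgHom_mkAlgHom_apply k _ _ _).trans (by simp)⟩
  adjoin := by
    have h : Set.range (VPlane.e R') =
        RingQuot.mkAlgHom k (VRel R') '' Set.range (FreeAlgebra.ι k) := (Set.range_comp _ _)
    have h2 := (Algebra.map_top (RingQuot.mkAlgHom k (VRel R'))).trans
      ((AlgHom.range_eq_top _).mpr (RingQuot.mkAlgHom_surjective k (VRel R')))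
    rw [← FreeAlgebra.adjoin_range_ι, AlgHom.map_adjoin, ← h] at h2
    exact h2

theorem isPlane_VCheckPlane (R' : Mat2 k n) :
    IsPlane (permMul R').transpose (VCheckPlane R') (VCheckPlane.f R') where
  rel x := by
    have h := RingQuot.mkAlgHom_rel k (VCheckRel.rel (R' := R') x.1 x.2)
    simp only [map_sum, map_smul, map_mul] at h
    simp only [act, Fintype.sum_prod_type]
    exact h.trans Finset.sum_comm
  lift x h := by
    let φ : VCheckPlane R' →ₐ[k] _ :=
      RingQuot.liftAlgHom k (s := VCheckRel R') ⟨FreeAlgebra.lift k x, by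
        rintro _ _ ⟨i, j⟩
        simp only [map_sum, map_smul, map_mul, FreeAlgebra.lift_ι_apply]
        refine (h (i, j)).trans ?_
        simp only [act, Fintype.sum_prod_type]
        exact Finset.sum_comm⟩
    exact ⟨φ, fun i => (RingQuot.liftAlgHom_mkAlgHom_apply k _ _ _).trans (by simp)⟩
  adjoin := by
    have h : Set.range (VCheckPlane.f R') =
        RingQuot.mkAlgHom k (VCheckRel R') '' Set.range (FreeAlgebra.ι k) := (Set.range_comp _ _)
    have h2 := (Algebra.map_top (RingQuot.mkAlgHom k (VCheckRel R'))).trans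
      ((AlgHom.range_eq_top _).mpr (RingQuot.mkAlgHom_surjective k (VCheckRel R')))
    rw [← FreeAlgebra.adjoin_range_ι, AlgHom.map_adjoin, ← h] at h2
    exact h2

variable {A A' V W : Type u} [Ring A] [Algebra k A] [Ring A'] [Algebra k A'] [Ring V]
  [Algebra k V] [Ring W] [Algebra k W] {φ ψ : A →ₗ[k] A'} (h : ∀ a b, φ a * φ b = ψ (a * b))

include h

/-- In the application `φ` is `a ↦ a g` and `ψ` is `a ↦ a g²`. Since the relations of a plane are
homogeneous of degree two, rescaling the coefficients of the generators by `g` preserves them. -/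
theorem rTensor_mul_rTensor (x y : A ⊗[k] V) :
    φ.rTensor V x * φ.rTensor V y = ψ.rTensor V (x * y) := by
  induction x using TensorProduct.induction_on with
  | zero => simp
  | add x x' hx hx' => simp only [map_add, add_mul, hx, hx']
  | tmul a v =>
    induction y using TensorProduct.induction_on with
    | zero => simp
    | add y y' hy hy' => simp only [map_add, mul_add, hy, hy']
    | tmul b w => simp [h]

theorem lTensor_mul_lTensor (x y : V ⊗[k] A) :
    φ.lTensor V x * φ.lTensor V y = ψ.lTensor V (x * y) := by
  induction x using TensorProduct.induction_on with
  | zero => simp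
  | add x x' hx hx' => simp only [map_add, add_mul, hx, hx']
  | tmul v a =>
    induction y using TensorProduct.induction_on with
    | zero => simp
    | add y y' hy hy' => simp only [map_add, mul_add, hy, hy']
    | tmul w b => simp [h]

/-- A map from a quadratic algebra to `A ⊗ V` can be rescaled by a central element. -/
theorem IsPlane.exists_rTensor {Q : Mat2 k n} {v : Fin n → W} (hv : IsPlane Q W v)
    (β : W →ₐ[k] A ⊗[k] V) : ∃ β' : W →ₐ[k] A' ⊗[k] V, ∀ i, β' (v i) = φ.rTensor V (β (v i)) := by
  refine hv.lift (fun i => φ.rTensor V (β (v i))) fun y => ?_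
  simp only [rTensor_mul_rTensor h, ← map_mul, hv.rel y, act, map_sum, map_smul]

/-- A map from a quadratic algebra to `V ⊗ A` can be rescaled by a central element. -/
theorem IsPlane.exists_lTensor {Q : Mat2 k n} {v : Fin n → W} (hv : IsPlane Q W v)
    (δ : W →ₐ[k] V ⊗[k] A) : ∃ δ' : W →ₐ[k] V ⊗[k] A', ∀ i, δ' (v i) = φ.lTensor V (δ (v i)) := by
  refine hv.lift (fun i => φ.lTensor V (δ (v i))) fun y => ?_
  simp only [lTensor_mul_lTensor h, ← map_mul, hv.rel y, act, map_sum, map_smul]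

end Planes

/-- A quantum group quotient `(H, A)` of `(Ũ(R), A(R))` with normalisation constant `lam`, under
which the quantum-braided planes of `(R', R)` are covariant. -/
structure QuotientPlane {k : Type u} [Field k] {n : ℕ} (R R' : Mat2 k n) (lam : k)
    (H A : Type u) [Ring H] [Ring A] [Bialgebra k H] [Bialgebra k A] where
  /-- The projection of `Ũ(R)`. -/
  πH : UR R →ₐc[k] H
  /-- The projection of `A(R)`. -/
  πA : AR R →ₐc[k] A
  /-- The pairing of the quotients. -/
  P : WeakQTPair k H A
  surj : Function.Surjective πH
  lam_ne_zero : lam ≠ 0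
  pair_eq : ∀ i j p l, P.pair (πH (UR.mp R i j)) (πA (AR.t R p l)) = lam * R (i, p) (j, l)
  Rp_t : ∀ i j, P.Rp (πA (AR.t R i j)) = πH (UR.mp R i j)
  Rm_t : ∀ i j, P.Rm (πA (AR.t R i j)) = πH (UR.mm R i j)
  hecke : (permMul R + 1) * (permMul R' - 1) = 0
  comm : permMul R * permMul R' = permMul R' * permMul R
  covB : ∃ β : VPlane R' →ₐ[k] A ⊗[k] VPlane R', ∀ i,
    β (VPlane.e R' i) = ∑ a, πA (AR.t R i a) ⊗ₜ[k] VPlane.e R' a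
  covD : ∃ δ : VCheckPlane R' →ₐ[k] VCheckPlane R' ⊗[k] A, ∀ i,
    δ (VCheckPlane.f R' i) = ∑ a, VCheckPlane.f R' a ⊗ₜ[k] πA (AR.t R a i)

namespace QuotientPlane

variable {k : Type u} [Field k] {n : ℕ} {R R' : Mat2 k n} {lam : k} {H A : Type u} [Ring H]
  [Ring A] [Bialgebra k H] [Bialgebra k A] (q : QuotientPlane R R' lam H A)

/-- The extended pair. -/
abbrev ext : WeakQTPair k (H ⊗[k] LaurentPolynomial k) (A ⊗[k] LaurentPolynomial k) :=
  q.P.centralExt q.lam_ne_zero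

theorem tmulT_mul_tmulT (a b : A) : (tmulT k A 1).toLinearMap a * (tmulT k A 1).toLinearMap b =
    (tmulT k A 2).toLinearMap (a * b) := by
  change (a ⊗ₜ[k] (T 1 : LaurentPolynomial k)) * (b ⊗ₜ[k] (T 1 : LaurentPolynomial k)) =
    (a * b) ⊗ₜ[k] (T 2 : LaurentPolynomial k)
  rw [Algebra.TensorProduct.tmul_mul_tmul, ← LaurentPolynomial.T_add]
  rfl

theorem exists_coactB : ∃ β : VPlane R' →ₐ[k] (A ⊗[k] LaurentPolynomial k) ⊗[k] VPlane R',
    ∀ i, β (VPlane.e R' i) = ∑ a, (q.πA (AR.t R i a) ⊗ₜ[k] T 1) ⊗ₜ[k] VPlane.e R' a := by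
  obtain ⟨β, hβ⟩ := q.covB
  obtain ⟨β', hβ'⟩ := (isPlane_VPlane R').exists_rTensor tmulT_mul_tmulT β
  exact ⟨β', fun i => by simp [hβ', hβ]⟩

theorem exists_coactD :
    ∃ δ : VCheckPlane R' →ₐ[k] VCheckPlane R' ⊗[k] (A ⊗[k] LaurentPolynomial k),
    ∀ i, δ (VCheckPlane.f R' i) =
      ∑ a, VCheckPlane.f R' a ⊗ₜ[k] (q.πA (AR.t R a i) ⊗ₜ[k] T 1) := by
  obtain ⟨δ, hδ⟩ := q.covD
  obtain ⟨δ', hδ'⟩ := (isPlane_VCheckPlane R').exists_lTensor tmulT_mul_tmulT δ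
  exact ⟨δ', fun i => by simp [hδ', hδ]⟩

/-- The quantum-braided planes over the extended pair. -/
def planeData : PlaneData q.ext R R' (VPlane R') (VCheckPlane R') where
  T i j := q.πA (AR.t R i j) ⊗ₜ T 1
  comul_T i j := by
    rw [comul_tmul_T, ← CoalgHomClass.map_comp_comul_apply, AR.comul_t]
    simp
  counit_T i j := by
    simp [AR.counit_t]
  rtt i j p l := by
    simp only [Algebra.TensorProduct.tmul_mul_tmul, TensorProduct.smul_tmul',
      ← TensorProduct.sum_tmul, ← map_mul, ← map_smul, ← map_sum, AR.rel]
  -- Here the dilaton does its work: `𝓡(t g) = m⁺ c⁻¹`, and pairing `c⁻¹` with `g` contributes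
  -- `lam⁻¹`, which cancels the normalisation of the pairing on `(H, A)`.
  pair_T i j p l := by
    change extPair q.P.pair lam (extInv q.P.Rp (q.πA (AR.t R i j) ⊗ₜ T 1)) _ = _
    have := q.lam_ne_zero
    simp only [extInv, Algebra.TensorProduct.map_tmul, q.Rp_t]
    simp [extPair_tmul, q.pair_eq]
    field_simp
  hecke := q.hecke
  comm := q.comm
  e := VPlane.e R'
  f := VCheckPlane.f R'
  planeB := isPlane_VPlane R'
  planeD := isPlane_VCheckPlane R'
  β := q.exists_coactB.choose
  β_e := q.exists_coactB.choose_spec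
  δ := q.exists_coactD.choose
  δ_f := q.exists_coactD.choose_spec

theorem planeData_Mp (i j : Fin n) : q.planeData.Mp i j = q.πH (UR.mp R i j) ⊗ₜ T (-1) := by
  change extInv q.P.Rp (q.πA (AR.t R i j) ⊗ₜ T 1) = _
  simp [extInv, q.Rp_t]

theorem planeData_Mm (i j : Fin n) : q.planeData.Mm i j = q.πH (UR.mm R i j) ⊗ₜ T 1 := by
  change extId q.P.Rm (q.πA (AR.t R i j) ⊗ₜ T 1) = _
  simp [extId, q.Rm_t]

/-- A power of `c` is group-like and meets only the factor `g` of the coaction, so it commutes with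
generators of the planes up to a power of `lam`. -/
theorem nR_T (i j : Fin n) (m : ℤ) :
    q.planeData.nR i j (1 ⊗ₜ T m) = if i = j then lam ^ m • (1 ⊗ₜ T m) else 0 := by
  have h := LinearMap.congr_fun (diffR_extPair q.P.pair lam 1 m 1) (q.πA (AR.t R i j))
  rw [← PlaneData.diffR_T]
  refine h.trans ?_
  simp [diffR, Algebra.TensorProduct.one_def, q.P.pair_one_left, AR.counit_t, ite_smul,
    TensorProduct.smul_tmul', apply_ite (lam ^ m • ·), TensorProduct.ite_tmul]

theorem nL_T (i j : Fin n) (m : ℤ) :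
    q.planeData.nL i j (1 ⊗ₜ T m) = if i = j then lam ^ m • (1 ⊗ₜ T m) else 0 := by
  have h := LinearMap.congr_fun (diffL_extPair q.P.pair lam 1 m 1) (q.πA (AR.t R i j))
  rw [← PlaneData.diffL_T]
  refine h.trans ?_
  simp [diffL, Algebra.TensorProduct.one_def, q.P.pair_one_left, AR.counit_t, ite_smul,
    TensorProduct.smul_tmul', apply_ite (lam ^ m • ·), TensorProduct.ite_tmul]

theorem nR_mul_T (i j : Fin n) (x : H ⊗[k] LaurentPolynomial k) (m : ℤ) :
    q.planeData.nR i j (x * (1 ⊗ₜ T m)) = lam ^ m • (q.planeData.nR i j x * (1 ⊗ₜ T m)) := by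
  simp only [PlaneData.nR_mul, nR_T, mul_ite, mul_zero, Finset.sum_ite_eq', Finset.mem_univ,
    if_true]
  exact mul_smul_comm _ _ _

theorem nL_mul_T (i j : Fin n) (x : H ⊗[k] LaurentPolynomial k) (m : ℤ) :
    q.planeData.nL i j (x * (1 ⊗ₜ T m)) = lam ^ m • (q.planeData.nL i j x * (1 ⊗ₜ T m)) := by
  simp only [PlaneData.nL_mul, nL_T, mul_ite, mul_zero, Finset.sum_ite_eq', Finset.mem_univ,
    if_true]
  exact mul_smul_comm _ _ _

theorem mp_tmul_one (i j : Fin n) : q.πH (UR.mp R i j) ⊗ₜ[k] (1 : LaurentPolynomial k) =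
    q.planeData.Mp i j * (1 ⊗ₜ T 1) := by
  rw [planeData_Mp, Algebra.TensorProduct.tmul_mul_tmul, ← LaurentPolynomial.T_add]
  simp

theorem mm_tmul_one (i j : Fin n) : q.πH (UR.mm R i j) ⊗ₜ[k] (1 : LaurentPolynomial k) =
    q.planeData.Mm i j * (1 ⊗ₜ T (-1)) := by
  rw [planeData_Mm, Algebra.TensorProduct.tmul_mul_tmul, ← LaurentPolynomial.T_add]
  simp

/-- In `U` the role of `m⁺` is played by `m⁺ c⁻¹`, whose derivative involves `R`. Restoring the
factor `c` multiplies this by `lam`, which is why `lam • R` appears in the cross relations. -/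
theorem nR_mp (i j p l : Fin n) : q.planeData.nR p l (q.πH (UR.mp R i j) ⊗ₜ 1) =
    ∑ a, (lam • R) (i, p) (a, l) • q.πH (UR.mp R a j) ⊗ₜ 1 := by
  simp only [mp_tmul_one, nR_mul_T, PlaneData.nR_Mp, Finset.sum_mul, Finset.smul_sum, zpow_one,
    smul_mul_assoc, smul_smul, Matrix.smul_apply, smul_eq_mul]

theorem nR_mm (i j p l : Fin n) : q.planeData.nR p l (q.πH (UR.mm R i j) ⊗ₜ 1) =
    ∑ a, (lam⁻¹ • q.planeData.Rbar) (p, i) (l, a) • q.πH (UR.mm R a j) ⊗ₜ 1 := by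
  simp only [mm_tmul_one, nR_mul_T, PlaneData.nR_Mm, Finset.sum_mul, Finset.smul_sum, zpow_neg_one,
    smul_mul_assoc, smul_smul, Matrix.smul_apply, smul_eq_mul]

theorem nL_mp (i j p l : Fin n) : q.planeData.nL p l (q.πH (UR.mp R i j) ⊗ₜ 1) =
    ∑ a, (lam • R) (a, p) (j, l) • q.πH (UR.mp R i a) ⊗ₜ 1 := by
  simp only [mp_tmul_one, nL_mul_T, PlaneData.nL_Mp, Finset.sum_mul, Finset.smul_sum, zpow_one,
    smul_mul_assoc, smul_smul, Matrix.smul_apply, smul_eq_mul]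

theorem nL_mm (i j p l : Fin n) : q.planeData.nL p l (q.πH (UR.mm R i j) ⊗ₜ 1) =
    ∑ a, (lam⁻¹ • q.planeData.Rbar) (p, a) (l, j) • q.πH (UR.mm R i a) ⊗ₜ 1 := by
  simp only [mm_tmul_one, nL_mul_T, PlaneData.nL_Mm, Finset.sum_mul, Finset.smul_sum, zpow_neg_one,
    smul_mul_assoc, smul_smul, Matrix.smul_apply, smul_eq_mul]

theorem smul_R_mul : (lam • R) * (lam⁻¹ • q.planeData.Rbar) = 1 := by
  rw [Matrix.smul_mul, Matrix.mul_smul, smul_smul, mul_inv_cancel₀ q.lam_ne_zero, one_smul,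
    PlaneData.mul_Rbar]

/-- Surjectivity of the map from `Ũ(R)` supplies `H`, and `c`, `c⁻¹` supply the Laurent polynomials.
Hence the cross relations with these few elements determine those with the whole extension. -/
theorem adjoin_eq_top : Algebra.adjoin k
    ({x : H ⊗[k] LaurentPolynomial k | ∃ i j, x = q.πH (UR.mp R i j) ⊗ₜ 1 ∨
      x = q.πH (UR.mm R i j) ⊗ₜ 1} ∪ {x | x = 1 ⊗ₜ T 1 ∨ x = 1 ⊗ₜ T (-1)}) = ⊤ := by
  set s := ({x : H ⊗[k] LaurentPolynomial k | ∃ i j, x = q.πH (UR.mp R i j) ⊗ₜ 1 ∨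
      x = q.πH (UR.mm R i j) ⊗ₜ 1} ∪ {x | x = 1 ⊗ₜ T 1 ∨ x = 1 ⊗ₜ T (-1)})
  have hH : ∀ h : H, h ⊗ₜ[k] (1 : LaurentPolynomial k) ∈ Algebra.adjoin k s := by
    intro h
    obtain ⟨g, rfl⟩ := q.surj h
    have hg : g ∈ Algebra.adjoin k {x | ∃ i j, x = UR.mp R i j ∨ x = UR.mm R i j} := by
      rw [UR.adjoin_mp_mm]
      trivial
    let ι : UR R →ₐ[k] H ⊗[k] LaurentPolynomial k :=
      Algebra.TensorProduct.includeLeft.comp (q.πH : UR R →ₐ[k] H)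
    have h2 : ι g ∈ (Algebra.adjoin k {x | ∃ i j, x = UR.mp R i j ∨ x = UR.mm R i j}).map ι :=
      ⟨g, hg, rfl⟩
    rw [AlgHom.map_adjoin] at h2
    refine Algebra.adjoin_mono ?_ h2
    rintro _ ⟨_, ⟨i, j, rfl | rfl⟩, rfl⟩
    · exact Or.inl ⟨i, j, Or.inl rfl⟩
    · exact Or.inl ⟨i, j, Or.inr rfl⟩
  have hT : ∀ m : ℤ, (1 : H) ⊗ₜ[k] (T m : LaurentPolynomial k) ∈ Algebra.adjoin k s := by
    intro m
    induction m using Int.induction_on with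
    | zero => simpa using hH 1
    | succ m hm =>
      have := mul_mem hm (Algebra.subset_adjoin (Or.inr (Or.inl rfl)) :
        (1 : H) ⊗ₜ[k] (T 1 : LaurentPolynomial k) ∈ Algebra.adjoin k s)
      rwa [Algebra.TensorProduct.tmul_mul_tmul, ← LaurentPolynomial.T_add, one_mul] at this
    | pred m hm =>
      have := mul_mem hm (Algebra.subset_adjoin (Or.inr (Or.inr rfl)) :
        (1 : H) ⊗ₜ[k] (T (-1) : LaurentPolynomial k) ∈ Algebra.adjoin k s)
      rwa [Algebra.TensorProduct.tmul_mul_tmul, ← LaurentPolynomial.T_add, one_mul] at this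
  rw [eq_top_iff]
  rintro x -
  induction x using tmulT_induction with
  | add x y hx hy => exact add_mem hx hy
  | tmul h m =>
    have := mul_mem (hH h) (hT m)
    rwa [Algebra.TensorProduct.tmul_mul_tmul, one_mul, mul_one] at this

end QuotientPlane

end

end DoubleBosonisation

/-! ### Relations and universal property in the presence of the dilaton. -/

namespace DoubleBosonisation

noncomputable section

open scoped Shortcuts

open LaurentPolynomial (T)

namespace QuotientPlane

open DoubleBosonisation.PlaneData hiding T

variable {k : Type u} [Field k] {n : ℕ} {R R' : Mat2 k n} {lam : k} {H A : Type u} [Ring H]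
  [Ring A] [Bialgebra k H] [Bialgebra k A] (q : QuotientPlane R R' lam H A) (κ : k)

theorem mp_mul_cinv (i j : Fin n) : (q.πH (UR.mp R i j) ⊗ₜ[k] (1 : LaurentPolynomial k)) *
    (1 ⊗ₜ[k] T (-1)) = q.πH (UR.mp R i j) ⊗ₜ[k] T (-1) := by
  rw [Algebra.TensorProduct.tmul_mul_tmul, mul_one, one_mul]

theorem c_mul_mm (i j : Fin n) : ((1 : H) ⊗ₜ[k] (T 1 : LaurentPolynomial k)) *
    (q.πH (UR.mm R i j) ⊗ₜ[k] 1) = q.πH (UR.mm R i j) ⊗ₜ[k] T 1 := by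
  rw [Algebra.TensorProduct.tmul_mul_tmul, mul_one, one_mul]

theorem crossRelations :
    CrossRelations (lam • R) κ (fun i j => Double.inH q.planeData κ (q.πH (UR.mp R i j) ⊗ₜ 1))
      (fun i j => Double.inH q.planeData κ (q.πH (UR.mm R i j) ⊗ₜ 1))
      (fun i j => Double.inH q.planeData κ (q.πH (UR.mp R i j) ⊗ₜ T (-1)))
      (fun i j => Double.inH q.planeData κ (q.πH (UR.mm R i j) ⊗ₜ T 1))
      (Double.e q.planeData κ) (Double.f q.planeData κ) := by
  have h := Double.cross q.planeData κ
  refine ⟨fun i j l => ?_, ?_, fun i j l => ?_, ?_, fun i j => ?_⟩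
  · rw [h.eh]
    simp only [nR_mp, map_sum, map_smul, Finset.sum_mul, smul_mul_assoc]
    exact Finset.sum_comm
  · refine (mul_comm_form_iff q.smul_R_mul _ _).mp fun i j l => ?_
    rw [h.eh]
    simp only [nR_mm, map_sum, map_smul, Finset.sum_mul, smul_mul_assoc]
  · rw [h.hf]
    simp only [nL_mp, map_sum, map_smul, Finset.mul_sum, mul_smul_comm]
    exact Finset.sum_comm
  · refine (mul_comm_form_iff' q.smul_R_mul _ _).mp fun i j l => ?_
    rw [h.hf]
    simp only [nL_mm, map_sum, map_smul, Finset.mul_sum, mul_smul_comm]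
  · rw [← planeData_Mp, ← planeData_Mm]
    exact h.e_f i j

theorem c_mul_f (i : Fin n) : Double.inH q.planeData κ (1 ⊗ₜ T 1) * Double.f q.planeData κ i =
    lam • (Double.f q.planeData κ i * Double.inH q.planeData κ (1 ⊗ₜ T 1)) := by
  rw [(Double.cross q.planeData κ).hf]
  simp [nL_T, apply_ite (Double.inH q.planeData κ), mul_ite]

theorem e_mul_c (i : Fin n) : Double.e q.planeData κ i * Double.inH q.planeData κ (1 ⊗ₜ T 1) =
    lam • (Double.inH q.planeData κ (1 ⊗ₜ T 1) * Double.e q.planeData κ i) := by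
  rw [(Double.cross q.planeData κ).eh]
  simp [nR_T, apply_ite (Double.inH q.planeData κ), ite_mul]

theorem T_mul_T_neg : ((1 : H) ⊗ₜ[k] (T 1 : LaurentPolynomial k)) * (1 ⊗ₜ[k] T (-1)) = 1 := by
  rw [Algebra.TensorProduct.tmul_mul_tmul, ← LaurentPolynomial.T_add, one_mul,
    Algebra.TensorProduct.one_def]
  simp

theorem T_neg_mul_T : ((1 : H) ⊗ₜ[k] (T (-1) : LaurentPolynomial k)) * (1 ⊗ₜ[k] T 1) = 1 := by
  rw [Algebra.TensorProduct.tmul_mul_tmul, ← LaurentPolynomial.T_add, one_mul,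
    Algebra.TensorProduct.one_def]
  simp

theorem existsUnique_hom (X : Type u) [Ring X] [Algebra k X]
    (jC : VCheckPlane R' →ₐ[k] X) (jH : H ⊗[k] LaurentPolynomial k →ₐ[k] X)
    (jB : VPlane R' →ₐ[k] X)
    (hc : ∀ i, jH (1 ⊗ₜ T 1) * jC (VCheckPlane.f R' i) =
      lam • (jC (VCheckPlane.f R' i) * jH (1 ⊗ₜ T 1)))
    (he : ∀ i, jB (VPlane.e R' i) * jH (1 ⊗ₜ T 1) = lam • (jH (1 ⊗ₜ T 1) * jB (VPlane.e R' i)))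
    (h : CrossRelations (lam • R) κ
      (fun i j => jH (q.πH (UR.mp R i j) ⊗ₜ 1)) (fun i j => jH (q.πH (UR.mm R i j) ⊗ₜ 1))
      (fun i j => jH (q.πH (UR.mp R i j) ⊗ₜ T (-1))) (fun i j => jH (q.πH (UR.mm R i j) ⊗ₜ T 1))
      (fun i => jB (VPlane.e R' i)) (fun i => jC (VCheckPlane.f R' i))) :
    ∃! φ : q.planeData.Double κ →ₐ[k] X, (∀ x, φ (Double.inC q.planeData κ x) = jC x) ∧
      (∀ g, φ (Double.incH q.planeData κ g) = jH g) ∧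
      ∀ x, φ (Double.inB q.planeData κ x) = jB x := by
  have hl := q.lam_ne_zero
  have h1 : jH (1 ⊗ₜ T 1) * jH (1 ⊗ₜ T (-1)) = 1 := by rw [← map_mul, T_mul_T_neg, map_one]
  have h2 : jH (1 ⊗ₜ T (-1)) * jH (1 ⊗ₜ T 1) = 1 := by rw [← map_mul, T_neg_mul_T, map_one]
  refine Double.existsUnique_hom _ κ jC jH jB
    (eh_of_adjoin _ q.adjoin_eq_top (E := fun i => jB (VPlane.e R' i)) ?_)
    (hf_of_adjoin _ q.adjoin_eq_top (F := fun i => jC (VCheckPlane.f R' i)) ?_) ?_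
  · rintro i _ (⟨j, l, rfl | rfl⟩ | rfl | rfl)
    · rw [h.e_mp]
      simp only [nR_mp, map_sum, map_smul, Finset.sum_mul, smul_mul_assoc]
      exact Finset.sum_comm
    · rw [(mul_comm_form_iff q.smul_R_mul _ _).mpr h.mm_e]
      simp only [nR_mm, map_sum, map_smul, Finset.sum_mul, smul_mul_assoc]
    · rw [he]
      simp [nR_T, apply_ite jH, ite_mul]
    · have h3 : lam • (jB (VPlane.e R' i) * jH (1 ⊗ₜ T (-1))) =
          jH (1 ⊗ₜ T (-1)) * jB (VPlane.e R' i) := by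
        calc _ = jH (1 ⊗ₜ T (-1)) * (lam • (jH (1 ⊗ₜ T 1) * jB (VPlane.e R' i))) *
              jH (1 ⊗ₜ T (-1)) := by
              rw [mul_smul_comm, ← mul_assoc, h2, one_mul, smul_mul_assoc]
          _ = _ := by rw [← he, mul_assoc, mul_assoc, h1, mul_one]
      simp [nR_T, apply_ite jH, ite_mul, ← h3, smul_smul, hl]
  · rintro _ (⟨j, l, rfl | rfl⟩ | rfl | rfl) i
    · rw [h.mp_f]
      simp only [nL_mp, map_sum, map_smul, Finset.mul_sum, mul_smul_comm]
      exact Finset.sum_comm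
    · rw [(mul_comm_form_iff' q.smul_R_mul _ _).mpr h.f_mm]
      simp only [nL_mm, map_sum, map_smul, Finset.mul_sum, mul_smul_comm]
    · rw [hc]
      simp [nL_T, apply_ite jH, mul_ite]
    · have h3 : lam • (jH (1 ⊗ₜ T (-1)) * jC (VCheckPlane.f R' i)) =
          jC (VCheckPlane.f R' i) * jH (1 ⊗ₜ T (-1)) := by
        calc _ = jH (1 ⊗ₜ T (-1)) * (lam • (jC (VCheckPlane.f R' i) * jH (1 ⊗ₜ T 1))) *
              jH (1 ⊗ₜ T (-1)) := by
              rw [mul_smul_comm, smul_mul_assoc, mul_assoc, mul_assoc, h1, mul_one]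
          _ = _ := by rw [← hc, ← mul_assoc, h2, one_mul]
      simp [nL_T, apply_ite jH, mul_ite, ← h3, smul_smul, hl]
  · intro i j
    rw [planeData_Mp, planeData_Mm]
    exact h.e_f i j

end QuotientPlane

end

end DoubleBosonisation

/-- Double bosonisation of the free braided plane of an invertible solution `R` of the
Yang-Baxter equation over a field (first part), and of a quotient quantum-braided plane over a
centrally extended weakly quasitriangular pair of Hopf algebras (second part). The constant `κ` is
the normalisation factor `q - q⁻¹`, which may be any nonzero element of the field. -/
theorem proposition5p2 {k : Type u} [Field k] {n : ℕ} (R : Mat2 k n) (hR : QYBE R)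
    (hRinv : IsUnit R) (κ : k) (hκ : κ ≠ 0) :
    -- the bialgebra `U(V(R), Ũ(R), V̌(R₂₁⁻¹))`
    (∃ (P : WeakQTPair k (UR R) (AR R))
      (D' : RightBraidedGroup P (FreeAlgebra k (Fin n)))
      (B' : LeftBraidedGroup P (FreeAlgebra k (Fin n)))
      (E : BraidedPairing D' B'),
      -- the weakly quasitriangular dual pair `(Ũ(R), A(R))`
      ((∀ i j p l, P.pair (UR.mp R i j) (AR.t R p l) = R (i, p) (j, l)) ∧
        (∀ i j p l, P.pair (UR.mm R i j) (AR.t R p l) = R⁻¹ (p, i) (l, j)) ∧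
        (∀ i j, P.Rp (AR.t R i j) = UR.mp R i j) ∧
        (∀ i j, P.Rm (AR.t R i j) = UR.mm R i j)) ∧
      -- the braided vector algebra `V(R)`, its dual, and their pairing
      ((∀ i, B'.coact (FreeAlgebra.ι k i) = ∑ a, AR.t R i a ⊗ₜ[k] FreeAlgebra.ι k a) ∧
        (∀ i, B'.comul (FreeAlgebra.ι k i) =
          FreeAlgebra.ι k i ⊗ₜ[k] 1 + 1 ⊗ₜ[k] FreeAlgebra.ι k i) ∧
        (∀ i, D'.coact (FreeAlgebra.ι k i) = ∑ a, FreeAlgebra.ι k a ⊗ₜ[k] AR.t R a i) ∧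
        (∀ i, D'.comul (FreeAlgebra.ι k i) =
          FreeAlgebra.ι k i ⊗ₜ[k] 1 + 1 ⊗ₜ[k] FreeAlgebra.ι k i) ∧
        (∀ i j, E.ev (FreeAlgebra.ι k i) (FreeAlgebra.ι k j) = if i = j then κ⁻¹ else 0)) ∧
      -- the double bosonisation
      ∃ (U : Type u) (_ : Ring U) (_ : Bialgebra k U)
        (iC : FreeAlgebra k (Fin n) →ₐ[k] U) (iH : UR R →ₐc[k] U)
        (iB : FreeAlgebra k (Fin n) →ₐ[k] U)
        (mp mm : Fin n → Fin n → U) (e f : Fin n → U),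
        IsDoubleBosonisation E iC iH iB ∧
        (∀ i j, mp i j = iH (UR.mp R i j)) ∧ (∀ i j, mm i j = iH (UR.mm R i j)) ∧
        (∀ i, e i = iB (FreeAlgebra.ι k i)) ∧ (∀ i, f i = iC (FreeAlgebra.ι k i)) ∧
        -- `Ũ(R)` is a sub-bialgebra
        Function.Injective iH ∧
        -- generators, cross relations and coproduct
        Algebra.adjoin k ({x | ∃ i j, x = mp i j ∨ x = mm i j} ∪ Set.range e ∪ Set.range f) = ⊤ ∧
        CrossRelations R κ mp mm mp mm e f ∧
        (∀ i j, Coalgebra.comul (R := k) (mp i j) = ∑ a, mp a j ⊗ₜ[k] mp i a) ∧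
        (∀ i j, Coalgebra.comul (R := k) (mm i j) = ∑ a, mm a j ⊗ₜ[k] mm i a) ∧
        (∀ i j, Coalgebra.counit (R := k) (mp i j) = if i = j then 1 else 0) ∧
        (∀ i j, Coalgebra.counit (R := k) (mm i j) = if i = j then 1 else 0) ∧
        (∀ i, Coalgebra.comul (R := k) (e i) = ∑ a, e a ⊗ₜ[k] mp i a + 1 ⊗ₜ[k] e i) ∧
        (∀ i, Coalgebra.comul (R := k) (f i) = f i ⊗ₜ[k] 1 + ∑ a, mm a i ⊗ₜ[k] f a) ∧
        (∀ i, Coalgebra.counit (R := k) (e i) = 0) ∧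
        (∀ i, Coalgebra.counit (R := k) (f i) = 0) ∧
        -- these cross relations define `U` as an algebra
        (∀ (X : Type u) [Ring X] [Algebra k X] (jC : FreeAlgebra k (Fin n) →ₐ[k] X)
          (jH : UR R →ₐ[k] X) (jB : FreeAlgebra k (Fin n) →ₐ[k] X),
          CrossRelations R κ (fun i j => jH (UR.mp R i j)) (fun i j => jH (UR.mm R i j))
            (fun i j => jH (UR.mp R i j)) (fun i j => jH (UR.mm R i j))
            (fun i => jB (FreeAlgebra.ι k i)) (fun i => jC (FreeAlgebra.ι k i)) →
          ∃! φ : U →ₐ[k] X, (∀ x, φ (iC x) = jC x) ∧ (∀ h, φ (iH h) = jH h) ∧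
            (∀ x, φ (iB x) = jB x))) ∧
    -- the version for quotients, with a dilaton
    (∀ (H A : Type u) [Ring H] [Ring A] [HopfAlgebra k H] [HopfAlgebra k A]
      (πH : UR R →ₐc[k] H) (πA : AR R →ₐc[k] A) (P : WeakQTPair k H A) (lam : k)
      (R' : Mat2 k n),
      -- `(H, A)` is a quantum group quotient of `(Ũ(R), A(R))` with normalisation constant `lam`
      Function.Surjective πH → Function.Surjective πA → lam ≠ 0 →
      (∀ i j p l, P.pair (πH (UR.mp R i j)) (πA (AR.t R p l)) = lam * R (i, p) (j, l)) →
      (∀ i j, P.Rp (πA (AR.t R i j)) = πH (UR.mp R i j)) →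
      (∀ i j, P.Rm (πA (AR.t R i j)) = πH (UR.mm R i j)) →
      -- `(R, R')` are quantum-braided plane data
      (permMul R + 1) * (permMul R' - 1) = 0 →
      permMul R * permMul R' = permMul R' * permMul R →
      -- the quantum planes are covariant under `A`
      (∃ β : VPlane R' →ₐ[k] A ⊗[k] VPlane R', ∀ i,
        β (VPlane.e R' i) = ∑ a, πA (AR.t R i a) ⊗ₜ[k] VPlane.e R' a) →
      (∃ δ : VCheckPlane R' →ₐ[k] VCheckPlane R' ⊗[k] A, ∀ i,
        δ (VCheckPlane.f R' i) = ∑ a, VCheckPlane.f R' a ⊗ₜ[k] πA (AR.t R a i)) →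
      ∃ (P' : WeakQTPair k (H ⊗[k] LaurentPolynomial k) (A ⊗[k] LaurentPolynomial k))
        (D' : RightBraidedGroup P' (VCheckPlane R'))
        (B' : LeftBraidedGroup P' (VPlane R'))
        (E : BraidedPairing D' B'),
        -- the central extension of `(H, A)` by `c` and `g`
        ((∀ h a (i j : ℤ),
            P'.pair (h ⊗ₜ LaurentPolynomial.T i) (a ⊗ₜ LaurentPolynomial.T j) =
              P.pair h a * lam ^ (i * j)) ∧
          (∀ a (j : ℤ), P'.Rp (a ⊗ₜ LaurentPolynomial.T j) =
            P.Rp a ⊗ₜ LaurentPolynomial.T (-j)) ∧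
          (∀ a (j : ℤ), P'.Rm (a ⊗ₜ LaurentPolynomial.T j) =
            P.Rm a ⊗ₜ LaurentPolynomial.T j)) ∧
        -- the braided groups and their pairing
        ((∀ i, B'.coact (VPlane.e R' i) =
            ∑ a, (πA (AR.t R i a) ⊗ₜ[k] LaurentPolynomial.T 1) ⊗ₜ[k] VPlane.e R' a) ∧
          (∀ i, B'.comul (VPlane.e R' i) =
            VPlane.e R' i ⊗ₜ[k] 1 + 1 ⊗ₜ[k] VPlane.e R' i) ∧
          (∀ i, D'.coact (VCheckPlane.f R' i) =
            ∑ a, VCheckPlane.f R' a ⊗ₜ[k] (πA (AR.t R a i) ⊗ₜ[k] LaurentPolynomial.T 1)) ∧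
          (∀ i, D'.comul (VCheckPlane.f R' i) =
            VCheckPlane.f R' i ⊗ₜ[k] 1 + 1 ⊗ₜ[k] VCheckPlane.f R' i) ∧
          (∀ i j, E.ev (VCheckPlane.f R' i) (VPlane.e R' j) = if i = j then κ⁻¹ else 0)) ∧
        -- the double bosonisation
        ∃ (U : Type u) (_ : Ring U) (_ : HopfAlgebra k U)
          (iC : VCheckPlane R' →ₐ[k] U) (iH : H ⊗[k] LaurentPolynomial k →ₐc[k] U)
          (iB : VPlane R' →ₐ[k] U)
          (mp mm : Fin n → Fin n → U) (c cinv : U) (e f : Fin n → U),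
          IsDoubleBosonisation E iC iH iB ∧
          (∀ i j, mp i j = iH (πH (UR.mp R i j) ⊗ₜ 1)) ∧
          (∀ i j, mm i j = iH (πH (UR.mm R i j) ⊗ₜ 1)) ∧
          c = iH (1 ⊗ₜ LaurentPolynomial.T 1) ∧ cinv = iH (1 ⊗ₜ LaurentPolynomial.T (-1)) ∧
          (∀ i, e i = iB (VPlane.e R' i)) ∧ (∀ i, f i = iC (VCheckPlane.f R' i)) ∧
          Function.Injective iH ∧
          -- cross relations and coproduct
          c * cinv = 1 ∧ cinv * c = 1 ∧
          (∀ i, c * f i = lam • (f i * c)) ∧ (∀ i, e i * c = lam • (c * e i)) ∧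
          (∀ i j, c * mp i j = mp i j * c) ∧ (∀ i j, c * mm i j = mm i j * c) ∧
          CrossRelations (lam • R) κ mp mm (fun i j => mp i j * cinv) (fun i j => c * mm i j)
            e f ∧
          (∀ i j, Coalgebra.comul (R := k) (mp i j) = ∑ a, mp a j ⊗ₜ[k] mp i a) ∧
          (∀ i j, Coalgebra.comul (R := k) (mm i j) = ∑ a, mm a j ⊗ₜ[k] mm i a) ∧
          (∀ i j, Coalgebra.counit (R := k) (mp i j) = if i = j then 1 else 0) ∧
          (∀ i j, Coalgebra.counit (R := k) (mm i j) = if i = j then 1 else 0) ∧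
          Coalgebra.comul (R := k) c = c ⊗ₜ[k] c ∧ Coalgebra.counit (R := k) c = 1 ∧
          (∀ i, Coalgebra.comul (R := k) (e i) =
            ∑ a, e a ⊗ₜ[k] (mp i a * cinv) + 1 ⊗ₜ[k] e i) ∧
          (∀ i, Coalgebra.comul (R := k) (f i) =
            f i ⊗ₜ[k] 1 + ∑ a, (c * mm a i) ⊗ₜ[k] f a) ∧
          (∀ i, Coalgebra.counit (R := k) (e i) = 0) ∧
          (∀ i, Coalgebra.counit (R := k) (f i) = 0) ∧
          -- these relations define `U` as an algebra
          (∀ (X : Type u) [Ring X] [Algebra k X] (jC : VCheckPlane R' →ₐ[k] X)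
            (jH : H ⊗[k] LaurentPolynomial k →ₐ[k] X) (jB : VPlane R' →ₐ[k] X),
            (∀ i, jH (1 ⊗ₜ LaurentPolynomial.T 1) * jC (VCheckPlane.f R' i) =
              lam • (jC (VCheckPlane.f R' i) * jH (1 ⊗ₜ LaurentPolynomial.T 1))) →
            (∀ i, jB (VPlane.e R' i) * jH (1 ⊗ₜ LaurentPolynomial.T 1) =
              lam • (jH (1 ⊗ₜ LaurentPolynomial.T 1) * jB (VPlane.e R' i))) →
            CrossRelations (lam • R) κ
              (fun i j => jH (πH (UR.mp R i j) ⊗ₜ 1)) (fun i j => jH (πH (UR.mm R i j) ⊗ₜ 1))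
              (fun i j => jH (πH (UR.mp R i j) ⊗ₜ LaurentPolynomial.T (-1)))
              (fun i j => jH (πH (UR.mm R i j) ⊗ₜ LaurentPolynomial.T 1))
              (fun i => jB (VPlane.e R' i)) (fun i => jC (VCheckPlane.f R' i)) →
            ∃! φ : U →ₐ[k] X, (∀ x, φ (iC x) = jC x) ∧ (∀ h, φ (iH h) = jH h) ∧
              (∀ x, φ (iB x) = jB x))) := by
  constructor
  · let S := freePlaneData hR hRinv
    have comul_m : ∀ s i j, Coalgebra.comul (R := k) (PlaneData.Double.inH S κ (UR.m R s i j)) =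
        ∑ a, PlaneData.Double.inH S κ (UR.m R s a j) ⊗ₜ[k]
          PlaneData.Double.inH S κ (UR.m R s i a) := fun s i j => by
      rw [PlaneData.Double.comul_inH, UR.comul_m]
      simp
    have counit_m : ∀ s i j, Coalgebra.counit (R := k) (PlaneData.Double.inH S κ (UR.m R s i j)) =
        if i = j then 1 else 0 := fun s i j => by
      rw [PlaneData.Double.counit_inH, UR.counit_m]
    -- For `s = false` the right hand side unfolds to the entry `(p, i) (l, j)` of `R⁻¹`, so a
    -- single statement yields the pairing of both `m⁺` and `m⁻`.
    have pair_m : ∀ s i j p l, (UR.weakQTPair hR hRinv).pair (UR.m R s i j) (AR.t R p l) =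
        signMat R s (i, p) (j, l) := fun s i j p l => by
      simp [UR.weakQTPair, UR.pair_m, AR.coeff_apply]
    have comul_e := PlaneData.Double.comul_e S κ
    have comul_f := PlaneData.Double.comul_f S κ
    simp only [S, freePlaneData_Mp, freePlaneData_Mm] at comul_e comul_f
    exact ⟨UR.weakQTPair hR hRinv, S.groupD, S.groupB, S.pairing κ,
      ⟨pair_m true, pair_m false, UR.ofAR_t true, UR.ofAR_t false⟩,
      ⟨S.β_e, S.groupB_comul_e, S.δ_f, S.groupD_comul_f, S.pairing_f_e κ⟩,
      S.Double κ, inferInstance, inferInstance, PlaneData.Double.inC S κ,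
      PlaneData.Double.incH S κ, PlaneData.Double.inB S κ,
      fun i j => PlaneData.Double.inH S κ (UR.mp R i j),
      fun i j => PlaneData.Double.inH S κ (UR.mm R i j),
      PlaneData.Double.e S κ, PlaneData.Double.f S κ,
      PlaneData.Double.isDoubleBosonisation S κ, fun _ _ => rfl, fun _ _ => rfl,
      fun i => (PlaneData.Double.inB_e S κ i).symm, fun i => (PlaneData.Double.inC_f S κ i).symm,
      PlaneData.Double.inH_injective S κ, freePlaneData_adjoin hR hRinv κ,
      freePlaneData_crossRelations hR hRinv κ, comul_m true, comul_m false, counit_m true,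
      counit_m false, comul_e, comul_f, PlaneData.Double.counit_e S κ,
      PlaneData.Double.counit_f S κ, freePlaneData_existsUnique_hom hR hRinv κ⟩
  · intro H A _ _ _ _ πH πA P lam R' hπH _ hlam hpair hRp hRm hhecke hcomm hB hD
    let q : QuotientPlane R R' lam H A :=
      ⟨πH, πA, P, hπH, hlam, hpair, hRp, hRm, hhecke, hcomm, hB, hD⟩
    let S := q.planeData
    have comul_m : ∀ s i j, Coalgebra.comul (R := k)
        (PlaneData.Double.inH S κ (πH (UR.m R s i j) ⊗ₜ 1)) =
        ∑ a, PlaneData.Double.inH S κ (πH (UR.m R s a j) ⊗ₜ 1) ⊗ₜ[k]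
          PlaneData.Double.inH S κ (πH (UR.m R s i a) ⊗ₜ 1) := fun s i j => by
      rw [PlaneData.Double.comul_inH, ← LaurentPolynomial.T_zero, comul_tmul_T,
        ← CoalgHomClass.map_comp_comul_apply, UR.comul_m]
      simp
    have counit_m : ∀ s i j, Coalgebra.counit (R := k)
        (PlaneData.Double.inH S κ (πH (UR.m R s i j) ⊗ₜ 1)) = if i = j then 1 else 0 :=
      fun s i j => by
      rw [PlaneData.Double.counit_inH]
      simp [UR.counit_m]
    have comul_c : Coalgebra.comul (R := k)
        (PlaneData.Double.inH S κ (1 ⊗ₜ LaurentPolynomial.T 1)) =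
        PlaneData.Double.inH S κ (1 ⊗ₜ LaurentPolynomial.T 1) ⊗ₜ[k]
          PlaneData.Double.inH S κ (1 ⊗ₜ LaurentPolynomial.T 1) := by
      rw [PlaneData.Double.comul_inH, comul_tmul_T, Bialgebra.comul_one,
        Algebra.TensorProduct.one_def]
      simp
    have counit_c : Coalgebra.counit (R := k)
        (PlaneData.Double.inH S κ (1 ⊗ₜ LaurentPolynomial.T 1)) = 1 := by
      rw [PlaneData.Double.counit_inH]
      simp
    have mp_cinv : ∀ i j, PlaneData.Double.inH S κ (πH (UR.mp R i j) ⊗ₜ 1) *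
        PlaneData.Double.inH S κ (1 ⊗ₜ LaurentPolynomial.T (-1)) =
        PlaneData.Double.inH S κ (πH (UR.mp R i j) ⊗ₜ LaurentPolynomial.T (-1)) := fun i j => by
      rw [← map_mul]
      exact congrArg _ (q.mp_mul_cinv i j)
    have c_mm : ∀ i j, PlaneData.Double.inH S κ (1 ⊗ₜ LaurentPolynomial.T 1) *
        PlaneData.Double.inH S κ (πH (UR.mm R i j) ⊗ₜ 1) =
        PlaneData.Double.inH S κ (πH (UR.mm R i j) ⊗ₜ LaurentPolynomial.T 1) := fun i j => by
      rw [← map_mul]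
      exact congrArg _ (q.c_mul_mm i j)
    have c_comm : ∀ h : H, PlaneData.Double.inH S κ (1 ⊗ₜ LaurentPolynomial.T 1) *
        PlaneData.Double.inH S κ (h ⊗ₜ 1) = PlaneData.Double.inH S κ (h ⊗ₜ 1) *
          PlaneData.Double.inH S κ (1 ⊗ₜ LaurentPolynomial.T 1) := fun h => by
      rw [← map_mul, ← map_mul, Algebra.TensorProduct.tmul_mul_tmul,
        Algebra.TensorProduct.tmul_mul_tmul, one_mul, mul_one, one_mul, mul_one]
    have cross := q.crossRelations κ
    have comul_e := PlaneData.Double.comul_e S κ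
    have comul_f := PlaneData.Double.comul_f S κ
    have hMp : ∀ i j, S.Mp i j = πH (UR.mp R i j) ⊗ₜ LaurentPolynomial.T (-1) := q.planeData_Mp
    have hMm : ∀ i j, S.Mm i j = πH (UR.mm R i j) ⊗ₜ LaurentPolynomial.T 1 := q.planeData_Mm
    -- The matrices of the general construction are `m⁺ c⁻¹` and `c m⁻`, which accounts for the
    -- powers of `c` in the coproducts of `e^i` and `f_i`.
    simp only [hMp, hMm] at comul_e comul_f
    refine ⟨q.ext, S.groupD, S.groupB, S.pairing κ,
      ⟨extPair_tmul P.pair lam, fun a j => LinearMap.congr_fun (extInv_comp P.Rp j) a,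
        fun a j => LinearMap.congr_fun (extId_comp P.Rm j) a⟩,
      ⟨S.β_e, S.groupB_comul_e, S.δ_f, S.groupD_comul_f, S.pairing_f_e κ⟩,
      S.Double κ, inferInstance, inferInstance, PlaneData.Double.inC S κ,
      PlaneData.Double.incH S κ, PlaneData.Double.inB S κ,
      fun i j => PlaneData.Double.inH S κ (πH (UR.mp R i j) ⊗ₜ 1),
      fun i j => PlaneData.Double.inH S κ (πH (UR.mm R i j) ⊗ₜ 1),
      PlaneData.Double.inH S κ (1 ⊗ₜ LaurentPolynomial.T 1),
      PlaneData.Double.inH S κ (1 ⊗ₜ LaurentPolynomial.T (-1)),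
      PlaneData.Double.e S κ, PlaneData.Double.f S κ,
      PlaneData.Double.isDoubleBosonisation S κ, fun _ _ => rfl, fun _ _ => rfl, rfl, rfl,
      fun i => (PlaneData.Double.inB_e S κ i).symm, fun i => (PlaneData.Double.inC_f S κ i).symm,
      PlaneData.Double.inH_injective S κ, ?_, ?_, q.c_mul_f κ, q.e_mul_c κ,
      fun i j => c_comm _, fun i j => c_comm _, ?_, comul_m true, comul_m false, counit_m true,
      counit_m false, comul_c, counit_c, ?_, ?_, PlaneData.Double.counit_e S κ,
      PlaneData.Double.counit_f S κ, q.existsUnique_hom κ⟩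
    · rw [← map_mul, QuotientPlane.T_mul_T_neg, map_one]
    · rw [← map_mul, QuotientPlane.T_neg_mul_T, map_one]
    · simp only [mp_cinv, c_mm]
      exact cross
    · simpa only [mp_cinv] using comul_e
    · simpa only [c_mm] using comul_f
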